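/- Let $n\ge 9$ and let $(M,g)$ be a smooth compact $n$-dimensional Riemannian manifold with boundary $\partial M$. For $q\in\partial M$ let $\Lambda_q$ be a smooth positive function on $M$ with $\Lambda_q(q)=1$, $d\Lambda_q(q)=0$, such that the metric $\tilde g_q=\Lambda_q^{4/(n-2)}g$ satisfies at the point $q$ $$\bar R_{kl}(q)=R_{nn}(q)=R_{nk}(q)=0\qquad(1\le k,l\le n-1).$$ Here and below components are taken with respect to an orthonormal basis $e_1,\dots,e_n$ of $T_qM$ with $e_1,\dots,e_{n-1}$ tangent to $\partial M$ and $e_n$ the inward normal (an *adapted frame*; equivalently, in Fermi coordinates at $q$); $R_{abcd}$ and $R_{ab}=\sum_c R_{cacb}$ are the Riemann and Ricci tensors of $\tilde g_q$, with $R_{abab}>0$ on round spheres, and $\bar R_{ijkl}$, $\bar R_{kl}=\sum_i\bar R_{ikil}$ those of the metric induced by $\tilde g_q$ on $\partial M$. On $\mathbb R^n_+=\{y=(z,t): z\in\mathbb R^{n-1},\ t=y_n\ge 0\}$ let $$U(z,t)=\big((1+t)^2+|z|^2\big)^{-\frac{n-2}{2}},\qquad j_i=\partial_{y_i}U\ (1\le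 i\le n-1),\qquad j_n=\tfrac{n-2}{2}U+\sum_{a=1}^n y_a\partial_{y_a}U .$$ For $q\in\partial M$ and an adapted frame at $q$ consider the problem $$-\Delta v=\sum_{i,j=1}^{n-1}\Big[\tfrac13\sum_{k,l=1}^{n-1}\bar R_{ikjl}(q)\,y_ky_l+R_{ninj}(q)\,y_n^2\Big]\partial^2_{ij}U\ \text{ in }\mathbb R^n_+,\qquad \frac{\partial v}{\partial y_n}=-n\,U^{\frac{2}{n-2}}v\ \text{ on }\partial\mathbb R^n_+ .$$ A solution means a function $v\in H^1(\mathbb R^n_+)$ which is $C^2$ in the open half-space, $C^1$ up to the boundary, and satisfies both equations pointwise. Then there is a unique solution $v_q$ such that, for $b=1,\dots,n$, $v_q\,j_b$ is integrable and $\int_{\mathbb R^n_+}v_q\,j_b\,dy=0$. It is $C^2$ up to the boundary, and: 1. There is a constant $C$, independent of $q\in\partial M$, of the adapted frame and of $y$, such that $|\nabla^\tau v_q(y)|\le C(1+|y|)^{4-\tau-n}$ for all $y\in\mathbb R^n_+$ and $\tau=0,1,2$. 2. $U^{\frac n{n-2}}v_q$ is integrable over $\partial\mathbb R^n_+$ and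 $\displaystyle\int_{\partial\mathbb R^n_+}U^{\frac{n}{n-2}}v_q\,dz=0$. 3. $v_q\Delta v_q$ is integrable over $\mathbb R^n_+$ and $\displaystyle\int_{\mathbb R^n_+}v_q\,\Delta v_q\,dy\le 0$. 4. $q\mapsto v_q$ is $C^2$ on $\partial M$: along every $C^2$ field of adapted frames over a (relatively) open subset of $\partial M$, and for $\tau=0,1,2$, the map $q\mapsto (1+|y|)^{n-4+\tau}\,\nabla^\tau v_q$ is of class $C^2$ with values in the Banach space of bounded continuous tensor-valued functions on $\mathbb R^n_+$ with the sup norm. -/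

import Mathlib

open scoped Manifold ContDiff BoundedContinuousFunction
open MeasureTheory

noncomputable section

namespace BoundaryBubble

/-! ### The half-space

The dimension is `n = m + 1`. As in Mathlib's model of manifolds with boundary, the coordinate with
index `0` is the normal one (called `y_n` or `t` in the usual notation), and the coordinates with
indices `i.succ`, `i : Fin m`, are the tangential ones (called `y_1, …, y_{n-1}` or `z`). -/

/-- The closed half-space `{y : t ≥ 0}` of dimension `m + 1`. -/
def halfSpace (m : ℕ) : Set (EuclideanSpace ℝ (Fin (m + 1))) := {y | 0 ≤ y 0}

/-- The open half-space `{y : t > 0}` of dimension `m + 1`. -/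
def openHalfSpace (m : ℕ) : Set (EuclideanSpace ℝ (Fin (m + 1))) := {y | 0 < y 0}

/-- The boundary point `(0, z)`. -/
def bdPoint {m : ℕ} (z : EuclideanSpace ℝ (Fin m)) : EuclideanSpace ℝ (Fin (m + 1)) :=
  WithLp.toLp 2 (Fin.cons (0 : ℝ) fun i => z i)

/-- The tangential part `z` of `y = (t, z)`. -/
def tanPart {m : ℕ} (y : EuclideanSpace ℝ (Fin (m + 1))) : EuclideanSpace ℝ (Fin m) :=
  WithLp.toLp 2 fun i => y i.succ

/-- The partial derivative `∂_a f` of `f` within the set `S`. -/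
def pd {k : ℕ} (S : Set (EuclideanSpace ℝ (Fin k))) (f : EuclideanSpace ℝ (Fin k) → ℝ) (a : Fin k)
    (y : EuclideanSpace ℝ (Fin k)) : ℝ :=
  fderivWithin ℝ f S y (EuclideanSpace.single a 1)

/-! ### The bubble and the linear problem -/

/-- The standard bubble `U(t, z) = ((1 + t)² + |z|²) ^ (-(n - 2) / 2)`, with `n = m + 1`. -/
def bubble {m : ℕ} (y : EuclideanSpace ℝ (Fin (m + 1))) : ℝ :=
  ((1 + y 0) ^ 2 + ∑ i : Fin m, y i.succ ^ 2) ^ (-(((m : ℝ) - 1) / 2))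

/-- The kernel functions of the linearized problem. Index `0` is `j_n = (n-2)/2 U + ∑ y_a ∂_a U`,
index `i.succ` is `j_i = ∂_i U` (`i` tangential). -/
def kernelFn {m : ℕ} (b : Fin (m + 1)) (y : EuclideanSpace ℝ (Fin (m + 1))) : ℝ :=
  Fin.cases (((m : ℝ) - 1) / 2 * bubble y + ∑ a, y a * pd Set.univ bubble a y)
    (fun i => pd Set.univ bubble i.succ y) b

/-- `∑_{i,j} [ 1/3 ∑_{k,l} R̄_{ikjl} y_k y_l + R_{ninj} y_n² ] ∂²_{ij} U`, all sums over tangential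
indices; `Rbar` is the array `R̄_{ijkl}` and `Rn` the array `R_{ninj}`. -/
def correctorRhs {m : ℕ} (Rbar : Fin m → Fin m → Fin m → Fin m → ℝ) (Rn : Fin m → Fin m → ℝ)
    (y : EuclideanSpace ℝ (Fin (m + 1))) : ℝ :=
  ∑ i, ∑ j, ((1 / 3) * (∑ k, ∑ l, Rbar i k j l * y k.succ * y l.succ) + Rn i j * y 0 ^ 2) *
    pd Set.univ (pd Set.univ bubble j.succ) i.succ y

/-- `v` is a (classical, `H¹`) solution of
`-Δ v = f` in the half-space, `∂v/∂t = -n U^{2/(n-2)} v` on its boundary.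
Only the values of `v` on the closed half-space matter. -/
structure IsSolution {m : ℕ} (f v : EuclideanSpace ℝ (Fin (m + 1)) → ℝ) : Prop where
  contDiffOn_interior : ContDiffOn ℝ 2 v (openHalfSpace m)
  contDiffOn_closed : ContDiffOn ℝ 1 v (halfSpace m)
  memLp : MemLp v 2 (volume.restrict (openHalfSpace m))
  memLp_gradient : MemLp (fderiv ℝ v) 2 (volume.restrict (openHalfSpace m))
  equation : ∀ y ∈ openHalfSpace m, -(Laplacian.laplacian v y) = f y
  boundary : ∀ y : EuclideanSpace ℝ (Fin (m + 1)), y 0 = 0 →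
    pd (halfSpace m) v 0 y = -((m : ℝ) + 1) * bubble y ^ (2 / ((m : ℝ) - 1)) * v y

/-- `v` is orthogonal to all the kernel functions: `v j_b` is integrable over the half-space, with
vanishing integral, for `b = 1, …, n`. -/
def OrthogonalToKernel {m : ℕ} (v : EuclideanSpace ℝ (Fin (m + 1)) → ℝ) : Prop :=
  ∀ b : Fin (m + 1), IntegrableOn (fun y => v y * kernelFn b y) (openHalfSpace m) ∧
    ∫ y in openHalfSpace m, v y * kernelFn b y = 0

/-! ### Curvature in coordinates -/

/-- Christoffel symbols `Γ^c_{ab}` of a metric with matrix `G`, derivatives taken within `S`. -/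
def christoffel {k : ℕ} (S : Set (EuclideanSpace ℝ (Fin k)))
    (G : EuclideanSpace ℝ (Fin k) → Matrix (Fin k) (Fin k) ℝ) (c a b : Fin k)
    (y : EuclideanSpace ℝ (Fin k)) : ℝ :=
  (1 / 2) * ∑ d, (G y)⁻¹ c d *
    (pd S (fun x => G x b d) a y + pd S (fun x => G x a d) b y - pd S (fun x => G x a b) d y)

/-- The Riemann tensor `R_{abcd} = ⟨R(∂_c, ∂_d) ∂_b, ∂_a⟩` of a metric with matrix `G`. The sign
is such that `R_{abab}` is positive on round spheres. -/
def riemann {k : ℕ} (S : Set (EuclideanSpace ℝ (Fin k)))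
    (G : EuclideanSpace ℝ (Fin k) → Matrix (Fin k) (Fin k) ℝ) (a b c d : Fin k)
    (y : EuclideanSpace ℝ (Fin k)) : ℝ :=
  ∑ e, G y a e * (pd S (christoffel S G e d b) c y - pd S (christoffel S G e c b) d y +
    ∑ f, (christoffel S G e c f y * christoffel S G f d b y -
      christoffel S G e d f y * christoffel S G f c b y))

/-! ### Riemannian manifolds with boundary -/

section Manifold

variable {m : ℕ} {M : Type*} [TopologicalSpace M] [ChartedSpace (EuclideanHalfSpace (m + 1)) M]

/-- A field of bilinear forms on the tangent spaces of `M`; used for Riemannian metrics. -/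
abbrev FormField (m : ℕ) (M : Type*) [TopologicalSpace M]
    [ChartedSpace (EuclideanHalfSpace (m + 1)) M] : Type _ :=
  (x : M) → TangentSpace (𝓡∂ (m + 1)) x →L[ℝ] TangentSpace (𝓡∂ (m + 1)) x →L[ℝ] ℝ

/-- The matrix of `B` in the preferred chart at `q`, as a function of the coordinates. -/
def chartMatrix (B : FormField m M) (q : M) (y : EuclideanSpace ℝ (Fin (m + 1))) :
    Matrix (Fin (m + 1)) (Fin (m + 1)) ℝ :=
  let D := mfderivWithin 𝓘(ℝ, EuclideanSpace ℝ (Fin (m + 1))) (𝓡∂ (m + 1))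
    (extChartAt (𝓡∂ (m + 1)) q).symm (Set.range (𝓡∂ (m + 1))) y
  Matrix.of fun a b => B ((extChartAt (𝓡∂ (m + 1)) q).symm y)
    (D (EuclideanSpace.single a (1 : ℝ))) (D (EuclideanSpace.single b (1 : ℝ)))

/-- The matrix of the form induced by `B` on `∂M`, in the chart of `∂M` obtained by restricting the
preferred chart at `q`. -/
def bdChartMatrix (B : FormField m M) (q : M) (z : EuclideanSpace ℝ (Fin m)) :
    Matrix (Fin m) (Fin m) ℝ :=
  Matrix.of fun i j => chartMatrix B q (bdPoint z) i.succ j.succ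

/-- The coordinate vector, in the preferred chart at `q`, of a tangent vector at `q`. -/
def coordVec (q : M) (w : TangentSpace (𝓡∂ (m + 1)) q) : EuclideanSpace ℝ (Fin (m + 1)) :=
  mfderiv (𝓡∂ (m + 1)) 𝓘(ℝ, EuclideanSpace ℝ (Fin (m + 1))) (extChartAt (𝓡∂ (m + 1)) q) q w

/-- `e` is an orthonormal frame at the boundary point `q`, with `e 0` the inward unit normal and
`e i.succ` tangent to the boundary. These are the coordinate frames at `q` of the Fermi coordinate
systems centered at `q`. -/
structure IsAdaptedFrame (B : FormField m M) (q : M)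
    (e : Fin (m + 1) → TangentSpace (𝓡∂ (m + 1)) q) : Prop where
  orthonormal : ∀ a b, B q (e a) (e b) = if a = b then 1 else 0
  tangent : ∀ i : Fin m, coordVec q (e i.succ) 0 = 0
  inward : 0 < coordVec q (e 0) 0

/-- The component `R_{abcd}(q)`, in the frame `e`, of the Riemann tensor of the metric `B`. -/
def curv (B : FormField m M) (q : M) (e : Fin (m + 1) → TangentSpace (𝓡∂ (m + 1)) q)
    (a b c d : Fin (m + 1)) : ℝ :=
  ∑ α, ∑ β, ∑ γ, ∑ δ, coordVec q (e a) α * coordVec q (e b) β * coordVec q (e c) γ *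
    coordVec q (e d) δ * riemann (Set.range (𝓡∂ (m + 1))) (chartMatrix B q) α β γ δ
      (extChartAt (𝓡∂ (m + 1)) q q)

/-- The component `R̄_{ijkl}(q)`, in the tangential frame `e i.succ`, of the Riemann tensor of the
metric induced by `B` on `∂M`. -/
def bdCurv (B : FormField m M) (q : M) (e : Fin (m + 1) → TangentSpace (𝓡∂ (m + 1)) q)
    (i j k l : Fin m) : ℝ :=
  ∑ α : Fin m, ∑ β : Fin m, ∑ γ : Fin m, ∑ δ : Fin m,
    coordVec q (e i.succ) α.succ * coordVec q (e j.succ) β.succ *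
    coordVec q (e k.succ) γ.succ * coordVec q (e l.succ) δ.succ *
    riemann Set.univ (bdChartMatrix B q) α β γ δ (tanPart (extChartAt (𝓡∂ (m + 1)) q q))

/-- The conformal metric `Λ ^ (4 / (n - 2)) g`, with `n = m + 1`. -/
def conformal (B : FormField m M) (Λ : M → ℝ) : FormField m M :=
  fun x => (Λ x ^ (4 / ((m : ℝ) - 1))) • B x

/-- `Λ q`, for `q ∈ ∂M`, are conformal factors normalized at `q`:
`Λ_q(q) = 1`, `dΛ_q(q) = 0`, and the metric `g̃_q = Λ_q ^ (4 / (n - 2)) g` satisfies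
`R̄_{kl}(q) = R_{nn}(q) = R_{nk}(q) = 0`. -/
structure IsNormalizedConformalFamily (B : FormField m M) (Λ : M → M → ℝ) : Prop where
  smooth : ∀ q ∈ (𝓡∂ (m + 1)).boundary M, ContMDiff (𝓡∂ (m + 1)) 𝓘(ℝ, ℝ) ∞ (Λ q)
  pos : ∀ q ∈ (𝓡∂ (m + 1)).boundary M, ∀ x, 0 < Λ q x
  one : ∀ q ∈ (𝓡∂ (m + 1)).boundary M, Λ q q = 1
  deriv_zero : ∀ q ∈ (𝓡∂ (m + 1)).boundary M, mfderiv (𝓡∂ (m + 1)) 𝓘(ℝ, ℝ) (Λ q) q = 0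
  bdRicci : ∀ q ∈ (𝓡∂ (m + 1)).boundary M, ∀ e, IsAdaptedFrame (conformal B (Λ q)) q e →
    ∀ k l : Fin m, ∑ i, bdCurv (conformal B (Λ q)) q e i k i l = 0
  ricci : ∀ q ∈ (𝓡∂ (m + 1)).boundary M, ∀ e, IsAdaptedFrame (conformal B (Λ q)) q e →
    ∀ b : Fin (m + 1), ∑ a, curv (conformal B (Λ q)) q e a 0 a b = 0

/-- The right-hand side of the linear problem at `q`, with the curvatures at `q` of
`g̃_q = Λ_q ^ (4 / (n - 2)) g` expressed in the frame `e`. -/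
def geomRhs (B : FormField m M) (Λ : M → M → ℝ) (q : M)
    (e : Fin (m + 1) → TangentSpace (𝓡∂ (m + 1)) q) : EuclideanSpace ℝ (Fin (m + 1)) → ℝ :=
  correctorRhs (bdCurv (conformal B (Λ q)) q e)
    (fun i j => curv (conformal B (Λ q)) q e 0 i.succ 0 j.succ)

end Manifold

end BoundaryBubble

end

noncomputable section

set_option maxSynthPendingDepth 3

namespace BoundaryBubble

open scoped Topology Matrix

/-! ### Curvature in terms of bilinear forms -/

/-! Write n = m + 1, t and z for the normal and tangential coordinates, e for the inward normal and
ρ = (1+t)² + |z|². After the normalization the curvature enters the problem only through one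
trace-free matrix A_ij = R_ninj. Indeed ∂²_ij U = (n-2)(n y_i y_j ρ^(-(n+2)/2) - δ_ij ρ^(-n/2)); the
boundary curvature term vanishes by the antisymmetry of R̄ and the vanishing of its Ricci tensor,
and R_nn = 0 kills the trace of R_ninj. The right-hand side becomes n(n-2) t² ρ^(-(n+2)/2) A(z,z)
(`correctorRhs_eq`).

Existence is explicit. For A trace-free and φ a function of t and |z|, Δ(A(z,z) φ) is A(z,z) times
the Laplacian of φ in dimension n+4. The potentials J_k = ∫_0^∞ λ^k |y+(1+λ)e|^(-(n+2)) dλ are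
harmonic in that dimension, ∂_t J_(k+1) = -(k+1) J_k and ∂_t J_0 = -ρ^(-(n+2)/2). Hence one can
solve with φ = ∑_(k≤3) q_k(t) J_k, where the polynomials q_k come from a short recursion and their
constant terms are chosen for the boundary condition (`laplacian_profile`, `pd_zero_profile`). The
solution is v = A(z,z) φ (`tensorSol`). Its decay is a count of degrees (`IsSymbol`). Since φ ≥ 0,
the product v Δv is pointwise nonpositive. Orthogonality to the kernel and the boundary integral
follow from sign changes and permutations of the tangential coordinates, together with the vanishing
trace of A.

For uniqueness, think of the homogeneous problem on the unit ball: u is harmonic with ∂_r u = u on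
the sphere, so x·∇u - u is harmonic, vanishes on the sphere, hence is zero, and u is linear. The
linear functions are the kernel functions, so orthogonality forces u = 0. The proof carries this out
on the half-space: `conformalDeriv` is the transported x·∇u - u, and it vanishes by a Liouville
theorem (`eq_zero_of_harmonic`) whose growth hypothesis is supplied by w ∈ H¹.

For the dependence on q, note that Λ_q carries no regularity in q. The vanishing Ricci components
determine precisely those entries of its Hessian at q that enter R_ninj, so A is an expression
`normalizedCurv` in the curvature of g alone (`curv_eq_normalizedCurv`). Curvature at q is defined
in the chart centred at q, so its invariance under coordinate changes
(`IsPullbackAt.riemannForm_eq`) is needed to see it vary in one fixed chart. It is then C² along C²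
frames and bounded by compactness; v is linear in A, which gives the uniform constant and the C²
dependence. -/

/-- The bilinear form with matrix `A` in the standard basis. -/
def matrixForm {k : ℕ} (A : Matrix (Fin k) (Fin k) ℝ) :
    EuclideanSpace ℝ (Fin k) →L[ℝ] EuclideanSpace ℝ (Fin k) →L[ℝ] ℝ :=
  ∑ a, ∑ b, A a b • (EuclideanSpace.proj (𝕜 := ℝ) a).smulRight (EuclideanSpace.proj (𝕜 := ℝ) b)

theorem matrixForm_apply {k : ℕ} (A : Matrix (Fin k) (Fin k) ℝ) (u v : EuclideanSpace ℝ (Fin k)) :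
    matrixForm A u v = ∑ a, ∑ b, A a b * u a * v b := by
  simp [matrixForm, mul_assoc]

@[simp] theorem matrixForm_single {k : ℕ} (A : Matrix (Fin k) (Fin k) ℝ) (a b : Fin k) :
    matrixForm A (EuclideanSpace.single a 1) (EuclideanSpace.single b 1) = A a b := by
  rw [matrixForm_apply, Finset.sum_eq_single a, Finset.sum_eq_single b] <;> simp +contextual

theorem matrixForm_comm {k : ℕ} {A : Matrix (Fin k) (Fin k) ℝ} (hA : A.IsSymm)
    (u v : EuclideanSpace ℝ (Fin k)) : matrixForm A u v = matrixForm A v u := by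
  rw [matrixForm_apply, matrixForm_apply, Finset.sum_comm]
  refine Finset.sum_congr rfl fun a _ => Finset.sum_congr rfl fun b _ => ?_
  rw [hA.apply]; ring

theorem matrixForm_separating {k : ℕ} {A : Matrix (Fin k) (Fin k) ℝ} (hA : A.det ≠ 0)
    {u : EuclideanSpace ℝ (Fin k)} (hu : ∀ w, matrixForm A u w = 0) : u = 0 := by
  have h : Matrix.vecMul u.ofLp A = 0 := by
    ext b
    have := hu (EuclideanSpace.single b 1)
    rw [matrixForm_apply] at this
    simp only [Matrix.vecMul, dotProduct, Pi.zero_apply]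
    rw [← this]
    refine Finset.sum_congr rfl fun a _ => ?_
    rw [Finset.sum_eq_single b] <;> simp +contextual [mul_comm]
  have := Matrix.eq_zero_of_vecMul_eq_zero hA h
  ext i; exact congrFun this i

theorem matrixForm_ext {k : ℕ} {A : Matrix (Fin k) (Fin k) ℝ} (hA : A.det ≠ 0)
    {u v : EuclideanSpace ℝ (Fin k)} (huv : ∀ w, matrixForm A u w = matrixForm A v w) : u = v := by
  rw [← sub_eq_zero]
  exact matrixForm_separating hA fun w => by simp [huv w]

theorem eq_sum_of_isLinearMap {k : ℕ} {f : EuclideanSpace ℝ (Fin k) → ℝ} (hf : IsLinearMap ℝ f)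
    (u : EuclideanSpace ℝ (Fin k)) : f u = ∑ a, u a * f (EuclideanSpace.single a 1) := by
  have hu : u = ∑ a, u a • EuclideanSpace.single a (1 : ℝ) := by
    ext i; simp [Finset.sum_apply, Pi.single_apply]
  have := congrArg (hf.mk' f) hu
  rw [map_sum] at this
  simpa using this

variable {k : ℕ} {S : Set (EuclideanSpace ℝ (Fin k))}
  {G : EuclideanSpace ℝ (Fin k) → Matrix (Fin k) (Fin k) ℝ} {y : EuclideanSpace ℝ (Fin k)}

theorem contDiffWithinAt_matrixForm {n : WithTop ℕ∞}
    (hG : ∀ a b, ContDiffWithinAt ℝ n (fun x => G x a b) S y) :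
    ContDiffWithinAt ℝ n (fun x => matrixForm (G x)) S y := by
  unfold matrixForm
  exact ContDiffWithinAt.sum fun a _ => ContDiffWithinAt.sum fun b _ =>
    (hG a b).smul contDiffWithinAt_const

theorem pd_apply_eq {B : EuclideanSpace ℝ (Fin k) →
      (EuclideanSpace ℝ (Fin k) →L[ℝ] EuclideanSpace ℝ (Fin k) →L[ℝ] ℝ)}
    (hS : UniqueDiffWithinAt ℝ S y)
    (hB : DifferentiableWithinAt ℝ B S y) (u v : EuclideanSpace ℝ (Fin k)) (c : Fin k) :
    pd S (fun x => B x u v) c y = fderivWithin ℝ B S y (EuclideanSpace.single c 1) u v := by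
  unfold pd
  have h := hB.hasFDerivWithinAt
  have h2 := (h.clm_apply (hasFDerivWithinAt_const u y S)).clm_apply (hasFDerivWithinAt_const v y S)
  rw [h2.fderivWithin hS]
  simp

/-- Christoffel symbols with the upper index lowered, as a trilinear form; `D` stands for the
derivative of the metric. -/
def lowChristoffel {E : Type*} [NormedAddCommGroup E] [NormedSpace ℝ E]
    (D : E →L[ℝ] E →L[ℝ] E →L[ℝ] ℝ) (u v w : E) : ℝ :=
  (1 / 2) * (D u v w + D v u w - D w u v)

theorem lowChristoffel_comm {E : Type*} [NormedAddCommGroup E] [NormedSpace ℝ E]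
    {D : E →L[ℝ] E →L[ℝ] E →L[ℝ] ℝ} (hD : ∀ a b c, D a b c = D a c b) (u v w : E) :
    lowChristoffel D u v w = lowChristoffel D v u w := by
  unfold lowChristoffel; rw [hD w u v]; ring

/-- The part of the Riemann tensor that is linear in the second derivatives `D₂` of the metric. -/
def riemannLinear {E : Type*} [NormedAddCommGroup E] [NormedSpace ℝ E]
    (D₂ : E →L[ℝ] E →L[ℝ] E →L[ℝ] E →L[ℝ] ℝ) (u₁ u₂ u₃ u₄ : E) : ℝ :=
  (1 / 2) * (D₂ u₃ u₂ u₁ u₄ + D₂ u₄ u₁ u₂ u₃ - D₂ u₃ u₁ u₂ u₄ - D₂ u₄ u₂ u₁ u₃)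

/-- The Riemann tensor evaluated on four vectors. -/
def riemannForm (S : Set (EuclideanSpace ℝ (Fin k)))
    (G : EuclideanSpace ℝ (Fin k) → Matrix (Fin k) (Fin k) ℝ) (y : EuclideanSpace ℝ (Fin k))
    (u₁ u₂ u₃ u₄ : EuclideanSpace ℝ (Fin k)) : ℝ :=
  ∑ a, ∑ b, ∑ c, ∑ d, u₁ a * u₂ b * u₃ c * u₄ d * riemann S G a b c d y

/-- The hypotheses on a metric, near a point of its domain, under which curvature is computed. -/
structure IsMetricAt (S : Set (EuclideanSpace ℝ (Fin k)))
    (G : EuclideanSpace ℝ (Fin k) → Matrix (Fin k) (Fin k) ℝ) (y : EuclideanSpace ℝ (Fin k)) :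
    Prop where
  uniqueDiffOn : UniqueDiffOn ℝ S
  mem : y ∈ S
  subset_closure : S ⊆ closure (interior S)
  contDiff : ∀ a b, ContDiffWithinAt ℝ 2 (fun x => G x a b) S y
  symm : ∀ᶠ x in 𝓝[S] y, (G x).IsSymm
  det_ne_zero : (G y).det ≠ 0

theorem contDiffWithinAt_matrix_det {n : WithTop ℕ∞} {A : EuclideanSpace ℝ (Fin k) →
      Matrix (Fin k) (Fin k) ℝ} (hA : ∀ a b, ContDiffWithinAt ℝ n (fun x => A x a b) S y) :
    ContDiffWithinAt ℝ n (fun x => (A x).det) S y := by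
  simp only [Matrix.det_apply]
  exact ContDiffWithinAt.sum fun σ _ => by
    simp only [Units.smul_def, zsmul_eq_mul]
    exact contDiffWithinAt_const.mul (contDiffWithinAt_prod fun i _ => hA _ _)

theorem contDiffWithinAt_matrix_inv {n : WithTop ℕ∞}
    (hG : ∀ a b, ContDiffWithinAt ℝ n (fun x => G x a b) S y) (hdet : (G y).det ≠ 0) (a b : Fin k) :
    ContDiffWithinAt ℝ n (fun x => (G x)⁻¹ a b) S y := by
  simp only [Matrix.inv_def, Ring.inverse_eq_inv', Matrix.smul_apply, smul_eq_mul,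
    Matrix.adjugate_apply]
  refine ((contDiffWithinAt_matrix_det hG).inv hdet).mul (contDiffWithinAt_matrix_det fun i j => ?_)
  simp only [Matrix.updateRow_apply]
  split_ifs
  · exact contDiffWithinAt_const
  · exact hG i j

theorem contDiffWithinAt_pd {n N : WithTop ℕ∞} {f : EuclideanSpace ℝ (Fin k) → ℝ}
    (hf : ContDiffWithinAt ℝ N f S y) (hS : UniqueDiffOn ℝ S) (hy : y ∈ S) (hn : n + 1 ≤ N)
    (a : Fin k) : ContDiffWithinAt ℝ n (pd S f a) S y :=
  (hf.fderivWithin_right hS hn hy).clm_apply contDiffWithinAt_const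

theorem contDiffWithinAt_christoffel {n N : WithTop ℕ∞}
    (hG : ∀ a b, ContDiffWithinAt ℝ N (fun x => G x a b) S y) (hdet : (G y).det ≠ 0)
    (hS : UniqueDiffOn ℝ S) (hy : y ∈ S) (hn : n + 1 ≤ N) (c a b : Fin k) :
    ContDiffWithinAt ℝ n (christoffel S G c a b) S y := by
  unfold christoffel
  have hpd := fun i j l => contDiffWithinAt_pd (hG i j) hS hy hn l
  have hn' : n ≤ N := le_self_add.trans hn
  exact contDiffWithinAt_const.mul (ContDiffWithinAt.sum fun d _ =>
    ((contDiffWithinAt_matrix_inv hG hdet c d).of_le hn').mul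
      (((hpd b d a).add (hpd a d b)).sub (hpd a b d)))

theorem contDiffWithinAt_riemann
    (hG : ∀ a b, ContDiffWithinAt ℝ ∞ (fun x => G x a b) S y) (hdet : (G y).det ≠ 0)
    (hS : UniqueDiffOn ℝ S) (hy : y ∈ S) (a b c d : Fin k) :
    ContDiffWithinAt ℝ ∞ (riemann S G a b c d) S y := by
  unfold riemann
  have hn : (∞ : WithTop ℕ∞) + 1 ≤ ∞ := by simp
  have hc := fun i j l => contDiffWithinAt_christoffel hG hdet hS hy hn i j l
  have hpc := fun i j l p => contDiffWithinAt_pd (hc i j l) hS hy hn p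
  exact ContDiffWithinAt.sum fun e _ => (hG a e).mul (((hpc e d b c).sub (hpc e c b d)).add
    (ContDiffWithinAt.sum fun f _ => ((hc e c f).mul (hc f d b)).sub ((hc e d f).mul (hc f c b))))

/-! ### Multilinearity and Christoffel symbols with lowered index. -/

variable {k : ℕ} {S : Set (EuclideanSpace ℝ (Fin k))}
  {G : EuclideanSpace ℝ (Fin k) → Matrix (Fin k) (Fin k) ℝ} {y : EuclideanSpace ℝ (Fin k)}

theorem eq_sum_of_multilinear {F : EuclideanSpace ℝ (Fin k) → EuclideanSpace ℝ (Fin k) →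
      EuclideanSpace ℝ (Fin k) → EuclideanSpace ℝ (Fin k) → ℝ}
    (h₁ : ∀ u₂ u₃ u₄, IsLinearMap ℝ fun u => F u u₂ u₃ u₄)
    (h₂ : ∀ u₁ u₃ u₄, IsLinearMap ℝ fun u => F u₁ u u₃ u₄)
    (h₃ : ∀ u₁ u₂ u₄, IsLinearMap ℝ fun u => F u₁ u₂ u u₄)
    (h₄ : ∀ u₁ u₂ u₃, IsLinearMap ℝ fun u => F u₁ u₂ u₃ u)
    (u₁ u₂ u₃ u₄ : EuclideanSpace ℝ (Fin k)) :
    F u₁ u₂ u₃ u₄ = ∑ a, ∑ b, ∑ c, ∑ d, u₁ a * u₂ b * u₃ c * u₄ d *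
      F (EuclideanSpace.single a 1) (EuclideanSpace.single b 1) (EuclideanSpace.single c 1)
        (EuclideanSpace.single d 1) := by
  rw [eq_sum_of_isLinearMap (h₁ u₂ u₃ u₄) u₁]
  refine Finset.sum_congr rfl fun a _ => ?_
  rw [eq_sum_of_isLinearMap (h₂ _ u₃ u₄) u₂, Finset.mul_sum]
  refine Finset.sum_congr rfl fun b _ => ?_
  rw [eq_sum_of_isLinearMap (h₃ _ _ u₄) u₃, Finset.mul_sum, Finset.mul_sum]
  refine Finset.sum_congr rfl fun c _ => ?_
  rw [eq_sum_of_isLinearMap (h₄ _ _ _) u₄, Finset.mul_sum, Finset.mul_sum, Finset.mul_sum]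
  refine Finset.sum_congr rfl fun d _ => ?_
  ring

/-- The vector `∇_u v` for constant vector fields `u`, `v`. -/
def christoffelVec (S : Set (EuclideanSpace ℝ (Fin k)))
    (G : EuclideanSpace ℝ (Fin k) → Matrix (Fin k) (Fin k) ℝ) (y u v : EuclideanSpace ℝ (Fin k)) :
    EuclideanSpace ℝ (Fin k) :=
  WithLp.toLp 2 fun c => ∑ a, ∑ b, christoffel S G c a b y * u a * v b

theorem christoffelVec_single (a b c : Fin k) :
    christoffelVec S G y (EuclideanSpace.single a 1) (EuclideanSpace.single b 1) c =
      christoffel S G c a b y := by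
  simp only [christoffelVec]
  rw [Finset.sum_eq_single a, Finset.sum_eq_single b] <;> simp +contextual

theorem isLinearMap_christoffelVec_left (v : EuclideanSpace ℝ (Fin k)) :
    IsLinearMap ℝ fun u => christoffelVec S G y u v := by
  constructor
  · intro u u'
    ext c
    simp [christoffelVec, mul_add, add_mul, Finset.sum_add_distrib]
  · intro r u
    ext c
    simp only [christoffelVec, PiLp.smul_apply, smul_eq_mul, Finset.mul_sum]
    exact Finset.sum_congr rfl fun a _ => Finset.sum_congr rfl fun b _ => by ring

theorem isLinearMap_christoffelVec_right (u : EuclideanSpace ℝ (Fin k)) :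
    IsLinearMap ℝ fun v => christoffelVec S G y u v := by
  constructor
  · intro v v'
    ext c
    simp [christoffelVec, mul_add, Finset.sum_add_distrib]
  · intro r v
    ext c
    simp only [christoffelVec, PiLp.smul_apply, smul_eq_mul, Finset.mul_sum]
    exact Finset.sum_congr rfl fun a _ => Finset.sum_congr rfl fun b _ => by ring

theorem eq_of_bilinear {F F' : EuclideanSpace ℝ (Fin k) → EuclideanSpace ℝ (Fin k) → ℝ}
    (h₁ : ∀ v, IsLinearMap ℝ fun u => F u v) (h₂ : ∀ u, IsLinearMap ℝ fun v => F u v)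
    (h₁' : ∀ v, IsLinearMap ℝ fun u => F' u v) (h₂' : ∀ u, IsLinearMap ℝ fun v => F' u v)
    (h : ∀ a b, F (EuclideanSpace.single a 1) (EuclideanSpace.single b 1) =
      F' (EuclideanSpace.single a 1) (EuclideanSpace.single b 1))
    (u v : EuclideanSpace ℝ (Fin k)) : F u v = F' u v := by
  rw [eq_sum_of_isLinearMap (h₁ v) u, eq_sum_of_isLinearMap (h₁' v) u]
  refine Finset.sum_congr rfl fun a _ => ?_
  rw [eq_sum_of_isLinearMap (h₂ _) v, eq_sum_of_isLinearMap (h₂' _) v]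
  simp only [h]

/-- Lowering the upper index cancels the inverse matrix. All later differentiation is done on this
form, so the derivative of G⁻¹ is never computed. -/
theorem sum_mul_christoffel (hS : UniqueDiffWithinAt ℝ S y)
    (hG : DifferentiableWithinAt ℝ (fun x => matrixForm (G x)) S y)
    (hdet : (G y).det ≠ 0) (a b d : Fin k) :
    ∑ e, G y a e * christoffel S G e d b y =
      lowChristoffel (fderivWithin ℝ (fun x => matrixForm (G x)) S y)
        (EuclideanSpace.single d 1) (EuclideanSpace.single b 1) (EuclideanSpace.single a 1) := by
  have hpd : ∀ i j l, pd S (fun x => G x i j) l y =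
      fderivWithin ℝ (fun x => matrixForm (G x)) S y (EuclideanSpace.single l 1)
        (EuclideanSpace.single i 1) (EuclideanSpace.single j 1) := by
    intro i j l
    rw [← pd_apply_eq hS hG]
    simp
  have hinv : ∀ f, ∑ e, G y a e * (G y)⁻¹ e f = if a = f then 1 else 0 := by
    intro f
    have := congrFun (congrFun (Matrix.mul_nonsing_inv (G y) (isUnit_iff_ne_zero.2 hdet)) a) f
    rwa [Matrix.mul_apply, Matrix.one_apply] at this
  unfold christoffel lowChristoffel
  simp only [← hpd]
  calc _ = (1 / 2) * ∑ f, (∑ e, G y a e * (G y)⁻¹ e f) * (pd S (fun x => G x b f) d y +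
        pd S (fun x => G x d f) b y - pd S (fun x => G x d b) f y) := by
        simp only [Finset.mul_sum, Finset.sum_mul]
        rw [Finset.sum_comm]
        exact Finset.sum_congr rfl fun a _ => Finset.sum_congr rfl fun b _ => by ring
    _ = _ := by simp [hinv]

theorem isLinearMap_lowChristoffel_left {E : Type*} [NormedAddCommGroup E] [NormedSpace ℝ E]
    (D : E →L[ℝ] E →L[ℝ] E →L[ℝ] ℝ) (v w : E) : IsLinearMap ℝ fun u => lowChristoffel D u v w :=
  ⟨fun _ _ => by simp [lowChristoffel]; ring, fun _ _ => by simp [lowChristoffel]; ring⟩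

theorem isLinearMap_lowChristoffel_mid {E : Type*} [NormedAddCommGroup E] [NormedSpace ℝ E]
    (D : E →L[ℝ] E →L[ℝ] E →L[ℝ] ℝ) (u w : E) : IsLinearMap ℝ fun v => lowChristoffel D u v w :=
  ⟨fun _ _ => by simp [lowChristoffel]; ring, fun _ _ => by simp [lowChristoffel]; ring⟩

theorem isLinearMap_lowChristoffel_right {E : Type*} [NormedAddCommGroup E] [NormedSpace ℝ E]
    (D : E →L[ℝ] E →L[ℝ] E →L[ℝ] ℝ) (u v : E) : IsLinearMap ℝ fun w => lowChristoffel D u v w :=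
  ⟨fun _ _ => by simp [lowChristoffel]; ring, fun _ _ => by simp [lowChristoffel]; ring⟩

/-- Koszul's formula for constant fields. As the form is nondegenerate, it characterizes the vector
∇_u v; identities between connections are proved by pairing with an arbitrary w. -/
theorem matrixForm_christoffelVec (hS : UniqueDiffWithinAt ℝ S y)
    (hG : DifferentiableWithinAt ℝ (fun x => matrixForm (G x)) S y)
    (hdet : (G y).det ≠ 0) (hsymm : (G y).IsSymm) (u v w : EuclideanSpace ℝ (Fin k)) :
    matrixForm (G y) (christoffelVec S G y u v) w =
      lowChristoffel (fderivWithin ℝ (fun x => matrixForm (G x)) S y) u v w := by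
  revert u v
  have key : ∀ c u v, matrixForm (G y) (christoffelVec S G y u v) (EuclideanSpace.single c 1) =
      lowChristoffel (fderivWithin ℝ (fun x => matrixForm (G x)) S y) u v
        (EuclideanSpace.single c 1) := by
    intro c
    refine eq_of_bilinear (F := fun u v => matrixForm (G y) (christoffelVec S G y u v) _)
      (fun v => ?_) (fun u => ?_) (fun v => isLinearMap_lowChristoffel_left _ _ _)
      (fun u => isLinearMap_lowChristoffel_mid _ _ _) fun a b => ?_
    · have h := isLinearMap_christoffelVec_left (S := S) (G := G) (y := y) v
      exact ⟨fun x x' => by simp only [h.map_add]; simp, fun r x => by simp only [h.map_smul]; simp⟩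
    · have h := isLinearMap_christoffelVec_right (S := S) (G := G) (y := y) u
      exact ⟨fun x x' => by simp only [h.map_add]; simp, fun r x => by simp only [h.map_smul]; simp⟩
    · rw [← sum_mul_christoffel hS hG hdet, matrixForm_apply]
      refine Finset.sum_congr rfl fun e _ => ?_
      rw [Finset.sum_eq_single c, christoffelVec_single, ← hsymm.apply e c] <;>
        simp +contextual
  intro u v
  have h1 : IsLinearMap ℝ fun w => matrixForm (G y) (christoffelVec S G y u v) w :=
    ⟨fun _ _ => by simp, fun _ _ => by simp⟩
  rw [eq_sum_of_isLinearMap h1 w, eq_sum_of_isLinearMap (isLinearMap_lowChristoffel_right _ u v) w]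
  simp only [key]

/-! ### The Riemann tensor in terms of derivatives of the metric form. -/

variable {k : ℕ} {S : Set (EuclideanSpace ℝ (Fin k))}
  {G : EuclideanSpace ℝ (Fin k) → Matrix (Fin k) (Fin k) ℝ} {y : EuclideanSpace ℝ (Fin k)}

theorem pd_congr {f f' : EuclideanSpace ℝ (Fin k) → ℝ} (h : f =ᶠ[𝓝[S] y] f') (hy : y ∈ S)
    (a : Fin k) : pd S f a y = pd S f' a y := by
  unfold pd
  rw [h.fderivWithin_eq_of_mem hy]

theorem pd_sum {ι : Type*} {s : Finset ι} {f : ι → EuclideanSpace ℝ (Fin k) → ℝ}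
    (hS : UniqueDiffWithinAt ℝ S y) (hf : ∀ i ∈ s, DifferentiableWithinAt ℝ (f i) S y) (a : Fin k) :
    pd S (fun x => ∑ i ∈ s, f i x) a y = ∑ i ∈ s, pd S (f i) a y := by
  unfold pd
  rw [fderivWithin_fun_sum hS hf]
  simp

theorem pd_mul {f f' : EuclideanSpace ℝ (Fin k) → ℝ} (hS : UniqueDiffWithinAt ℝ S y)
    (hf : DifferentiableWithinAt ℝ f S y) (hf' : DifferentiableWithinAt ℝ f' S y) (a : Fin k) :
    pd S (fun x => f x * f' x) a y = pd S f a y * f' y + f y * pd S f' a y := by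
  unfold pd
  rw [fderivWithin_fun_mul hS hf hf']
  simp; ring

theorem fderivWithin_lowChristoffel {E F : Type*} [NormedAddCommGroup E] [NormedSpace ℝ E]
    [NormedAddCommGroup F] [NormedSpace ℝ F] {T : Set F} {x : F}
    {D : F → E →L[ℝ] E →L[ℝ] E →L[ℝ] ℝ} (hT : UniqueDiffWithinAt ℝ T x)
    (hD : DifferentiableWithinAt ℝ D T x) (u v w : E) (p : F) :
    fderivWithin ℝ (fun x => lowChristoffel (D x) u v w) T x p =
      lowChristoffel (fderivWithin ℝ D T x p) u v w := by
  have key : ∀ u v w, HasFDerivWithinAt (fun x => D x u v w)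
      (((fderivWithin ℝ D T x).flip u).flip v |>.flip w) T x := by
    intro u v w
    refine (((hD.hasFDerivWithinAt.clm_apply (hasFDerivWithinAt_const u x T)).clm_apply
      (hasFDerivWithinAt_const v x T)).clm_apply (hasFDerivWithinAt_const w x T)).congr_fderiv ?_
    ext; simp
  unfold lowChristoffel
  rw [((((key u v w).fun_add (key v u w)).fun_sub (key w u v)).const_mul (1 / 2)).fderivWithin hT]
  simp

namespace IsMetricAt

variable (h : IsMetricAt S G y)
include h

theorem contDiffWithinAt_form : ContDiffWithinAt ℝ 2 (fun x => matrixForm (G x)) S y :=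
  contDiffWithinAt_matrixForm h.contDiff

theorem uniqueDiffWithinAt : UniqueDiffWithinAt ℝ S y := h.uniqueDiffOn y h.mem

theorem differentiableWithinAt_form :
    DifferentiableWithinAt ℝ (fun x => matrixForm (G x)) S y :=
  h.contDiffWithinAt_form.differentiableWithinAt (by norm_num)

theorem differentiableWithinAt_fderivWithin :
    DifferentiableWithinAt ℝ (fderivWithin ℝ (fun x => matrixForm (G x)) S) S y :=
  (h.contDiffWithinAt_form.fderivWithin_right (m := 1) h.uniqueDiffOn (by norm_num)
    h.mem).differentiableWithinAt (by norm_num)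

theorem eventually_differentiable :
    ∀ᶠ x in 𝓝[S] y, DifferentiableWithinAt ℝ (fun x => matrixForm (G x)) S x := by
  have := h.contDiffWithinAt_form.eventually (by simp)
  rw [Set.insert_eq_of_mem h.mem] at this
  filter_upwards [this] with x hx using hx.differentiableWithinAt (by norm_num)

theorem eventually_det_ne_zero : ∀ᶠ x in 𝓝[S] y, (G x).det ≠ 0 :=
  (contDiffWithinAt_matrix_det h.contDiff).continuousWithinAt.eventually_ne h.det_ne_zero

theorem mem_closure : y ∈ closure (interior S) := h.subset_closure h.mem

theorem isSymm : (G y).IsSymm := h.symm.self_of_nhdsWithin h.mem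

theorem fderivWithin_comm (a u v : EuclideanSpace ℝ (Fin k)) :
    fderivWithin ℝ (fun x => matrixForm (G x)) S y a u v =
      fderivWithin ℝ (fun x => matrixForm (G x)) S y a v u := by
  have hB := h.differentiableWithinAt_form.hasFDerivWithinAt
  have h1 := (hB.clm_apply (hasFDerivWithinAt_const u y S)).clm_apply
    (hasFDerivWithinAt_const v y S)
  have h2 := (hB.clm_apply (hasFDerivWithinAt_const v y S)).clm_apply
    (hasFDerivWithinAt_const u y S)
  have h3 : (fun x => matrixForm (G x) u v) =ᶠ[𝓝[S] y] fun x => matrixForm (G x) v u := by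
    filter_upwards [h.symm] with x hx using matrixForm_comm hx u v
  have h4 := h2.congr_of_eventuallyEq h3 (h3.self_of_nhdsWithin h.mem)
  have := congrArg (fun L => L a) (h.uniqueDiffWithinAt.eq h1 h4)
  simpa using this

theorem eventually_isMetric_fderivWithin_comm :
    ∀ᶠ x in 𝓝[S] y, ∀ a u v, fderivWithin ℝ (fun x => matrixForm (G x)) S x a u v =
      fderivWithin ℝ (fun x => matrixForm (G x)) S x a v u := by
  have hs := eventually_eventually_nhdsWithin.2 h.symm
  filter_upwards [h.eventually_differentiable, hs, self_mem_nhdsWithin] with x hx hx' hxS a u v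
  have hB := hx.hasFDerivWithinAt
  have h1 := (hB.clm_apply (hasFDerivWithinAt_const u x S)).clm_apply
    (hasFDerivWithinAt_const v x S)
  have h2 := (hB.clm_apply (hasFDerivWithinAt_const v x S)).clm_apply
    (hasFDerivWithinAt_const u x S)
  have h3 : (fun x => matrixForm (G x) u v) =ᶠ[𝓝[S] x] fun x => matrixForm (G x) v u := by
    filter_upwards [hx'] with x hx using matrixForm_comm hx u v
  have h4 := h2.congr_of_eventuallyEq h3 (h3.self_of_nhdsWithin hxS)
  have := congrArg (fun L => L a) ((h.uniqueDiffOn x hxS).eq h1 h4)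
  simpa using this

theorem fderivWithin_fderivWithin_comm (a b u v : EuclideanSpace ℝ (Fin k)) :
    fderivWithin ℝ (fderivWithin ℝ (fun x => matrixForm (G x)) S) S y a b u v =
      fderivWithin ℝ (fderivWithin ℝ (fun x => matrixForm (G x)) S) S y a b v u := by
  have hB := h.differentiableWithinAt_fderivWithin.hasFDerivWithinAt
  have key := fun u v => ((hB.clm_apply (hasFDerivWithinAt_const b y S)).clm_apply
    (hasFDerivWithinAt_const u y S)).clm_apply (hasFDerivWithinAt_const v y S)
  have h3 : (fun x => fderivWithin ℝ (fun x => matrixForm (G x)) S x b u v) =ᶠ[𝓝[S] y]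
      fun x => fderivWithin ℝ (fun x => matrixForm (G x)) S x b v u := by
    filter_upwards [h.eventually_isMetric_fderivWithin_comm] with x hx using hx _ _ _
  have h4 := (key v u).congr_of_eventuallyEq h3 (h3.self_of_nhdsWithin h.mem)
  have := congrArg (fun L => L a) (h.uniqueDiffWithinAt.eq (key u v) h4)
  simpa using this

/-- Schwarz's theorem within S. It holds at boundary points too, because S lies in the closure of
its interior; this is the reason for that field of `IsMetricAt`. -/
theorem fderivWithin_fderivWithin_swap (a b u v : EuclideanSpace ℝ (Fin k)) :
    fderivWithin ℝ (fderivWithin ℝ (fun x => matrixForm (G x)) S) S y a b u v =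
      fderivWithin ℝ (fderivWithin ℝ (fun x => matrixForm (G x)) S) S y b a u v := by
  have := h.contDiffWithinAt_form.isSymmSndFDerivWithinAt (by simp) h.uniqueDiffOn h.mem_closure
    h.mem
  rw [this.eq a b]

/-- The product rule applied to G Γ = (lowered Γ) gives G ∂Γ = ∂(lowered Γ) - (∂G) Γ. The ΓΓ terms
of the definition are then combined with (∂G) Γ through metric compatibility. -/
theorem riemann_eq_lowChristoffel (a b c d : Fin k) :
    let D := fderivWithin ℝ (fun x => matrixForm (G x)) S y
    let D₂ := fderivWithin ℝ (fderivWithin ℝ (fun x => matrixForm (G x)) S) S y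
    let e : Fin k → EuclideanSpace ℝ (Fin k) := fun i => EuclideanSpace.single i 1
    riemann S G a b c d y =
      lowChristoffel (D₂ (e c)) (e d) (e b) (e a) - lowChristoffel (D₂ (e d)) (e c) (e b) (e a) -
      lowChristoffel D (e c) (e a) (christoffelVec S G y (e d) (e b)) +
      lowChristoffel D (e d) (e a) (christoffelVec S G y (e c) (e b)) := by
  intro D D₂ e
  have hlow : ∀ d b, ∀ᶠ x in 𝓝[S] y, ∑ f, G x a f * christoffel S G f d b x =
      lowChristoffel (fderivWithin ℝ (fun x => matrixForm (G x)) S x) (e d) (e b) (e a) := by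
    intro d b
    filter_upwards [h.eventually_differentiable, h.eventually_det_ne_zero, self_mem_nhdsWithin]
      with x hx hdet hxS
    exact sum_mul_christoffel (h.uniqueDiffOn x hxS) hx hdet a b d
  have hGd : ∀ i j, DifferentiableWithinAt ℝ (fun x => G x i j) S y := fun i j =>
    (h.contDiff i j).differentiableWithinAt (by norm_num)
  have hCd : ∀ i j l, DifferentiableWithinAt ℝ (christoffel S G i j l) S y := fun i j l =>
    (contDiffWithinAt_christoffel (n := 1) h.contDiff h.det_ne_zero h.uniqueDiffOn h.mem
      (by norm_num) i j l).differentiableWithinAt (by norm_num)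
  have hpd : ∀ c d b, ∑ f, G y a f * pd S (christoffel S G f d b) c y =
      lowChristoffel (D₂ (e c)) (e d) (e b) (e a) -
        ∑ f, D (e c) (e a) (e f) * christoffel S G f d b y := by
    intro c d b
    have h1 := pd_congr (hlow d b) h.mem c
    rw [pd_sum h.uniqueDiffWithinAt fun i _ => (hGd a i).fun_mul (hCd i d b)] at h1
    simp only [pd_mul h.uniqueDiffWithinAt (hGd a _) (hCd _ d b), Finset.sum_add_distrib] at h1
    have h2 : pd S (fun x => lowChristoffel (fderivWithin ℝ (fun x => matrixForm (G x)) S x)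
        (e d) (e b) (e a)) c y = lowChristoffel (D₂ (e c)) (e d) (e b) (e a) :=
      fderivWithin_lowChristoffel h.uniqueDiffWithinAt h.differentiableWithinAt_fderivWithin _ _ _ _
    have h3 : ∀ f, pd S (fun x => G x a f) c y = D (e c) (e a) (e f) := by
      intro f
      rw [← pd_apply_eq h.uniqueDiffWithinAt h.differentiableWithinAt_form]
      simp [e]
    simp only [h3] at h1
    linarith
  have hquad : ∀ c d, ∑ f, G y a f * ∑ g, christoffel S G f c g y * christoffel S G g d b y =
      ∑ g, lowChristoffel D (e c) (e g) (e a) * christoffel S G g d b y := by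
    intro c d
    have := fun g => (hlow c g).self_of_nhdsWithin h.mem
    simp only [D, ← this, Finset.mul_sum, Finset.sum_mul]
    rw [Finset.sum_comm]
    simp only [mul_assoc]
  have hvec : ∀ c d, lowChristoffel D (e c) (e a) (christoffelVec S G y (e d) (e b)) =
      ∑ f, lowChristoffel D (e c) (e a) (e f) * christoffel S G f d b y := by
    intro c d
    rw [eq_sum_of_isLinearMap (isLinearMap_lowChristoffel_right _ _ _) (christoffelVec _ _ _ _ _)]
    refine Finset.sum_congr rfl fun f _ => ?_
    rw [christoffelVec_single, mul_comm]
  -- Metric compatibility ∂_c G_af = Γ_cfa + Γ_caf for lowered symbols.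
  have hsplit : ∀ c d, ∑ g, lowChristoffel D (e c) (e g) (e a) * christoffel S G g d b y -
      ∑ f, D (e c) (e a) (e f) * christoffel S G f d b y =
      - ∑ f, lowChristoffel D (e c) (e a) (e f) * christoffel S G f d b y := by
    intro c d
    rw [← Finset.sum_sub_distrib, ← Finset.sum_neg_distrib]
    refine Finset.sum_congr rfl fun f _ => ?_
    have hc := h.fderivWithin_comm
    simp only [lowChristoffel, D]
    rw [hc (e f) (e c) (e a), hc (e c) (e f) (e a), hc (e a) (e c) (e f)]
    ring
  unfold riemann
  simp only [mul_add, mul_sub, Finset.sum_sub_distrib, Finset.sum_add_distrib]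
  have q1 := hquad c d
  have q2 := hquad d c
  rw [hpd, hpd, hvec, hvec, q1, q2]
  have := hsplit c d
  have := hsplit d c
  linarith

end IsMetricAt

/-! ### Symmetries of the Riemann tensor and its conformal change. -/

variable {k : ℕ} {S : Set (EuclideanSpace ℝ (Fin k))}
  {G : EuclideanSpace ℝ (Fin k) → Matrix (Fin k) (Fin k) ℝ} {y : EuclideanSpace ℝ (Fin k)}

namespace IsMetricAt

section
variable (h : IsMetricAt S G y)
include h

theorem matrixForm_christoffelVec (u v w : EuclideanSpace ℝ (Fin k)) :
    matrixForm (G y) (christoffelVec S G y u v) w =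
      lowChristoffel (fderivWithin ℝ (fun x => matrixForm (G x)) S y) u v w :=
  BoundaryBubble.matrixForm_christoffelVec h.uniqueDiffWithinAt h.differentiableWithinAt_form
    h.det_ne_zero h.isSymm u v w

theorem christoffelVec_comm (u v : EuclideanSpace ℝ (Fin k)) :
    christoffelVec S G y u v = christoffelVec S G y v u := by
  refine matrixForm_ext h.det_ne_zero fun w => ?_
  rw [h.matrixForm_christoffelVec, h.matrixForm_christoffelVec,
    lowChristoffel_comm h.fderivWithin_comm]

/-- The classical expression of R: a part linear in the second derivatives of the metric plus ⟨Γ,Γ⟩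
terms. The two antisymmetries, the conformal change and the coordinate invariance are all read off
from it. -/
theorem riemannForm_eq (u₁ u₂ u₃ u₄ : EuclideanSpace ℝ (Fin k)) :
    riemannForm S G y u₁ u₂ u₃ u₄ =
      riemannLinear (fderivWithin ℝ (fderivWithin ℝ (fun x => matrixForm (G x)) S) S y) u₁ u₂ u₃ u₄ +
      matrixForm (G y) (christoffelVec S G y u₁ u₄) (christoffelVec S G y u₂ u₃) -
      matrixForm (G y) (christoffelVec S G y u₁ u₃) (christoffelVec S G y u₂ u₄) := by
  set D := fderivWithin ℝ (fun x => matrixForm (G x)) S y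
  set D₂ := fderivWithin ℝ (fderivWithin ℝ (fun x => matrixForm (G x)) S) S y with hD₂
  let F : EuclideanSpace ℝ (Fin k) → EuclideanSpace ℝ (Fin k) →
      EuclideanSpace ℝ (Fin k) → EuclideanSpace ℝ (Fin k) → ℝ := fun u₁ u₂ u₃ u₄ =>
      lowChristoffel (D₂ u₃) u₄ u₂ u₁ - lowChristoffel (D₂ u₄) u₃ u₂ u₁ -
      lowChristoffel D u₃ u₁ (christoffelVec S G y u₄ u₂) +
      lowChristoffel D u₄ u₁ (christoffelVec S G y u₃ u₂)
  have cl := fun v => isLinearMap_christoffelVec_left (S := S) (G := G) (y := y) v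
  have cr := fun v => isLinearMap_christoffelVec_right (S := S) (G := G) (y := y) v
  have hF : riemannForm S G y u₁ u₂ u₃ u₄ = F u₁ u₂ u₃ u₄ := by
    rw [eq_sum_of_multilinear (F := F)]
    · unfold riemannForm
      refine Finset.sum_congr rfl fun a _ => Finset.sum_congr rfl fun b _ =>
        Finset.sum_congr rfl fun c _ => Finset.sum_congr rfl fun d _ => ?_
      rw [h.riemann_eq_lowChristoffel]
    · refine fun _ _ _ => ⟨fun _ _ => ?_, fun _ _ => ?_⟩ <;> simp [F, lowChristoffel] <;> ring
    · refine fun _ _ _ => ⟨fun _ _ => ?_, fun _ _ => ?_⟩ <;>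
        simp [F, lowChristoffel, (cr _).map_add, (cr _).map_smul] <;> ring
    · refine fun _ _ _ => ⟨fun _ _ => ?_, fun _ _ => ?_⟩ <;>
        simp [F, lowChristoffel, (cl _).map_add, (cl _).map_smul] <;> ring
    · refine fun _ _ _ => ⟨fun _ _ => ?_, fun _ _ => ?_⟩ <;>
        simp [F, lowChristoffel, (cl _).map_add, (cl _).map_smul] <;> ring
  rw [hF]
  have hc := h.fderivWithin_fderivWithin_comm
  have hs := h.fderivWithin_fderivWithin_swap
  simp only [F, D, ← h.matrixForm_christoffelVec]
  rw [h.christoffelVec_comm u₃ u₁, h.christoffelVec_comm u₄ u₁, h.christoffelVec_comm u₃ u₂,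
    h.christoffelVec_comm u₄ u₂]
  simp only [lowChristoffel, riemannLinear]
  have e1 := hs u₃ u₄ u₂ u₁
  have e2 := hc u₃ u₂ u₄ u₁
  have e3 := hc u₃ u₁ u₄ u₂
  have e4 := hc u₄ u₂ u₃ u₁
  have e5 := hc u₄ u₁ u₃ u₂
  simp only [← hD₂] at e1 e2 e3 e4 e5
  linarith

theorem riemannForm_swap (u₁ u₂ u₃ u₄ : EuclideanSpace ℝ (Fin k)) :
    riemannForm S G y u₂ u₁ u₃ u₄ = -riemannForm S G y u₁ u₂ u₃ u₄ := by
  rw [h.riemannForm_eq, h.riemannForm_eq, riemannLinear, riemannLinear,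
    matrixForm_comm h.isSymm (christoffelVec S G y u₂ u₄),
    matrixForm_comm h.isSymm (christoffelVec S G y u₂ u₃)]
  ring

theorem riemannForm_swap_right (u₁ u₂ u₃ u₄ : EuclideanSpace ℝ (Fin k)) :
    riemannForm S G y u₁ u₂ u₄ u₃ = -riemannForm S G y u₁ u₂ u₃ u₄ := by
  rw [h.riemannForm_eq, h.riemannForm_eq, riemannLinear, riemannLinear]
  ring

end

section Conformal

theorem conformal {lam : EuclideanSpace ℝ (Fin k) → ℝ} (h : IsMetricAt S G y)
    (hlam : ContDiffWithinAt ℝ 2 lam S y) (h1 : lam y = 1) :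
    IsMetricAt S (fun x => lam x • G x) y where
  uniqueDiffOn := h.uniqueDiffOn
  mem := h.mem
  subset_closure := h.subset_closure
  contDiff a b := hlam.mul (h.contDiff a b)
  symm := by filter_upwards [h.symm] with x hx using hx.smul _
  det_ne_zero := by simpa [h1] using h.det_ne_zero

/-- The factor equals 1 to first order at y, so the metric, its first derivative and the vectors ∇_u
v are unchanged there. Only the second derivative changes, by Hess(lam) ⊗ G, and this enters through
the linear part of R. -/
theorem riemannForm_conformal {lam : EuclideanSpace ℝ (Fin k) → ℝ} (h : IsMetricAt S G y)
    (hlam : ContDiffWithinAt ℝ 2 lam S y) (h1 : lam y = 1) (h0 : fderivWithin ℝ lam S y = 0)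
    (u₁ u₂ u₃ u₄ : EuclideanSpace ℝ (Fin k)) :
    let L := fderivWithin ℝ (fderivWithin ℝ lam S) S y
    riemannForm S (fun x => lam x • G x) y u₁ u₂ u₃ u₄ = riemannForm S G y u₁ u₂ u₃ u₄ +
      (1 / 2) * (L u₃ u₂ * matrixForm (G y) u₁ u₄ + L u₄ u₁ * matrixForm (G y) u₂ u₃ -
        L u₃ u₁ * matrixForm (G y) u₂ u₄ - L u₄ u₂ * matrixForm (G y) u₁ u₃) := by
  intro L
  have h' := h.conformal hlam h1
  have hform : (fun x => matrixForm (lam x • G x)) = fun x => lam x • matrixForm (G x) := by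
    ext x u v
    simp only [matrixForm_apply, Matrix.smul_apply, smul_eq_mul, smul_apply,
      Finset.mul_sum, mul_assoc]
  -- The product rule is needed on a neighbourhood, not only at y, because it is differentiated once
  -- more.
  have hev : ∀ᶠ x in 𝓝[S] y, fderivWithin ℝ (fun x => lam x • matrixForm (G x)) S x =
      lam x • fderivWithin ℝ (fun x => matrixForm (G x)) S x +
        (fderivWithin ℝ lam S x).smulRight (matrixForm (G x)) := by
    have hl := hlam.eventually (by simp)
    rw [Set.insert_eq_of_mem h.mem] at hl
    filter_upwards [h.eventually_differentiable, hl, self_mem_nhdsWithin] with x hx hx' hxS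
    exact fderivWithin_fun_smul (h.uniqueDiffOn x hxS)
      (hx'.differentiableWithinAt (by norm_num)) hx
  have hD : fderivWithin ℝ (fun x => matrixForm (lam x • G x)) S y =
      fderivWithin ℝ (fun x => matrixForm (G x)) S y := by
    rw [hform, hev.self_of_nhdsWithin h.mem, h1, h0]
    ext; simp
  have hlD : DifferentiableWithinAt ℝ (fderivWithin ℝ lam S) S y :=
    (hlam.fderivWithin_right (m := 1) h.uniqueDiffOn (by norm_num)
      h.mem).differentiableWithinAt (by norm_num)
  have hl1 := (hlam.differentiableWithinAt (by norm_num)).hasFDerivWithinAt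
  have hD₂ : ∀ a b u v, fderivWithin ℝ (fderivWithin ℝ
      (fun x => matrixForm (lam x • G x)) S) S y a b u v =
      fderivWithin ℝ (fderivWithin ℝ (fun x => matrixForm (G x)) S) S y a b u v +
        L a b * matrixForm (G y) u v := by
    intro a b u v
    have hA : fderivWithin ℝ (fderivWithin ℝ (fun x => matrixForm (lam x • G x)) S) S y a b u v =
        fderivWithin ℝ (fun x => fderivWithin ℝ (fun x => matrixForm (lam x • G x)) S x b u v)
          S y a := by
      have hB := h'.differentiableWithinAt_fderivWithin.hasFDerivWithinAt
      rw [(((hB.clm_apply (hasFDerivWithinAt_const b y S)).clm_apply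
        (hasFDerivWithinAt_const u y S)).clm_apply
        (hasFDerivWithinAt_const v y S)).fderivWithin h.uniqueDiffWithinAt]
      simp
    have hev' : (fun x => fderivWithin ℝ (fun x => matrixForm (lam x • G x)) S x b u v) =ᶠ[𝓝[S] y]
        fun x => lam x * fderivWithin ℝ (fun x => matrixForm (G x)) S x b u v +
          fderivWithin ℝ lam S x b * matrixForm (G x) u v := by
      filter_upwards [hev] with x hx
      rw [hform, hx]
      simp
    rw [hA, hev'.fderivWithin_eq_of_mem h.mem]
    have hB := h.differentiableWithinAt_fderivWithin.hasFDerivWithinAt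
    have hB1 := h.differentiableWithinAt_form.hasFDerivWithinAt
    have hc1 := ((hB.clm_apply (hasFDerivWithinAt_const b y S)).clm_apply
        (hasFDerivWithinAt_const u y S)).clm_apply (hasFDerivWithinAt_const v y S)
    have hc2 := (hB1.clm_apply (hasFDerivWithinAt_const u y S)).clm_apply
        (hasFDerivWithinAt_const v y S)
    have hc3 := hlD.hasFDerivWithinAt.clm_apply (hasFDerivWithinAt_const b y S)
    rw [((hl1.fun_mul hc1).fun_add (hc3.fun_mul hc2)).fderivWithin h.uniqueDiffWithinAt]
    simp [h0, h1, L, mul_comm]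
  have hΓ : ∀ u v, christoffelVec S (fun x => lam x • G x) y u v = christoffelVec S G y u v := by
    intro u v
    refine matrixForm_ext h.det_ne_zero fun w => ?_
    rw [h.matrixForm_christoffelVec, ← hD, ← h'.matrixForm_christoffelVec, h1, one_smul]
  rw [h'.riemannForm_eq, h.riemannForm_eq]
  simp only [hΓ, riemannLinear, hD₂, h1, one_smul]
  ring

end Conformal

end IsMetricAt

/-! ### Invariance of the Riemann tensor under changes of coordinates. -/

variable {k : ℕ} {S S' : Set (EuclideanSpace ℝ (Fin k))}
  {G G' : EuclideanSpace ℝ (Fin k) → Matrix (Fin k) (Fin k) ℝ} {y : EuclideanSpace ℝ (Fin k)}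
  {ψ : EuclideanSpace ℝ (Fin k) → EuclideanSpace ℝ (Fin k)}

/-- The algebraic identity behind the invariance of the Riemann tensor: the terms with second and
third derivatives of the change of coordinates cancel. -/
theorem riemann_pullback_identity {E : Type*} {B : E → E → ℝ} {D : E → E → E → ℝ}
    {D₂ : E → E → E → E → ℝ} {H : E → E → E} {T : E → E → E → E} {J : E → E}
    {R : E → E → E → E → ℝ} {Q : E → E → E → E → ℝ} {Γ : E → E → E → ℝ}
    (hB : ∀ a b, B a b = B b a) (hD : ∀ a b c, D a b c = D a c b)
    (hH : ∀ a b, H a b = H b a) (hT : ∀ a b c, T a b c = T b a c) (hT' : ∀ a b c, T a b c = T a c b)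
    (hΓ : ∀ a b w, Γ a b w = (1 / 2) * (D (J a) (J b) w + D (J b) (J a) w - D w (J a) (J b)))
    (hR : ∀ a b u v, R a b u v = D₂ (J a) (J b) (J u) (J v) + D (H a b) (J u) (J v) +
      D (J b) (H a u) (J v) + D (J b) (J u) (H a v) + D (J a) (H b u) (J v) + B (T a b u) (J v) +
      B (H b u) (H a v) + D (J a) (J u) (H b v) + B (H a u) (H b v) + B (J u) (T a b v))
    (hQ : ∀ a b c d, Q a b c d =
      Γ a b (H c d) + Γ c d (H a b) + B (H a b) (H c d)) (u₁ u₂ u₃ u₄ : E) :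
    1 / 2 * (R u₃ u₂ u₁ u₄ + R u₄ u₁ u₂ u₃ - R u₃ u₁ u₂ u₄ - R u₄ u₂ u₁ u₃) + Q u₁ u₄ u₂ u₃ -
      Q u₁ u₃ u₂ u₄ = 1 / 2 * (D₂ (J u₃) (J u₂) (J u₁) (J u₄) + D₂ (J u₄) (J u₁) (J u₂) (J u₃) -
      D₂ (J u₃) (J u₁) (J u₂) (J u₄) - D₂ (J u₄) (J u₂) (J u₁) (J u₃)) := by
  simp only [hR, hQ, hΓ]
  rw [hH u₃ u₂, hH u₄ u₁, hH u₃ u₁, hH u₄ u₂, hH u₄ u₃, hH u₂ u₁]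
  rw [hT u₃ u₂ u₁, hT' u₂ u₃ u₁, hT u₂ u₁ u₃, hT u₃ u₂ u₄, hT u₄ u₁ u₂, hT' u₁ u₄ u₂, hT u₄ u₁ u₃,
    hT' u₁ u₄ u₃, hT u₃ u₁ u₂, hT' u₁ u₃ u₂, hT u₃ u₁ u₄, hT u₄ u₂ u₁, hT' u₂ u₄ u₁, hT u₂ u₁ u₄,
    hT u₄ u₂ u₃, hT' u₂ u₄ u₃]
  rw [hB (H u₂ u₃) (H u₁ u₄), hB (H u₂ u₄) (H u₁ u₃)]
  simp only [fun a b c d => hD a (J b) (H c d)]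
  ring

/-- `G` is, near `y`, the pullback of the metric `G'` under `ψ`. -/
structure IsPullbackAt (S S' : Set (EuclideanSpace ℝ (Fin k)))
    (G G' : EuclideanSpace ℝ (Fin k) → Matrix (Fin k) (Fin k) ℝ)
    (ψ : EuclideanSpace ℝ (Fin k) → EuclideanSpace ℝ (Fin k)) (y : EuclideanSpace ℝ (Fin k)) :
    Prop where
  source : IsMetricAt S G y
  target : IsMetricAt S' G' (ψ y)
  contDiff : ContDiffWithinAt ℝ 3 ψ S y
  mapsTo : ∀ᶠ x in 𝓝[S] y, ψ x ∈ S'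
  pullback : ∀ᶠ x in 𝓝[S] y, ∀ u v, matrixForm (G x) u v =
    matrixForm (G' (ψ x)) (fderivWithin ℝ ψ S x u) (fderivWithin ℝ ψ S x v)

namespace IsPullbackAt

variable (h : IsPullbackAt S S' G G' ψ y)
include h

theorem tendsto : Filter.Tendsto ψ (𝓝[S] y) (𝓝[S'] (ψ y)) :=
  tendsto_nhdsWithin_iff.2 ⟨h.contDiff.continuousWithinAt, h.mapsTo⟩

theorem contDiffWithinAt_fderivWithin : ContDiffWithinAt ℝ 2 (fderivWithin ℝ ψ S) S y :=
  h.contDiff.fderivWithin_right h.source.uniqueDiffOn (by norm_num) h.source.mem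

theorem contDiffWithinAt_fderivWithin₂ :
    ContDiffWithinAt ℝ 1 (fderivWithin ℝ (fderivWithin ℝ ψ S) S) S y :=
  h.contDiffWithinAt_fderivWithin.fderivWithin_right h.source.uniqueDiffOn (by norm_num)
    h.source.mem

theorem fderivWithin_form :
    ∀ᶠ x in 𝓝[S] y, ∀ a u v,
      fderivWithin ℝ (fun x => matrixForm (G x)) S x a u v =
        fderivWithin ℝ (fun x => matrixForm (G' x)) S' (ψ x) (fderivWithin ℝ ψ S x a)
          (fderivWithin ℝ ψ S x u) (fderivWithin ℝ ψ S x v) +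
        matrixForm (G' (ψ x)) (fderivWithin ℝ (fderivWithin ℝ ψ S) S x a u)
          (fderivWithin ℝ ψ S x v) +
        matrixForm (G' (ψ x)) (fderivWithin ℝ ψ S x u)
          (fderivWithin ℝ (fderivWithin ℝ ψ S) S x a v) := by
  have e1 := h.contDiff.eventually (by simp)
  have e2 := h.contDiffWithinAt_fderivWithin.eventually (by simp)
  rw [Set.insert_eq_of_mem h.source.mem] at e1 e2
  have e3 := h.tendsto.eventually h.target.eventually_differentiable
  filter_upwards [e1, e2, e3, h.source.eventually_differentiable,
    eventually_eventually_nhdsWithin.2 h.pullback, eventually_eventually_nhdsWithin.2 h.mapsTo,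
    self_mem_nhdsWithin] with x h1 h2 h3 h4 h5 h6 hxS a u v
  have hu : UniqueDiffWithinAt ℝ S x := h.source.uniqueDiffOn x hxS
  have hψ := (h1.differentiableWithinAt (by norm_num)).hasFDerivWithinAt
  have hJ := (h2.differentiableWithinAt (by norm_num)).hasFDerivWithinAt
  have hB := h3.hasFDerivWithinAt.comp_of_tendsto x hψ
    (tendsto_nhdsWithin_iff.2 ⟨h1.continuousWithinAt, h6⟩)
  have hG := (h4.hasFDerivWithinAt.clm_apply (hasFDerivWithinAt_const u x S)).clm_apply
    (hasFDerivWithinAt_const v x S)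
  have hR := (hB.clm_apply (hJ.clm_apply (hasFDerivWithinAt_const u x S))).clm_apply
    (hJ.clm_apply (hasFDerivWithinAt_const v x S))
  have hev : (fun x => matrixForm (G x) u v) =ᶠ[𝓝[S] x] fun x =>
      (matrixForm (G' (ψ x))) (fderivWithin ℝ ψ S x u) (fderivWithin ℝ ψ S x v) := by
    filter_upwards [h5] with z hz using hz u v
  have := congrArg (fun L => L a) (hu.eq hG
    (hR.congr_of_eventuallyEq hev (hev.self_of_nhdsWithin hxS)))
  simp at this
  rw [this]
  ring

theorem fderivWithin_fderivWithin_form (a b u v : EuclideanSpace ℝ (Fin k)) :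
    let J := fderivWithin ℝ ψ S y
    let H := fderivWithin ℝ (fderivWithin ℝ ψ S) S y
    let T := fderivWithin ℝ (fderivWithin ℝ (fderivWithin ℝ ψ S) S) S y
    let B := matrixForm (G' (ψ y))
    let D := fderivWithin ℝ (fun x => matrixForm (G' x)) S' (ψ y)
    let D₂ := fderivWithin ℝ (fderivWithin ℝ (fun x => matrixForm (G' x)) S') S' (ψ y)
    fderivWithin ℝ (fderivWithin ℝ (fun x => matrixForm (G x)) S) S y a b u v =
      D₂ (J a) (J b) (J u) (J v) + D (H a b) (J u) (J v) + D (J b) (H a u) (J v) +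
      D (J b) (J u) (H a v) + D (J a) (H b u) (J v) + B (T a b u) (J v) + B (H b u) (H a v) +
      D (J a) (J u) (H b v) + B (H a u) (H b v) + B (J u) (T a b v) := by
  intro J H T B D D₂
  have hu := h.source.uniqueDiffWithinAt
  have hψ := (h.contDiff.differentiableWithinAt (by norm_num)).hasFDerivWithinAt
  have hJ := (h.contDiffWithinAt_fderivWithin.differentiableWithinAt (by norm_num)).hasFDerivWithinAt
  have hH := (h.contDiffWithinAt_fderivWithin₂.differentiableWithinAt
    (by norm_num)).hasFDerivWithinAt
  have hB := h.target.differentiableWithinAt_form.hasFDerivWithinAt.comp_of_tendsto y hψ h.tendsto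
  have hD := h.target.differentiableWithinAt_fderivWithin.hasFDerivWithinAt.comp_of_tendsto y hψ
    h.tendsto
  have c := fun p : EuclideanSpace ℝ (Fin k) => hasFDerivWithinAt_const (𝕜 := ℝ) p y S
  have hG := ((h.source.differentiableWithinAt_fderivWithin.hasFDerivWithinAt.clm_apply
    (c b)).clm_apply (c u)).clm_apply (c v)
  have hR := (((((hD.clm_apply (hJ.clm_apply (c b))).clm_apply (hJ.clm_apply (c u))).clm_apply
      (hJ.clm_apply (c v)))).fun_add
    ((hB.clm_apply ((hH.clm_apply (c b)).clm_apply (c u))).clm_apply (hJ.clm_apply (c v)))).fun_add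
    ((hB.clm_apply (hJ.clm_apply (c u))).clm_apply ((hH.clm_apply (c b)).clm_apply (c v)))
  have hev := h.fderivWithin_form.mono fun z hz => hz b u v
  have := congrArg (fun L => L a) (hu.eq hG
    (hR.congr_of_eventuallyEq hev (hev.self_of_nhdsWithin h.source.mem)))
  simp at this
  rw [this]
  simp only [J, H, T, B, D, D₂]
  ring

theorem hessian_comm (a b : EuclideanSpace ℝ (Fin k)) :
    fderivWithin ℝ (fderivWithin ℝ ψ S) S y a b = fderivWithin ℝ (fderivWithin ℝ ψ S) S y b a := by
  have := (h.contDiff.of_le (m := 2) (by norm_num)).isSymmSndFDerivWithinAt (by simp) h.source.uniqueDiffOn h.source.mem_closure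
    h.source.mem
  rw [this.eq a b]

theorem third_comm (a b c : EuclideanSpace ℝ (Fin k)) :
    fderivWithin ℝ (fderivWithin ℝ (fderivWithin ℝ ψ S) S) S y a b c =
      fderivWithin ℝ (fderivWithin ℝ (fderivWithin ℝ ψ S) S) S y b a c := by
  have := h.contDiffWithinAt_fderivWithin.isSymmSndFDerivWithinAt (by simp) h.source.uniqueDiffOn
    h.source.mem_closure h.source.mem
  rw [this.eq a b]

theorem third_comm_right (a b c : EuclideanSpace ℝ (Fin k)) :
    fderivWithin ℝ (fderivWithin ℝ (fderivWithin ℝ ψ S) S) S y a b c =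
      fderivWithin ℝ (fderivWithin ℝ (fderivWithin ℝ ψ S) S) S y a c b := by
  have hH := (h.contDiffWithinAt_fderivWithin₂.differentiableWithinAt
    (by norm_num)).hasFDerivWithinAt
  have key := fun b c => (hH.clm_apply (hasFDerivWithinAt_const b y S)).clm_apply
    (hasFDerivWithinAt_const c y S)
  have e1 := h.contDiff.eventually (by simp)
  rw [Set.insert_eq_of_mem h.source.mem] at e1
  have hev : (fun x => fderivWithin ℝ (fderivWithin ℝ ψ S) S x b c) =ᶠ[𝓝[S] y]
      fun x => fderivWithin ℝ (fderivWithin ℝ ψ S) S x c b := by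
    filter_upwards [e1, self_mem_nhdsWithin] with x hx hxS
    have := (hx.of_le (m := 2) (by norm_num)).isSymmSndFDerivWithinAt (by simp)
      h.source.uniqueDiffOn (h.source.subset_closure hxS) hxS
    rw [this.eq b c]
  have := congrArg (fun L => L a) (h.source.uniqueDiffWithinAt.eq (key b c)
    ((key c b).congr_of_eventuallyEq hev (hev.self_of_nhdsWithin h.source.mem)))
  simpa using this

theorem pullback_self (u v : EuclideanSpace ℝ (Fin k)) : matrixForm (G y) u v =
    matrixForm (G' (ψ y)) (fderivWithin ℝ ψ S y u) (fderivWithin ℝ ψ S y v) :=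
  h.pullback.self_of_nhdsWithin h.source.mem u v

theorem injective : Function.Injective (fderivWithin ℝ ψ S y) := by
  rw [injective_iff_map_eq_zero]
  intro u hu
  refine matrixForm_separating h.source.det_ne_zero fun w => ?_
  rw [h.pullback_self, hu]
  simp

theorem surjective : Function.Surjective (fderivWithin ℝ ψ S y) :=
  (LinearMap.injective_iff_surjective (f := (fderivWithin ℝ ψ S y).toLinearMap)).1 h.injective

/-- The inhomogeneous transformation law of the connection. Pairing with arbitrary vectors of the
target suffices because the derivative of ψ is injective (the pulled-back form is nondegenerate),
hence surjective. -/
theorem fderivWithin_christoffelVec (u v : EuclideanSpace ℝ (Fin k)) :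
    fderivWithin ℝ ψ S y (christoffelVec S G y u v) =
      christoffelVec S' G' (ψ y) (fderivWithin ℝ ψ S y u) (fderivWithin ℝ ψ S y v) +
        fderivWithin ℝ (fderivWithin ℝ ψ S) S y u v := by
  refine matrixForm_ext h.target.det_ne_zero fun w' => ?_
  obtain ⟨w, rfl⟩ := h.surjective w'
  have hf := h.fderivWithin_form.self_of_nhdsWithin h.source.mem
  rw [← h.pullback_self, h.source.matrixForm_christoffelVec, map_add, add_apply,
    h.target.matrixForm_christoffelVec]
  simp only [lowChristoffel, hf]
  have hB := matrixForm_comm h.target.isSymm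
  rw [h.hessian_comm v u, h.hessian_comm w u, h.hessian_comm w v,
    hB (fderivWithin ℝ ψ S y u), hB (fderivWithin ℝ ψ S y v)]
  ring

/-- Substituting the transformation laws of the second derivatives of the metric and of Γ leaves a
purely algebraic identity, in which all second and third derivatives of ψ cancel:
`riemann_pullback_identity`. -/
theorem riemannForm_eq (u₁ u₂ u₃ u₄ : EuclideanSpace ℝ (Fin k)) :
    riemannForm S G y u₁ u₂ u₃ u₄ = riemannForm S' G' (ψ y) (fderivWithin ℝ ψ S y u₁)
      (fderivWithin ℝ ψ S y u₂) (fderivWithin ℝ ψ S y u₃) (fderivWithin ℝ ψ S y u₄) := by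
  have hB := matrixForm_comm h.target.isSymm
  have key := riemann_pullback_identity (B := fun a b => matrixForm (G' (ψ y)) a b)
    (D := fun a b c => fderivWithin ℝ (fun x => matrixForm (G' x)) S' (ψ y) a b c)
    (D₂ := fun a b c d =>
      fderivWithin ℝ (fderivWithin ℝ (fun x => matrixForm (G' x)) S') S' (ψ y) a b c d)
    (H := fun a b => fderivWithin ℝ (fderivWithin ℝ ψ S) S y a b)
    (T := fun a b c => fderivWithin ℝ (fderivWithin ℝ (fderivWithin ℝ ψ S) S) S y a b c)
    (J := fun a => fderivWithin ℝ ψ S y a) hB h.target.fderivWithin_comm h.hessian_comm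
    h.third_comm h.third_comm_right
    (Γ := fun a b w => matrixForm (G' (ψ y))
      (christoffelVec S' G' (ψ y) (fderivWithin ℝ ψ S y a) (fderivWithin ℝ ψ S y b)) w)
    (fun a b w => by rw [h.target.matrixForm_christoffelVec, lowChristoffel])
    h.fderivWithin_fderivWithin_form (fun a b c d => rfl) u₁ u₂ u₃ u₄
  rw [h.source.riemannForm_eq, h.target.riemannForm_eq]
  simp only [h.pullback_self, h.fderivWithin_christoffelVec, riemannLinear, map_add, add_apply]
  have e1 := hB (fderivWithin ℝ (fderivWithin ℝ ψ S) S y u₁ u₄)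
    (christoffelVec S' G' (ψ y) (fderivWithin ℝ ψ S y u₂) (fderivWithin ℝ ψ S y u₃))
  have e2 := hB (fderivWithin ℝ (fderivWithin ℝ ψ S) S y u₁ u₃)
    (christoffelVec S' G' (ψ y) (fderivWithin ℝ ψ S y u₂) (fderivWithin ℝ ψ S y u₄))
  rw [e1, e2]
  linarith [key]

end IsPullbackAt

/-! ### The metric in charts -/

/-- `bdPoint` as a continuous linear map. -/
def bdPointL (m : ℕ) : EuclideanSpace ℝ (Fin m) →L[ℝ] EuclideanSpace ℝ (Fin (m + 1)) :=
  LinearMap.toContinuousLinearMap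
    { toFun := bdPoint
      map_add' := fun u v => by ext i; refine Fin.cases ?_ (fun j => ?_) i <;> simp [bdPoint]
      map_smul' := fun r u => by ext i; refine Fin.cases ?_ (fun j => ?_) i <;> simp [bdPoint] }

/-- `tanPart` as a continuous linear map. -/
def tanPartL (m : ℕ) : EuclideanSpace ℝ (Fin (m + 1)) →L[ℝ] EuclideanSpace ℝ (Fin m) :=
  LinearMap.toContinuousLinearMap
    { toFun := tanPart
      map_add' := fun u v => by ext i; simp [tanPart]
      map_smul' := fun r u => by ext i; simp [tanPart] }

@[simp] theorem bdPointL_apply {m : ℕ} (z : EuclideanSpace ℝ (Fin m)) :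
    bdPointL m z = bdPoint z := rfl

@[simp] theorem tanPartL_apply {m : ℕ} (y : EuclideanSpace ℝ (Fin (m + 1))) :
    tanPartL m y = tanPart y := rfl

@[simp] theorem bdPoint_zero_coord {m : ℕ} (z : EuclideanSpace ℝ (Fin m)) : bdPoint z 0 = 0 := rfl

@[simp] theorem bdPoint_succ {m : ℕ} (z : EuclideanSpace ℝ (Fin m)) (i : Fin m) :
    bdPoint z i.succ = z i := rfl

@[simp] theorem tanPart_apply {m : ℕ} (y : EuclideanSpace ℝ (Fin (m + 1))) (i : Fin m) :
    tanPart y i = y i.succ := rfl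

@[simp] theorem tanPart_bdPoint {m : ℕ} (z : EuclideanSpace ℝ (Fin m)) : tanPart (bdPoint z) = z := by
  ext i; simp

theorem bdPoint_tanPart {m : ℕ} {y : EuclideanSpace ℝ (Fin (m + 1))} (hy : y 0 = 0) :
    bdPoint (tanPart y) = y := by
  ext i; refine Fin.cases ?_ (fun j => ?_) i <;> simp [hy]

section Manifold

variable {m : ℕ} {M : Type*} [TopologicalSpace M]
    [ChartedSpace (EuclideanHalfSpace (m + 1)) M]

theorem matrixForm_chartMatrix (B : FormField m M) (q : M)
    (y u v : EuclideanSpace ℝ (Fin (m + 1))) :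
    matrixForm (chartMatrix B q y) u v =
      B ((extChartAt (𝓡∂ (m + 1)) q).symm y)
        (mfderivWithin 𝓘(ℝ, EuclideanSpace ℝ (Fin (m + 1))) (𝓡∂ (m + 1))
          (extChartAt (𝓡∂ (m + 1)) q).symm (Set.range (𝓡∂ (m + 1))) y u)
        (mfderivWithin 𝓘(ℝ, EuclideanSpace ℝ (Fin (m + 1))) (𝓡∂ (m + 1))
          (extChartAt (𝓡∂ (m + 1)) q).symm (Set.range (𝓡∂ (m + 1))) y v) := by
  let D : EuclideanSpace ℝ (Fin (m + 1)) →L[ℝ] EuclideanSpace ℝ (Fin (m + 1)) :=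
    mfderivWithin 𝓘(ℝ, EuclideanSpace ℝ (Fin (m + 1))) (𝓡∂ (m + 1))
      (extChartAt (𝓡∂ (m + 1)) q).symm (Set.range (𝓡∂ (m + 1))) y
  let B' : EuclideanSpace ℝ (Fin (m + 1)) →L[ℝ] EuclideanSpace ℝ (Fin (m + 1)) →L[ℝ] ℝ :=
    B ((extChartAt (𝓡∂ (m + 1)) q).symm y)
  exact eq_of_bilinear (F := fun u v => matrixForm (chartMatrix B q y) u v)
    (F' := fun u v => B' (D u) (D v))
    (fun v => ⟨fun _ _ => by simp, fun _ _ => by simp⟩)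
    (fun v => ⟨fun _ _ => by simp, fun _ _ => by simp⟩)
    (fun v => ⟨fun _ _ => by simp, fun _ _ => by simp⟩)
    (fun v => ⟨fun _ _ => by simp, fun _ _ => by simp⟩)
    (fun a b => by simp only [matrixForm_single]; rfl) u v

theorem matrixForm_bdChartMatrix (B : FormField m M) (q : M) (z u v : EuclideanSpace ℝ (Fin m)) :
    matrixForm (bdChartMatrix B q z) u v =
      matrixForm (chartMatrix B q (bdPoint z)) (bdPoint u) (bdPoint v) := by
  rw [matrixForm_apply, matrixForm_apply, Fin.sum_univ_succ]
  simp [Fin.sum_univ_succ, bdChartMatrix]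

theorem range_eq_halfSpace : Set.range (𝓡∂ (m + 1)) = halfSpace m :=
  range_modelWithCornersEuclideanHalfSpace _

theorem uniqueDiffOn_halfSpace : UniqueDiffOn ℝ (halfSpace m) := by
  rw [← range_eq_halfSpace]; exact (𝓡∂ (m + 1)).uniqueDiffOn

theorem interior_halfSpace_eq : interior (halfSpace m) = openHalfSpace m := by
  rw [← range_eq_halfSpace]; exact interior_range_modelWithCornersEuclideanHalfSpace _

theorem halfSpace_subset_closure_interior :
    halfSpace m ⊆ closure (interior (halfSpace m)) := by
  rw [← range_eq_halfSpace]
  exact (𝓡∂ (m + 1)).range_subset_closure_interior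

variable [IsManifold (𝓡∂ (m + 1)) ∞ M]

/-- Being a boundary point can be tested in any chart of the atlas. Hence transition maps send
boundary to boundary, which makes the induced boundary charts compatible. -/
theorem extChartAt_mem_boundary_iff {q x : M} (hx : x ∈ (extChartAt (𝓡∂ (m + 1)) q).source) :
    x ∈ (𝓡∂ (m + 1)).boundary M ↔ (extChartAt (𝓡∂ (m + 1)) q x) 0 = 0 := by
  have hx' : x ∈ (chartAt (EuclideanHalfSpace (m + 1)) q).source := by
    rwa [extChartAt_source] at hx
  have h0 : 0 ≤ (extChartAt (𝓡∂ (m + 1)) q x) 0 := by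
    have := extChartAt_target_subset_range q ((extChartAt (𝓡∂ (m + 1)) q).map_source hx)
    rwa [range_eq_halfSpace] at this
  have h1 := (𝓡∂ (m + 1)).isInteriorPoint_iff_of_mem_atlas (n := ∞) (by simp)
    (chart_mem_atlas (EuclideanHalfSpace (m + 1)) q) hx'
  have h2 : (extChartAt (𝓡∂ (m + 1)) q x) ∈
      interior ((extChartAt (𝓡∂ (m + 1)) q).target) ↔ 0 < (extChartAt (𝓡∂ (m + 1)) q x) 0 := by
    have hr := interior_range_modelWithCornersEuclideanHalfSpace (m + 1)
    constructor
    · intro h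
      have := interior_mono (extChartAt_target_subset_range q) h
      rwa [hr] at this
    · intro h
      refine (chartAt (EuclideanHalfSpace (m + 1)) q).mem_interior_extend_target
        ((chartAt (EuclideanHalfSpace (m + 1)) q).map_source hx') ?_
      rw [hr]; exact h
  rw [← ModelWithCorners.compl_interior]
  change ¬ (𝓡∂ (m + 1)).IsInteriorPoint x ↔ _
  rw [h1]
  change ¬ (extChartAt (𝓡∂ (m + 1)) q x) ∈ interior ((extChartAt (𝓡∂ (m + 1)) q).target) ↔ _
  rw [h2, not_lt]
  exact ⟨fun h => le_antisymm h h0, fun h => h.le⟩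

variable (g : Bundle.ContMDiffRiemannianMetric (𝓡∂ (m + 1)) ∞ (EuclideanSpace ℝ (Fin (m + 1)))
      (fun x : M => TangentSpace (𝓡∂ (m + 1)) x))

theorem isManifold_one : IsManifold (𝓡∂ (m + 1)) 1 M := IsManifold.of_le (n := ∞) (by simp)

/-- Over the chart domain the coordinate vector fields are the frame of the tangent bundle
trivialization at q; the entries are therefore the smooth metric evaluated on smooth local sections.
-/
theorem contDiffWithinAt_chartMatrix (q : M) {y : EuclideanSpace ℝ (Fin (m + 1))}
    (hy : y ∈ (extChartAt (𝓡∂ (m + 1)) q).target) (a b : Fin (m + 1)) :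
    ContDiffWithinAt ℝ ∞ (fun y => chartMatrix g.inner q y a b) (halfSpace m) y := by
  rw [← range_eq_halfSpace]
  have h1 : IsManifold (𝓡∂ (m + 1)) 1 M := isManifold_one
  set e := trivializationAt (EuclideanSpace ℝ (Fin (m + 1)))
    (fun x : M => TangentSpace (𝓡∂ (m + 1)) x) q with he
  let F : M → ℝ := fun p => g.inner p (e.symmL ℝ p (EuclideanSpace.single a 1))
    (e.symmL ℝ p (EuclideanSpace.single b 1))
  have hp : (extChartAt (𝓡∂ (m + 1)) q).symm y ∈ (extChartAt (𝓡∂ (m + 1)) q).source :=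
    (extChartAt (𝓡∂ (m + 1)) q).map_target hy
  have hF : ContMDiffAt (𝓡∂ (m + 1)) 𝓘(ℝ, ℝ) ∞ F ((extChartAt (𝓡∂ (m + 1)) q).symm y) := by
    have hb : (extChartAt (𝓡∂ (m + 1)) q).symm y ∈ e.baseSet := by
      rw [he, TangentBundle.trivializationAt_baseSet]
      rwa [extChartAt_source] at hp
    have hv : ∀ c : Fin (m + 1), ContMDiffAt (𝓡∂ (m + 1)) ((𝓡∂ (m + 1)).prod
        𝓘(ℝ, EuclideanSpace ℝ (Fin (m + 1)))) ∞ (fun p => (Bundle.TotalSpace.mk'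
          (EuclideanSpace ℝ (Fin (m + 1))) p (e.symmL ℝ p (EuclideanSpace.single c 1)) :
          TangentBundle (𝓡∂ (m + 1)) M)) ((extChartAt (𝓡∂ (m + 1)) q).symm y) := by
      intro c
      rw [e.contMDiffAt_section_iff hb]
      refine contMDiffAt_const (c := EuclideanSpace.single c (1 : ℝ)) |>.congr_of_eventuallyEq ?_
      filter_upwards [e.open_baseSet.mem_nhds hb] with p hp
      rw [e.symmL_apply hp]
      exact congrArg Prod.snd (e.apply_mk_symm hp _)
    have := ContMDiffAt.clm_bundle_apply₂ (F₁ := EuclideanSpace ℝ (Fin (m + 1)))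
      (F₂ := EuclideanSpace ℝ (Fin (m + 1))) (F₃ := ℝ) (E₃ := Bundle.Trivial M ℝ)
      (g.contMDiff _) (hv a) (hv b)
    rw [Bundle.contMDiffAt_totalSpace] at this
    exact this.2
  have hsymm := contMDiffWithinAt_extChartAt_symm_range (I := 𝓡∂ (m + 1)) (n := ∞) q hy
  have := (hF.comp_contMDiffWithinAt y hsymm).contDiffWithinAt
  refine this.congr_of_eventuallyEq_of_mem ?_ (extChartAt_target_subset_range q hy)
  filter_upwards [extChartAt_target_mem_nhdsWithin_of_mem hy] with z hz
  have hz' : (extChartAt (𝓡∂ (m + 1)) q).symm z ∈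
      (chartAt (EuclideanHalfSpace (m + 1)) q).source := by
    rw [← extChartAt_source (𝓡∂ (m + 1))]; exact (extChartAt (𝓡∂ (m + 1)) q).map_target hz
  have hs := TangentBundle.symmL_trivializationAt (𝕜 := ℝ) (I := 𝓡∂ (m + 1)) hz'
  rw [(extChartAt (𝓡∂ (m + 1)) q).right_inv hz] at hs
  simp only [F, Function.comp, he, hs, chartMatrix, Matrix.of_apply]
  rfl

theorem chartMatrix_isSymm (q : M) (y : EuclideanSpace ℝ (Fin (m + 1))) :
    (chartMatrix g.inner q y).IsSymm := by
  ext a b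
  simp only [Matrix.transpose_apply, chartMatrix, Matrix.of_apply]
  exact g.symm _ _ _

theorem matrixForm_chartMatrix_pos (q : M) {y u : EuclideanSpace ℝ (Fin (m + 1))}
    (hy : y ∈ (extChartAt (𝓡∂ (m + 1)) q).target) (hu : u ≠ 0) :
    0 < matrixForm (chartMatrix g.inner q y) u u := by
  have h1 : IsManifold (𝓡∂ (m + 1)) 1 M := isManifold_one
  rw [matrixForm_chartMatrix]
  refine g.pos _ _ fun h => hu ?_
  obtain ⟨e, he⟩ := isInvertible_mfderivWithin_extChartAt_symm hy
  rw [← he] at h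
  exact e.map_eq_zero_iff.1 h

theorem matrixForm_bdChartMatrix_pos (q : M) {z u : EuclideanSpace ℝ (Fin m)}
    (hy : bdPoint z ∈ (extChartAt (𝓡∂ (m + 1)) q).target) (hu : u ≠ 0) :
    0 < matrixForm (bdChartMatrix g.inner q z) u u := by
  rw [matrixForm_bdChartMatrix]
  refine matrixForm_chartMatrix_pos g q hy fun h => hu ?_
  rw [← tanPart_bdPoint u, h]
  ext i; simp

theorem det_ne_zero_of_matrixForm_pos {k : ℕ} {A : Matrix (Fin k) (Fin k) ℝ}
    (hA : ∀ u : EuclideanSpace ℝ (Fin k), u ≠ 0 → 0 < matrixForm A u u) : A.det ≠ 0 := by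
  intro h
  obtain ⟨v, hv, hv'⟩ := Matrix.exists_mulVec_eq_zero_iff.2 h
  have h1 : matrixForm A (WithLp.toLp 2 v) (WithLp.toLp 2 v) = 0 := by
    rw [matrixForm_apply]
    refine Finset.sum_eq_zero fun a _ => ?_
    have := congrFun hv' a
    simp only [Matrix.mulVec, dotProduct, Pi.zero_apply] at this
    calc _ = v a * ∑ b, A a b * v b := by
          rw [Finset.mul_sum]; exact Finset.sum_congr rfl fun b _ => by simp; ring
      _ = 0 := by rw [this, mul_zero]
  refine (hA (WithLp.toLp 2 v) fun h0 => hv ?_).ne' h1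
  ext i
  exact congrArg (fun w : EuclideanSpace ℝ (Fin k) => w i) h0

theorem isMetricAt_chartMatrix (q : M) {y : EuclideanSpace ℝ (Fin (m + 1))}
    (hy : y ∈ (extChartAt (𝓡∂ (m + 1)) q).target) :
    IsMetricAt (halfSpace m) (chartMatrix g.inner q) y where
  uniqueDiffOn := uniqueDiffOn_halfSpace
  mem := by rw [← range_eq_halfSpace]; exact extChartAt_target_subset_range q hy
  subset_closure := halfSpace_subset_closure_interior
  contDiff a b := (contDiffWithinAt_chartMatrix g q hy a b).of_le ENat.LEInfty.out
  symm := Filter.Eventually.of_forall fun x => chartMatrix_isSymm g q x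
  det_ne_zero := det_ne_zero_of_matrixForm_pos fun u hu => matrixForm_chartMatrix_pos g q hy hu

theorem contDiffAt_bdChartMatrix (q : M) {z : EuclideanSpace ℝ (Fin m)}
    (hz : bdPoint z ∈ (extChartAt (𝓡∂ (m + 1)) q).target) (i j : Fin m) :
    ContDiffAt ℝ ∞ (fun z => bdChartMatrix g.inner q z i j) z := by
  have h := contDiffWithinAt_chartMatrix g q hz i.succ j.succ
  have hb : ContDiffWithinAt ℝ ∞ (bdPointL m) Set.univ z := (bdPointL m).contDiff.contDiffWithinAt
  rw [← contDiffWithinAt_univ]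
  exact h.comp z hb (fun w _ => by simp [halfSpace])

theorem isMetricAt_bdChartMatrix (q : M) {z : EuclideanSpace ℝ (Fin m)}
    (hz : bdPoint z ∈ (extChartAt (𝓡∂ (m + 1)) q).target) :
    IsMetricAt Set.univ (bdChartMatrix g.inner q) z where
  uniqueDiffOn := uniqueDiffOn_univ
  mem := Set.mem_univ _
  subset_closure := by simp
  contDiff i j := ((contDiffAt_bdChartMatrix g q hz i j).of_le
    ENat.LEInfty.out).contDiffWithinAt
  symm := Filter.Eventually.of_forall fun x => by
    ext i j
    exact (chartMatrix_isSymm g q (bdPoint x)).apply i.succ j.succ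
  det_ne_zero := det_ne_zero_of_matrixForm_pos fun u hu => matrixForm_bdChartMatrix_pos g q hz hu

/-- The coordinate vector, in the preferred chart at `q`, of a tangent vector at `x`. -/
def chartVec (q x : M) (w : TangentSpace (𝓡∂ (m + 1)) x) : EuclideanSpace ℝ (Fin (m + 1)) :=
  mfderiv (𝓡∂ (m + 1)) 𝓘(ℝ, EuclideanSpace ℝ (Fin (m + 1))) (extChartAt (𝓡∂ (m + 1)) q) x w

/-- The tangent space at x is by construction the model space seen through the preferred chart at x,
so the derivative of that chart at x is the identity. -/
theorem coordVec_eq_self (x : M) (w : TangentSpace (𝓡∂ (m + 1)) x) : coordVec x w = w := by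
  have h1 : IsManifold (𝓡∂ (m + 1)) 1 M := isManifold_one
  rw [coordVec, mfderiv_extChartAt_self]
  rfl

/-- The change of coordinates from the preferred chart at `x` to the preferred chart at `q`. -/
abbrev transition (q x : M) : EuclideanSpace ℝ (Fin (m + 1)) → EuclideanSpace ℝ (Fin (m + 1)) :=
  extChartAt (𝓡∂ (m + 1)) q ∘ (extChartAt (𝓡∂ (m + 1)) x).symm

omit [IsManifold (𝓡∂ (m + 1)) ∞ M] in
theorem eventually_mem_chart {q x : M} (hx : x ∈ (extChartAt (𝓡∂ (m + 1)) q).source) :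
    ∀ᶠ y in 𝓝[halfSpace m] (extChartAt (𝓡∂ (m + 1)) x x),
      y ∈ (extChartAt (𝓡∂ (m + 1)) x).target ∧
        (extChartAt (𝓡∂ (m + 1)) x).symm y ∈ (extChartAt (𝓡∂ (m + 1)) q).source := by
  rw [← range_eq_halfSpace]
  refine Filter.Eventually.and (extChartAt_target_mem_nhdsWithin x) ?_
  have hc := (continuousAt_extChartAt_symm (I := 𝓡∂ (m + 1)) x).continuousWithinAt
    (s := Set.range (𝓡∂ (m + 1)))
  refine hc.eventually_mem ?_
  rw [extChartAt_to_inv]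
  exact (isOpen_extChartAt_source q).mem_nhds hx

theorem contDiffWithinAt_transition {q x : M} {y : EuclideanSpace ℝ (Fin (m + 1))}
    (hy : y ∈ (extChartAt (𝓡∂ (m + 1)) x).target)
    (hy' : (extChartAt (𝓡∂ (m + 1)) x).symm y ∈ (extChartAt (𝓡∂ (m + 1)) q).source) :
    ContDiffWithinAt ℝ ∞ (transition q x) (halfSpace m) y := by
  rw [← range_eq_halfSpace]
  refine contDiffWithinAt_ext_coord_change q x ?_
  rw [PartialEquiv.trans_source]
  exact ⟨hy, hy'⟩

/-- Chain rule for the inverse chart at x, written near y as the inverse chart at q after the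
transition map. Both sides are read in the model space, since the two base points are equal but not
definitionally so. -/
theorem mfderivWithin_symm_eq {q x : M} {y : EuclideanSpace ℝ (Fin (m + 1))}
    (hy : y ∈ (extChartAt (𝓡∂ (m + 1)) x).target)
    (hy' : (extChartAt (𝓡∂ (m + 1)) x).symm y ∈ (extChartAt (𝓡∂ (m + 1)) q).source)
    (u : EuclideanSpace ℝ (Fin (m + 1))) :
    (mfderivWithin 𝓘(ℝ, EuclideanSpace ℝ (Fin (m + 1))) (𝓡∂ (m + 1))
      (extChartAt (𝓡∂ (m + 1)) x).symm (Set.range (𝓡∂ (m + 1))) y u : EuclideanSpace ℝ (Fin (m + 1)))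
      = (mfderivWithin 𝓘(ℝ, EuclideanSpace ℝ (Fin (m + 1))) (𝓡∂ (m + 1))
      (extChartAt (𝓡∂ (m + 1)) q).symm (Set.range (𝓡∂ (m + 1))) (transition q x y)
        (fderivWithin ℝ (transition q x) (halfSpace m) y u) : EuclideanSpace ℝ (Fin (m + 1))) := by
  have h1 : IsManifold (𝓡∂ (m + 1)) 1 M := isManifold_one
  rw [← range_eq_halfSpace]
  have hyr : y ∈ Set.range (𝓡∂ (m + 1)) := extChartAt_target_subset_range x hy
  have ht : transition q x y ∈ (extChartAt (𝓡∂ (m + 1)) q).target :=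
    (extChartAt (𝓡∂ (m + 1)) q).map_source hy'
  have hU : UniqueMDiffWithinAt 𝓘(ℝ, EuclideanSpace ℝ (Fin (m + 1))) (Set.range (𝓡∂ (m + 1))) y :=
    (𝓡∂ (m + 1)).uniqueMDiffOn y hyr
  have hd := ((contDiffWithinAt_transition hy hy').differentiableWithinAt
    (by simp)).mdifferentiableWithinAt
  rw [← range_eq_halfSpace] at hd
  have hcomp := mfderivWithin_comp y (mdifferentiableWithinAt_extChartAt_symm ht) hd
    (fun z _ => ⟨_, rfl⟩) hU
  have hev : (extChartAt (𝓡∂ (m + 1)) x).symm =ᶠ[𝓝[Set.range (𝓡∂ (m + 1))] y]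
      (extChartAt (𝓡∂ (m + 1)) q).symm ∘ transition q x := by
    have hc := (continuousAt_extChartAt_symm'' (I := 𝓡∂ (m + 1)) hy).continuousWithinAt
      (s := Set.range (𝓡∂ (m + 1)))
    filter_upwards [hc.eventually_mem ((isOpen_extChartAt_source q).mem_nhds hy')] with z hz
    simp only [Function.comp, (extChartAt (𝓡∂ (m + 1)) q).left_inv hz]
  have h2 := hev.mfderivWithin_eq (I := 𝓘(ℝ, EuclideanSpace ℝ (Fin (m + 1))))
    (I' := 𝓡∂ (m + 1)) (hev.self_of_nhdsWithin hyr)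
  rw [mfderivWithin_eq_fderivWithin] at hcomp
  have h3 := congrArg (fun L => L u) (h2.trans hcomp)
  exact h3

end Manifold

/-! ### Curvature components read in a fixed chart. -/

section Manifold

variable {m : ℕ} {M : Type*} [TopologicalSpace M]
    [ChartedSpace (EuclideanHalfSpace (m + 1)) M]

theorem curv_eq_riemannForm (B : FormField m M) (q : M)
    (e : Fin (m + 1) → TangentSpace (𝓡∂ (m + 1)) q) (a b c d : Fin (m + 1)) :
    curv B q e a b c d = riemannForm (halfSpace m) (chartMatrix B q) (extChartAt (𝓡∂ (m + 1)) q q)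
      (coordVec q (e a)) (coordVec q (e b)) (coordVec q (e c)) (coordVec q (e d)) := by
  rw [curv, range_eq_halfSpace, riemannForm]

theorem bdCurv_eq_riemannForm (B : FormField m M) (q : M)
    (e : Fin (m + 1) → TangentSpace (𝓡∂ (m + 1)) q) (i j k l : Fin m) :
    bdCurv B q e i j k l = riemannForm Set.univ (bdChartMatrix B q)
      (tanPart (extChartAt (𝓡∂ (m + 1)) q q))
      (tanPart (coordVec q (e i.succ))) (tanPart (coordVec q (e j.succ)))
      (tanPart (coordVec q (e k.succ))) (tanPart (coordVec q (e l.succ))) := rfl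

theorem tendsto_bdPoint (z : EuclideanSpace ℝ (Fin m)) :
    Filter.Tendsto (bdPoint (m := m)) (𝓝 z) (𝓝[halfSpace m] (bdPoint z)) :=
  tendsto_nhdsWithin_iff.2 ⟨(bdPointL m).continuous.continuousAt,
    Filter.Eventually.of_forall fun _ => by simp [halfSpace]⟩

variable [IsManifold (𝓡∂ (m + 1)) ∞ M]
variable (g : Bundle.ContMDiffRiemannianMetric (𝓡∂ (m + 1)) ∞ (EuclideanSpace ℝ (Fin (m + 1)))
      (fun x : M => TangentSpace (𝓡∂ (m + 1)) x))

omit [IsManifold (𝓡∂ (m + 1)) ∞ M] in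
theorem transition_apply_self (q x : M) :
    transition q x (extChartAt (𝓡∂ (m + 1)) x x) = extChartAt (𝓡∂ (m + 1)) q x := by
  change extChartAt (𝓡∂ (m + 1)) q _ = _
  rw [extChartAt_to_inv]

theorem fderivWithin_transition {q x : M} (hx : x ∈ (extChartAt (𝓡∂ (m + 1)) q).source)
    (w : TangentSpace (𝓡∂ (m + 1)) x) :
    fderivWithin ℝ (transition q x) (halfSpace m) (extChartAt (𝓡∂ (m + 1)) x x) (coordVec x w) =
      chartVec q x w := by
  have h1 : IsManifold (𝓡∂ (m + 1)) 1 M := isManifold_one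
  rw [coordVec_eq_self, chartVec, ← range_eq_halfSpace]
  rw [extChartAt_source] at hx
  have h2 : mfderiv (𝓡∂ (m + 1)) 𝓘(ℝ, EuclideanSpace ℝ (Fin (m + 1)))
      (extChartAt (𝓡∂ (m + 1)) q) x = fderivWithin ℝ (writtenInExtChartAt (𝓡∂ (m + 1))
        𝓘(ℝ, EuclideanSpace ℝ (Fin (m + 1))) x (extChartAt (𝓡∂ (m + 1)) q))
        (Set.range (𝓡∂ (m + 1))) (extChartAt (𝓡∂ (m + 1)) x x) := by
    simp only [mfderiv]
    exact if_pos (mdifferentiableAt_extChartAt hx)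
  exact (congrArg (fun L => L w) h2).symm

theorem matrixForm_chartMatrix_transition {q x : M} {y : EuclideanSpace ℝ (Fin (m + 1))}
    (hy : y ∈ (extChartAt (𝓡∂ (m + 1)) x).target)
    (hy' : (extChartAt (𝓡∂ (m + 1)) x).symm y ∈ (extChartAt (𝓡∂ (m + 1)) q).source)
    (u v : EuclideanSpace ℝ (Fin (m + 1))) :
    matrixForm (chartMatrix g.inner x y) u v = matrixForm (chartMatrix g.inner q
      (transition q x y)) (fderivWithin ℝ (transition q x) (halfSpace m) y u)
      (fderivWithin ℝ (transition q x) (halfSpace m) y v) := by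
  rw [matrixForm_chartMatrix, matrixForm_chartMatrix]
  have h : (extChartAt (𝓡∂ (m + 1)) q).symm (transition q x y) =
      (extChartAt (𝓡∂ (m + 1)) x).symm y := by
    rw [transition, Function.comp, (extChartAt (𝓡∂ (m + 1)) q).left_inv hy']
  have hu := mfderivWithin_symm_eq hy hy' u
  have hv := mfderivWithin_symm_eq hy hy' v
  -- The form is transported along an equality of base points; in the model space this transport is
  -- invisible.
  have key : ∀ {p p' : M} (_ : p = p') (a b : EuclideanSpace ℝ (Fin (m + 1))),
      (g.inner p : EuclideanSpace ℝ (Fin (m + 1)) →L[ℝ] EuclideanSpace ℝ (Fin (m + 1)) →L[ℝ] ℝ)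
        a b = (g.inner p' : EuclideanSpace ℝ (Fin (m + 1)) →L[ℝ]
          EuclideanSpace ℝ (Fin (m + 1)) →L[ℝ] ℝ) a b := by
    rintro p _ rfl a b; rfl
  refine Eq.trans ?_ (key h _ _).symm
  exact congrArg₂ (fun a b => (g.inner ((extChartAt (𝓡∂ (m + 1)) x).symm y) :
    EuclideanSpace ℝ (Fin (m + 1)) →L[ℝ] EuclideanSpace ℝ (Fin (m + 1)) →L[ℝ] ℝ) a b) hu hv

theorem isPullbackAt_transition {q x : M} (hx : x ∈ (extChartAt (𝓡∂ (m + 1)) q).source) :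
    IsPullbackAt (halfSpace m) (halfSpace m) (chartMatrix g.inner x) (chartMatrix g.inner q)
      (transition q x) (extChartAt (𝓡∂ (m + 1)) x x) where
  source := isMetricAt_chartMatrix g x (mem_extChartAt_target x)
  target := isMetricAt_chartMatrix g q
    (by rw [transition_apply_self]; exact (extChartAt (𝓡∂ (m + 1)) q).map_source hx)
  contDiff := (contDiffWithinAt_transition (mem_extChartAt_target x)
    (by rwa [extChartAt_to_inv])).of_le ENat.LEInfty.out
  mapsTo := Filter.Eventually.of_forall fun y => by
    rw [← range_eq_halfSpace]; exact ⟨_, rfl⟩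
  pullback := by
    filter_upwards [eventually_mem_chart hx] with y hy u v
    exact matrixForm_chartMatrix_transition g hy.1 hy.2 u v

/-- The definition of `curv` at x uses the chart centred at x, which jumps with x. Here everything
is expressed in the one chart at q, the form needed for continuity and differentiability in x. -/
theorem curv_eq_chart {q x : M} (hx : x ∈ (extChartAt (𝓡∂ (m + 1)) q).source)
    (e : Fin (m + 1) → TangentSpace (𝓡∂ (m + 1)) x) (a b c d : Fin (m + 1)) :
    curv g.inner x e a b c d = riemannForm (halfSpace m) (chartMatrix g.inner q)
      (extChartAt (𝓡∂ (m + 1)) q x) (chartVec q x (e a)) (chartVec q x (e b)) (chartVec q x (e c))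
      (chartVec q x (e d)) := by
  rw [curv_eq_riemannForm, (isPullbackAt_transition g hx).riemannForm_eq, transition_apply_self]
  simp only [fderivWithin_transition hx]

/-- The change of coordinates between the boundary charts at `x` and at `q`. -/
abbrev bdTransition (q x : M) : EuclideanSpace ℝ (Fin m) → EuclideanSpace ℝ (Fin m) :=
  tanPart ∘ transition q x ∘ bdPoint

theorem transition_bdPoint_zero {q x : M} {z : EuclideanSpace ℝ (Fin m)}
    (hz : bdPoint z ∈ (extChartAt (𝓡∂ (m + 1)) x).target)
    (hz' : (extChartAt (𝓡∂ (m + 1)) x).symm (bdPoint z) ∈ (extChartAt (𝓡∂ (m + 1)) q).source) :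
    transition q x (bdPoint z) 0 = 0 := by
  refine (extChartAt_mem_boundary_iff hz').1 ?_
  rw [extChartAt_mem_boundary_iff ((extChartAt (𝓡∂ (m + 1)) x).map_target hz),
    (extChartAt (𝓡∂ (m + 1)) x).right_inv hz]
  rfl

theorem bdPoint_bdTransition {q x : M} {z : EuclideanSpace ℝ (Fin m)}
    (hz : bdPoint z ∈ (extChartAt (𝓡∂ (m + 1)) x).target)
    (hz' : (extChartAt (𝓡∂ (m + 1)) x).symm (bdPoint z) ∈ (extChartAt (𝓡∂ (m + 1)) q).source) :
    bdPoint (bdTransition q x z) = transition q x (bdPoint z) :=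
  bdPoint_tanPart (transition_bdPoint_zero hz hz')

theorem hasFDerivAt_transition_bdPoint {q x : M} {z : EuclideanSpace ℝ (Fin m)}
    (hz : bdPoint z ∈ (extChartAt (𝓡∂ (m + 1)) x).target)
    (hz' : (extChartAt (𝓡∂ (m + 1)) x).symm (bdPoint z) ∈ (extChartAt (𝓡∂ (m + 1)) q).source) :
    HasFDerivAt (transition q x ∘ bdPoint)
      (fderivWithin ℝ (transition q x) (halfSpace m) (bdPoint z) ∘L bdPointL m) z := by
  have h := ((contDiffWithinAt_transition hz hz').differentiableWithinAt
    (by simp)).hasFDerivWithinAt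
  rw [← hasFDerivWithinAt_univ]
  exact h.comp z (bdPointL m).hasFDerivAt.hasFDerivWithinAt (fun w _ => by simp [halfSpace])

theorem eventually_bdPoint_mem_chart {q x : M} (hx : x ∈ (extChartAt (𝓡∂ (m + 1)) q).source)
    (hb : x ∈ (𝓡∂ (m + 1)).boundary M) :
    ∀ᶠ z in 𝓝 (tanPart (extChartAt (𝓡∂ (m + 1)) x x)),
      bdPoint z ∈ (extChartAt (𝓡∂ (m + 1)) x).target ∧
        (extChartAt (𝓡∂ (m + 1)) x).symm (bdPoint z) ∈ (extChartAt (𝓡∂ (m + 1)) q).source := by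
  have h := tendsto_bdPoint (tanPart (extChartAt (𝓡∂ (m + 1)) x x))
  rw [bdPoint_tanPart ((extChartAt_mem_boundary_iff (mem_extChartAt_source x)).1 hb)] at h
  exact h.eventually (eventually_mem_chart hx)

/-- Along the boundary the normal component of the transition map vanishes identically, so its
tangential derivatives vanish as well. -/
theorem fderivWithin_transition_bdPoint_zero {q x : M}
    {z : EuclideanSpace ℝ (Fin m)}
    (hz : ∀ᶠ z in 𝓝 z, bdPoint z ∈ (extChartAt (𝓡∂ (m + 1)) x).target ∧
      (extChartAt (𝓡∂ (m + 1)) x).symm (bdPoint z) ∈ (extChartAt (𝓡∂ (m + 1)) q).source)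
    (u : EuclideanSpace ℝ (Fin m)) :
    fderivWithin ℝ (transition q x) (halfSpace m) (bdPoint z) (bdPoint u) 0 = 0 := by
  have h := hasFDerivAt_transition_bdPoint hz.self_of_nhds.1 hz.self_of_nhds.2
  have h2 := (EuclideanSpace.proj (𝕜 := ℝ) (0 : Fin (m + 1))).hasFDerivAt.comp z h
  have h3 : HasFDerivAt (fun _ : EuclideanSpace ℝ (Fin m) => (0 : ℝ)) _ z :=
    h2.congr_of_eventuallyEq (by
      filter_upwards [hz] with w hw
      exact (transition_bdPoint_zero hw.1 hw.2).symm)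
  have := congrArg (fun L => L u) (h3.unique (hasFDerivAt_const 0 z))
  simpa using this

theorem fderivWithin_bdTransition {q x : M} {z : EuclideanSpace ℝ (Fin m)}
    (hz : bdPoint z ∈ (extChartAt (𝓡∂ (m + 1)) x).target)
    (hz' : (extChartAt (𝓡∂ (m + 1)) x).symm (bdPoint z) ∈ (extChartAt (𝓡∂ (m + 1)) q).source)
    (u : EuclideanSpace ℝ (Fin m)) :
    fderivWithin ℝ (bdTransition q x) Set.univ z u =
      tanPart (fderivWithin ℝ (transition q x) (halfSpace m) (bdPoint z) (bdPoint u)) := by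
  have := (tanPartL m).hasFDerivAt.comp z (hasFDerivAt_transition_bdPoint hz hz')
  rw [fderivWithin_univ]
  exact congrArg (fun L => L u) this.fderiv

theorem isPullbackAt_bdTransition {q x : M} (hx : x ∈ (extChartAt (𝓡∂ (m + 1)) q).source)
    (hb : x ∈ (𝓡∂ (m + 1)).boundary M) :
    IsPullbackAt Set.univ Set.univ (bdChartMatrix g.inner x) (bdChartMatrix g.inner q)
      (bdTransition q x) (tanPart (extChartAt (𝓡∂ (m + 1)) x x)) := by
  have h0 := bdPoint_tanPart ((extChartAt_mem_boundary_iff (mem_extChartAt_source x)).1 hb)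
  have hev := eventually_bdPoint_mem_chart hx hb
  have h1 := hev.self_of_nhds
  refine ⟨isMetricAt_bdChartMatrix g x h1.1, isMetricAt_bdChartMatrix g q ?_, ?_,
    Filter.Eventually.of_forall fun _ => Set.mem_univ _, ?_⟩
  · rw [bdPoint_bdTransition h1.1 h1.2]
    exact (extChartAt (𝓡∂ (m + 1)) q).map_source h1.2
  · have h2 := (contDiffWithinAt_transition h1.1 h1.2).comp
      (tanPart (extChartAt (𝓡∂ (m + 1)) x x)) (t := halfSpace m)
      ((bdPointL m).contDiff (n := ∞)).contDiffWithinAt (s := Set.univ)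
      (fun w _ => by simp [halfSpace])
    exact ((tanPartL m).contDiff.contDiffAt.comp_contDiffWithinAt _ h2).of_le ENat.LEInfty.out
  · rw [nhdsWithin_univ]
    filter_upwards [eventually_eventually_nhds.2 hev, eventually_bdPoint_mem_chart hx hb]
      with z hz hz1 u v
    rw [fderivWithin_bdTransition hz1.1 hz1.2, fderivWithin_bdTransition hz1.1 hz1.2,
      matrixForm_bdChartMatrix, matrixForm_bdChartMatrix,
      bdPoint_tanPart (fderivWithin_transition_bdPoint_zero hz u),
      bdPoint_tanPart (fderivWithin_transition_bdPoint_zero hz v)]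
    rw [bdPoint_bdTransition hz1.1 hz1.2]
    exact matrixForm_chartMatrix_transition g hz1.1 hz1.2 _ _

/-- The analogue of `curv_eq_chart` for the induced metric. Tangency of the frame ensures that its
tangential coordinates determine it, so they transform by the derivative of the boundary transition
map. -/
theorem bdCurv_eq_chart {q x : M} (hx : x ∈ (extChartAt (𝓡∂ (m + 1)) q).source)
    (hb : x ∈ (𝓡∂ (m + 1)).boundary M)
    (e : Fin (m + 1) → TangentSpace (𝓡∂ (m + 1)) x)
    (he : ∀ i : Fin m, coordVec x (e i.succ) 0 = 0) (i j k l : Fin m) :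
    bdCurv g.inner x e i j k l = riemannForm Set.univ (bdChartMatrix g.inner q)
      (tanPart (extChartAt (𝓡∂ (m + 1)) q x)) (tanPart (chartVec q x (e i.succ)))
      (tanPart (chartVec q x (e j.succ))) (tanPart (chartVec q x (e k.succ)))
      (tanPart (chartVec q x (e l.succ))) := by
  have h0 := bdPoint_tanPart ((extChartAt_mem_boundary_iff (mem_extChartAt_source x)).1 hb)
  have hev := eventually_bdPoint_mem_chart hx hb
  have hd : ∀ i : Fin m, fderivWithin ℝ (bdTransition q x) Set.univ
      (tanPart (extChartAt (𝓡∂ (m + 1)) x x)) (tanPart (coordVec x (e i.succ))) =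
        tanPart (chartVec q x (e i.succ)) := by
    intro i
    rw [fderivWithin_bdTransition hev.self_of_nhds.1 hev.self_of_nhds.2, bdPoint_tanPart (he i),
      h0, fderivWithin_transition hx]
  rw [bdCurv_eq_riemannForm, (isPullbackAt_bdTransition g hx hb).riemannForm_eq]
  simp only [hd]
  congr 1
  simp only [bdTransition, Function.comp]
  rw [h0]
  exact congrArg tanPart (transition_apply_self q x)

end Manifold

/-! ### Regularity and uniform bounds of curvature components. -/

/-- If `e` is orthonormal for the symmetric matrix `A`, then `∑ a, e_a e_aᵀ = A⁻¹`. -/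
theorem sum_mul_eq_inv_of_orthonormal {k : ℕ} {A : Matrix (Fin k) (Fin k) ℝ}
    {e : Fin k → EuclideanSpace ℝ (Fin k)}
    (he : ∀ a b, matrixForm A (e a) (e b) = if a = b then 1 else 0) (i j : Fin k) :
    ∑ a, e a i * e a j = A⁻¹ i j := by
  let P : Matrix (Fin k) (Fin k) ℝ := Matrix.of fun i a => e a i
  have h1 : Pᵀ * A * P = 1 := by
    ext a b
    rw [Matrix.one_apply, ← he, matrixForm_apply]
    simp only [Matrix.mul_apply, P, Matrix.transpose_apply, Matrix.of_apply, Finset.sum_mul]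
    rw [Finset.sum_comm]
    exact Finset.sum_congr rfl fun i _ => Finset.sum_congr rfl fun j _ => by ring
  have h2 : P * (Pᵀ * A) = 1 := mul_eq_one_comm.1 h1
  have h3 : (P * Pᵀ) * A = 1 := by rw [Matrix.mul_assoc, h2]
  rw [Matrix.inv_eq_left_inv h3, Matrix.mul_apply]
  rfl

theorem eventually_abs_le_add_one {X : Type*} [TopologicalSpace X] {T : Set X} {x₀ : X} {f : X → ℝ}
    (hf : ContinuousWithinAt f T x₀) :
    ∀ᶠ x in 𝓝[T] x₀, |f x| ≤ |f x₀| + 1 := by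
  filter_upwards [hf.abs.eventually (Iic_mem_nhds (lt_add_one _))] with x hx
  exact hx

section Manifold

variable {m : ℕ} {M : Type*} [TopologicalSpace M]
    [ChartedSpace (EuclideanHalfSpace (m + 1)) M] [IsManifold (𝓡∂ (m + 1)) ∞ M]

theorem matrixForm_chartMatrix_coordVec (B : FormField m M) (x : M)
    (u v : TangentSpace (𝓡∂ (m + 1)) x) :
    matrixForm (chartMatrix B x (extChartAt (𝓡∂ (m + 1)) x x)) (coordVec x u) (coordVec x v) =
      B x u v := by
  have h1 : IsManifold (𝓡∂ (m + 1)) 1 M := isManifold_one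
  rw [matrixForm_chartMatrix, mfderivWithin_range_extChartAt_symm, coordVec_eq_self,
    coordVec_eq_self]
  have key : ∀ {p p' : M} (_ : p = p') (a b : EuclideanSpace ℝ (Fin (m + 1))),
      (B p : EuclideanSpace ℝ (Fin (m + 1)) →L[ℝ] EuclideanSpace ℝ (Fin (m + 1)) →L[ℝ] ℝ)
        a b = (B p' : EuclideanSpace ℝ (Fin (m + 1)) →L[ℝ]
          EuclideanSpace ℝ (Fin (m + 1)) →L[ℝ] ℝ) a b := by
    rintro p _ rfl a b; rfl
  exact key (extChartAt_to_inv x) u v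

variable (g : Bundle.ContMDiffRiemannianMetric (𝓡∂ (m + 1)) ∞ (EuclideanSpace ℝ (Fin (m + 1)))
      (fun x : M => TangentSpace (𝓡∂ (m + 1)) x))

theorem matrixForm_chartMatrix_chartVec {q x : M}
    (hx : x ∈ (extChartAt (𝓡∂ (m + 1)) q).source) (u v : TangentSpace (𝓡∂ (m + 1)) x) :
    matrixForm (chartMatrix g.inner q (extChartAt (𝓡∂ (m + 1)) q x)) (chartVec q x u)
      (chartVec q x v) = g.inner x u v := by
  rw [← matrixForm_chartMatrix_coordVec, matrixForm_chartMatrix_transition g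
    (mem_extChartAt_target x) (by rwa [extChartAt_to_inv]), fderivWithin_transition hx,
    fderivWithin_transition hx, transition_apply_self]

theorem contMDiffWithinAt_chartVec {T : Set M} {x₀ : M}
    {w : (x : M) → TangentSpace (𝓡∂ (m + 1)) x}
    (hw : ContMDiffWithinAt (𝓡∂ (m + 1)) (𝓡∂ (m + 1)).tangent 2
      (fun x => (⟨x, w x⟩ : TangentBundle (𝓡∂ (m + 1)) M)) T x₀) :
    ContMDiffWithinAt (𝓡∂ (m + 1)) 𝓘(ℝ, EuclideanSpace ℝ (Fin (m + 1))) 2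
      (fun x => chartVec x₀ x (w x)) T x₀ := by
  have h1 : IsManifold (𝓡∂ (m + 1)) 1 M := isManifold_one
  have h := (Bundle.contMDiffWithinAt_totalSpace.1 hw).2
  have key : ∀ x ∈ (chartAt (EuclideanHalfSpace (m + 1)) x₀).source,
      chartVec x₀ x (w x) = ((trivializationAt (EuclideanSpace ℝ (Fin (m + 1)))
        (TangentSpace (𝓡∂ (m + 1))) x₀) ⟨x, w x⟩).2 := by
    intro x hx
    have h2 : (trivializationAt (EuclideanSpace ℝ (Fin (m + 1))) (TangentSpace (𝓡∂ (m + 1)))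
        x₀).continuousLinearMapAt ℝ x (w x) = ((trivializationAt (EuclideanSpace ℝ (Fin (m + 1)))
        (TangentSpace (𝓡∂ (m + 1))) x₀) ⟨x, w x⟩).2 := by
      rw [Bundle.Trivialization.continuousLinearMapAt_apply,
        Bundle.Trivialization.linearMapAt_apply,
        if_pos (by rwa [TangentBundle.trivializationAt_baseSet])]
    refine Eq.trans ?_ h2
    exact congrArg (fun L => L (w x))
      (TangentBundle.continuousLinearMapAt_trivializationAt (𝕜 := ℝ) (I := 𝓡∂ (m + 1)) hx).symm
  refine h.congr_of_eventuallyEq ?_ (key x₀ (mem_chart_source _ x₀))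
  filter_upwards [mem_nhdsWithin_of_mem_nhds ((chartAt (EuclideanHalfSpace (m + 1))
    x₀).open_source.mem_nhds (mem_chart_source _ x₀))] with x hx using key x hx

theorem contMDiffWithinAt_riemann_chart (T : Set M) (x₀ : M) (a b c d : Fin (m + 1)) :
    ContMDiffWithinAt (𝓡∂ (m + 1)) 𝓘(ℝ, ℝ) 2 (fun x => riemann (halfSpace m)
      (chartMatrix g.inner x₀) a b c d (extChartAt (𝓡∂ (m + 1)) x₀ x)) T x₀ := by
  have hm := isMetricAt_chartMatrix g x₀ (mem_extChartAt_target x₀)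
  have h := contDiffWithinAt_riemann
    (fun a b => contDiffWithinAt_chartMatrix g x₀ (mem_extChartAt_target x₀) a b)
    hm.det_ne_zero hm.uniqueDiffOn hm.mem a b c d
  have h2 : ContMDiffWithinAt (𝓡∂ (m + 1)) 𝓘(ℝ, EuclideanSpace ℝ (Fin (m + 1))) ∞
    (extChartAt (𝓡∂ (m + 1)) x₀) T x₀ := contMDiffAt_extChartAt.contMDiffWithinAt
  refine ((ContMDiffWithinAt.comp' x₀ h.contMDiffWithinAt h2).mono_of_mem_nhdsWithin
    (Filter.inter_mem self_mem_nhdsWithin ?_)).of_le ENat.LEInfty.out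
  · filter_upwards [mem_nhdsWithin_of_mem_nhds ((isOpen_extChartAt_source
      (I := 𝓡∂ (m + 1)) x₀).mem_nhds (mem_extChartAt_source x₀))] with x hx
    have := extChartAt_target_subset_range x₀ ((extChartAt (𝓡∂ (m + 1)) x₀).map_source hx)
    rwa [range_eq_halfSpace] at this

theorem contMDiffWithinAt_riemann_bdChart (T : Set M) {x₀ : M}
    (hb : x₀ ∈ (𝓡∂ (m + 1)).boundary M) (a b c d : Fin m) :
    ContMDiffWithinAt (𝓡∂ (m + 1)) 𝓘(ℝ, ℝ) 2 (fun x => riemann Set.univ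
      (bdChartMatrix g.inner x₀) a b c d (tanPart (extChartAt (𝓡∂ (m + 1)) x₀ x))) T x₀ := by
  have h0 := bdPoint_tanPart ((extChartAt_mem_boundary_iff (mem_extChartAt_source x₀)).1 hb)
  have ht : bdPoint (tanPart (extChartAt (𝓡∂ (m + 1)) x₀ x₀)) ∈
      (extChartAt (𝓡∂ (m + 1)) x₀).target := by rw [h0]; exact mem_extChartAt_target x₀
  have hm := isMetricAt_bdChartMatrix g x₀ ht
  have h := contDiffWithinAt_riemann
    (fun a b => (contDiffAt_bdChartMatrix g x₀ ht a b).contDiffWithinAt (s := Set.univ))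
    hm.det_ne_zero hm.uniqueDiffOn hm.mem a b c d
  have h2 : ContMDiffWithinAt (𝓡∂ (m + 1)) 𝓘(ℝ, EuclideanSpace ℝ (Fin m)) ∞
      (tanPartL m ∘ extChartAt (𝓡∂ (m + 1)) x₀) T x₀ :=
    (tanPartL m).contMDiff.contMDiffAt.comp_contMDiffWithinAt x₀
      contMDiffAt_extChartAt.contMDiffWithinAt
  have h3 := ContMDiffWithinAt.comp x₀ h.contMDiffWithinAt h2 (Set.mapsTo_univ _ _)
  exact h3.of_le ENat.LEInfty.out

omit [IsManifold (𝓡∂ (m + 1)) ∞ M] in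
theorem contMDiffWithinAt_coord {k : ℕ} {T : Set M} {x₀ : M} {f : M → EuclideanSpace ℝ (Fin k)}
    (hf : ContMDiffWithinAt (𝓡∂ (m + 1)) 𝓘(ℝ, EuclideanSpace ℝ (Fin k)) 2 f T x₀) (i : Fin k) :
    ContMDiffWithinAt (𝓡∂ (m + 1)) 𝓘(ℝ, ℝ) 2 (fun x => f x i) T x₀ :=
  (EuclideanSpace.proj (𝕜 := ℝ) i).contMDiff.contMDiffAt.comp_contMDiffWithinAt x₀ hf

theorem contMDiffWithinAt_curv {T : Set M} {x₀ : M}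
    {e : (x : M) → Fin (m + 1) → TangentSpace (𝓡∂ (m + 1)) x}
    (he : ∀ a, ContMDiffWithinAt (𝓡∂ (m + 1)) (𝓡∂ (m + 1)).tangent 2
      (fun x => (⟨x, e x a⟩ : TangentBundle (𝓡∂ (m + 1)) M)) T x₀) (a b c d : Fin (m + 1)) :
    ContMDiffWithinAt (𝓡∂ (m + 1)) 𝓘(ℝ, ℝ) 2 (fun x => curv g.inner x (e x) a b c d) T x₀ := by
  have hc := fun a i => contMDiffWithinAt_coord (contMDiffWithinAt_chartVec (he a)) i
  have hr := contMDiffWithinAt_riemann_chart g T x₀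
  have h : ContMDiffWithinAt (𝓡∂ (m + 1)) 𝓘(ℝ, ℝ) 2 (fun x => riemannForm (halfSpace m)
      (chartMatrix g.inner x₀) (extChartAt (𝓡∂ (m + 1)) x₀ x) (chartVec x₀ x (e x a))
      (chartVec x₀ x (e x b)) (chartVec x₀ x (e x c)) (chartVec x₀ x (e x d))) T x₀ := by
    unfold riemannForm
    exact contMDiffWithinAt_finsetSum fun i _ => contMDiffWithinAt_finsetSum fun j _ =>
      contMDiffWithinAt_finsetSum fun k _ => contMDiffWithinAt_finsetSum fun l _ =>
        ((((hc a i).mul (hc b j)).mul (hc c k)).mul (hc d l)).mul (hr i j k l)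
  refine h.congr_of_eventuallyEq ?_ (curv_eq_chart g (mem_extChartAt_source x₀) _ _ _ _ _)
  filter_upwards [mem_nhdsWithin_of_mem_nhds ((isOpen_extChartAt_source
      (I := 𝓡∂ (m + 1)) x₀).mem_nhds (mem_extChartAt_source x₀))] with x hx
  exact curv_eq_chart g hx _ _ _ _ _

theorem contMDiffWithinAt_bdCurv {T : Set M} {x₀ : M} (hx₀ : x₀ ∈ T)
    (hT : T ⊆ (𝓡∂ (m + 1)).boundary M)
    {e : (x : M) → Fin (m + 1) → TangentSpace (𝓡∂ (m + 1)) x}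
    (he : ∀ a, ContMDiffWithinAt (𝓡∂ (m + 1)) (𝓡∂ (m + 1)).tangent 2
      (fun x => (⟨x, e x a⟩ : TangentBundle (𝓡∂ (m + 1)) M)) T x₀)
    (het : ∀ x ∈ T, ∀ i : Fin m, coordVec x (e x i.succ) 0 = 0) (a b c d : Fin m) :
    ContMDiffWithinAt (𝓡∂ (m + 1)) 𝓘(ℝ, ℝ) 2 (fun x => bdCurv g.inner x (e x) a b c d) T x₀ := by
  have hc := fun a i => contMDiffWithinAt_coord (contMDiffWithinAt_chartVec (he a)) i
  have hr := contMDiffWithinAt_riemann_bdChart g T (hT hx₀)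
  have h : ContMDiffWithinAt (𝓡∂ (m + 1)) 𝓘(ℝ, ℝ) 2 (fun x => riemannForm Set.univ
      (bdChartMatrix g.inner x₀) (tanPart (extChartAt (𝓡∂ (m + 1)) x₀ x))
      (tanPart (chartVec x₀ x (e x a.succ))) (tanPart (chartVec x₀ x (e x b.succ)))
      (tanPart (chartVec x₀ x (e x c.succ))) (tanPart (chartVec x₀ x (e x d.succ)))) T x₀ := by
    unfold riemannForm
    exact contMDiffWithinAt_finsetSum fun i _ => contMDiffWithinAt_finsetSum fun j _ =>
      contMDiffWithinAt_finsetSum fun k _ => contMDiffWithinAt_finsetSum fun l _ =>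
        ((((hc a.succ i.succ).mul (hc b.succ j.succ)).mul (hc c.succ k.succ)).mul
          (hc d.succ l.succ)).mul (hr i j k l)
  refine h.congr_of_eventuallyEq ?_
    (bdCurv_eq_chart g (mem_extChartAt_source x₀) (hT hx₀) _ (het x₀ hx₀) _ _ _ _)
  filter_upwards [mem_nhdsWithin_of_mem_nhds ((isOpen_extChartAt_source
      (I := 𝓡∂ (m + 1)) x₀).mem_nhds (mem_extChartAt_source x₀)), self_mem_nhdsWithin] with x hx hxT
  exact bdCurv_eq_chart g hx (hT hxT) _ (het x hxT) _ _ _ _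

/-- Frames that are orthonormal for `g` have locally bounded coordinates. -/
theorem exists_chartVec_bound (x₀ : M) :
    ∃ C : ℝ, 0 ≤ C ∧ ∀ᶠ x in 𝓝 x₀, ∀ e : Fin (m + 1) → TangentSpace (𝓡∂ (m + 1)) x,
      (∀ a b, g.inner x (e a) (e b) = if a = b then 1 else 0) →
        ∀ a i, |chartVec x₀ x (e a) i| ≤ C := by
  have hm := isMetricAt_chartMatrix g x₀ (mem_extChartAt_target x₀)
  have hcont : ∀ i, ∀ᶠ x in 𝓝 x₀, (chartMatrix g.inner x₀
      (extChartAt (𝓡∂ (m + 1)) x₀ x))⁻¹ i i ≤ (chartMatrix g.inner x₀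
      (extChartAt (𝓡∂ (m + 1)) x₀ x₀))⁻¹ i i + 1 := by
    intro i
    have h := (contDiffWithinAt_matrix_inv hm.contDiff hm.det_ne_zero i i).continuousWithinAt
    have h2 : Filter.Tendsto (extChartAt (𝓡∂ (m + 1)) x₀) (𝓝 x₀)
        (𝓝[halfSpace m] (extChartAt (𝓡∂ (m + 1)) x₀ x₀)) := by
      refine tendsto_nhdsWithin_iff.2 ⟨continuousAt_extChartAt x₀, ?_⟩
      filter_upwards [(isOpen_extChartAt_source
        (I := 𝓡∂ (m + 1)) x₀).mem_nhds (mem_extChartAt_source x₀)] with x hx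
      have := extChartAt_target_subset_range x₀ ((extChartAt (𝓡∂ (m + 1)) x₀).map_source hx)
      rwa [range_eq_halfSpace] at this
    exact (h.tendsto.comp h2).eventually (Iic_mem_nhds (lt_add_one _))
  let A : Fin (m + 1) → ℝ := fun i => |(chartMatrix g.inner x₀
      (extChartAt (𝓡∂ (m + 1)) x₀ x₀))⁻¹ i i| + 1
  refine ⟨1 + ∑ i, A i, add_nonneg zero_le_one (Finset.sum_nonneg fun i _ => by positivity), ?_⟩
  filter_upwards [Filter.eventually_all.2 hcont, (isOpen_extChartAt_source
      (I := 𝓡∂ (m + 1)) x₀).mem_nhds (mem_extChartAt_source x₀)] with x hx hxs e he a i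
  -- For an orthonormal frame the squares of the i-th coordinates add up to the i-th diagonal entry
  -- of the inverse metric, which is continuous in x.
  have h1 := sum_mul_eq_inv_of_orthonormal (e := fun a => chartVec x₀ x (e a)) (fun a b => by
    rw [matrixForm_chartMatrix_chartVec g hxs, he]) i i
  have h2 : chartVec x₀ x (e a) i * chartVec x₀ x (e a) i ≤ A i := by
    refine le_trans ?_ ((hx i).trans (by simp only [A]; gcongr; exact le_abs_self _))
    rw [← h1]
    exact Finset.single_le_sum (f := fun a => chartVec x₀ x (e a) i * chartVec x₀ x (e a) i)
      (fun _ _ => mul_self_nonneg _) (Finset.mem_univ a)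
  have h3 : A i ≤ ∑ i, A i := Finset.single_le_sum (f := A) (fun i _ => by positivity)
    (Finset.mem_univ i)
  refine abs_le_of_sq_le_sq (by nlinarith) (by positivity)

theorem abs_riemannForm_le {k : ℕ} {S : Set (EuclideanSpace ℝ (Fin k))}
    {G : EuclideanSpace ℝ (Fin k) → Matrix (Fin k) (Fin k) ℝ} {y u₁ u₂ u₃ u₄ : EuclideanSpace ℝ (Fin k)}
    {C : ℝ} (h₁ : ∀ i, |u₁ i| ≤ C) (h₂ : ∀ i, |u₂ i| ≤ C)
    (h₃ : ∀ i, |u₃ i| ≤ C) (h₄ : ∀ i, |u₄ i| ≤ C) {D : Fin k → Fin k → Fin k → Fin k → ℝ}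
    (hD : ∀ a b c d, |riemann S G a b c d y| ≤ D a b c d) :
    |riemannForm S G y u₁ u₂ u₃ u₄| ≤ ∑ a, ∑ b, ∑ c, ∑ d, C * C * C * C * D a b c d := by
  unfold riemannForm
  refine (Finset.abs_sum_le_sum_abs _ _).trans (Finset.sum_le_sum fun a _ => ?_)
  refine (Finset.abs_sum_le_sum_abs _ _).trans (Finset.sum_le_sum fun b _ => ?_)
  refine (Finset.abs_sum_le_sum_abs _ _).trans (Finset.sum_le_sum fun c _ => ?_)
  refine (Finset.abs_sum_le_sum_abs _ _).trans (Finset.sum_le_sum fun d _ => ?_)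
  have hC : 0 ≤ C := (abs_nonneg _).trans (h₁ a)
  rw [abs_mul, abs_mul, abs_mul, abs_mul]
  gcongr
  exacts [h₁ a, h₂ b, h₃ c, h₄ d, hD a b c d]

/-- Near x₀ the components of R in the chart at x₀ are bounded by continuity, and so are the
coordinates of every orthonormal frame; compactness of the boundary makes the bound global and
independent of the frame. -/
theorem exists_curv_bound [CompactSpace M] :
    ∃ C : ℝ, ∀ x ∈ (𝓡∂ (m + 1)).boundary M,
      ∀ e : Fin (m + 1) → TangentSpace (𝓡∂ (m + 1)) x, IsAdaptedFrame g.inner x e →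
        (∀ a b c d, |curv g.inner x e a b c d| ≤ C) ∧ ∀ i j k l, |bdCurv g.inner x e i j k l| ≤ C := by
  have hK : IsCompact ((𝓡∂ (m + 1)).boundary M) :=
    ((𝓡∂ (m + 1)).isClosed_boundary (n := ∞) (by simp)).isCompact
  refine hK.induction_on (p := fun s => ∃ C : ℝ, ∀ x ∈ s,
      ∀ e : Fin (m + 1) → TangentSpace (𝓡∂ (m + 1)) x, IsAdaptedFrame g.inner x e →
        (∀ a b c d, |curv g.inner x e a b c d| ≤ C) ∧ ∀ i j k l, |bdCurv g.inner x e i j k l| ≤ C)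
    ⟨0, by simp⟩ ?_ ?_ ?_
  · rintro s t hst ⟨C, hC⟩
    exact ⟨C, fun x hx => hC x (hst hx)⟩
  · rintro s t ⟨C, hC⟩ ⟨D, hD⟩
    refine ⟨max C D, ?_⟩
    rintro x (hx | hx) e he
    · exact ⟨fun a b c d => ((hC x hx e he).1 a b c d).trans (le_max_left _ _),
        fun a b c d => ((hC x hx e he).2 a b c d).trans (le_max_left _ _)⟩
    · exact ⟨fun a b c d => ((hD x hx e he).1 a b c d).trans (le_max_right _ _),
        fun a b c d => ((hD x hx e he).2 a b c d).trans (le_max_right _ _)⟩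
  · intro x₀ hx₀
    obtain ⟨C, hC0, hC⟩ := exists_chartVec_bound g x₀
    have h1 := fun a b c d => eventually_abs_le_add_one
      (contMDiffWithinAt_riemann_chart g ((𝓡∂ (m + 1)).boundary M) x₀ a b c d).continuousWithinAt
    have h2 := fun a b c d => eventually_abs_le_add_one
      (contMDiffWithinAt_riemann_bdChart g ((𝓡∂ (m + 1)).boundary M) hx₀ a b c d).continuousWithinAt
    simp only [← Filter.eventually_all] at h1 h2
    have h3 := (isOpen_extChartAt_source
      (I := 𝓡∂ (m + 1)) x₀).mem_nhds (mem_extChartAt_source x₀)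
    refine ⟨_, Filter.inter_mem (Filter.inter_mem (Filter.inter_mem (Filter.inter_mem h1 h2)
      (mem_nhdsWithin_of_mem_nhds hC)) (mem_nhdsWithin_of_mem_nhds h3)) self_mem_nhdsWithin,
      max (∑ a, ∑ b, ∑ c, ∑ d, C * C * C * C * (|riemann (halfSpace m) (chartMatrix g.inner x₀) a b c d
        (extChartAt (𝓡∂ (m + 1)) x₀ x₀)| + 1))
      (∑ a, ∑ b, ∑ c, ∑ d, C * C * C * C * (|riemann Set.univ (bdChartMatrix g.inner x₀) a b c d
        (tanPart (extChartAt (𝓡∂ (m + 1)) x₀ x₀))| + 1)), ?_⟩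
    rintro x ⟨⟨⟨⟨hx1, hx2⟩, hx3⟩, hx4⟩, hx5⟩ e he
    have hb := hx3 e he.orthonormal
    refine ⟨fun a b c d => ?_, fun i j k l => ?_⟩
    · rw [curv_eq_chart g hx4]
      exact (abs_riemannForm_le (hb a) (hb b) (hb c) (hb d) hx1).trans (le_max_left _ _)
    · rw [bdCurv_eq_chart g hx4 hx5 e he.tangent]
      exact (abs_riemannForm_le (fun p => hb _ p.succ) (fun p => hb _ p.succ)
        (fun p => hb _ p.succ) (fun p => hb _ p.succ) hx2).trans (le_max_right _ _)

end Manifold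

/-! ### Eliminating the conformal factor. -/

section Manifold

variable {m : ℕ} {M : Type*} [TopologicalSpace M]
    [ChartedSpace (EuclideanHalfSpace (m + 1)) M]

/-- The conformal factor `Λ ^ (4 / (n - 2))` in the preferred chart at `q`. -/
def chartFactor (Λ : M → ℝ) (q : M) (y : EuclideanSpace ℝ (Fin (m + 1))) : ℝ :=
  Λ ((extChartAt (𝓡∂ (m + 1)) q).symm y) ^ (4 / ((m : ℝ) - 1))

theorem chartMatrix_conformal (B : FormField m M) (Λ : M → ℝ) (q : M) :
    chartMatrix (conformal B Λ) q = fun y => chartFactor Λ q y • chartMatrix B q y := by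
  ext y a b
  rfl

theorem bdChartMatrix_conformal (B : FormField m M) (Λ : M → ℝ) (q : M) :
    bdChartMatrix (conformal B Λ) q =
      fun z => chartFactor Λ q (bdPoint z) • bdChartMatrix B q z := by
  ext z a b
  rfl

/-- The Ricci curvature of the boundary in an adapted frame. -/
def boundaryRicci (B : FormField m M) (q : M) (e : Fin (m + 1) → TangentSpace (𝓡∂ (m + 1)) q)
    (k l : Fin m) : ℝ := ∑ i, bdCurv B q e i k i l

/-- The components `R_{0i0j}` of the curvature of the normalized conformal metric, in terms of the
curvature of the original metric. -/
def normalizedCurv (B : FormField m M) (q : M) (e : Fin (m + 1) → TangentSpace (𝓡∂ (m + 1)) q)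
    (i j : Fin m) : ℝ :=
  curv B q e 0 i.succ 0 j.succ -
    (boundaryRicci B q e i j - (if i = j then 1 else 0) *
      ((∑ k, boundaryRicci B q e k k) / (2 * ((m : ℝ) - 1)))) / ((m : ℝ) - 2) -
    (if i = j then 1 else 0) *
      ((∑ a, curv B q e a 0 a 0 - (∑ k, boundaryRicci B q e k k) / (2 * ((m : ℝ) - 1))) / m)

theorem isAdaptedFrame_conformal_iff {B : FormField m M} {Λ : M → ℝ} {q : M} (h1 : Λ q = 1)
    (e : Fin (m + 1) → TangentSpace (𝓡∂ (m + 1)) q) :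
    IsAdaptedFrame (conformal B Λ) q e ↔ IsAdaptedFrame B q e := by
  have h : conformal B Λ q = B q := by
    rw [conformal, h1, Real.one_rpow, one_smul]
  constructor <;> intro H <;> refine ⟨fun a b => ?_, H.tangent, H.inward⟩ <;>
    have := H.orthonormal a b
  · rwa [h] at this
  · rwa [h]

variable [IsManifold (𝓡∂ (m + 1)) ∞ M]

theorem contDiffWithinAt_chartFactor {Λ : M → ℝ} (hΛ : ContMDiff (𝓡∂ (m + 1)) 𝓘(ℝ, ℝ) ∞ Λ)
    (hpos : ∀ x, 0 < Λ x) (q : M) {y : EuclideanSpace ℝ (Fin (m + 1))}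
    (hy : y ∈ (extChartAt (𝓡∂ (m + 1)) q).target) :
    ContDiffWithinAt ℝ 2 (chartFactor Λ q) (halfSpace m) y := by
  rw [← range_eq_halfSpace]
  have hsymm := contMDiffWithinAt_extChartAt_symm_range (I := 𝓡∂ (m + 1)) (n := ∞) q hy
  have := (hΛ.contMDiffAt.comp_contMDiffWithinAt y hsymm).contDiffWithinAt
  exact (this.rpow_const_of_ne (hpos _).ne').of_le ENat.LEInfty.out

omit [IsManifold (𝓡∂ (m + 1)) ∞ M] in
theorem fderivWithin_chartFactor {Λ : M → ℝ} (hΛ : ContMDiff (𝓡∂ (m + 1)) 𝓘(ℝ, ℝ) ∞ Λ)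
    {q : M} (h1 : Λ q = 1) (h0 : mfderiv (𝓡∂ (m + 1)) 𝓘(ℝ, ℝ) Λ q = 0) :
    fderivWithin ℝ (chartFactor Λ q) (halfSpace m) (extChartAt (𝓡∂ (m + 1)) q q) = 0 := by
  rw [← range_eq_halfSpace]
  have h := ((hΛ.mdifferentiable (by simp) q).hasMFDerivAt).2
  rw [h0] at h
  have hw : writtenInExtChartAt (𝓡∂ (m + 1)) 𝓘(ℝ, ℝ) q Λ (extChartAt (𝓡∂ (m + 1)) q q) ≠ 0 := by
    change Λ ((extChartAt (𝓡∂ (m + 1)) q).symm (extChartAt (𝓡∂ (m + 1)) q q)) ≠ 0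
    rw [extChartAt_to_inv, h1]
    exact one_ne_zero
  have h2 := HasFDerivWithinAt.rpow_const (p := 4 / ((m : ℝ) - 1)) h (Or.inl hw)
  have h3 := h2.fderivWithin ((𝓡∂ (m + 1)).uniqueDiffWithinAt_image)
  refine h3.trans ?_
  ext u
  exact mul_zero _

/-- Because the inclusion of the boundary in a chart is linear, the coordinate Hessian of the
restriction is the restriction of the Hessian, with no first-order term. -/
theorem fderiv_fderiv_comp_bdPoint {lam : EuclideanSpace ℝ (Fin (m + 1)) → ℝ}
    {z : EuclideanSpace ℝ (Fin m)} (h : ContDiffWithinAt ℝ 2 lam (halfSpace m) (bdPoint z))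
    (u v : EuclideanSpace ℝ (Fin m)) :
    fderivWithin ℝ (fderivWithin ℝ (fun z => lam (bdPoint z)) Set.univ) Set.univ z u v =
      fderivWithin ℝ (fderivWithin ℝ lam (halfSpace m)) (halfSpace m) (bdPoint z)
        (bdPoint u) (bdPoint v) := by
  have hz : bdPoint z ∈ halfSpace m := by simp [halfSpace]
  have hmaps : Set.MapsTo (bdPointL m) Set.univ (halfSpace m) := fun w _ => by simp [halfSpace]
  have hl := h.eventually (by simp)
  rw [Set.insert_eq_of_mem hz] at hl
  have hev : ∀ᶠ w in 𝓝 z, fderivWithin ℝ (fun z => lam (bdPoint z)) Set.univ w =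
      (fderivWithin ℝ lam (halfSpace m) (bdPoint w)) ∘L bdPointL m := by
    filter_upwards [(tendsto_bdPoint z).eventually hl] with w hw
    have h1 := (hw.differentiableWithinAt (by norm_num)).hasFDerivWithinAt
    exact (h1.comp w (bdPointL m).hasFDerivAt.hasFDerivWithinAt hmaps).fderivWithin
      uniqueDiffWithinAt_univ
  have hD : DifferentiableWithinAt ℝ (fderivWithin ℝ lam (halfSpace m)) (halfSpace m) (bdPoint z) :=
    (h.fderivWithin_right (m := 1) uniqueDiffOn_halfSpace (by norm_num)
      hz).differentiableWithinAt (by norm_num)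
  have hcomp := hD.hasFDerivWithinAt.comp z
    (bdPointL m).hasFDerivAt.hasFDerivWithinAt hmaps
  have h2 := hcomp.clm_comp (hasFDerivWithinAt_const (bdPointL m) z Set.univ)
  rw [Filter.EventuallyEq.fderivWithin_eq_of_mem (f := fun w =>
      (fderivWithin ℝ lam (halfSpace m) (bdPoint w)) ∘L bdPointL m)
      (by rw [nhdsWithin_univ]; exact hev) (Set.mem_univ z)]
  have h3 := h2.fderivWithin uniqueDiffWithinAt_univ
  simp only [Function.comp] at h3
  rw [h3]
  simp

variable {g : Bundle.ContMDiffRiemannianMetric (𝓡∂ (m + 1)) ∞ (EuclideanSpace ℝ (Fin (m + 1)))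
      (fun x : M => TangentSpace (𝓡∂ (m + 1)) x)} {Λ : M → M → ℝ}

namespace IsNormalizedConformalFamily

variable (hΛ : IsNormalizedConformalFamily g.inner Λ) {q : M} (hq : q ∈ (𝓡∂ (m + 1)).boundary M)
  {e : Fin (m + 1) → TangentSpace (𝓡∂ (m + 1)) q} (he : IsAdaptedFrame g.inner q e)

include hΛ hq he

/-- L is the Hessian of Λ_q^(4/(n-2)) at q in the frame e. The same L governs the change of the
interior and of the boundary curvature, which is what makes the normalization solvable for the
entries needed below. -/
theorem exists_hessian : ∃ L : Fin (m + 1) → Fin (m + 1) → ℝ,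
    (∀ a b c d, curv (conformal g.inner (Λ q)) q e a b c d = curv g.inner q e a b c d + (1 / 2) *
      (L c b * (if a = d then 1 else 0) + L d a * (if b = c then 1 else 0) -
        L c a * (if b = d then 1 else 0) - L d b * (if a = c then 1 else 0))) ∧
    (∀ i j k l, bdCurv (conformal g.inner (Λ q)) q e i j k l = bdCurv g.inner q e i j k l +
      (1 / 2) * (L k.succ j.succ * (if i = l then 1 else 0) +
        L l.succ i.succ * (if j = k then 1 else 0) -
        L k.succ i.succ * (if j = l then 1 else 0) -
        L l.succ j.succ * (if i = k then 1 else 0))) := by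
  have ht := mem_extChartAt_target (I := 𝓡∂ (m + 1)) q
  have h0 := bdPoint_tanPart ((extChartAt_mem_boundary_iff (mem_extChartAt_source q)).1 hq)
  have hlam := contDiffWithinAt_chartFactor (hΛ.smooth q hq) (hΛ.pos q hq) q ht
  have hone : chartFactor (Λ q) q (extChartAt (𝓡∂ (m + 1)) q q) = 1 := by
    rw [chartFactor, extChartAt_to_inv, hΛ.one q hq, Real.one_rpow]
  have hzero := fderivWithin_chartFactor (hΛ.smooth q hq) (hΛ.one q hq) (hΛ.deriv_zero q hq)
  have hlam' : ContDiffWithinAt ℝ 2 (chartFactor (Λ q) q) (halfSpace m)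
      (bdPoint (tanPart (extChartAt (𝓡∂ (m + 1)) q q))) := by rwa [h0]
  let L := fderivWithin ℝ (fderivWithin ℝ (chartFactor (Λ q) q) (halfSpace m)) (halfSpace m)
    (extChartAt (𝓡∂ (m + 1)) q q)
  refine ⟨fun a b => L (coordVec q (e a)) (coordVec q (e b)), fun a b c d => ?_,
    fun i j k l => ?_⟩
  · rw [curv_eq_riemannForm, curv_eq_riemannForm, chartMatrix_conformal,
      (isMetricAt_chartMatrix g q ht).riemannForm_conformal hlam hone hzero]
    simp only [matrixForm_chartMatrix_coordVec, he.orthonormal, L]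
  · have hmaps : Set.MapsTo (bdPointL m) Set.univ (halfSpace m) := fun w _ => by simp [halfSpace]
    have hb2 : ContDiffWithinAt ℝ 2 (fun z => chartFactor (Λ q) q (bdPoint z)) Set.univ
        (tanPart (extChartAt (𝓡∂ (m + 1)) q q)) :=
      hlam'.comp _ (bdPointL m).contDiff.contDiffWithinAt hmaps
    have hb0 : fderivWithin ℝ (fun z => chartFactor (Λ q) q (bdPoint z)) Set.univ
        (tanPart (extChartAt (𝓡∂ (m + 1)) q q)) = 0 := by
      have h1 := (hlam'.differentiableWithinAt (by norm_num)).hasFDerivWithinAt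
      rw [h0, hzero, ← h0] at h1
      have h2 := (h1.comp _ (bdPointL m).hasFDerivAt.hasFDerivWithinAt hmaps).fderivWithin
        uniqueDiffWithinAt_univ
      rw [ContinuousLinearMap.zero_comp] at h2
      exact h2
    rw [bdCurv_eq_riemannForm, bdCurv_eq_riemannForm, bdChartMatrix_conformal,
      (isMetricAt_bdChartMatrix g q (by rwa [h0])).riemannForm_conformal hb2
        (by rw [h0, hone]) hb0]
    have hδ : ∀ i j : Fin m, matrixForm (bdChartMatrix g.inner q
        (tanPart (extChartAt (𝓡∂ (m + 1)) q q))) (tanPart (coordVec q (e i.succ)))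
        (tanPart (coordVec q (e j.succ))) = if i = j then 1 else 0 := by
      intro i j
      rw [matrixForm_bdChartMatrix, bdPoint_tanPart (he.tangent i), bdPoint_tanPart (he.tangent j),
        h0, matrixForm_chartMatrix_coordVec, he.orthonormal]
      simp
    have hL : ∀ i j : Fin m, fderivWithin ℝ (fderivWithin ℝ
        (fun z => chartFactor (Λ q) q (bdPoint z)) Set.univ) Set.univ
        (tanPart (extChartAt (𝓡∂ (m + 1)) q q)) (tanPart (coordVec q (e i.succ)))
        (tanPart (coordVec q (e j.succ))) = L (coordVec q (e i.succ)) (coordVec q (e j.succ)) := by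
      intro i j
      rw [fderiv_fderiv_comp_bdPoint hlam', bdPoint_tanPart (he.tangent i),
        bdPoint_tanPart (he.tangent j), h0]
    simp only [hδ, hL]

/-- The vanishing of the boundary Ricci tensor determines the tangential block of the Hessian L, and
R_nn = 0 then determines L_nn. These are the only entries of L in R_ninj, so R_ninj of the
normalized metric is expressed by the curvature of g alone; this removes any dependence on how Λ_q
varies with q. -/
theorem curv_eq_normalizedCurv (hm : 3 ≤ m) (i j : Fin m) :
    curv (conformal g.inner (Λ q)) q e 0 i.succ 0 j.succ = normalizedCurv g.inner q e i j := by
  obtain ⟨L, hL, hbL⟩ := hΛ.exists_hessian hq he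
  have he' := (isAdaptedFrame_conformal_iff (B := g.inner) (hΛ.one q hq) e).2 he
  have hm' : (3 : ℝ) ≤ m := by exact_mod_cast hm
  set τ := ∑ k : Fin m, L k.succ k.succ with hτ
  -- Contracting the conformal change in the m boundary dimensions gives 0 = Ric_kl - ((m-2) L_lk +
  -- τ δ_kl)/2, with τ the tangential trace of L.
  have h1 : ∀ k l, boundaryRicci g.inner q e k l =
      (1 / 2) * (((m : ℝ) - 2) * L l.succ k.succ + (if k = l then 1 else 0) * τ) := by
    intro k l
    have h := hΛ.bdRicci q hq e he' k l
    simp only [hbL, Finset.sum_add_distrib, ← Finset.mul_sum, Finset.sum_sub_distrib,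
      mul_ite, mul_one, mul_zero, Finset.sum_ite_eq, Finset.sum_ite_eq',
      Finset.mem_univ, if_true, Finset.sum_const, Finset.card_univ, Fintype.card_fin,
      nsmul_eq_mul] at h
    rw [boundaryRicci]
    by_cases hkl : k = l
    · subst hkl; simp at h ⊢; linarith
    · simp [hkl] at h ⊢; linarith
  have h2 : ∑ k, boundaryRicci g.inner q e k k = ((m : ℝ) - 1) * τ := by
    simp only [h1, if_true, ← Finset.mul_sum, Finset.sum_add_distrib, Finset.sum_const,
      Finset.card_univ, Fintype.card_fin, nsmul_eq_mul, ← hτ]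
    ring
  -- The nn-component of the same contraction, now over all m + 1 directions.
  have h3 : ∑ a, curv g.inner q e a 0 a 0 = (1 / 2) * (m * L 0 0 + τ) := by
    have h := hΛ.ricci q hq e he' 0
    simp only [hL, Finset.sum_add_distrib, ← Finset.mul_sum, Finset.sum_sub_distrib,
      mul_ite, mul_one, mul_zero, Finset.sum_ite_eq, Finset.sum_ite_eq', Fin.sum_univ_succ,
      Finset.mem_univ, if_true, Finset.sum_const, Finset.card_univ, Fintype.card_fin,
      nsmul_eq_mul] at h
    rw [Fin.sum_univ_succ]
    simp at h
    linarith
  have h4 : (∑ k, boundaryRicci g.inner q e k k) / (2 * ((m : ℝ) - 1)) = τ / 2 := by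
    rw [h2]
    have : (m : ℝ) - 1 ≠ 0 := by linarith
    field_simp
  have h5 : (boundaryRicci g.inner q e i j - (if i = j then 1 else 0) * (τ / 2)) / ((m : ℝ) - 2) =
      L j.succ i.succ / 2 := by
    rw [h1]
    have : (m : ℝ) - 2 ≠ 0 := by linarith
    field_simp
    ring
  have h6 : ((1 / 2) * (m * L 0 0 + τ) - τ / 2) / m = L 0 0 / 2 := by
    have : (m : ℝ) ≠ 0 := by linarith
    field_simp
    ring
  rw [normalizedCurv, h4, h5, h3, h6, hL]
  by_cases hij : i = j
  · simp [hij, (Fin.succ_ne_zero _).symm]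
    ring
  · simp [hij, (Fin.succ_ne_zero _).symm]
    ring

omit he in
theorem isMetricAt_conformal : IsMetricAt (halfSpace m)
    (chartMatrix (conformal g.inner (Λ q)) q) (extChartAt (𝓡∂ (m + 1)) q q) := by
  have ht := mem_extChartAt_target (I := 𝓡∂ (m + 1)) q
  rw [chartMatrix_conformal]
  exact (isMetricAt_chartMatrix g q ht).conformal
    (contDiffWithinAt_chartFactor (hΛ.smooth q hq) (hΛ.pos q hq) q ht)
    (by rw [chartFactor, extChartAt_to_inv, hΛ.one q hq, Real.one_rpow])

/-- This is R_nn = 0 after removing the term R_nnnn, which is zero by antisymmetry, and exchanging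
both index pairs. It provides the trace-free condition on A. -/
theorem sum_curv_conformal : ∑ i : Fin m,
    curv (conformal g.inner (Λ q)) q e 0 i.succ 0 i.succ = 0 := by
  have he' := (isAdaptedFrame_conformal_iff (B := g.inner) (hΛ.one q hq) e).2 he
  have hM := hΛ.isMetricAt_conformal hq
  have h := hΛ.ricci q hq e he' 0
  have h0 : curv (conformal g.inner (Λ q)) q e 0 0 0 0 = 0 := by
    have := hM.riemannForm_swap (coordVec q (e 0)) (coordVec q (e 0)) (coordVec q (e 0))
      (coordVec q (e 0))
    rw [curv_eq_riemannForm]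
    linarith
  rw [Fin.sum_univ_succ, h0, zero_add] at h
  rw [← h]
  refine Finset.sum_congr rfl fun i _ => ?_
  rw [curv_eq_riemannForm, curv_eq_riemannForm, hM.riemannForm_swap, hM.riemannForm_swap_right]
  ring

theorem bdCurv_conformal_swap (i j k l : Fin m) :
    bdCurv (conformal g.inner (Λ q)) q e j i k l =
      -bdCurv (conformal g.inner (Λ q)) q e i j k l := by
  obtain ⟨L, -, hbL⟩ := hΛ.exists_hessian hq he
  have h0 := bdPoint_tanPart ((extChartAt_mem_boundary_iff (mem_extChartAt_source q)).1 hq)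
  have h := (isMetricAt_bdChartMatrix g q (z := tanPart (extChartAt (𝓡∂ (m + 1)) q q))
    (by rw [h0]; exact mem_extChartAt_target q)).riemannForm_swap (tanPart (coordVec q (e i.succ)))
    (tanPart (coordVec q (e j.succ))) (tanPart (coordVec q (e k.succ)))
    (tanPart (coordVec q (e l.succ)))
  rw [hbL, hbL, bdCurv_eq_riemannForm, h, bdCurv_eq_riemannForm]
  ring

end IsNormalizedConformalFamily

theorem contMDiffWithinAt_normalizedCurv
    (g : Bundle.ContMDiffRiemannianMetric (𝓡∂ (m + 1)) ∞ (EuclideanSpace ℝ (Fin (m + 1)))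
      (fun x : M => TangentSpace (𝓡∂ (m + 1)) x)) {T : Set M} {x₀ : M} (hx₀ : x₀ ∈ T)
    (hT : T ⊆ (𝓡∂ (m + 1)).boundary M)
    {e : (x : M) → Fin (m + 1) → TangentSpace (𝓡∂ (m + 1)) x}
    (he : ∀ a, ContMDiffWithinAt (𝓡∂ (m + 1)) (𝓡∂ (m + 1)).tangent 2
      (fun x => (⟨x, e x a⟩ : TangentBundle (𝓡∂ (m + 1)) M)) T x₀)
    (het : ∀ x ∈ T, ∀ i : Fin m, coordVec x (e x i.succ) 0 = 0) (i j : Fin m) :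
    ContMDiffWithinAt (𝓡∂ (m + 1)) 𝓘(ℝ, ℝ) 2 (fun x => normalizedCurv g.inner x (e x) i j) T x₀ := by
  have h1 := contMDiffWithinAt_curv g he
  have h2 : ∀ k l, ContMDiffWithinAt (𝓡∂ (m + 1)) 𝓘(ℝ, ℝ) 2
      (fun x => boundaryRicci g.inner x (e x) k l) T x₀ := fun k l =>
    contMDiffWithinAt_finsetSum fun i _ => contMDiffWithinAt_bdCurv g hx₀ hT he het i k i l
  have h3 : ContMDiffWithinAt (𝓡∂ (m + 1)) 𝓘(ℝ, ℝ) 2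
      (fun x => ∑ k, boundaryRicci g.inner x (e x) k k) T x₀ :=
    contMDiffWithinAt_finsetSum fun k _ => h2 k k
  have h4 : ContMDiffWithinAt (𝓡∂ (m + 1)) 𝓘(ℝ, ℝ) 2
      (fun x => ∑ a, curv g.inner x (e x) a 0 a 0) T x₀ :=
    contMDiffWithinAt_finsetSum fun a _ => h1 a 0 a 0
  have hc : ∀ c : ℝ, ContMDiffWithinAt (𝓡∂ (m + 1)) 𝓘(ℝ, ℝ) 2 (fun _ : M => c) T x₀ :=
    fun c => contMDiffWithinAt_const
  unfold normalizedCurv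
  simp only [div_eq_mul_inv]
  exact ((h1 0 i.succ 0 j.succ).sub (((h2 i j).sub ((hc _).mul (h3.mul (hc _)))).mul (hc _))).sub
    ((hc _).mul ((h4.sub (h3.mul (hc _))).mul (hc _)))

theorem exists_normalizedCurv_bound [CompactSpace M]
    (g : Bundle.ContMDiffRiemannianMetric (𝓡∂ (m + 1)) ∞ (EuclideanSpace ℝ (Fin (m + 1)))
      (fun x : M => TangentSpace (𝓡∂ (m + 1)) x)) :
    ∃ C : ℝ, ∀ x ∈ (𝓡∂ (m + 1)).boundary M,
      ∀ e : Fin (m + 1) → TangentSpace (𝓡∂ (m + 1)) x, IsAdaptedFrame g.inner x e →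
        ∀ i j, |normalizedCurv g.inner x e i j| ≤ C := by
  obtain ⟨C, hC⟩ := exists_curv_bound g
  let s : ℝ := (∑ _k : Fin m, ∑ _i : Fin m, C) / |2 * ((m : ℝ) - 1)|
  refine ⟨C + ((∑ _i : Fin m, C) + 1 * s) / |(m : ℝ) - 2| + 1 * (((∑ _a : Fin (m + 1), C) + s) / |(m : ℝ)|),
    fun x hx e he i j => ?_⟩
  obtain ⟨h1, h2⟩ := hC x hx e he
  have h3 : ∀ k l, |boundaryRicci g.inner x e k l| ≤ ∑ _i : Fin m, C := fun k l =>
    (Finset.abs_sum_le_sum_abs _ _).trans (Finset.sum_le_sum fun i _ => h2 i k i l)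
  have h4 : |(∑ k, boundaryRicci g.inner x e k k) / (2 * ((m : ℝ) - 1))| ≤ s := by
    rw [abs_div]
    exact div_le_div_of_nonneg_right ((Finset.abs_sum_le_sum_abs _ _).trans
      (Finset.sum_le_sum fun k _ => h3 k k)) (abs_nonneg _)
  have h5 : |∑ a, curv g.inner x e a 0 a 0| ≤ ∑ _a : Fin (m + 1), C :=
    (Finset.abs_sum_le_sum_abs _ _).trans (Finset.sum_le_sum fun a _ => h1 a 0 a 0)
  have h6 : |(if i = j then (1 : ℝ) else 0)| ≤ 1 := by split_ifs <;> simp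
  have hs : 0 ≤ s := (abs_nonneg _).trans h4
  unfold normalizedCurv
  refine (abs_sub _ _).trans (add_le_add ((abs_sub _ _).trans (add_le_add (h1 _ _ _ _) ?_)) ?_)
  · rw [abs_div]
    gcongr
    refine (abs_sub _ _).trans (add_le_add (h3 i j) ?_)
    rw [abs_mul]
    gcongr
  · rw [abs_mul, abs_div]
    gcongr
    exact (abs_sub _ _).trans (add_le_add h5 h4)

end Manifold

/-! ### Partial derivatives and the Laplacian -/

section Laplacian

variable {k : ℕ} {f f' : EuclideanSpace ℝ (Fin k) → ℝ} {y : EuclideanSpace ℝ (Fin k)}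

theorem pd_univ (f : EuclideanSpace ℝ (Fin k) → ℝ) (a : Fin k) (y : EuclideanSpace ℝ (Fin k)) :
    pd Set.univ f a y = fderiv ℝ f y (EuclideanSpace.single a 1) := by
  rw [pd, fderivWithin_univ]

theorem pd_eq_of_hasFDerivAt {L : EuclideanSpace ℝ (Fin k) →L[ℝ] ℝ} (h : HasFDerivAt f L y)
    (a : Fin k) : pd Set.univ f a y = L (EuclideanSpace.single a 1) := by
  rw [pd_univ, h.fderiv]

theorem pd_univ_sub (hf : DifferentiableAt ℝ f y) (hf' : DifferentiableAt ℝ f' y) (a : Fin k) :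
    pd Set.univ (fun x => f x - f' x) a y = pd Set.univ f a y - pd Set.univ f' a y := by
  rw [pd_eq_of_hasFDerivAt (hf.hasFDerivAt.fun_sub hf'.hasFDerivAt), pd_univ, pd_univ]
  rfl

theorem contDiffAt_pd {n N : WithTop ℕ∞} (hf : ContDiffAt ℝ N f y) (hn : n + 1 ≤ N) (a : Fin k) :
    ContDiffAt ℝ n (pd Set.univ f a) y := by
  rw [← contDiffWithinAt_univ] at hf ⊢
  exact contDiffWithinAt_pd hf uniqueDiffOn_univ (Set.mem_univ y) hn a

theorem fderiv_apply_eq_sum (v : EuclideanSpace ℝ (Fin k)) :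
    fderiv ℝ f y v = ∑ a, v a * pd Set.univ f a y := by
  rw [eq_sum_of_isLinearMap (f := fderiv ℝ f y) ⟨map_add _, fun c x => by simp⟩ v]
  simp [pd_univ]

theorem pd_univ_congr (h : f =ᶠ[𝓝 y] f') (a : Fin k) :
    pd Set.univ f a y = pd Set.univ f' a y := by
  rw [pd_univ, pd_univ, h.fderiv_eq]

theorem pd_univ_mul (hf : DifferentiableAt ℝ f y) (hf' : DifferentiableAt ℝ f' y) (a : Fin k) :
    pd Set.univ (fun x => f x * f' x) a y =
      f y * pd Set.univ f' a y + pd Set.univ f a y * f' y := by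
  rw [pd_eq_of_hasFDerivAt (hf.hasFDerivAt.fun_mul hf'.hasFDerivAt), pd_univ, pd_univ]
  simp [mul_comm]

theorem pd_univ_add (hf : DifferentiableAt ℝ f y) (hf' : DifferentiableAt ℝ f' y) (a : Fin k) :
    pd Set.univ (fun x => f x + f' x) a y = pd Set.univ f a y + pd Set.univ f' a y := by
  rw [pd_eq_of_hasFDerivAt (hf.hasFDerivAt.fun_add hf'.hasFDerivAt), pd_univ, pd_univ]
  rfl

theorem pd_univ_sum {ι : Type*} {s : Finset ι} {F : ι → EuclideanSpace ℝ (Fin k) → ℝ}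
    (hF : ∀ i ∈ s, DifferentiableAt ℝ (F i) y) (a : Fin k) :
    pd Set.univ (fun x => ∑ i ∈ s, F i x) a y = ∑ i ∈ s, pd Set.univ (F i) a y := by
  have h := HasFDerivAt.fun_sum fun i hi => (hF i hi).hasFDerivAt
  rw [pd_eq_of_hasFDerivAt h]
  simp [pd_univ]

theorem pd_univ_comp {G : ℝ → ℝ} (hG : DifferentiableAt ℝ G (f y)) (hf : DifferentiableAt ℝ f y)
    (a : Fin k) : pd Set.univ (fun x => G (f x)) a y = deriv G (f y) * pd Set.univ f a y := by
  rw [pd_eq_of_hasFDerivAt (f := fun x => G (f x))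
    (hG.hasDerivAt.comp_hasFDerivAt y hf.hasFDerivAt), pd_univ]
  simp

theorem pd_pd_eq (hf : ContDiffAt ℝ 2 f y) (a b : Fin k) :
    pd Set.univ (pd Set.univ f a) b y =
      fderiv ℝ (fderiv ℝ f) y (EuclideanSpace.single b 1) (EuclideanSpace.single a 1) := by
  have h : DifferentiableAt ℝ (fderiv ℝ f) y :=
    (hf.fderiv_right (m := 1) (by norm_num)).differentiableAt (by norm_num)
  have h2 := h.hasFDerivAt.clm_apply (hasFDerivAt_const (EuclideanSpace.single a (1 : ℝ)) y)
  have h3 : pd Set.univ f a = fun x => fderiv ℝ f x (EuclideanSpace.single a 1) := by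
    ext x; exact pd_univ f a x
  rw [h3, pd_eq_of_hasFDerivAt h2]
  simp

theorem pd_pd_comm (hf : ContDiffAt ℝ 2 f y) (a b : Fin k) :
    pd Set.univ (pd Set.univ f a) b y = pd Set.univ (pd Set.univ f b) a y := by
  rw [pd_pd_eq hf, pd_pd_eq hf]
  exact (hf.isSymmSndFDerivAt (by simp)) _ _

theorem laplacian_eq_sum_pd (hf : ContDiffAt ℝ 2 f y) :
    Laplacian.laplacian f y = ∑ a, pd Set.univ (pd Set.univ f a) a y := by
  rw [InnerProductSpace.laplacian_eq_iteratedFDeriv_orthonormalBasis f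
    (EuclideanSpace.basisFun (Fin k) ℝ)]
  refine Finset.sum_congr rfl fun a _ => ?_
  rw [pd_pd_eq hf, iteratedFDeriv_two_apply]
  simp

theorem differentiableAt_of_contDiffAt_two (hf : ContDiffAt ℝ 2 f y) : DifferentiableAt ℝ f y :=
  hf.differentiableAt (by norm_num)

theorem differentiableAt_pd (hf : ContDiffAt ℝ 2 f y) (a : Fin k) :
    DifferentiableAt ℝ (pd Set.univ f a) y :=
  (contDiffAt_pd (n := 1) hf (by norm_num) a).differentiableAt (by norm_num)

theorem eventually_contDiffAt_two (hf : ContDiffAt ℝ 2 f y) : ∀ᶠ x in 𝓝 y, ContDiffAt ℝ 2 f x :=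
  hf.eventually (by simp)

theorem laplacian_mul (hf : ContDiffAt ℝ 2 f y) (hf' : ContDiffAt ℝ 2 f' y) :
    Laplacian.laplacian (fun x => f x * f' x) y = f y * Laplacian.laplacian f' y +
      2 * ∑ a, pd Set.univ f a y * pd Set.univ f' a y + Laplacian.laplacian f y * f' y := by
  rw [laplacian_eq_sum_pd (hf.mul hf'), laplacian_eq_sum_pd hf, laplacian_eq_sum_pd hf',
    Finset.mul_sum, Finset.mul_sum, Finset.sum_mul, ← Finset.sum_add_distrib,
    ← Finset.sum_add_distrib]
  refine Finset.sum_congr rfl fun a _ => ?_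
  have h : pd Set.univ (fun x => f x * f' x) a =ᶠ[𝓝 y]
      fun x => f x * pd Set.univ f' a x + pd Set.univ f a x * f' x := by
    filter_upwards [eventually_contDiffAt_two hf, eventually_contDiffAt_two hf'] with x h1 h2
    exact pd_univ_mul (differentiableAt_of_contDiffAt_two h1)
      (differentiableAt_of_contDiffAt_two h2) a
  have h1 := differentiableAt_of_contDiffAt_two hf
  have h2 := differentiableAt_of_contDiffAt_two hf'
  rw [pd_univ_congr h, pd_univ_add (h1.fun_mul (differentiableAt_pd hf' a))
    ((differentiableAt_pd hf a).fun_mul h2), pd_univ_mul h1 (differentiableAt_pd hf' a),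
    pd_univ_mul (differentiableAt_pd hf a) h2]
  ring

theorem laplacian_comp {G : ℝ → ℝ} (hG : ContDiff ℝ 2 G) (hf : ContDiffAt ℝ 2 f y) :
    Laplacian.laplacian (fun x => G (f x)) y = deriv (deriv G) (f y) *
      ∑ a, pd Set.univ f a y ^ 2 + deriv G (f y) * Laplacian.laplacian f y := by
  rw [laplacian_eq_sum_pd (f := fun x => G (f x)) (hG.contDiffAt.comp y hf), laplacian_eq_sum_pd hf,
    Finset.mul_sum, Finset.mul_sum, ← Finset.sum_add_distrib]
  refine Finset.sum_congr rfl fun a _ => ?_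
  have hG' : ContDiff ℝ 1 (deriv G) := ((contDiff_succ_iff_deriv (n := 1)).1 hG).2.2
  have h : pd Set.univ (fun x => G (f x)) a =ᶠ[𝓝 y]
      fun x => deriv G (f x) * pd Set.univ f a x := by
    filter_upwards [eventually_contDiffAt_two hf] with x h1
    exact pd_univ_comp (hG.differentiable (by norm_num) _)
      (differentiableAt_of_contDiffAt_two h1) a
  have h1 := differentiableAt_of_contDiffAt_two hf
  have h2 : DifferentiableAt ℝ (deriv G) (f y) := hG'.differentiable (by norm_num) _
  rw [pd_univ_congr h, pd_univ_mul (f := fun x => deriv G (f x)) (h2.comp y h1)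
    (differentiableAt_pd hf a), pd_univ_comp h2 h1]
  ring

theorem laplacian_fun_add (hf : ContDiffAt ℝ 2 f y) (hf' : ContDiffAt ℝ 2 f' y) :
    Laplacian.laplacian (fun x => f x + f' x) y =
      Laplacian.laplacian f y + Laplacian.laplacian f' y :=
  hf.laplacian_add hf'

theorem laplacian_sum {ι : Type*} {s : Finset ι} {F : ι → EuclideanSpace ℝ (Fin k) → ℝ}
    (hF : ∀ i ∈ s, ContDiffAt ℝ 2 (F i) y) :
    Laplacian.laplacian (fun x => ∑ i ∈ s, F i x) y = ∑ i ∈ s, Laplacian.laplacian (F i) y := by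
  classical
  induction s using Finset.induction_on with
  | empty => simp [InnerProductSpace.laplacian_const]
  | insert i s hi ih =>
    simp only [Finset.sum_insert hi]
    rw [laplacian_fun_add (hF i (Finset.mem_insert_self i s))
      (ContDiffAt.sum fun j hj => hF j (Finset.mem_insert_of_mem hj)),
      ih fun j hj => hF j (Finset.mem_insert_of_mem hj)]

theorem laplacian_pd (hf : ContDiffAt ℝ 3 f y) (b : Fin k) :
    Laplacian.laplacian (pd Set.univ f b) y = pd Set.univ (Laplacian.laplacian f) b y := by
  have hf2 : ContDiffAt ℝ 2 f y := hf.of_le (by norm_num)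
  have h : Laplacian.laplacian f =ᶠ[𝓝 y] fun x => ∑ a, pd Set.univ (pd Set.univ f a) a x := by
    filter_upwards [eventually_contDiffAt_two hf2] with x hx using laplacian_eq_sum_pd hx
  have hp : ∀ a, ContDiffAt ℝ 2 (pd Set.univ f a) y := fun a =>
    contDiffAt_pd hf (by norm_num) a
  rw [laplacian_eq_sum_pd (hp b), pd_univ_congr h,
    pd_univ_sum (fun a _ => differentiableAt_pd (hp a) a)]
  refine Finset.sum_congr rfl fun a _ => ?_
  have h2 : pd Set.univ (pd Set.univ f b) a =ᶠ[𝓝 y] pd Set.univ (pd Set.univ f a) b := by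
    filter_upwards [eventually_contDiffAt_two hf2] with x hx using pd_pd_comm hx b a
  rw [pd_univ_congr h2, pd_pd_comm (hp a)]

theorem pd_coord (a b : Fin k) (y : EuclideanSpace ℝ (Fin k)) :
    pd Set.univ (fun x : EuclideanSpace ℝ (Fin k) => x b) a y = if a = b then 1 else 0 := by
  have h : HasFDerivAt (fun x : EuclideanSpace ℝ (Fin k) => x b)
    (EuclideanSpace.proj (𝕜 := ℝ) b : EuclideanSpace ℝ (Fin k) →L[ℝ] ℝ) y :=
    (EuclideanSpace.proj (𝕜 := ℝ) b).hasFDerivAt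
  rw [pd_eq_of_hasFDerivAt h]
  simp [eq_comm]

theorem contDiff_coord {n : WithTop ℕ∞} (b : Fin k) :
    ContDiff ℝ n (fun x : EuclideanSpace ℝ (Fin k) => x b) :=
  (EuclideanSpace.proj (𝕜 := ℝ) b : EuclideanSpace ℝ (Fin k) →L[ℝ] ℝ).contDiff

theorem pd_const (c : ℝ) (a : Fin k) (y : EuclideanSpace ℝ (Fin k)) :
    pd Set.univ (fun _ => c) a y = 0 := by
  rw [pd_eq_of_hasFDerivAt (hasFDerivAt_const c y)]
  rfl

theorem laplacian_coord (b : Fin k) (y : EuclideanSpace ℝ (Fin k)) :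
    Laplacian.laplacian (fun x : EuclideanSpace ℝ (Fin k) => x b) y = 0 := by
  rw [laplacian_eq_sum_pd (contDiff_coord b).contDiffAt]
  refine Finset.sum_eq_zero fun a _ => ?_
  have : pd Set.univ (fun x : EuclideanSpace ℝ (Fin k) => x b) a =
    fun _ => if a = b then (1 : ℝ) else 0 := by ext x; exact pd_coord a b x
  rw [this, pd_const]

theorem laplacian_fun_const (c : ℝ) (y : EuclideanSpace ℝ (Fin k)) :
    Laplacian.laplacian (fun _ : EuclideanSpace ℝ (Fin k) => c) y = 0 := by
  rw [InnerProductSpace.laplacian_const]; rfl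

end Laplacian

/-! ### Mean values -/

/-- A smooth convex function that vanishes exactly on `(-∞, 0]` and grows linearly. -/
def ramp (s : ℝ) : ℝ := ∫ r in (0 : ℝ)..s, Real.smoothTransition r

theorem hasDerivAt_ramp (s : ℝ) : HasDerivAt ramp (Real.smoothTransition s) s :=
  (Real.smoothTransition.continuous.integral_hasStrictDerivAt 0 s).hasDerivAt

theorem deriv_ramp : deriv ramp = Real.smoothTransition := by
  ext s; exact (hasDerivAt_ramp s).deriv

theorem contDiff_ramp : ContDiff ℝ 2 ramp := by
  refine (contDiff_succ_iff_deriv (n := 1)).2 ⟨fun s => (hasDerivAt_ramp s).differentiableAt,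
    by simp, ?_⟩
  rw [deriv_ramp]
  exact Real.smoothTransition.contDiff (n := 1)

theorem ramp_of_nonpos {s : ℝ} (hs : s ≤ 0) : ramp s = 0 := by
  rw [ramp, intervalIntegral.integral_symm, neg_eq_zero]
  refine intervalIntegral.integral_zero_ae (Filter.Eventually.of_forall fun r hr => ?_)
  rw [Set.uIoc_of_le hs] at hr
  exact Real.smoothTransition.zero_of_nonpos hr.2

theorem ramp_nonneg (s : ℝ) : 0 ≤ ramp s := by
  rcases le_total s 0 with hs | hs
  · rw [ramp_of_nonpos hs]
  · exact intervalIntegral.integral_nonneg hs fun r _ => Real.smoothTransition.nonneg r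

theorem ramp_le {s : ℝ} (hs : 0 ≤ s) : ramp s ≤ s := by
  calc ramp s ≤ ∫ _ in (0 : ℝ)..s, (1 : ℝ) :=
        intervalIntegral.integral_mono_on hs
          (Real.smoothTransition.continuous.intervalIntegrable _ _)
          (continuous_const.intervalIntegrable _ _) fun r _ => Real.smoothTransition.le_one r
    _ = s := by simp

theorem ramp_pos {s : ℝ} (hs : 0 < s) : 0 < ramp s :=
  intervalIntegral.intervalIntegral_pos_of_pos_on
    (Real.smoothTransition.continuous.intervalIntegrable _ _)
    (fun _ hr => Real.smoothTransition.pos_of_pos hr.1) hs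

section MeanValue

variable {k : ℕ}

/-- A radial averaging kernel supported in the unit ball. -/
def meanKernel (y : EuclideanSpace ℝ (Fin k)) : ℝ := Real.smoothTransition (1 - ‖y‖ ^ 2)

/-- A potential whose gradient is `-meanKernel y • y`. -/
def meanPotential (y : EuclideanSpace ℝ (Fin k)) : ℝ := 1 / 2 * ramp (1 - ‖y‖ ^ 2)

theorem contDiff_meanKernel : ContDiff ℝ ∞ (meanKernel (k := k)) :=
  (Real.smoothTransition.contDiff (n := (⊤ : ℕ∞))).comp (contDiff_const.sub (contDiff_norm_sq ℝ))

theorem meanKernel_nonneg (y : EuclideanSpace ℝ (Fin k)) : 0 ≤ meanKernel y :=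
  Real.smoothTransition.nonneg _

theorem meanKernel_le_one (y : EuclideanSpace ℝ (Fin k)) : meanKernel y ≤ 1 :=
  Real.smoothTransition.le_one _

theorem meanKernel_eq_zero {y : EuclideanSpace ℝ (Fin k)} (hy : 1 ≤ ‖y‖) : meanKernel y = 0 :=
  Real.smoothTransition.zero_of_nonpos (by nlinarith)

theorem meanPotential_nonneg (y : EuclideanSpace ℝ (Fin k)) : 0 ≤ meanPotential y :=
  mul_nonneg (by norm_num) (ramp_nonneg _)

theorem meanPotential_eq_zero {y : EuclideanSpace ℝ (Fin k)} (hy : 1 ≤ ‖y‖) :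
    meanPotential y = 0 := by
  rw [meanPotential, ramp_of_nonpos (by nlinarith), mul_zero]

theorem hasCompactSupport_of_unitBall {f : EuclideanSpace ℝ (Fin k) → ℝ}
    (hf : ∀ y, 1 ≤ ‖y‖ → f y = 0) : HasCompactSupport f :=
  HasCompactSupport.intro (isCompact_closedBall (0 : EuclideanSpace ℝ (Fin k)) 1) fun y hy => by
    refine hf y ?_
    simp only [Metric.mem_closedBall, dist_zero_right, not_le] at hy
    exact hy.le

theorem hasCompactSupport_meanKernel : HasCompactSupport (meanKernel (k := k)) :=
  hasCompactSupport_of_unitBall fun _ => meanKernel_eq_zero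

theorem hasFDerivAt_meanPotential (y : EuclideanSpace ℝ (Fin k)) :
    HasFDerivAt (meanPotential (k := k)) (-meanKernel y • innerSL ℝ y) y := by
  have h1 : HasFDerivAt (fun y : EuclideanSpace ℝ (Fin k) => 1 - ‖y‖ ^ 2) _ y :=
    ((hasFDerivAt_id y).norm_sq).const_sub 1
  have h2 := ((hasDerivAt_ramp (1 - ‖y‖ ^ 2)).comp_hasFDerivAt y h1).const_mul (1 / 2)
  refine h2.congr_fderiv ?_
  ext v
  simp [meanKernel]
  ring

theorem continuous_meanPotential : Continuous (meanPotential (k := k)) :=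
  continuous_iff_continuousAt.2 fun y => (hasFDerivAt_meanPotential y).continuousAt

theorem integral_meanKernel_pos : 0 < ∫ y : EuclideanSpace ℝ (Fin k), meanKernel y := by
  have hc : Continuous (meanKernel (k := k)) := contDiff_meanKernel.continuous
  refine hc.integral_pos_of_hasCompactSupport_nonneg_nonzero hasCompactSupport_meanKernel
    meanKernel_nonneg (x := 0) ?_
  simp [meanKernel]

variable {h : EuclideanSpace ℝ (Fin k) → ℝ}

/-- Differentiating under the integral produces ∇h(x+Ry)·y against the kernel. Since the kernel
times y is minus the gradient of `meanPotential`, an integration by parts leaves R times an average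
of Δh with nonnegative weight. This replaces Green's formula on spheres. -/
theorem hasDerivAt_mean (hh : ContDiff ℝ 2 h) (x : EuclideanSpace ℝ (Fin k)) (R : ℝ) :
    HasDerivAt (fun R : ℝ => ∫ y, h (x + R • y) * meanKernel y)
      (R * ∫ y, Laplacian.laplacian h (x + R • y) * meanPotential y) R := by
  have hηc : Continuous (meanKernel (k := k)) := contDiff_meanKernel.continuous
  have hD : Continuous (fderiv ℝ h) := hh.continuous_fderiv (by norm_num)
  have hmap : Continuous fun p : ℝ × EuclideanSpace ℝ (Fin k) => x + p.1 • p.2 := by fun_prop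
  have hF' : Continuous fun p : ℝ × EuclideanSpace ℝ (Fin k) =>
      fderiv ℝ h (x + p.1 • p.2) p.2 * meanKernel p.2 :=
    ((hD.comp hmap).clm_apply continuous_snd).mul (hηc.comp continuous_snd)
  obtain ⟨C, hC⟩ := ((isCompact_closedBall R 1).prod
    (isCompact_closedBall (0 : EuclideanSpace ℝ (Fin k)) 1)).exists_bound_of_continuousOn
    hF'.continuousOn
  have hint : ∀ (f : EuclideanSpace ℝ (Fin k) → ℝ), Continuous f →
      Integrable (fun y => f y * meanKernel y) := fun f hf =>
    (hf.mul hηc).integrable_of_hasCompactSupport (hasCompactSupport_meanKernel.mul_left)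
  have key := (hasDerivAt_integral_of_dominated_loc_of_deriv_le (μ := volume)
    (F := fun (R : ℝ) y => h (x + R • y) * meanKernel y)
    (F' := fun (R : ℝ) y => fderiv ℝ h (x + R • y) y * meanKernel y) (x₀ := R)
    (s := Metric.ball R 1)
    (bound := Set.indicator (Metric.closedBall (0 : EuclideanSpace ℝ (Fin k)) 1) fun _ => C)
    (Metric.ball_mem_nhds R one_pos)
    (Filter.Eventually.of_forall fun R =>
      ((hh.continuous.comp (by fun_prop)).mul hηc).aestronglyMeasurable)
    (hint _ (hh.continuous.comp (by fun_prop)))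
    (hF'.comp (by fun_prop : Continuous fun y : EuclideanSpace ℝ (Fin k) =>
      (R, y))).aestronglyMeasurable
    (Filter.Eventually.of_forall fun y r hr => ?_)
    ((integrable_indicator_iff measurableSet_closedBall).2
      (integrableOn_const (by exact measure_closedBall_lt_top.ne)))
    (Filter.Eventually.of_forall fun y r hr => ?_)).2
  · refine key.congr_deriv ?_
    have hpd : ∀ a, ContDiff ℝ 1 (pd Set.univ h a) := fun a =>
      contDiff_iff_contDiffAt.2 fun z => contDiffAt_pd hh.contDiffAt (by norm_num) a
    have hpp : ∀ a, Continuous (pd Set.univ (pd Set.univ h a) a) := fun a =>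
      continuous_iff_continuousAt.2 fun z =>
        (contDiffAt_pd (n := 0) (hpd a).contDiffAt (by norm_num) a).continuousAt
    have hcs : ∀ f : EuclideanSpace ℝ (Fin k) → ℝ, Continuous f →
        Integrable (fun y => f y * meanPotential y) := fun f hf =>
      (hf.mul continuous_meanPotential).integrable_of_hasCompactSupport
        ((hasCompactSupport_of_unitBall fun _ => meanPotential_eq_zero).mul_left)
    have hshift : Continuous fun y : EuclideanSpace ℝ (Fin k) => x + R • y := by fun_prop
    -- Integration by parts in direction a; the factor R is the chain rule for y ↦ x + R y. There is
    -- no boundary term, the potential being compactly supported.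
    have hparts : ∀ a : Fin k, ∫ y, pd Set.univ h a (x + R • y) * (y a * meanKernel y) =
        ∫ y, R * pd Set.univ (pd Set.univ h a) a (x + R • y) * meanPotential y := by
      intro a
      have hd : ∀ y, HasFDerivAt (fun y => pd Set.univ h a (x + R • y))
          (R • fderiv ℝ (pd Set.univ h a) (x + R • y)) y := by
        intro y
        have h1 : HasFDerivAt (fun y : EuclideanSpace ℝ (Fin k) => x + R • y)
          (R • ContinuousLinearMap.id ℝ (EuclideanSpace ℝ (Fin k))) y :=
          ((hasFDerivAt_id y).const_smul R).const_add x
        refine (((hpd a).differentiable (by norm_num) _).hasFDerivAt.comp y h1).congr_fderiv ?_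
        ext v; simp
      have hg : ∀ y : EuclideanSpace ℝ (Fin k),
          (-meanKernel y • innerSL ℝ y) (EuclideanSpace.single a (1 : ℝ)) =
            -(y a * meanKernel y) := by
        intro y
        simp [EuclideanSpace.inner_single_right, mul_comm]
      have hR : ∀ y, (R • fderiv ℝ (pd Set.univ h a) (x + R • y))
          (EuclideanSpace.single a (1 : ℝ)) =
            R * pd Set.univ (pd Set.univ h a) a (x + R • y) := by
        intro y
        rw [pd_univ]; simp
      have := integral_bilinear_hasFDerivAt_right_eq_neg_left_of_integrable (μ := volume)
        (B := ContinuousLinearMap.mul ℝ ℝ) (v := EuclideanSpace.single a (1 : ℝ))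
        (f := fun y => pd Set.univ h a (x + R • y)) (g := meanPotential)
        (f' := fun y => R • fderiv ℝ (pd Set.univ h a) (x + R • y))
        (g' := fun y => -meanKernel y • innerSL ℝ y)
        (by
          simp only [hR, ContinuousLinearMap.mul_apply']
          exact hcs _ (continuous_const.mul ((hpp a).comp hshift)))
        (by
          simp only [hg, ContinuousLinearMap.mul_apply']
          have := (hint (fun y => pd Set.univ h a (x + R • y) * y a)
            (((hpd a).continuous.comp hshift).mul (contDiff_coord (n := 0) a).continuous)).neg
          refine this.congr (Filter.Eventually.of_forall fun y => ?_)
          simp only [Pi.neg_apply]; ring)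
        (by
          simp only [ContinuousLinearMap.mul_apply']
          exact hcs _ ((hpd a).continuous.comp hshift))
        (fun y _ => hd y) (fun y _ => hasFDerivAt_meanPotential y)
      simp only [hg, hR, ContinuousLinearMap.mul_apply', mul_neg, integral_neg, neg_inj] at this
      exact this
    have h1 : ∀ y, fderiv ℝ h (x + R • y) y * meanKernel y =
        ∑ a, pd Set.univ h a (x + R • y) * (y a * meanKernel y) := by
      intro y
      rw [fderiv_apply_eq_sum, Finset.sum_mul]
      exact Finset.sum_congr rfl fun a _ => by ring
    have h2 : ∀ y, R * (Laplacian.laplacian h (x + R • y) * meanPotential y) =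
        ∑ a, R * pd Set.univ (pd Set.univ h a) a (x + R • y) * meanPotential y := by
      intro y
      rw [laplacian_eq_sum_pd hh.contDiffAt, Finset.sum_mul, Finset.mul_sum]
      exact Finset.sum_congr rfl fun a _ => by ring
    rw [← integral_const_mul]
    simp only [h1, h2]
    rw [integral_finsetSum, integral_finsetSum]
    · exact Finset.sum_congr rfl fun a _ => hparts a
    · intro a _
      exact hcs _ (continuous_const.mul ((hpp a).comp hshift))
    · intro a _
      simpa only [mul_assoc] using hint (fun y => pd Set.univ h a (x + R • y) * y a)
            (((hpd a).continuous.comp hshift).mul (contDiff_coord (n := 0) a).continuous)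
  · by_cases hy : y ∈ Metric.closedBall (0 : EuclideanSpace ℝ (Fin k)) 1
    · rw [Set.indicator_of_mem hy]
      exact hC (r, y) ⟨Metric.ball_subset_closedBall hr, hy⟩
    · rw [Set.indicator_of_notMem hy]
      simp only [Metric.mem_closedBall, dist_zero_right, not_le] at hy
      simp [meanKernel_eq_zero hy.le]
  · have h1 : HasDerivAt (fun r : ℝ => x + r • y) y r := by
      simpa using ((hasDerivAt_id r).smul_const y).const_add x
    exact ((hh.differentiable (by norm_num) _).hasFDerivAt.comp_hasDerivAt r h1).mul_const _

theorem mean_zero (x : EuclideanSpace ℝ (Fin k)) :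
    ∫ y, h (x + (0 : ℝ) • y) * meanKernel y =
      h x * ∫ y : EuclideanSpace ℝ (Fin k), meanKernel y := by
  simp [integral_const_mul]

/-- Subharmonic functions are bounded by their mean values. -/
theorem le_mean_of_subharmonic (hh : ContDiff ℝ 2 h) (hΔ : ∀ y, 0 ≤ Laplacian.laplacian h y)
    (x : EuclideanSpace ℝ (Fin k)) {R : ℝ} (hR : 0 ≤ R) :
    h x * ∫ y : EuclideanSpace ℝ (Fin k), meanKernel y ≤ ∫ y, h (x + R • y) * meanKernel y := by
  rw [← mean_zero]
  refine (monotoneOn_of_deriv_nonneg (f := fun R : ℝ => ∫ y, h (x + R • y) * meanKernel y)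
    (convex_Icc 0 R) ?_ ?_ ?_) (Set.left_mem_Icc.2 hR) (Set.right_mem_Icc.2 hR) hR
  · exact fun r _ => (hasDerivAt_mean hh x r).continuousAt.continuousWithinAt
  · exact fun r _ => (hasDerivAt_mean hh x r).differentiableAt.differentiableWithinAt
  · intro r hr
    rw [interior_Icc] at hr
    rw [(hasDerivAt_mean hh x r).deriv]
    exact mul_nonneg hr.1.le (integral_nonneg fun y => mul_nonneg (hΔ _) (meanPotential_nonneg y))

/-- The mean value property of harmonic functions. -/
theorem mean_eq_of_harmonic (hh : ContDiff ℝ 2 h) {x : EuclideanSpace ℝ (Fin k)} {R : ℝ}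
    (hR : 0 ≤ R) (hΔ : ∀ y ∈ Metric.ball x R, Laplacian.laplacian h y = 0) :
    ∫ y, h (x + R • y) * meanKernel y = h x * ∫ y : EuclideanSpace ℝ (Fin k), meanKernel y := by
  rw [← mean_zero]
  refine (constant_of_derivWithin_zero (f := fun R : ℝ => ∫ y, h (x + R • y) * meanKernel y)
    (a := 0) (b := R) ?_ ?_) R (Set.right_mem_Icc.2 hR)
  · exact fun r _ => (hasDerivAt_mean hh x r).differentiableAt.differentiableWithinAt
  · intro r hr
    have hu : UniqueDiffWithinAt ℝ (Set.Icc 0 R) r :=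
      uniqueDiffOn_Icc (hr.1.trans_lt hr.2) r (Set.Ico_subset_Icc_self hr)
    rw [(hasDerivAt_mean hh x r).hasDerivWithinAt.derivWithin hu]
    refine mul_eq_zero_of_right _ (integral_eq_zero_of_ae (Filter.Eventually.of_forall fun y => ?_))
    by_cases hy : 1 ≤ ‖y‖
    · simp [meanPotential_eq_zero hy]
    · have : Laplacian.laplacian h (x + r • y) = 0 := by
        refine hΔ _ ?_
        rw [Metric.mem_ball, dist_self_add_left, norm_smul, Real.norm_eq_abs, abs_of_nonneg hr.1]
        nlinarith [hr.1, hr.2, norm_nonneg y]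
      simp [this]

end MeanValue

/-! ### Smoothness of harmonic functions. -/

section Regularity

variable {k : ℕ}

theorem meanKernel_neg (y : EuclideanSpace ℝ (Fin k)) : meanKernel (-y) = meanKernel y := by
  simp [meanKernel]

/-- A change of variables turns the average into a convolution with a smooth compactly supported
kernel, so it is smooth for merely continuous h. -/
theorem contDiff_mean {h : EuclideanSpace ℝ (Fin k) → ℝ} (hh : Continuous h) {r : ℝ} (hr : 0 < r) :
    ContDiff ℝ ∞ fun x => ∫ y, h (x + r • y) * meanKernel y := by
  let κ : EuclideanSpace ℝ (Fin k) → ℝ := fun u => meanKernel (r⁻¹ • u)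
  have hκ : ContDiff ℝ ∞ κ := contDiff_meanKernel.comp (contDiff_const_smul r⁻¹)
  have hκs : HasCompactSupport κ := hasCompactSupport_meanKernel.comp_smul (inv_ne_zero hr.ne')
  have h1 : ContDiff ℝ ∞ (convolution h κ (ContinuousLinearMap.mul ℝ ℝ) volume) :=
    hκs.contDiff_convolution_right (n := (⊤ : ℕ∞)) _ hh.locallyIntegrable hκ
  have h2 : (fun x => ∫ y, h (x + r • y) * meanKernel y) = fun x =>
      |(r ^ Module.finrank ℝ (EuclideanSpace ℝ (Fin k)))⁻¹| •
        (convolution h κ (ContinuousLinearMap.mul ℝ ℝ) volume) x := by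
    ext x
    have h3 := Measure.integral_comp_smul (volume : Measure (EuclideanSpace ℝ (Fin k)))
      (fun z => h (x + z) * κ z) r
    simp only [κ, smul_smul, inv_mul_cancel₀ hr.ne', one_smul] at h3
    rw [h3, convolution_def, ← integral_add_left_eq_self
      (fun t => (ContinuousLinearMap.mul ℝ ℝ) (h t) (κ (x - t))) x]
    congr 1
    refine integral_congr_ae (Filter.Eventually.of_forall fun z => ?_)
    simp only [ContinuousLinearMap.mul_apply', κ]
    rw [show x - (x + z) = -z by abel, smul_neg, meanKernel_neg]
  rw [h2]
  exact h1.const_smul _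

/-- Harmonic functions are smooth. -/
theorem contDiffAt_of_harmonic {Ω : Set (EuclideanSpace ℝ (Fin k))} (hΩ : IsOpen Ω)
    {f : EuclideanSpace ℝ (Fin k) → ℝ} (hf : ContDiffOn ℝ 2 f Ω)
    (hΔ : ∀ y ∈ Ω, Laplacian.laplacian f y = 0) {x : EuclideanSpace ℝ (Fin k)} (hx : x ∈ Ω) :
    ContDiffAt ℝ ∞ f x := by
  obtain ⟨ε, hε, hεΩ⟩ := Metric.isOpen_iff.1 hΩ x hx
  set r := ε / 4 with hr_def
  have hr : 0 < r := by positivity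
  -- The mean value formula is stated for functions that are C² on the whole space, so f is cut off:
  -- unchanged on the ball of radius 2r, supported in that of radius 3r < ε = 4r. Averages of radius
  -- r at points within r of x only see the region where nothing changed.
  let χ : ContDiffBump x := ⟨2 * r, 3 * r, by positivity, by linarith⟩
  let h : EuclideanSpace ℝ (Fin k) → ℝ := fun y => χ y * f y
  have hh : ContDiff ℝ 2 h := by
    refine contDiff_iff_contDiffAt.2 fun z => ?_
    by_cases hz : z ∈ tsupport χ
    · have hzΩ : z ∈ Ω := by
        refine hεΩ ?_
        rw [χ.tsupport_eq, Metric.mem_closedBall] at hz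
        rw [Metric.mem_ball]
        change dist z x ≤ 3 * r at hz
        linarith
      exact χ.contDiff.contDiffAt.mul (hf.contDiffAt (hΩ.mem_nhds hzΩ))
    · refine (contDiffAt_const (c := (0 : ℝ))).congr_of_eventuallyEq ?_
      filter_upwards [notMem_tsupport_iff_eventuallyEq.1 hz] with y hy
      simp [h, hy]
  have heq : ∀ y ∈ Metric.ball x (2 * r), h =ᶠ[𝓝 y] f := by
    intro y hy
    filter_upwards [Metric.isOpen_ball.mem_nhds hy] with z hz
    simp only [h]
    rw [χ.one_of_mem_closedBall (Metric.ball_subset_closedBall hz), one_mul]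
  have hΔh : ∀ y ∈ Metric.ball x (2 * r), Laplacian.laplacian h y = 0 := by
    intro y hy
    rw [(InnerProductSpace.laplacian_congr_nhds (heq y hy)).self_of_nhds]
    refine hΔ y (hεΩ (Metric.ball_subset_ball (by linarith) hy))
  have hc := integral_meanKernel_pos (k := k)
  refine ((contDiff_mean hh.continuous hr).contDiffAt.div_const
    (∫ y : EuclideanSpace ℝ (Fin k), meanKernel y)).congr_of_eventuallyEq ?_
  filter_upwards [Metric.ball_mem_nhds x hr] with x' hx'
  rw [mean_eq_of_harmonic hh hr.le fun y hy => hΔh y ?_, mul_div_assoc, div_self hc.ne', mul_one]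
  · exact (heq x' (Metric.ball_subset_ball (by linarith) hx')).self_of_nhds.symm
  · rw [Metric.mem_ball] at *
    linarith [dist_triangle y x' x]

end Regularity

/-! ### A Liouville theorem in the half-space. -/

section Liouville

variable {m : ℕ} {f : EuclideanSpace ℝ (Fin (m + 1)) → ℝ}

theorem isOpen_openHalfSpace : IsOpen (openHalfSpace m) :=
  isOpen_lt continuous_const (contDiff_coord (n := 0) 0).continuous

theorem openHalfSpace_subset : openHalfSpace m ⊆ halfSpace m :=
  fun y hy => le_of_lt (show 0 < y 0 from hy)

/-- The positive part of a function in the half-space, smoothly truncated at height `δ`. -/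
def truncation (f : EuclideanSpace ℝ (Fin (m + 1)) → ℝ) (δ : ℝ) :
    EuclideanSpace ℝ (Fin (m + 1)) → ℝ :=
  (openHalfSpace m).indicator fun y => ramp (f y - δ)

theorem truncation_eventuallyEq {δ : ℝ} {y : EuclideanSpace ℝ (Fin (m + 1))}
    (hy : y ∈ openHalfSpace m) : truncation f δ =ᶠ[𝓝 y] fun y => ramp (f y - δ) := by
  filter_upwards [isOpen_openHalfSpace.mem_nhds hy] with z hz
  exact Set.indicator_of_mem hz _

/-- By continuity f < δ near each boundary point, so cutting at a positive height leaves a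
neighbourhood of the boundary on which the truncation is zero. The extension by zero is thus as
smooth as in the interior. -/
theorem truncation_eventuallyEq_zero {δ : ℝ} (hδ : 0 < δ) (hc : ContinuousOn f (halfSpace m))
    (hb : ∀ y : EuclideanSpace ℝ (Fin (m + 1)), y 0 = 0 → f y = 0)
    {y : EuclideanSpace ℝ (Fin (m + 1))} (hy : y ∉ openHalfSpace m) :
    truncation f δ =ᶠ[𝓝 y] fun _ => 0 := by
  have hcoord : Continuous fun z : EuclideanSpace ℝ (Fin (m + 1)) => z 0 :=
    (contDiff_coord (n := 0) 0).continuous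
  rcases lt_or_eq_of_le (not_lt.1 (show ¬0 < y 0 from hy)) with h | h
  · filter_upwards [(isOpen_lt hcoord continuous_const).mem_nhds h] with z hz
    have hz' : z ∉ openHalfSpace m := not_lt.2 (show z 0 ≤ 0 from le_of_lt hz)
    exact Set.indicator_of_notMem hz' _
  · have hyH : y ∈ halfSpace m := h.ge
    have := (hc y hyH).eventually (Iio_mem_nhds (by rw [hb y h]; exact hδ))
    filter_upwards [eventually_nhdsWithin_iff.1 this] with z hz
    by_cases hzo : z ∈ openHalfSpace m
    · rw [truncation, Set.indicator_of_mem hzo]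
      exact ramp_of_nonpos (by have h1 : f z < δ := hz (openHalfSpace_subset hzo); linarith)
    · exact Set.indicator_of_notMem hzo _

theorem contDiff_ramp_sub (δ : ℝ) : ContDiff ℝ 2 fun s => ramp (s - δ) :=
  contDiff_ramp.comp (contDiff_id.sub contDiff_const)

theorem deriv_ramp_sub (δ : ℝ) : deriv (fun s => ramp (s - δ)) =
    fun s => Real.smoothTransition (s - δ) := by
  ext s
  rw [deriv_comp_sub_const, deriv_ramp]

theorem contDiff_truncation {δ : ℝ} (hδ : 0 < δ) (hc : ContinuousOn f (halfSpace m))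
    (hb : ∀ y : EuclideanSpace ℝ (Fin (m + 1)), y 0 = 0 → f y = 0)
    (hf : ContDiffOn ℝ 2 f (openHalfSpace m)) : ContDiff ℝ 2 (truncation f δ) := by
  refine contDiff_iff_contDiffAt.2 fun y => ?_
  by_cases hy : y ∈ openHalfSpace m
  · exact ((contDiff_ramp_sub δ).contDiffAt.comp y
      (hf.contDiffAt (isOpen_openHalfSpace.mem_nhds hy))).congr_of_eventuallyEq
        (truncation_eventuallyEq hy)
  · exact contDiffAt_const.congr_of_eventuallyEq (truncation_eventuallyEq_zero hδ hc hb hy)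

/-- Composing a harmonic function with G gives ΔG(f) = G''(f)|∇f|², and G'' ≥ 0 for the shifted
ramp. -/
theorem laplacian_truncation_nonneg {δ : ℝ} (hδ : 0 < δ) (hc : ContinuousOn f (halfSpace m))
    (hb : ∀ y : EuclideanSpace ℝ (Fin (m + 1)), y 0 = 0 → f y = 0)
    (hf : ContDiffOn ℝ 2 f (openHalfSpace m))
    (hΔ : ∀ y ∈ openHalfSpace m, Laplacian.laplacian f y = 0)
    (y : EuclideanSpace ℝ (Fin (m + 1))) : 0 ≤ Laplacian.laplacian (truncation f δ) y := by
  by_cases hy : y ∈ openHalfSpace m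
  · rw [(InnerProductSpace.laplacian_congr_nhds (truncation_eventuallyEq hy)).self_of_nhds,
      laplacian_comp (contDiff_ramp_sub δ) (hf.contDiffAt (isOpen_openHalfSpace.mem_nhds hy)),
      hΔ y hy, mul_zero, add_zero]
    refine mul_nonneg ?_ (Finset.sum_nonneg fun a _ => sq_nonneg _)
    rw [deriv_ramp_sub]
    have hm : Monotone fun s : ℝ => Real.smoothTransition (s - δ) :=
      fun a b hab => Real.smoothTransition.monotone (sub_le_sub_right hab δ)
    exact hm.deriv_nonneg
  · rw [(InnerProductSpace.laplacian_congr_nhds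
      (truncation_eventuallyEq_zero hδ hc hb hy)).self_of_nhds, laplacian_fun_const]

theorem truncation_nonneg (δ : ℝ) (y : EuclideanSpace ℝ (Fin (m + 1))) : 0 ≤ truncation f δ y :=
  Set.indicator_nonneg (fun _ _ => ramp_nonneg _) y

/-- Trades linear for quadratic growth, so that a bound on f² controls the truncation linearly. -/
theorem ramp_sub_le {s δ : ℝ} (hδ : 0 < δ) : ramp (s - δ) ≤ s ^ 2 / δ := by
  rcases le_total s δ with h | h
  · rw [ramp_of_nonpos (by linarith)]; positivity
  · refine (ramp_le (by linarith)).trans ?_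
    rw [le_div_iff₀ hδ]
    nlinarith

/-- If f(x) > δ, the truncation h is positive at x. But h is subharmonic on the whole space and at
most (1+|y|)⁴ W(y)/δ, so its averages at scale R are of order R⁴ R^(-(m+1)) ∫ W and tend to zero: a
contradiction. -/
theorem le_of_harmonic {W : EuclideanSpace ℝ (Fin (m + 1)) → ℝ} (hm : 4 ≤ m)
    (hc : ContinuousOn f (halfSpace m))
    (hb : ∀ y : EuclideanSpace ℝ (Fin (m + 1)), y 0 = 0 → f y = 0)
    (hf : ContDiffOn ℝ 2 f (openHalfSpace m))
    (hΔ : ∀ y ∈ openHalfSpace m, Laplacian.laplacian f y = 0)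
    (hW : IntegrableOn W (openHalfSpace m)) (hW0 : ∀ y, 0 ≤ W y)
    (hfW : ∀ y ∈ openHalfSpace m, f y ^ 2 ≤ (1 + ‖y‖) ^ 4 * W y) {δ : ℝ} (hδ : 0 < δ)
    {x : EuclideanSpace ℝ (Fin (m + 1))} (hx : x ∈ openHalfSpace m) : f x ≤ δ := by
  set h := truncation f δ with hh
  set c := ∫ y : EuclideanSpace ℝ (Fin (m + 1)), meanKernel y with hc_def
  have hcpos : 0 < c := integral_meanKernel_pos
  set W' := (openHalfSpace m).indicator W with hW'
  have hW'i : Integrable W' := (integrable_indicator_iff isOpen_openHalfSpace.measurableSet).2 hW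
  have hW'0 : ∀ y, 0 ≤ W' y := fun y => Set.indicator_nonneg (fun _ _ => hW0 _) y
  have hhW : ∀ y, h y ≤ (1 + ‖y‖) ^ 4 / δ * W' y := by
    intro y
    by_cases hy : y ∈ openHalfSpace m
    · rw [hh, truncation, hW', Set.indicator_of_mem hy, Set.indicator_of_mem hy, div_mul_eq_mul_div]
      refine (ramp_sub_le hδ).trans ?_
      gcongr
      exact hfW y hy
    · rw [hh, truncation, Set.indicator_of_notMem hy]
      exact mul_nonneg (by positivity) (hW'0 y)
  have hC2 := contDiff_truncation hδ hc hb hf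
  have key : ∀ R : ℝ, 1 + ‖x‖ ≤ R → h x * c ≤ (16 / δ * ∫ y, W' y) * R⁻¹ := by
    intro R hR
    have hR1 : 1 ≤ R := le_trans (by linarith [norm_nonneg x]) hR
    have hR0 : 0 < R := by linarith
    have hWR : Integrable fun y => W' (x + R • y) :=
      (hW'i.comp_add_left x).comp_smul hR0.ne'
    -- The Jacobian of the scaling in dimension m + 1 provides the decay.
    have hcomp : ∫ y, W' (x + R • y) = (R ^ (m + 1))⁻¹ * ∫ y, W' y := by
      rw [Measure.integral_comp_smul volume (fun z => W' (x + z)) R, integral_add_left_eq_self W' x,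
        finrank_euclideanSpace_fin, abs_of_pos (by positivity), smul_eq_mul]
    calc h x * c ≤ ∫ y, h (x + R • y) * meanKernel y :=
          le_mean_of_subharmonic hC2 (laplacian_truncation_nonneg hδ hc hb hf hΔ) x hR0.le
      _ ≤ ∫ y, (2 * R) ^ 4 / δ * W' (x + R • y) := by
          refine integral_mono_of_nonneg (Filter.Eventually.of_forall fun y =>
            mul_nonneg (truncation_nonneg _ _) (meanKernel_nonneg _)) (hWR.const_mul _)
            (Filter.Eventually.of_forall fun y => ?_)
          simp only
          by_cases hy : 1 ≤ ‖y‖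
          · rw [meanKernel_eq_zero hy, mul_zero]
            exact mul_nonneg (by positivity) (hW'0 _)
          · have h1 : 1 + ‖x + R • y‖ ≤ 2 * R := by
              have := norm_add_le x (R • y)
              rw [norm_smul, Real.norm_eq_abs, abs_of_pos hR0] at this
              nlinarith [norm_nonneg y]
            calc h (x + R • y) * meanKernel y ≤ h (x + R • y) * 1 :=
                  mul_le_mul_of_nonneg_left (meanKernel_le_one y) (truncation_nonneg _ _)
              _ ≤ (1 + ‖x + R • y‖) ^ 4 / δ * W' (x + R • y) := by
                  rw [mul_one]; exact hhW _
              _ ≤ _ := by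
                  gcongr
                  exact hW'0 _
      _ = (16 / δ * ∫ y, W' y) * (R ^ 4 * (R ^ (m + 1))⁻¹) := by
          rw [integral_const_mul, hcomp]; ring
      _ ≤ (16 / δ * ∫ y, W' y) * R⁻¹ := by
          have hI : 0 ≤ ∫ y, W' y := integral_nonneg hW'0
          gcongr
          -- Here the dimension must be at least five: quadratic growth squared costs R⁴, while the
          -- volume gains R^(m+1).
          rw [← div_eq_mul_inv, div_le_iff₀ (by positivity)]
          calc R ^ 4 ≤ R ^ m := pow_le_pow_right₀ hR1 hm
            _ = R⁻¹ * R ^ (m + 1) := by rw [pow_succ]; field_simp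
  have hlim : h x * c ≤ 0 := by
    have ht : Filter.Tendsto (fun R : ℝ => (16 / δ * ∫ y, W' y) * R⁻¹) Filter.atTop (𝓝 0) := by
      simpa using tendsto_inv_atTop_zero.const_mul (16 / δ * ∫ y, W' y)
    exact ge_of_tendsto ht (Filter.eventually_atTop.2 ⟨1 + ‖x‖, key⟩)
  by_contra! hcon
  have : 0 < h x := by
    rw [hh, truncation, Set.indicator_of_mem hx]
    exact ramp_pos (by linarith)
  exact absurd hlim (not_le.2 (mul_pos this hcpos))

/-- A Liouville theorem: a harmonic function in a half-space of dimension at least five, vanishing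
on the boundary, is zero if it is square integrable up to a weight of quadratic growth. -/
theorem eq_zero_of_harmonic {W : EuclideanSpace ℝ (Fin (m + 1)) → ℝ} (hm : 4 ≤ m)
    (hc : ContinuousOn f (halfSpace m))
    (hb : ∀ y : EuclideanSpace ℝ (Fin (m + 1)), y 0 = 0 → f y = 0)
    (hf : ContDiffOn ℝ 2 f (openHalfSpace m))
    (hΔ : ∀ y ∈ openHalfSpace m, Laplacian.laplacian f y = 0)
    (hW : IntegrableOn W (openHalfSpace m)) (hW0 : ∀ y, 0 ≤ W y)
    (hfW : ∀ y ∈ openHalfSpace m, f y ^ 2 ≤ (1 + ‖y‖) ^ 4 * W y)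
    {x : EuclideanSpace ℝ (Fin (m + 1))} (hx : x ∈ openHalfSpace m) : f x = 0 := by
  refine le_antisymm (le_of_forall_pos_le_add fun δ hδ => ?_)
    (neg_nonpos.1 (le_of_forall_pos_le_add fun δ hδ => ?_))
  · rw [zero_add]
    exact le_of_harmonic hm hc hb hf hΔ hW hW0 hfW hδ hx
  · rw [zero_add]
    refine le_of_harmonic (f := -f) hm hc.neg (fun y hy => by simp [hb y hy]) hf.neg
      (fun y hy => ?_) hW hW0 (fun y hy => by simpa using hfW y hy) hδ hx
    rw [InnerProductSpace.laplacian_neg, Pi.neg_apply, hΔ y hy, neg_zero]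

end Liouville

/-! ### The bubble -/

section Bubble

variable {m : ℕ}

/-- The inward normal vector of the half-space. -/
abbrev normalVec (m : ℕ) : EuclideanSpace ℝ (Fin (m + 1)) := EuclideanSpace.single 0 1

/-- The squared distance to the point `-normalVec`. -/
def rho (y : EuclideanSpace ℝ (Fin (m + 1))) : ℝ := (1 + y 0) ^ 2 + ∑ i : Fin m, y i.succ ^ 2

theorem norm_sq_eq_sum {k : ℕ} (y : EuclideanSpace ℝ (Fin k)) : ‖y‖ ^ 2 = ∑ c, y c * y c := by
  rw [EuclideanSpace.norm_sq_eq]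
  exact Finset.sum_congr rfl fun c _ => by rw [Real.norm_eq_abs, sq_abs, sq]

theorem rho_eq_norm_sq (y : EuclideanSpace ℝ (Fin (m + 1))) : rho y = ‖y + normalVec m‖ ^ 2 := by
  rw [norm_sq_eq_sum, Fin.sum_univ_succ, rho]
  simp [sq, add_comm]

theorem rho_eq (y : EuclideanSpace ℝ (Fin (m + 1))) : rho y = ‖y‖ ^ 2 + 2 * y 0 + 1 := by
  rw [norm_sq_eq_sum, Fin.sum_univ_succ, rho]
  simp only [sq]; ring

theorem rho_nonneg (y : EuclideanSpace ℝ (Fin (m + 1))) : 0 ≤ rho y := by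
  rw [rho_eq_norm_sq]; positivity

theorem one_le_rho {y : EuclideanSpace ℝ (Fin (m + 1))} (hy : y ∈ halfSpace m) : 1 ≤ rho y := by
  have h : 0 ≤ y 0 := hy
  have : 0 ≤ ∑ i : Fin m, y i.succ ^ 2 := Finset.sum_nonneg fun i _ => sq_nonneg _
  unfold rho
  nlinarith

theorem rho_pos {y : EuclideanSpace ℝ (Fin (m + 1))} (hy : y ∈ halfSpace m) : 0 < rho y :=
  zero_lt_one.trans_le (one_le_rho hy)

theorem contDiff_rho {n : WithTop ℕ∞} : ContDiff ℝ n (rho (m := m)) := by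
  have : rho (m := m) = fun y => ‖y + normalVec m‖ ^ 2 := by ext y; exact rho_eq_norm_sq y
  rw [this]
  exact (contDiff_id.add contDiff_const).norm_sq ℝ

theorem continuous_rho : Continuous (rho (m := m)) := (contDiff_rho (n := 0)).continuous

theorem pd_rho (a : Fin (m + 1)) (y : EuclideanSpace ℝ (Fin (m + 1))) :
    pd Set.univ rho a y = 2 * (y + normalVec m) a := by
  have h : HasFDerivAt (rho (m := m)) (2 • (innerSL ℝ (y + normalVec m))) y := by
    have : rho (m := m) = fun y => ‖y + normalVec m‖ ^ 2 := by ext y; exact rho_eq_norm_sq y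
    rw [this]
    refine (((hasFDerivAt_id y).add_const (normalVec m)).norm_sq).congr_fderiv ?_
    ext; simp
  rw [pd_eq_of_hasFDerivAt h]
  simp [EuclideanSpace.inner_single_right]
  split_ifs <;> ring

theorem pd_rho_rpow (p : ℝ) {y : EuclideanSpace ℝ (Fin (m + 1))} (hy : 0 < rho y)
    (a : Fin (m + 1)) :
    pd Set.univ (fun y => rho y ^ p) a y = 2 * p * (y + normalVec m) a * rho y ^ (p - 1) := by
  have h := ((contDiff_rho (n := 1)).differentiable (by norm_num) y).hasFDerivAt.rpow_const
    (p := p) (Or.inl hy.ne')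
  rw [pd_eq_of_hasFDerivAt h]
  have := pd_rho a y
  rw [pd_univ] at this
  simp only [smul_apply, smul_eq_mul, this]
  ring

theorem bubble_eq : bubble (m := m) = fun y => rho y ^ (-(((m : ℝ) - 1) / 2)) := rfl

theorem pd_bubble {y : EuclideanSpace ℝ (Fin (m + 1))} (hy : 0 < rho y) (a : Fin (m + 1)) :
    pd Set.univ bubble a y =
      -((m : ℝ) - 1) * (y + normalVec m) a * rho y ^ (-(((m : ℝ) + 1) / 2)) := by
  rw [bubble_eq, pd_rho_rpow _ hy,
    show -(((m : ℝ) - 1) / 2) - 1 = -(((m : ℝ) + 1) / 2) by ring]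
  ring

theorem eventually_rho_pos {y : EuclideanSpace ℝ (Fin (m + 1))} (hy : 0 < rho y) :
    ∀ᶠ x in 𝓝 y, 0 < rho x := continuous_rho.continuousAt.eventually (Ioi_mem_nhds hy)

theorem contDiffAt_rho_rpow {n : WithTop ℕ∞} (p : ℝ) {y : EuclideanSpace ℝ (Fin (m + 1))}
    (hy : 0 < rho y) : ContDiffAt ℝ n (fun y => rho y ^ p) y :=
  contDiff_rho.contDiffAt.rpow_const_of_ne hy.ne'

theorem pd_pd_bubble {y : EuclideanSpace ℝ (Fin (m + 1))} (hy : 0 < rho y) (i j : Fin m) :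
    pd Set.univ (pd Set.univ bubble j.succ) i.succ y =
      ((m : ℝ) - 1) * ((m + 1) * (y i.succ * y j.succ) * rho y ^ (-(((m : ℝ) + 3) / 2)) -
        (if i = j then 1 else 0) * rho y ^ (-(((m : ℝ) + 1) / 2))) := by
  have h : pd Set.univ (bubble (m := m)) j.succ =ᶠ[𝓝 y] fun y =>
      y j.succ * (-((m : ℝ) - 1) * rho y ^ (-(((m : ℝ) + 1) / 2))) := by
    filter_upwards [eventually_rho_pos hy] with x hx
    rw [pd_bubble hx]
    simp
    ring
  have h1 : DifferentiableAt ℝ (fun y : EuclideanSpace ℝ (Fin (m + 1)) =>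
      rho y ^ (-(((m : ℝ) + 1) / 2))) y :=
    (contDiffAt_rho_rpow (n := 1) _ hy).differentiableAt (by norm_num)
  have h2 : DifferentiableAt ℝ (fun y : EuclideanSpace ℝ (Fin (m + 1)) => y j.succ) y :=
    (contDiff_coord (n := 1) _).differentiable (by norm_num) y
  have h3 : DifferentiableAt ℝ (fun _ : EuclideanSpace ℝ (Fin (m + 1)) => -((m : ℝ) - 1)) y :=
    differentiableAt_const _
  rw [pd_univ_congr h, pd_univ_mul h2 (h3.fun_mul h1), pd_univ_mul h3 h1, pd_const, pd_coord,
    pd_rho_rpow _ hy, show -(((m : ℝ) + 1) / 2) - 1 = -(((m : ℝ) + 3) / 2) by ring]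
  simp only [PiLp.add_apply, Fin.succ_inj]
  by_cases hij : i = j
  · simp [hij]; ring
  · simp [hij]; ring

theorem bubble_bdry (hm : 2 ≤ m) (y : EuclideanSpace ℝ (Fin (m + 1))) :
    bubble y ^ (2 / ((m : ℝ) - 1)) = (rho y)⁻¹ := by
  have hm' : (2 : ℝ) ≤ m := by exact_mod_cast hm
  have h0 : (m : ℝ) - 1 ≠ 0 := by linarith
  rw [bubble_eq, ← Real.rpow_mul (rho_nonneg y), ← Real.rpow_neg_one]
  congr 1
  field_simp

theorem kernelFn_succ {y : EuclideanSpace ℝ (Fin (m + 1))} (hy : 0 < rho y) (i : Fin m) :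
    kernelFn i.succ y = -((m : ℝ) - 1) * y i.succ * rho y ^ (-(((m : ℝ) + 1) / 2)) := by
  rw [kernelFn, Fin.cases_succ, pd_bubble hy]
  simp

theorem rho_rpow_mul {y : EuclideanSpace ℝ (Fin (m + 1))} (hy : 0 < rho y) :
    rho y ^ (-(((m : ℝ) - 1) / 2)) = rho y * rho y ^ (-(((m : ℝ) + 1) / 2)) := by
  rw [show -(((m : ℝ) - 1) / 2) = -(((m : ℝ) + 1) / 2) + 1 by ring, Real.rpow_add_one hy.ne',
    mul_comm]

theorem kernelFn_zero {y : EuclideanSpace ℝ (Fin (m + 1))} (hy : 0 < rho y) :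
    kernelFn 0 y = ((m : ℝ) - 1) / 2 * (1 - ‖y‖ ^ 2) * rho y ^ (-(((m : ℝ) + 1) / 2)) := by
  have h : ∑ a, y a * pd Set.univ bubble a y =
      -((m : ℝ) - 1) * (‖y‖ ^ 2 + y 0) * rho y ^ (-(((m : ℝ) + 1) / 2)) := by
    have h1 : ‖y‖ ^ 2 + y 0 = ∑ a, y a * (y + normalVec m) a := by
      rw [norm_sq_eq_sum]
      simp [mul_add, Finset.sum_add_distrib]
    rw [h1, Finset.mul_sum, Finset.sum_mul]
    refine Finset.sum_congr rfl fun a _ => ?_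
    rw [pd_bubble hy]; ring
  rw [kernelFn, Fin.cases_zero, h, bubble_eq]
  simp only
  rw [rho_rpow_mul hy, rho_eq]
  ring

end Bubble

/-! ### Reduction of the right-hand side to a trace-free quadratic form. -/

section Geometry

variable {m : ℕ} {M : Type*} [TopologicalSpace M]
    [ChartedSpace (EuclideanHalfSpace (m + 1)) M] [IsManifold (𝓡∂ (m + 1)) ∞ M]
    {g : Bundle.ContMDiffRiemannianMetric (𝓡∂ (m + 1)) ∞ (EuclideanSpace ℝ (Fin (m + 1)))
      (fun x : M => TangentSpace (𝓡∂ (m + 1)) x)} {Λ : M → M → ℝ}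

/-- The second tangential derivatives of U consist of a y_i y_j part and a δ_ij part, so four
contractions appear. Three vanish: R̄ against y_i y_k y_j y_l by antisymmetry, R̄ against δ_ij
because it is a Ricci contraction, and A against δ_ij because it is a trace. -/
theorem correctorRhs_eq {Rbar : Fin m → Fin m → Fin m → Fin m → ℝ} {A : Fin m → Fin m → ℝ}
    (hR : ∀ i j k l, Rbar j i k l = -Rbar i j k l) (hRic : ∀ k l, ∑ i, Rbar i k i l = 0)
    (hA : ∑ i, A i i = 0) {y : EuclideanSpace ℝ (Fin (m + 1))} (hy : 0 < rho y) :
    correctorRhs Rbar A y = ((m : ℝ) - 1) * (m + 1) * y 0 ^ 2 * rho y ^ (-(((m : ℝ) + 3) / 2)) *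
      ∑ i, ∑ j, A i j * (y i.succ * y j.succ) := by
  set P := rho y ^ (-(((m : ℝ) + 3) / 2))
  set Q := rho y ^ (-(((m : ℝ) + 1) / 2))
  -- Exchanging the names of i and k shows that the sum equals its own negative.
  have h1 : ∑ i, ∑ j, (∑ k, ∑ l, Rbar i k j l * y k.succ * y l.succ) * (y i.succ * y j.succ) = 0 := by
    have : ∑ i, ∑ j, (∑ k, ∑ l, Rbar i k j l * y k.succ * y l.succ) * (y i.succ * y j.succ) =
        -∑ i, ∑ j, (∑ k, ∑ l, Rbar i k j l * y k.succ * y l.succ) * (y i.succ * y j.succ) := by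
      simp only [Finset.sum_mul]
      conv_lhs =>
        enter [2, i]
        rw [Finset.sum_comm]
      rw [Finset.sum_comm, ← Finset.sum_neg_distrib]
      refine Finset.sum_congr rfl fun k _ => ?_
      rw [← Finset.sum_neg_distrib]
      conv_rhs =>
        enter [2, j]
        rw [← Finset.sum_neg_distrib]
      rw [Finset.sum_comm]
      refine Finset.sum_congr rfl fun j _ => Finset.sum_congr rfl fun i _ => ?_
      rw [← Finset.sum_neg_distrib]
      refine Finset.sum_congr rfl fun l _ => ?_
      rw [hR k i j l]; ring
    linarith
  have h2 : ∑ i, ∑ j, (∑ k, ∑ l, Rbar i k j l * y k.succ * y l.succ) *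
      (if i = j then (1 : ℝ) else 0) = 0 := by
    simp only [mul_ite, mul_one, mul_zero, Finset.sum_ite_eq, Finset.mem_univ, if_true]
    rw [Finset.sum_comm]
    refine Finset.sum_eq_zero fun k _ => ?_
    rw [Finset.sum_comm]
    refine Finset.sum_eq_zero fun l _ => ?_
    simp only [← Finset.sum_mul, hRic, zero_mul]
  have h3 : ∑ i, ∑ j, A i j * (if i = j then (1 : ℝ) else 0) = 0 := by simpa using hA
  have h4 : correctorRhs Rbar A y =
      (1 / 3) * ((m : ℝ) - 1) * (m + 1) * P * (∑ i, ∑ j, (∑ k, ∑ l,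
        Rbar i k j l * y k.succ * y l.succ) * (y i.succ * y j.succ)) -
      (1 / 3) * ((m : ℝ) - 1) * Q * (∑ i, ∑ j, (∑ k, ∑ l, Rbar i k j l * y k.succ * y l.succ) *
        (if i = j then (1 : ℝ) else 0)) +
      ((m : ℝ) - 1) * (m + 1) * y 0 ^ 2 * P * (∑ i, ∑ j, A i j * (y i.succ * y j.succ)) -
      ((m : ℝ) - 1) * y 0 ^ 2 * Q * (∑ i, ∑ j, A i j * (if i = j then (1 : ℝ) else 0)) := by
    simp only [correctorRhs, pd_pd_bubble hy]
    rw [Finset.mul_sum, Finset.mul_sum, Finset.mul_sum, Finset.mul_sum, ← Finset.sum_sub_distrib,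
      ← Finset.sum_add_distrib, ← Finset.sum_sub_distrib]
    refine Finset.sum_congr rfl fun i _ => ?_
    rw [Finset.mul_sum, Finset.mul_sum, Finset.mul_sum, Finset.mul_sum, ← Finset.sum_sub_distrib,
      ← Finset.sum_add_distrib, ← Finset.sum_sub_distrib]
    refine Finset.sum_congr rfl fun j _ => ?_
    ring
  rw [h4, h1, h2, h3]
  ring

theorem IsNormalizedConformalFamily.geomRhs_eq (hm : 3 ≤ m)
    (hΛ : IsNormalizedConformalFamily g.inner Λ) {q : M} (hq : q ∈ (𝓡∂ (m + 1)).boundary M)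
    {e : Fin (m + 1) → TangentSpace (𝓡∂ (m + 1)) q} (he : IsAdaptedFrame g.inner q e)
    {y : EuclideanSpace ℝ (Fin (m + 1))} (hy : 0 < rho y) :
    geomRhs g.inner Λ q e y = ((m : ℝ) - 1) * (m + 1) * y 0 ^ 2 *
      rho y ^ (-(((m : ℝ) + 3) / 2)) *
      ∑ i, ∑ j, normalizedCurv g.inner q e i j * (y i.succ * y j.succ) := by
  have he' := (isAdaptedFrame_conformal_iff (B := g.inner) (hΛ.one q hq) e).2 he
  rw [geomRhs, correctorRhs_eq (fun i j k l => hΛ.bdCurv_conformal_swap hq he i j k l)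
    (fun k l => hΛ.bdRicci q hq e he' k l) (hΛ.sum_curv_conformal hq he) hy]
  simp only [hΛ.curv_eq_normalizedCurv hq he hm]

theorem IsNormalizedConformalFamily.sum_normalizedCurv (hm : 3 ≤ m)
    (hΛ : IsNormalizedConformalFamily g.inner Λ) {q : M} (hq : q ∈ (𝓡∂ (m + 1)).boundary M)
    {e : Fin (m + 1) → TangentSpace (𝓡∂ (m + 1)) q} (he : IsAdaptedFrame g.inner q e) :
    ∑ i, normalizedCurv g.inner q e i i = 0 := by
  rw [← hΛ.sum_curv_conformal hq he]
  exact Finset.sum_congr rfl fun i _ => (hΛ.curv_eq_normalizedCurv hq he hm i i).symm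

end Geometry

/-! ### Uniqueness -/

section Uniqueness

variable {m : ℕ} {w : EuclideanSpace ℝ (Fin (m + 1)) → ℝ}

/-- The conformal vector field fixing the center of the half-space. -/
def conformalField (y : EuclideanSpace ℝ (Fin (m + 1))) : EuclideanSpace ℝ (Fin (m + 1)) :=
  (2 * y 0) • y - (‖y‖ ^ 2 + 1) • normalVec m

/-- The derivative of `w` along the conformal vector field, suitably weighted: it is harmonic if `w`
is, and vanishes on the boundary if `w` satisfies the homogeneous boundary condition. -/
def conformalDeriv (w : EuclideanSpace ℝ (Fin (m + 1)) → ℝ)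
    (y : EuclideanSpace ℝ (Fin (m + 1))) : ℝ :=
  fderivWithin ℝ w (halfSpace m) y (conformalField y) + (((m : ℝ) - 1) * y 0 - (m + 1)) * w y

theorem halfSpace_mem_nhds {y : EuclideanSpace ℝ (Fin (m + 1))} (hy : y ∈ openHalfSpace m) :
    halfSpace m ∈ 𝓝 y :=
  Filter.mem_of_superset (isOpen_openHalfSpace.mem_nhds hy) openHalfSpace_subset

theorem conformalDeriv_of_mem {y : EuclideanSpace ℝ (Fin (m + 1))} (hy : y ∈ openHalfSpace m) :
    conformalDeriv w y =
      fderiv ℝ w y (conformalField y) + (((m : ℝ) - 1) * y 0 - (m + 1)) * w y := by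
  rw [conformalDeriv, fderivWithin_of_mem_nhds (halfSpace_mem_nhds hy)]

theorem continuous_conformalField : Continuous (conformalField (m := m)) := by
  unfold conformalField
  have := (contDiff_coord (k := m + 1) (n := 0) 0).continuous
  fun_prop

theorem continuousOn_conformalDeriv (hw : ContDiffOn ℝ 1 w (halfSpace m)) :
    ContinuousOn (conformalDeriv w) (halfSpace m) := by
  have h1 := hw.continuousOn_fderivWithin uniqueDiffOn_halfSpace le_rfl
  have h2 := (contDiff_coord (k := m + 1) (n := 0) 0).continuous
  exact (h1.clm_apply continuous_conformalField.continuousOn).add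
    (((continuous_const.mul h2).sub continuous_const).continuousOn.mul hw.continuousOn)

/-- On the boundary the field is -(|z|²+1) e with |z|²+1 = ρ, so the Robin condition makes the
derivative term equal to (m+1) w, exactly compensated by the zeroth-order term. -/
theorem conformalDeriv_boundary {y : EuclideanSpace ℝ (Fin (m + 1))} (hy : y 0 = 0)
    (hbc : pd (halfSpace m) w 0 y = -((m : ℝ) + 1) * (rho y)⁻¹ * w y) :
    conformalDeriv w y = 0 := by
  have hr : rho y = ‖y‖ ^ 2 + 1 := by rw [rho_eq, hy]; ring
  have hne : ‖y‖ ^ 2 + 1 ≠ 0 := by positivity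
  rw [pd, hr] at hbc
  rw [conformalDeriv, conformalField, hy]
  simp only [mul_zero, zero_smul, zero_sub, map_neg, map_smul, hbc, smul_eq_mul]
  field_simp
  ring

theorem laplacian_mul_coord_coord (a b : Fin (m + 1)) (y : EuclideanSpace ℝ (Fin (m + 1))) :
    Laplacian.laplacian (fun y : EuclideanSpace ℝ (Fin (m + 1)) => y a * y b) y =
      if a = b then 2 else 0 := by
  rw [laplacian_mul (contDiff_coord a).contDiffAt (contDiff_coord b).contDiffAt]
  simp [laplacian_coord, pd_coord, eq_comm]

theorem conformalField_apply (b : Fin (m + 1)) (y : EuclideanSpace ℝ (Fin (m + 1))) :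
    conformalField y b = 2 * (y 0 * y b) + (-(if b = 0 then 1 else 0)) * (∑ c, y c * y c + 1) := by
  simp [conformalField, norm_sq_eq_sum]
  split_ifs <;> ring_nf

theorem contDiff_sum_sq {n : WithTop ℕ∞} :
    ContDiff ℝ n (fun y : EuclideanSpace ℝ (Fin (m + 1)) => ∑ c, y c * y c) :=
  ContDiff.sum fun c _ => (contDiff_coord c).mul (contDiff_coord c)

theorem contDiff_conformalField (b : Fin (m + 1)) {n : WithTop ℕ∞} :
    ContDiff ℝ n (fun y : EuclideanSpace ℝ (Fin (m + 1)) => conformalField y b) := by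
  simp only [conformalField_apply]
  exact (contDiff_const.mul ((contDiff_coord 0).mul (contDiff_coord b))).add
    (contDiff_const.mul (contDiff_sum_sq.add contDiff_const))

theorem pd_conformalField (a b : Fin (m + 1)) (y : EuclideanSpace ℝ (Fin (m + 1))) :
    pd Set.univ (fun y => conformalField y b) a y =
      2 * (y 0 * (if a = b then 1 else 0) + (if a = 0 then 1 else 0) * y b) -
        (if b = 0 then 1 else 0) * (2 * y a) := by
  have hd : ∀ c, DifferentiableAt ℝ (fun y : EuclideanSpace ℝ (Fin (m + 1)) => y c) y := fun c =>
    (contDiff_coord (n := 1) c).differentiable (by norm_num) y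
  have hc : ∀ r : ℝ, DifferentiableAt ℝ (fun _ : EuclideanSpace ℝ (Fin (m + 1)) => r) y :=
    fun r => differentiableAt_const r
  have hs : DifferentiableAt ℝ (fun y : EuclideanSpace ℝ (Fin (m + 1)) => ∑ c, y c * y c) y :=
    (contDiff_sum_sq (n := 1)).differentiable (by norm_num) y
  simp only [conformalField_apply]
  rw [pd_univ_add ((hc _).fun_mul ((hd 0).fun_mul (hd b))) ((hc _).fun_mul (hs.fun_add (hc _))),
    pd_univ_mul (hc _) ((hd 0).fun_mul (hd b)), pd_univ_mul (hd 0) (hd b),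
    pd_univ_mul (hc _) (hs.fun_add (hc _)), pd_univ_add hs (hc _),
    pd_univ_sum (fun c _ => (hd c).fun_mul (hd c))]
  simp only [pd_univ_mul (hd _) (hd _), pd_coord, pd_const]
  simp [Finset.sum_add_distrib]
  ring_nf

theorem laplacian_conformalField (b : Fin (m + 1)) (y : EuclideanSpace ℝ (Fin (m + 1))) :
    Laplacian.laplacian (fun y : EuclideanSpace ℝ (Fin (m + 1)) => conformalField y b) y =
      (if b = 0 then 1 else 0) * (4 - 2 * ((m : ℝ) + 1)) := by
  have hs := (contDiff_sum_sq (m := m) (n := 2)).contDiffAt (x := y)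
  have hc : ∀ c : ℝ, ContDiffAt ℝ 2 (fun _ : EuclideanSpace ℝ (Fin (m + 1)) => c) y :=
    fun c => contDiffAt_const
  have hk : ∀ b : Fin (m + 1),
      ContDiffAt ℝ 2 (fun y : EuclideanSpace ℝ (Fin (m + 1)) => y b) y :=
    fun b => (contDiff_coord b).contDiffAt
  simp only [conformalField_apply]
  rw [laplacian_fun_add ((hc _).mul ((hk 0).mul (hk b))) ((hc _).mul (hs.add (hc _))),
    laplacian_mul (hc _) ((hk 0).mul (hk b)), laplacian_mul (hc _) (hs.add (hc _)),
    laplacian_fun_add hs (hc _), laplacian_sum fun c _ => (hk c).mul (hk c)]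
  simp only [laplacian_mul_coord_coord, laplacian_fun_const, pd_const]
  simp only [zero_mul, Finset.sum_const_zero, mul_zero, add_zero, if_true, Finset.sum_const,
    Finset.card_univ, Fintype.card_fin, nsmul_eq_mul]
  by_cases hb : b = 0
  · simp [hb]; ring
  · simp [hb, Ne.symm hb]

/-- The symmetric part of ∂_a X_b is 2t δ_ab, which contracts with the Hessian of w to a multiple of
Δw = 0; the antisymmetric part contracts to zero. What remains is ΔX·∇w = (4 - 2(m+1)) ∂_t w,
cancelled by 2(m-1) ∂_t w from the factor (m-1) t. -/
theorem laplacian_conformalDeriv (hw : ∀ y ∈ openHalfSpace m, ContDiffAt ℝ ∞ w y)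
    (hΔ : ∀ y ∈ openHalfSpace m, Laplacian.laplacian w y = 0)
    {y : EuclideanSpace ℝ (Fin (m + 1))} (hy : y ∈ openHalfSpace m) :
    Laplacian.laplacian (conformalDeriv w) y = 0 := by
  have hev : ∀ᶠ x in 𝓝 y, x ∈ openHalfSpace m := isOpen_openHalfSpace.mem_nhds hy
  have hD : conformalDeriv w =ᶠ[𝓝 y] fun y => ∑ b, conformalField y b * pd Set.univ w b y +
      (((m : ℝ) - 1) * y 0 - (m + 1)) * w y := by
    filter_upwards [hev] with x hx
    rw [conformalDeriv_of_mem hx, fderiv_apply_eq_sum]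
  have hw3 : ContDiffAt ℝ 3 w y := (hw y hy).of_le ENat.LEInfty.out
  have hw2 : ContDiffAt ℝ 2 w y := hw3.of_le (by norm_num)
  have hp : ∀ b, ContDiffAt ℝ 2 (pd Set.univ w b) y := fun b => contDiffAt_pd hw3 (by norm_num) b
  have hX : ∀ b, ContDiffAt ℝ 2 (fun y : EuclideanSpace ℝ (Fin (m + 1)) => conformalField y b) y :=
    fun b => (contDiff_conformalField b).contDiffAt
  have hc : ∀ c : ℝ, ContDiffAt ℝ 2 (fun _ : EuclideanSpace ℝ (Fin (m + 1)) => c) y :=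
    fun c => contDiffAt_const
  have hk : ContDiffAt ℝ 2 (fun y : EuclideanSpace ℝ (Fin (m + 1)) => y 0) y :=
    (contDiff_coord 0).contDiffAt
  have hl : ContDiffAt ℝ 2
      (fun y : EuclideanSpace ℝ (Fin (m + 1)) => ((m : ℝ) - 1) * y 0 - (m + 1)) y :=
    ((hc _).mul hk).sub (hc _)
  have hΔp : ∀ b, Laplacian.laplacian (pd Set.univ w b) y = 0 := by
    intro b
    rw [laplacian_pd hw3]
    have : Laplacian.laplacian w =ᶠ[𝓝 y] fun _ => 0 := by
      filter_upwards [hev] with x hx using hΔ x hx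
    rw [pd_univ_congr this, pd_const]
  have hpl : ∀ a, pd Set.univ
      (fun y : EuclideanSpace ℝ (Fin (m + 1)) => ((m : ℝ) - 1) * y 0 - (m + 1)) a y =
        ((m : ℝ) - 1) * (if a = 0 then 1 else 0) := by
    intro a
    rw [pd_univ_sub (((hc _).mul hk).differentiableAt (by norm_num))
      ((hc _).differentiableAt (by norm_num)), pd_univ_mul ((hc _).differentiableAt (by norm_num))
      (hk.differentiableAt (by norm_num)), pd_const, pd_const, pd_coord]
    ring
  have hΔl : Laplacian.laplacian
      (fun y : EuclideanSpace ℝ (Fin (m + 1)) => ((m : ℝ) - 1) * y 0 - (m + 1)) y = 0 := by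
    have : (fun y : EuclideanSpace ℝ (Fin (m + 1)) => ((m : ℝ) - 1) * y 0 - (m + 1)) =
        fun y => ((m : ℝ) - 1) * y 0 + (-((m : ℝ) + 1)) := by ext; ring
    rw [this, laplacian_fun_add ((hc _).mul hk) (hc _), laplacian_mul (hc _) hk, laplacian_coord,
      laplacian_fun_const, laplacian_fun_const]
    simp [pd_const]
  rw [(InnerProductSpace.laplacian_congr_nhds hD).self_of_nhds,
    laplacian_fun_add (ContDiffAt.sum fun b _ => (hX b).mul (hp b)) (hl.mul hw2),
    laplacian_sum fun b _ => (hX b).mul (hp b), laplacian_mul hl hw2, hΔ y hy, hΔl]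
  simp only [laplacian_mul (hX _) (hp _), hΔp, laplacian_conformalField, pd_conformalField, hpl,
    mul_zero, zero_mul, zero_add, add_zero]
  have h0 := hΔ y hy
  rw [laplacian_eq_sum_pd hw2] at h0
  have hcomm : ∀ a, pd Set.univ (pd Set.univ w a) 0 y = pd Set.univ (pd Set.univ w 0) a y :=
    fun a => pd_pd_comm hw2 a 0
  have hin : ∀ b, ∑ a, (2 * (y 0 * (if a = b then 1 else 0) + (if a = 0 then 1 else 0) * y b) -
      (if b = 0 then 1 else 0) * (2 * y a)) * pd Set.univ (pd Set.univ w b) a y =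
      2 * y 0 * pd Set.univ (pd Set.univ w b) b y + 2 * (y b * pd Set.univ (pd Set.univ w 0) b y) -
        (if b = 0 then 1 else 0) * (2 * ∑ a, y a * pd Set.univ (pd Set.univ w b) a y) := by
    intro b
    have h1 : ∑ a, (if a = b then (1 : ℝ) else 0) * pd Set.univ (pd Set.univ w b) a y =
        pd Set.univ (pd Set.univ w b) b y := by simp
    have h2 : ∑ a, (if a = 0 then (1 : ℝ) else 0) * pd Set.univ (pd Set.univ w b) a y =
        pd Set.univ (pd Set.univ w 0) b y := by simp [hcomm]
    rw [← h1, ← h2, Finset.mul_sum, Finset.mul_sum, Finset.mul_sum, Finset.mul_sum,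
      Finset.mul_sum, ← Finset.sum_add_distrib, ← Finset.sum_sub_distrib]
    exact Finset.sum_congr rfl fun a _ => by ring
  have hsum : ∀ b, 2 * (2 * y 0 * pd Set.univ (pd Set.univ w b) b y +
      2 * (y b * pd Set.univ (pd Set.univ w 0) b y) - (if b = 0 then 1 else 0) *
        (2 * ∑ a, y a * pd Set.univ (pd Set.univ w b) a y)) +
      (if b = 0 then 1 else 0) * (4 - 2 * ((m : ℝ) + 1)) * pd Set.univ w b y =
      4 * y 0 * pd Set.univ (pd Set.univ w b) b y + 4 * (y b * pd Set.univ (pd Set.univ w 0) b y) +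
      if b = 0 then (4 - 2 * ((m : ℝ) + 1)) * pd Set.univ w 0 y -
        4 * ∑ a, y a * pd Set.univ (pd Set.univ w 0) a y else 0 := by
    intro b
    by_cases hb : b = 0
    · subst hb; simp only [if_true]; ring
    · simp only [hb, if_false]; ring
  simp only [hin]
  have e1 := Finset.sum_congr rfl fun b (_ : b ∈ Finset.univ) => hsum b
  have e2 : ∑ a, (m - 1 : ℝ) * (if a = 0 then 1 else 0) * pd Set.univ w a y =
      (m - 1 : ℝ) * pd Set.univ w 0 y := by simp
  rw [e1, e2]
  simp only [Finset.sum_add_distrib, ← Finset.mul_sum, h0, Finset.sum_ite_eq',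
    Finset.mem_univ, if_true]
  ring

theorem norm_conformalField_le (y : EuclideanSpace ℝ (Fin (m + 1))) :
    ‖conformalField y‖ ≤ 3 * (1 + ‖y‖) ^ 2 := by
  have h0 : |y 0| ≤ ‖y‖ := by simpa using PiLp.norm_apply_le y 0
  have hn : ‖normalVec m‖ = 1 := by simp
  calc ‖conformalField y‖ ≤ ‖(2 * y 0) • y‖ + ‖(‖y‖ ^ 2 + 1) • normalVec m‖ := norm_sub_le _ _
    _ = 2 * |y 0| * ‖y‖ + (‖y‖ ^ 2 + 1) := by
        rw [norm_smul, norm_smul, hn, Real.norm_eq_abs, Real.norm_eq_abs, abs_mul, abs_two,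
          abs_of_pos (by positivity : 0 < ‖y‖ ^ 2 + 1), mul_one]
    _ ≤ 3 * (1 + ‖y‖) ^ 2 := by nlinarith [norm_nonneg y]

/-- The field grows quadratically and its weight at most so. The squared growth (1+|y|)⁴ multiplies
an integrable function when w ∈ H¹, which is the form required by `eq_zero_of_harmonic`. -/
theorem conformalDeriv_sq_le {y : EuclideanSpace ℝ (Fin (m + 1))} (hy : y ∈ openHalfSpace m) :
    conformalDeriv w y ^ 2 ≤ (1 + ‖y‖) ^ 4 *
      (18 * ‖fderiv ℝ w y‖ ^ 2 + 2 * ((m : ℝ) + 1) ^ 2 * ‖w y‖ ^ 2) := by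
  have h0 : |y 0| ≤ ‖y‖ := by simpa using PiLp.norm_apply_le y 0
  have h0' : 0 < y 0 := hy
  have h1 : |fderiv ℝ w y (conformalField y)| ≤ (1 + ‖y‖) ^ 2 * (3 * ‖fderiv ℝ w y‖) := by
    calc |fderiv ℝ w y (conformalField y)| ≤ ‖fderiv ℝ w y‖ * ‖conformalField y‖ :=
          (fderiv ℝ w y).le_opNorm _
      _ ≤ ‖fderiv ℝ w y‖ * (3 * (1 + ‖y‖) ^ 2) := by gcongr; exact norm_conformalField_le y
      _ = _ := by ring
  have h2 : |(((m : ℝ) - 1) * y 0 - (m + 1)) * w y| ≤ (1 + ‖y‖) ^ 2 * (((m : ℝ) + 1) * ‖w y‖) := by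
    have hm : (0 : ℝ) ≤ m := Nat.cast_nonneg m
    have h3 : |((m : ℝ) - 1) * y 0 - (m + 1)| ≤ (1 + ‖y‖) ^ 2 * ((m : ℝ) + 1) := by
      rw [abs_of_pos h0'] at h0
      rw [abs_le]
      constructor <;> nlinarith [norm_nonneg y, mul_nonneg hm h0'.le, mul_nonneg hm (norm_nonneg y),
        mul_nonneg hm (sq_nonneg ‖y‖), mul_le_mul_of_nonneg_left h0 hm]
    rw [abs_mul, ← mul_assoc]
    gcongr
    rfl
  rw [conformalDeriv_of_mem hy, ← sq_abs]
  calc |fderiv ℝ w y (conformalField y) + (((m : ℝ) - 1) * y 0 - (m + 1)) * w y| ^ 2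
      ≤ ((1 + ‖y‖) ^ 2 * (3 * ‖fderiv ℝ w y‖) + (1 + ‖y‖) ^ 2 * (((m : ℝ) + 1) * ‖w y‖)) ^ 2 := by
        gcongr
        exact (abs_add_le _ _).trans (add_le_add h1 h2)
    _ = (1 + ‖y‖) ^ 4 * (3 * ‖fderiv ℝ w y‖ + ((m : ℝ) + 1) * ‖w y‖) ^ 2 := by ring
    _ ≤ _ := by
        gcongr
        nlinarith [sq_nonneg (3 * ‖fderiv ℝ w y‖ - ((m : ℝ) + 1) * ‖w y‖)]

theorem conformalDeriv_eq_zero (hm : 4 ≤ m) (hw : ContDiffOn ℝ 2 w (openHalfSpace m))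
    (hw1 : ContDiffOn ℝ 1 w (halfSpace m))
    (hL : MemLp w 2 (volume.restrict (openHalfSpace m)))
    (hL' : MemLp (fderiv ℝ w) 2 (volume.restrict (openHalfSpace m)))
    (hΔ : ∀ y ∈ openHalfSpace m, Laplacian.laplacian w y = 0)
    (hbc : ∀ y : EuclideanSpace ℝ (Fin (m + 1)), y 0 = 0 →
      pd (halfSpace m) w 0 y = -((m : ℝ) + 1) * (rho y)⁻¹ * w y)
    {y : EuclideanSpace ℝ (Fin (m + 1))} (hy : y ∈ openHalfSpace m) : conformalDeriv w y = 0 := by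
  -- A solution is only assumed C², whereas the Laplacian of `conformalDeriv` involves third
  -- derivatives; interior smoothness of harmonic functions supplies them.
  have hs : ∀ y ∈ openHalfSpace m, ContDiffAt ℝ ∞ w y := fun y hy =>
    contDiffAt_of_harmonic isOpen_openHalfSpace hw hΔ hy
  refine eq_zero_of_harmonic
    (W := fun y => 18 * ‖fderiv ℝ w y‖ ^ 2 + 2 * ((m : ℝ) + 1) ^ 2 * ‖w y‖ ^ 2) hm
    (continuousOn_conformalDeriv hw1) (fun y hy => conformalDeriv_boundary hy (hbc y hy)) ?_
    (fun y hy => laplacian_conformalDeriv hs hΔ hy) ?_ (fun y => by positivity)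
    (fun y hy => conformalDeriv_sq_le hy) hy
  · intro y hy
    have h1 : ContDiffAt ℝ 2 (fun y => fderiv ℝ w y (conformalField y) +
        (((m : ℝ) - 1) * y 0 - (m + 1)) * w y) y := by
      have hw3 : ContDiffAt ℝ 3 w y := (hs y hy).of_le ENat.LEInfty.out
      have hX : ContDiff ℝ 2 (conformalField (m := m)) :=
        ((contDiff_const.mul (contDiff_coord 0)).smul contDiff_id).sub
          (((contDiff_norm_sq ℝ).add contDiff_const).smul contDiff_const)
      exact ((hw3.fderiv_right (m := 2) (by norm_num)).clm_apply hX.contDiffAt).add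
        (((contDiff_const.mul (contDiff_coord 0)).sub contDiff_const).contDiffAt.mul
          (hw3.of_le (by norm_num)))
    refine (h1.congr_of_eventuallyEq ?_).contDiffWithinAt
    filter_upwards [isOpen_openHalfSpace.mem_nhds hy] with x hx
    exact conformalDeriv_of_mem hx
  · exact ((hL'.integrable_norm_pow (by norm_num)).const_mul 18).add
      ((hL.integrable_norm_pow (by norm_num)).const_mul _)

/-- The conformal involution exchanging the unit ball and the half-space. -/
def ballMap (x : EuclideanSpace ℝ (Fin (m + 1))) : EuclideanSpace ℝ (Fin (m + 1)) :=
  (2 / rho x) • (x + normalVec m) - normalVec m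

theorem ballMap_zero_coord (x : EuclideanSpace ℝ (Fin (m + 1))) (hx : rho x ≠ 0) :
    ballMap x 0 = (1 - ‖x‖ ^ 2) / rho x := by
  have : ballMap x 0 = 2 / rho x * (x 0 + 1) - 1 := by simp [ballMap]; ring
  rw [this]
  field_simp
  rw [rho_eq]; ring

theorem ballMap_succ (x : EuclideanSpace ℝ (Fin (m + 1))) (i : Fin m) :
    ballMap x i.succ = 2 / rho x * x i.succ := by
  simp [ballMap]

theorem rho_pos_of_norm_lt {x : EuclideanSpace ℝ (Fin (m + 1))} (hx : ‖x‖ < 1) : 0 < rho x := by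
  have h0 : |x 0| ≤ ‖x‖ := by simpa using PiLp.norm_apply_le x 0
  have h1 := (abs_le.1 h0).1
  have h2 : 0 ≤ ∑ i : Fin m, x i.succ ^ 2 := Finset.sum_nonneg fun i _ => sq_nonneg _
  unfold rho
  nlinarith

theorem ballMap_mem {x : EuclideanSpace ℝ (Fin (m + 1))} (hx : ‖x‖ < 1) :
    ballMap x ∈ openHalfSpace m := by
  have := rho_pos_of_norm_lt hx
  change 0 < ballMap x 0
  rw [ballMap_zero_coord x this.ne']
  exact div_pos (by nlinarith [norm_nonneg x]) this

theorem rho_ballMap {x : EuclideanSpace ℝ (Fin (m + 1))} (hx : 0 < rho x) :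
    rho (ballMap x) = 4 / rho x := by
  rw [rho_eq_norm_sq, ballMap, sub_add_cancel, norm_smul, mul_pow, ← rho_eq_norm_sq,
    Real.norm_eq_abs, sq_abs]
  field_simp
  norm_num

theorem ballMap_ballMap {x : EuclideanSpace ℝ (Fin (m + 1))} (hx : 0 < rho x) :
    ballMap (ballMap x) = x := by
  rw [ballMap, rho_ballMap hx, ballMap, sub_add_cancel, smul_smul]
  rw [show 2 / (4 / rho x) * (2 / rho x) = 1 by field_simp; norm_num, one_smul, add_sub_cancel_right]

theorem norm_ballMap_lt {y : EuclideanSpace ℝ (Fin (m + 1))} (hy : y ∈ openHalfSpace m) :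
    ‖ballMap y‖ < 1 := by
  have hr := rho_pos (openHalfSpace_subset hy)
  have h0 : 0 < y 0 := hy
  have h1 : ‖ballMap y‖ ^ 2 = 1 - 4 * y 0 / rho y := by
    have h2 := rho_eq (ballMap y)
    rw [rho_ballMap hr, ballMap_zero_coord y hr.ne'] at h2
    have h3 : 4 / rho y - 2 * ((1 - ‖y‖ ^ 2) / rho y) - 1 = 1 - 4 * y 0 / rho y := by
      have h4 := rho_eq y
      field_simp
      linarith
    linarith
  have h5 : 0 < 4 * y 0 / rho y := by positivity
  nlinarith [norm_nonneg (ballMap y)]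

/-- The involution carries the radial field of the ball to half the conformal field. Thus an
equation along the conformal field becomes Euler's homogeneity equation on the ball. -/
theorem hasFDerivAt_ballMap {x : EuclideanSpace ℝ (Fin (m + 1))} (hx : 0 < rho x) :
    ∃ D : EuclideanSpace ℝ (Fin (m + 1)) →L[ℝ] EuclideanSpace ℝ (Fin (m + 1)),
      HasFDerivAt ballMap D x ∧ D x = (1 / 2 : ℝ) • conformalField (ballMap x) := by
  have hrd : HasFDerivAt (rho (m := m)) (2 • (innerSL ℝ (x + normalVec m))) x := by
    have : rho (m := m) = fun y => ‖y + normalVec m‖ ^ 2 := by ext y; exact rho_eq_norm_sq y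
    rw [this]
    refine (((hasFDerivAt_id x).add_const (normalVec m)).norm_sq).congr_fderiv ?_
    ext; simp
  have h1 := (hasDerivAt_inv hx.ne').comp_hasFDerivAt x hrd
  have h2 := ((h1.const_mul 2).smul ((hasFDerivAt_id x).add_const (normalVec m))).sub_const
    (normalVec m)
  refine ⟨_, h2.congr_of_eventuallyEq (Filter.Eventually.of_forall fun y => ?_), ?_⟩
  · simp [ballMap, div_eq_mul_inv]
  · have hx0 : inner ℝ (x + normalVec m) x = ‖x‖ ^ 2 + x 0 := by
      rw [inner_add_left, real_inner_self_eq_norm_sq]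
      simp [EuclideanSpace.inner_single_left]
    have hn : ‖ballMap x‖ ^ 2 + 1 = 2 * (‖x‖ ^ 2 + 1) / rho x := by
      have h3 := rho_eq (ballMap x)
      rw [rho_ballMap hx, ballMap_zero_coord x hx.ne'] at h3
      have h4 : 4 / rho x - 2 * ((1 - ‖x‖ ^ 2) / rho x) = 2 * (‖x‖ ^ 2 + 1) / rho x := by
        field_simp; ring
      linarith
    rw [conformalField, hn, ballMap_zero_coord x hx.ne']
    have hr := rho_eq x
    have hi : inner ℝ (normalVec m) x = x 0 := by simp [EuclideanSpace.inner_single_left]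
    ext a
    refine Fin.cases ?_ (fun i => ?_) a
    · simp [ballMap, EuclideanSpace.inner_single_left]
      field_simp
      rw [hr]
      ring
    · simp [ballMap, EuclideanSpace.inner_single_left]
      field_simp
      rw [hr]
      ring

/-- A function on the unit ball with `Du(x) x = u(x)` is linear. -/
theorem eq_fderiv_zero_of_radial {E : Type*} [NormedAddCommGroup E] [NormedSpace ℝ E] {u : E → ℝ}
    (hd : ∀ x, ‖x‖ < 1 → DifferentiableAt ℝ u x) (hu : ∀ x, ‖x‖ < 1 → fderiv ℝ u x x = u x)
    {x : E} (hx : ‖x‖ < 1) : u x = fderiv ℝ u 0 x := by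
  have hu0 : u 0 = 0 := by rw [← hu 0 (by simp), map_zero]
  have hball : ∀ r ∈ Set.Ioc (0 : ℝ) 1, ‖r • x‖ < 1 := by
    intro r hr
    rw [norm_smul, Real.norm_eq_abs, abs_of_pos hr.1]
    nlinarith [hr.1, hr.2, norm_nonneg x]
  -- Along each ray u(rx)/r has derivative zero, by Euler's relation for homogeneity of degree one.
  have hder : ∀ r ∈ Set.Ioc (0 : ℝ) 1, HasDerivAt (fun r : ℝ => u (r • x) / r) 0 r := by
    intro r hr
    have h1 : HasDerivAt (fun r : ℝ => r • x) x r := by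
      simpa using (hasDerivAt_id r).smul_const x
    have h2 := (hd _ (hball r hr)).hasFDerivAt.comp_hasDerivAt r h1
    have h3 := h2.div (hasDerivAt_id r) hr.1.ne'
    refine h3.congr_deriv ?_
    have h4 := hu _ (hball r hr)
    rw [map_smul, smul_eq_mul] at h4
    simp only [Function.comp, id, mul_one, ← h4]
    rw [mul_comm, sub_self, zero_div]
  have hconst : ∀ r ∈ Set.Ioc (0 : ℝ) 1, u (r • x) / r = u x := by
    intro r hr
    have h1 := constant_of_derivWithin_zero (f := fun r : ℝ => u (r • x) / r) (a := r) (b := 1)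
      (fun s hs => (hder s ⟨hr.1.trans_le hs.1, hs.2⟩).differentiableAt.differentiableWithinAt)
      (fun s hs => (hder s ⟨hr.1.trans_le hs.1, hs.2.le⟩).hasDerivWithinAt.derivWithin
        (uniqueDiffOn_Icc (hs.1.trans_lt hs.2) s (Set.Ico_subset_Icc_self hs)))
      1 (Set.right_mem_Icc.2 hr.2)
    simpa using h1.symm
  have h0 : HasDerivAt (fun r : ℝ => u (r • x)) (fderiv ℝ u 0 x) 0 := by
    have h1 : HasDerivAt (fun r : ℝ => r • x) x 0 := by
      simpa using (hasDerivAt_id (0 : ℝ)).smul_const x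
    have h2 : HasFDerivAt u (fderiv ℝ u 0) ((0 : ℝ) • x) := by
      rw [zero_smul]; exact (hd 0 (by simp)).hasFDerivAt
    exact h2.comp_hasDerivAt 0 h1
  have ht := h0.tendsto_slope_zero_right
  simp only [zero_add, zero_smul, hu0, sub_zero] at ht
  -- The constant quotient u(rx)/r = u(x) tends, as r → 0, to the derivative of u at the centre
  -- applied to x. Differentiability at the centre is what upgrades homogeneity to linearity.
  refine tendsto_nhds_unique ?_ ht
  refine Filter.Tendsto.congr' ?_ tendsto_const_nhds
  filter_upwards [Ioc_mem_nhdsGT (zero_lt_one' ℝ)] with r hr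
  rw [← hconst r hr, smul_eq_mul, div_eq_inv_mul]

end Uniqueness

/-! ### Homogeneous solutions are combinations of the kernel functions. -/

section Uniqueness

variable {m : ℕ} {w : EuclideanSpace ℝ (Fin (m + 1)) → ℝ}

theorem fderiv_rho_rpow_conformalField (p : ℝ) {y : EuclideanSpace ℝ (Fin (m + 1))}
    (hy : 0 < rho y) :
    fderiv ℝ (fun y => rho y ^ p) y (conformalField y) = 2 * p * (y 0 - 1) * rho y ^ p := by
  have h1 : ∑ a, conformalField y a * (y + normalVec m) a = (y 0 - 1) * rho y := by
    have h2 : ∑ a, conformalField y a * (y + normalVec m) a =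
        inner ℝ (y + normalVec m) (conformalField y) := by
      simp [PiLp.inner_apply]
    rw [h2, conformalField, inner_sub_right, inner_smul_right, inner_smul_right, inner_add_left,
      inner_add_left, real_inner_self_eq_norm_sq, real_inner_self_eq_norm_sq]
    simp [EuclideanSpace.inner_single_left, EuclideanSpace.inner_single_right, rho_eq]
    ring
  rw [fderiv_apply_eq_sum]
  simp only [pd_rho_rpow p hy]
  calc ∑ a, conformalField y a * (2 * p * (y + normalVec m) a * rho y ^ (p - 1))
      = 2 * p * (∑ a, conformalField y a * (y + normalVec m) a) * rho y ^ (p - 1) := by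
        rw [Finset.mul_sum, Finset.sum_mul]
        exact Finset.sum_congr rfl fun a _ => by ring
    _ = 2 * p * (y 0 - 1) * (rho y ^ (p - 1) * rho y) := by rw [h1]; ring
    _ = _ := by rw [← Real.rpow_add_one hy.ne', sub_add_cancel]

/-- The Kelvin factor absorbs the zeroth-order term of `conformalDeriv`: for f = w ρ^((m-1)/2), X·∇f
equals ρ^((m-1)/2) times `conformalDeriv`, plus 2f. -/
theorem fderiv_mul_rho_rpow (hw : ∀ y ∈ openHalfSpace m, DifferentiableAt ℝ w y)
    (hE : ∀ y ∈ openHalfSpace m, conformalDeriv w y = 0)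
    {y : EuclideanSpace ℝ (Fin (m + 1))} (hy : y ∈ openHalfSpace m) :
    fderiv ℝ (fun y => w y * rho y ^ (((m : ℝ) - 1) / 2)) y ((1 / 2 : ℝ) • conformalField y) =
      w y * rho y ^ (((m : ℝ) - 1) / 2) := by
  have hr := rho_pos (openHalfSpace_subset hy)
  have h1 := hE y hy
  rw [conformalDeriv_of_mem hy] at h1
  have h2 := fderiv_rho_rpow_conformalField (((m : ℝ) - 1) / 2) hr
  have h3 : DifferentiableAt ℝ (fun y => rho (m := m) y ^ (((m : ℝ) - 1) / 2)) y :=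
    (contDiffAt_rho_rpow (n := 1) _ hr).differentiableAt (by norm_num)
  rw [fderiv_fun_mul (hw y hy) h3]
  simp only [_root_.add_apply, _root_.smul_apply, map_smul, h2,
    smul_eq_mul]
  linear_combination (1 / 2 * rho y ^ (((m : ℝ) - 1) / 2)) * h1

/-- The Kelvin transform of w satisfies Du(x) x = u(x) on the unit ball, hence is linear.
Transported back, the coordinate functions of the ball are multiples of the kernel functions. -/
theorem exists_eq_sum_kernelFn (hm : 2 ≤ m) (hw : ∀ y ∈ openHalfSpace m, DifferentiableAt ℝ w y)
    (hE : ∀ y ∈ openHalfSpace m, conformalDeriv w y = 0) :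
    ∃ c : Fin (m + 1) → ℝ, ∀ y ∈ openHalfSpace m, w y = ∑ b, c b * kernelFn b y := by
  have hm' : (2 : ℝ) ≤ m := by exact_mod_cast hm
  have h0 : (m : ℝ) - 1 ≠ 0 := by linarith
  set f : EuclideanSpace ℝ (Fin (m + 1)) → ℝ := fun y => w y * rho y ^ (((m : ℝ) - 1) / 2) with hf
  have hfd : ∀ y ∈ openHalfSpace m, DifferentiableAt ℝ f y := fun y hy =>
    (hw y hy).mul ((contDiffAt_rho_rpow (n := 1) _
      (rho_pos (openHalfSpace_subset hy))).differentiableAt (by norm_num))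
  have hd : ∀ x : EuclideanSpace ℝ (Fin (m + 1)), ‖x‖ < 1 →
      DifferentiableAt ℝ (f ∘ ballMap) x ∧ fderiv ℝ (f ∘ ballMap) x x = (f ∘ ballMap) x := by
    intro x hx
    obtain ⟨D, hD, hDx⟩ := hasFDerivAt_ballMap (rho_pos_of_norm_lt hx)
    have h := (hfd _ (ballMap_mem hx)).hasFDerivAt.comp x hD
    refine ⟨h.differentiableAt, ?_⟩
    rw [h.fderiv, ContinuousLinearMap.comp_apply, hDx]
    exact fderiv_mul_rho_rpow hw hE (ballMap_mem hx)
  set L := fderiv ℝ (f ∘ ballMap) 0 with hL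
  -- The constants compare the components (1-|y|²)/ρ and 2 y_i/ρ of `ballMap` y, times ρ^(-(m-1)/2),
  -- with the explicit `kernelFn_zero` and `kernelFn_succ`.
  refine ⟨Fin.cases (2 / ((m : ℝ) - 1) * L (EuclideanSpace.single 0 1))
    fun i => -(2 / ((m : ℝ) - 1)) * L (EuclideanSpace.single i.succ 1), fun y hy => ?_⟩
  have hr := rho_pos (openHalfSpace_subset hy)
  have h1 := eq_fderiv_zero_of_radial (fun x hx => (hd x hx).1) (fun x hx => (hd x hx).2)
    (norm_ballMap_lt hy)
  rw [Function.comp, ballMap_ballMap hr, ← hL,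
    eq_sum_of_isLinearMap (f := L) ⟨map_add _, fun c x => by simp⟩ (ballMap y)] at h1
  have h2 : w y = f y * rho y ^ (-(((m : ℝ) - 1) / 2)) := by
    rw [hf]
    simp only
    rw [mul_assoc, ← Real.rpow_add hr, add_neg_cancel, Real.rpow_zero, mul_one]
  rw [h2, h1, Fin.sum_univ_succ, Fin.sum_univ_succ, rho_rpow_mul hr]
  simp only [Fin.cases_zero, Fin.cases_succ, kernelFn_zero hr, kernelFn_succ hr, ballMap_succ,
    ballMap_zero_coord y hr.ne', add_mul, Finset.sum_mul]
  congr 1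
  · field_simp
  · refine Finset.sum_congr rfl fun i _ => ?_
    field_simp

/-- A solution of the homogeneous problem orthogonal to the kernel functions vanishes. -/
theorem IsSolution.eq_zero (hm : 4 ≤ m) (hw : IsSolution (fun _ => 0) w)
    (ho : OrthogonalToKernel w) {y : EuclideanSpace ℝ (Fin (m + 1))} (hy : y ∈ halfSpace m) :
    w y = 0 := by
  have hdiff : ∀ y ∈ openHalfSpace m, DifferentiableAt ℝ w y := fun y hy =>
    (hw.contDiffOn_interior.contDiffAt (isOpen_openHalfSpace.mem_nhds hy)).differentiableAt
      (by norm_num)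
  have hE : ∀ y ∈ openHalfSpace m, conformalDeriv w y = 0 := fun y hy =>
    conformalDeriv_eq_zero hm hw.contDiffOn_interior hw.contDiffOn_closed hw.memLp
      hw.memLp_gradient (fun y hy => neg_eq_zero.1 (hw.equation y hy))
      (fun y hy => by rw [hw.boundary y hy, bubble_bdry (by omega)]) hy
  obtain ⟨c, hc⟩ := exists_eq_sum_kernelFn (by omega) hdiff hE
  -- One factor w is replaced by its expansion in the kernel functions, to which the other factor is
  -- orthogonal.
  have hsq : ∫ y in openHalfSpace m, w y ^ 2 = 0 := by
    have h1 : ∫ y in openHalfSpace m, w y ^ 2 =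
        ∫ y in openHalfSpace m, ∑ b, c b * (w y * kernelFn b y) := by
      refine setIntegral_congr_fun isOpen_openHalfSpace.measurableSet fun y hy => ?_
      rw [sq]
      nth_rw 2 [hc y hy]
      rw [Finset.mul_sum]
      exact Finset.sum_congr rfl fun b _ => by ring
    rw [h1, integral_finsetSum _ fun b _ => (ho b).1.const_mul (c b)]
    refine Finset.sum_eq_zero fun b _ => ?_
    rw [integral_const_mul, (ho b).2, mul_zero]
  have hae : (fun y => w y ^ 2) =ᵐ[volume.restrict (openHalfSpace m)] 0 :=
    (integral_eq_zero_iff_of_nonneg (fun y => sq_nonneg _) hw.memLp.integrable_sq).1 hsq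
  have hae' : w =ᵐ[volume.restrict (openHalfSpace m)] fun _ => 0 := by
    filter_upwards [hae] with y hy using by simpa using hy
  have h0 : Set.EqOn w (fun _ => 0) (openHalfSpace m) :=
    Measure.eqOn_open_of_ae_eq hae' isOpen_openHalfSpace hw.contDiffOn_interior.continuousOn
      continuousOn_const
  have hcl : halfSpace m ⊆ closure (openHalfSpace m) := by
    rw [← interior_halfSpace_eq]; exact halfSpace_subset_closure_interior
  exact h0.of_subset_closure hw.contDiffOn_closed.continuousOn continuousOn_const
    openHalfSpace_subset hcl hy

/-- Solutions orthogonal to the kernel functions are unique. -/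
theorem IsSolution.eqOn (hm : 4 ≤ m) {f v : EuclideanSpace ℝ (Fin (m + 1)) → ℝ}
    (hw : IsSolution f w) (hwo : OrthogonalToKernel w) (hv : IsSolution f v)
    (hvo : OrthogonalToKernel v) : Set.EqOn w v (halfSpace m) := by
  have hmeas := (isOpen_openHalfSpace (m := m)).measurableSet
  have hC : ∀ {u : EuclideanSpace ℝ (Fin (m + 1)) → ℝ}, IsSolution f u →
      ∀ y ∈ openHalfSpace m, ContDiffAt ℝ 2 u y := fun hu y hy =>
    hu.contDiffOn_interior.contDiffAt (isOpen_openHalfSpace.mem_nhds hy)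
  have hsol : IsSolution (fun _ => 0) (w - v) := by
    refine ⟨hw.contDiffOn_interior.sub hv.contDiffOn_interior,
      hw.contDiffOn_closed.sub hv.contDiffOn_closed, hw.memLp.sub hv.memLp,
      (hw.memLp_gradient.sub hv.memLp_gradient).ae_eq ?_, fun y hy => ?_, fun y hy => ?_⟩
    · filter_upwards [ae_restrict_mem hmeas] with y hy
      rw [fderiv_sub ((hC hw y hy).differentiableAt (by norm_num))
        ((hC hv y hy).differentiableAt (by norm_num))]
      rfl
    · have h1 : w - v = w + (-1 : ℝ) • v := by ext; simp; ring
      have h4 : ContDiffAt ℝ 2 ((-1 : ℝ) • v) y := (hC hv y hy).const_smul (-1 : ℝ)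
      rw [h1, (hC hw y hy).laplacian_add h4,
        InnerProductSpace.laplacian_smul (-1 : ℝ) (hC hv y hy)]
      have h2 := hw.equation y hy
      have h3 := hv.equation y hy
      rw [smul_eq_mul]
      linarith
    · have hy' : y ∈ halfSpace m := by rw [halfSpace, Set.mem_ofPred_eq, hy]
      have h1 := hw.boundary y hy
      have h2 := hv.boundary y hy
      rw [pd] at h1 h2 ⊢
      rw [fderivWithin_sub (uniqueDiffOn_halfSpace y hy')
        (hw.contDiffOn_closed.differentiableOn (by norm_num) y hy')
        (hv.contDiffOn_closed.differentiableOn (by norm_num) y hy'),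
        _root_.sub_apply, h1, h2, Pi.sub_apply]
      ring
  have horth : OrthogonalToKernel (w - v) := by
    intro b
    have h1 : (fun y => (w - v) y * kernelFn b y) =
        fun y => w y * kernelFn b y - v y * kernelFn b y := by
      ext y; rw [Pi.sub_apply]; ring
    rw [h1]
    exact ⟨(hwo b).1.sub (hvo b).1, by
      rw [integral_sub (hwo b).1 (hvo b).1, (hwo b).2, (hvo b).2, sub_zero]⟩
  intro y hy
  exact sub_eq_zero.1 (hsol.eq_zero hm horth hy)

end Uniqueness

/-! ### Symbol estimates -/

section Symbol

/-- An open half-space containing the closed half-space `halfSpace m`, away from the point where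
`rho` vanishes. -/
def enlargedHalfSpace (m : ℕ) : Set (EuclideanSpace ℝ (Fin (m + 1))) := {y | -(1 / 2) < y 0}

variable {m : ℕ}

theorem isOpen_enlargedHalfSpace : IsOpen (enlargedHalfSpace m) :=
  isOpen_lt continuous_const (contDiff_coord (n := 0) 0).continuous

theorem halfSpace_subset_enlargedHalfSpace : halfSpace m ⊆ enlargedHalfSpace m := fun y hy => by
  have : 0 ≤ y 0 := hy
  change -(1 / 2) < y 0
  linarith

theorem quarter_le_rho {y : EuclideanSpace ℝ (Fin (m + 1))} (hy : y ∈ enlargedHalfSpace m) :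
    1 / 4 ≤ rho y := by
  have h : -(1 / 2) < y 0 := hy
  have : 0 ≤ ∑ i : Fin m, y i.succ ^ 2 := Finset.sum_nonneg fun i _ => sq_nonneg _
  unfold rho
  nlinarith

theorem rho_pos_of_mem_enlarged {y : EuclideanSpace ℝ (Fin (m + 1))}
    (hy : y ∈ enlargedHalfSpace m) : 0 < rho y :=
  lt_of_lt_of_le (by norm_num) (quarter_le_rho hy)

/-- `f` is `C^N` near the half-space, and its derivatives of order `τ ≤ N` are bounded by
multiples of `ρ ^ ((d - τ) / 2)`. -/
structure IsSymbol {F : Type*} [NormedAddCommGroup F] [NormedSpace ℝ F] (N : ℕ) (d : ℝ)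
    (f : EuclideanSpace ℝ (Fin (m + 1)) → F) : Prop where
  contDiffOn : ContDiffOn ℝ N f (enlargedHalfSpace m)
  bound : ∀ τ ≤ N, ∃ C, ∀ y ∈ enlargedHalfSpace m,
    ‖iteratedFDerivWithin ℝ τ f (enlargedHalfSpace m) y‖ ≤ C * rho y ^ ((d - τ) / 2)

variable {F G : Type*} [NormedAddCommGroup F] [NormedSpace ℝ F] [NormedAddCommGroup G]
  [NormedSpace ℝ G] {N : ℕ} {d d' : ℝ} {f f' : EuclideanSpace ℝ (Fin (m + 1)) → F}

/-- Raising the degree weakens the bound because ρ ≥ 1/4 on the enlarged half-space. All degree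
counts below are therefore only inequalities. -/
theorem IsSymbol.mono (hf : IsSymbol N d f) (hd : d ≤ d') : IsSymbol N d' f := by
  refine ⟨hf.contDiffOn, fun τ hτ => ?_⟩
  obtain ⟨C, hC⟩ := hf.bound τ hτ
  refine ⟨|C| * (1 / 4) ^ ((d - d') / 2), fun y hy => (hC y hy).trans ?_⟩
  have hr := rho_pos_of_mem_enlarged hy
  have h1 : (rho y) ^ ((d - d') / 2) ≤ (1 / 4 : ℝ) ^ ((d - d') / 2) :=
    Real.rpow_le_rpow_of_nonpos (by norm_num) (quarter_le_rho hy) (by linarith)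
  calc C * rho y ^ ((d - τ) / 2)
      ≤ |C| * (rho y ^ ((d - d') / 2) * rho y ^ ((d' - τ) / 2)) := by
        rw [← Real.rpow_add hr, show (d - d') / 2 + (d' - τ) / 2 = (d - τ) / 2 by ring]
        gcongr
        exact le_abs_self C
    _ ≤ |C| * ((1 / 4) ^ ((d - d') / 2) * rho y ^ ((d' - τ) / 2)) := by gcongr
    _ = _ := by ring

theorem IsSymbol.congr (hf : IsSymbol N d f) (h : Set.EqOn f' f (enlargedHalfSpace m)) :
    IsSymbol N d f' := by
  refine ⟨hf.contDiffOn.congr h, fun τ hτ => ?_⟩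
  obtain ⟨C, hC⟩ := hf.bound τ hτ
  refine ⟨C, fun y hy => ?_⟩
  rw [iteratedFDerivWithin_congr h hy]
  exact hC y hy

theorem IsSymbol.add (hf : IsSymbol N d f) (hf' : IsSymbol N d f') :
    IsSymbol N d (fun y => f y + f' y) := by
  refine ⟨hf.contDiffOn.add hf'.contDiffOn, fun τ hτ => ?_⟩
  obtain ⟨C, hC⟩ := hf.bound τ hτ
  obtain ⟨C', hC'⟩ := hf'.bound τ hτ
  have hτ' : (τ : WithTop ℕ∞) ≤ N := by exact_mod_cast hτ
  refine ⟨C + C', fun y hy => ?_⟩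
  rw [fun_iteratedFDerivWithin_add_apply ((hf.contDiffOn y hy).of_le hτ')
    ((hf'.contDiffOn y hy).of_le hτ') isOpen_enlargedHalfSpace.uniqueDiffOn hy, add_mul]
  exact (norm_add_le _ _).trans (add_le_add (hC y hy) (hC' y hy))

theorem isSymbol_const (c : F) : IsSymbol (m := m) N 0 (fun _ => c) := by
  refine ⟨contDiffOn_const, fun τ _ => ⟨‖c‖, fun y hy => ?_⟩⟩
  rcases eq_or_ne τ 0 with rfl | h
  · simp
  · rw [iteratedFDerivWithin_const_of_ne h]
    have := rho_nonneg y
    simp only [Pi.zero_apply, norm_zero]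
    positivity

theorem IsSymbol.zero : IsSymbol (m := m) N d (fun _ => (0 : F)) := by
  refine ⟨contDiffOn_const, fun τ _ => ⟨0, fun y hy => ?_⟩⟩
  have h : (fun _ : EuclideanSpace ℝ (Fin (m + 1)) => (0 : F)) = 0 := rfl
  rw [h]
  simp

theorem IsSymbol.sum {ι : Type*} {s : Finset ι} {g : ι → EuclideanSpace ℝ (Fin (m + 1)) → F}
    (hg : ∀ i ∈ s, IsSymbol N d (g i)) : IsSymbol N d (fun y => ∑ i ∈ s, g i y) := by
  classical
  induction s using Finset.induction_on with
  | empty => simpa using IsSymbol.zero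
  | insert i s hi ih =>
    simp only [Finset.sum_insert hi]
    exact (hg i (Finset.mem_insert_self i s)).add
      (ih fun j hj => hg j (Finset.mem_insert_of_mem hj))

theorem IsSymbol.clm_comp (hf : IsSymbol N d f) (L : F →L[ℝ] G) :
    IsSymbol N d (fun y => L (f y)) := by
  refine ⟨L.contDiff.comp_contDiffOn hf.contDiffOn, fun τ hτ => ?_⟩
  obtain ⟨C, hC⟩ := hf.bound τ hτ
  have hτ' : (τ : WithTop ℕ∞) ≤ N := by exact_mod_cast hτ
  refine ⟨‖L‖ * C, fun y hy => ?_⟩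
  refine (L.norm_iteratedFDerivWithin_comp_left (hf.contDiffOn y hy)
    isOpen_enlargedHalfSpace.uniqueDiffOn hy hτ').trans ?_
  rw [mul_assoc]
  exact mul_le_mul_of_nonneg_left (hC y hy) (norm_nonneg L)

theorem IsSymbol.mul {f f' : EuclideanSpace ℝ (Fin (m + 1)) → ℝ} (hf : IsSymbol N d f)
    (hf' : IsSymbol N d' f') : IsSymbol N (d + d') (fun y => f y * f' y) := by
  refine ⟨hf.contDiffOn.mul hf'.contDiffOn, fun τ hτ => ?_⟩
  have hτ' : (τ : WithTop ℕ∞) ≤ N := by exact_mod_cast hτ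
  choose! C hC using hf.bound
  choose! C' hC' using hf'.bound
  refine ⟨∑ i ∈ Finset.range (τ + 1), (τ.choose i : ℝ) * (C i * C' (τ - i)), fun y hy => ?_⟩
  refine (norm_iteratedFDerivWithin_mul_le hf.contDiffOn hf'.contDiffOn
    isOpen_enlargedHalfSpace.uniqueDiffOn hy hτ').trans ?_
  rw [Finset.sum_mul]
  refine Finset.sum_le_sum fun i hi => ?_
  have hi' : i ≤ τ := Nat.lt_succ_iff.1 (Finset.mem_range.1 hi)
  have hr := rho_pos_of_mem_enlarged hy
  have h1 := hC i (hi'.trans hτ) y hy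
  have h2 := hC' (τ - i) ((Nat.sub_le _ _).trans hτ) y hy
  have h3 : rho y ^ ((d + d' - τ) / 2) =
      rho y ^ ((d - i) / 2) * rho y ^ ((d' - (τ - i : ℕ)) / 2) := by
    rw [← Real.rpow_add hr, Nat.cast_sub hi']
    congr 1
    ring
  rw [h3, mul_assoc]
  calc (τ.choose i : ℝ) * (‖iteratedFDerivWithin ℝ i f (enlargedHalfSpace m) y‖ *
        ‖iteratedFDerivWithin ℝ (τ - i) f' (enlargedHalfSpace m) y‖)
      ≤ (τ.choose i : ℝ) * ((C i * rho y ^ ((d - i) / 2)) *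
        (C' (τ - i) * rho y ^ ((d' - (τ - i : ℕ)) / 2))) := by
        gcongr
        exact (norm_nonneg _).trans h1
    _ = _ := by ring

theorem IsSymbol.const_mul {f : EuclideanSpace ℝ (Fin (m + 1)) → ℝ} (hf : IsSymbol N d f) (c : ℝ) :
    IsSymbol N d (fun y => c * f y) := by
  simpa using (isSymbol_const c).mul hf

theorem IsSymbol.of_continuousOn (hf : ContinuousOn f (enlargedHalfSpace m)) {C : ℝ}
    (hC : ∀ y ∈ enlargedHalfSpace m, ‖f y‖ ≤ C * rho y ^ (d / 2)) : IsSymbol 0 d f := by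
  refine ⟨contDiffOn_zero.2 hf, fun τ hτ => ⟨C, fun y hy => ?_⟩⟩
  obtain rfl : τ = 0 := by omega
  simpa using hC y hy

/-- Reduces a bound on N + 1 derivatives to the size of f and the symbol property of its derivative,
so families closed under differentiation are handled by induction on N. -/
theorem IsSymbol.of_hasFDerivAt {f' : EuclideanSpace ℝ (Fin (m + 1)) →
      EuclideanSpace ℝ (Fin (m + 1)) →L[ℝ] F}
    (hf : ∀ y ∈ enlargedHalfSpace m, HasFDerivAt f (f' y) y) {C : ℝ}
    (hC : ∀ y ∈ enlargedHalfSpace m, ‖f y‖ ≤ C * rho y ^ (d / 2))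
    (hf' : IsSymbol N (d - 1) f') : IsSymbol (N + 1) d f := by
  have hu : UniqueDiffOn ℝ (enlargedHalfSpace m) := isOpen_enlargedHalfSpace.uniqueDiffOn
  refine ⟨?_, fun τ hτ => ?_⟩
  · push_cast
    rw [contDiffOn_succ_iff_hasFDerivWithinAt_of_uniqueDiffOn hu]
    exact ⟨by simp, f', hf'.contDiffOn, fun y hy => (hf y hy).hasFDerivWithinAt⟩
  · rcases τ with _ | τ
    · exact ⟨C, fun y hy => by simpa using hC y hy⟩
    · obtain ⟨C', hC'⟩ := hf'.bound τ (by omega)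
      refine ⟨C', fun y hy => ?_⟩
      have h1 : Set.EqOn (fderivWithin ℝ f (enlargedHalfSpace m)) f' (enlargedHalfSpace m) :=
        fun x hx => (hf x hx).hasFDerivWithinAt.fderivWithin (hu x hx)
      rw [← norm_iteratedFDerivWithin_fderivWithin hu hy, iteratedFDerivWithin_congr h1 hy]
      convert! hC' y hy using 3
      push_cast
      ring

/-- Real functions are symbols as soon as their partial derivatives are. -/
theorem IsSymbol.of_pd {f : EuclideanSpace ℝ (Fin (m + 1)) → ℝ}
    {f' : Fin (m + 1) → EuclideanSpace ℝ (Fin (m + 1)) → ℝ}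
    (hf : ∀ y ∈ enlargedHalfSpace m, HasFDerivAt f
      (∑ a, f' a y • (EuclideanSpace.proj a : EuclideanSpace ℝ (Fin (m + 1)) →L[ℝ] ℝ)) y) {C : ℝ}
    (hC : ∀ y ∈ enlargedHalfSpace m, ‖f y‖ ≤ C * rho y ^ (d / 2))
    (hf' : ∀ a, IsSymbol N (d - 1) (f' a)) : IsSymbol (N + 1) d f :=
  IsSymbol.of_hasFDerivAt hf hC (IsSymbol.sum fun a _ =>
    (hf' a).clm_comp (ContinuousLinearMap.toSpanSingleton ℝ
      (EuclideanSpace.proj a : EuclideanSpace ℝ (Fin (m + 1)) →L[ℝ] ℝ)))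

theorem abs_add_normalVec_le (a : Fin (m + 1)) (y : EuclideanSpace ℝ (Fin (m + 1))) :
    |(y + normalVec m) a| ≤ rho y ^ (1 / 2 : ℝ) := by
  rw [rho_eq_norm_sq, ← Real.sqrt_eq_rpow, Real.sqrt_sq (norm_nonneg _)]
  exact PiLp.norm_apply_le (y + normalVec m) a

theorem isSymbol_coord (a : Fin (m + 1)) :
    IsSymbol (m := m) N 1 (fun y => (y + normalVec m) a) := by
  -- The derivative is constant, hence a symbol of degree 0 and any order. The recursion produces
  -- order N + 1, which then gives order N, including N = 0.
  have h1 : ∀ N, IsSymbol (m := m) (N + 1) 1 (fun y => (y + normalVec m) a) := fun N => by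
    refine IsSymbol.of_hasFDerivAt (C := 1)
      (f' := fun _ => (EuclideanSpace.proj a : EuclideanSpace ℝ (Fin (m + 1)) →L[ℝ] ℝ))
      (fun y _ => ?_) (fun y _ => ?_) ?_
    · exact ((EuclideanSpace.proj (𝕜 := ℝ) a).hasFDerivAt).comp y
        ((hasFDerivAt_id y).add_const (normalVec m))
    · rw [one_mul]; exact abs_add_normalVec_le a y
    · rw [sub_self]; exact isSymbol_const _
  have h2 := h1 N
  exact ⟨h2.contDiffOn.of_le (by exact_mod_cast Nat.le_succ N),
    fun τ hτ => h2.bound τ (hτ.trans (Nat.le_succ N))⟩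

theorem isSymbol_coord_succ (i : Fin m) : IsSymbol (m := m) N 1 (fun y => y i.succ) := by
  simpa using isSymbol_coord (N := N) i.succ

theorem isSymbol_coord_zero : IsSymbol (m := m) N 1 (fun y => y 0) := by
  have := (isSymbol_coord (m := m) (N := N) 0).add ((isSymbol_const (-1)).mono zero_le_one)
  simpa using this

end Symbol

/-! ### Potentials of moments on the normal line -/

section LinePotential

variable {m : ℕ}

/-- `∫_{λ > 0} λ ^ j |y + (1 + λ) e| ^ (-2β) dλ`, where `e` is the inward normal. -/
def linePotential (j : ℕ) (β : ℝ) (y : EuclideanSpace ℝ (Fin (m + 1))) : ℝ :=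
  ∫ l in Set.Ioi (0 : ℝ), l ^ j * rho (y + l • normalVec m) ^ (-β)

theorem rho_add_smul (y : EuclideanSpace ℝ (Fin (m + 1))) (l : ℝ) :
    rho (y + l • normalVec m) = rho y + 2 * (1 + y 0) * l + l ^ 2 := by
  simp [rho]
  ring

theorem add_smul_mem_enlarged {y : EuclideanSpace ℝ (Fin (m + 1))} (hy : y ∈ enlargedHalfSpace m)
    {l : ℝ} (hl : 0 ≤ l) : y + l • normalVec m ∈ enlargedHalfSpace m := by
  have h : -(1 / 2) < y 0 := hy
  change -(1 / 2) < (y + l • normalVec m) 0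
  simp
  linarith

/-- As 1 + t > 0 the cross term in ρ(y+le) is nonnegative, so ρ(y+le) ≥ ρ(y) + l². This reduces the
potentials to one-dimensional integrals of powers of l + √ρ. -/
theorem half_sq_le_rho {y : EuclideanSpace ℝ (Fin (m + 1))} (hy : y ∈ enlargedHalfSpace m)
    {l : ℝ} (hl : 0 ≤ l) : (l + √(rho y)) ^ 2 / 2 ≤ rho (y + l • normalVec m) := by
  have h : -(1 / 2) < y 0 := hy
  have h1 := Real.sq_sqrt (rho_nonneg y)
  rw [rho_add_smul]
  nlinarith [sq_nonneg (l - √(rho y)), mul_nonneg (by linarith : 0 ≤ 1 + y 0) hl]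

theorem half_le_sqrt_rho {y : EuclideanSpace ℝ (Fin (m + 1))} (hy : y ∈ enlargedHalfSpace m) :
    1 / 2 ≤ √(rho y) :=
  Real.le_sqrt_of_sq_le (by norm_num; linarith [quarter_le_rho hy])

theorem rho_rpow_neg_le {β : ℝ} (hβ : 0 ≤ β) {y : EuclideanSpace ℝ (Fin (m + 1))}
    (hy : y ∈ enlargedHalfSpace m) {l : ℝ} (hl : 0 ≤ l) :
    rho (y + l • normalVec m) ^ (-β) ≤ 2 ^ β * (l + √(rho y)) ^ (-(2 * β)) := by
  have h0 : 0 < l + √(rho y) := by have := half_le_sqrt_rho hy; linarith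
  calc rho (y + l • normalVec m) ^ (-β) ≤ ((l + √(rho y)) ^ 2 / 2) ^ (-β) :=
        Real.rpow_le_rpow_of_nonpos (by positivity) (half_sq_le_rho hy hl) (by linarith)
    _ = 2 ^ β * (l + √(rho y)) ^ (-(2 * β)) := by
        rw [Real.div_rpow (by positivity) (by norm_num), Real.rpow_neg (by norm_num : (0 : ℝ) ≤ 2),
          div_inv_eq_mul, ← Real.rpow_natCast, ← Real.rpow_mul h0.le, mul_comm]
        congr 2
        push_cast; ring

theorem pow_mul_rho_rpow_le (j : ℕ) {β : ℝ} (hβ : 0 ≤ β) {y : EuclideanSpace ℝ (Fin (m + 1))}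
    (hy : y ∈ enlargedHalfSpace m) {l : ℝ} (hl : 0 ≤ l) :
    l ^ j * rho (y + l • normalVec m) ^ (-β) ≤ 2 ^ β * (l + √(rho y)) ^ (j - 2 * β) := by
  have h0 : 0 < l + √(rho y) := by have := half_le_sqrt_rho hy; linarith
  have h1 := rho_rpow_neg_le hβ hy hl
  have h2 : l ^ j ≤ (l + √(rho y)) ^ j := pow_le_pow_left₀ hl (by linarith [Real.sqrt_nonneg (rho y)]) j
  calc l ^ j * rho (y + l • normalVec m) ^ (-β)
      ≤ (l + √(rho y)) ^ j * (2 ^ β * (l + √(rho y)) ^ (-(2 * β))) := by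
        gcongr
        exact Real.rpow_nonneg (rho_nonneg _) _
    _ = 2 ^ β * ((l + √(rho y)) ^ (j : ℝ) * (l + √(rho y)) ^ (-(2 * β))) := by
        rw [Real.rpow_natCast]; ring
    _ = _ := by rw [← Real.rpow_add h0, sub_eq_add_neg]

theorem continuous_rho_line (y : EuclideanSpace ℝ (Fin (m + 1))) :
    Continuous fun l : ℝ => rho (y + l • normalVec m) := by
  simp only [rho_add_smul]; fun_prop

theorem continuousOn_line (j : ℕ) (β : ℝ) {y : EuclideanSpace ℝ (Fin (m + 1))}
    (hy : y ∈ enlargedHalfSpace m) :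
    ContinuousOn (fun l : ℝ => l ^ j * rho (y + l • normalVec m) ^ (-β)) (Set.Ioi 0) :=
  (continuous_pow j).continuousOn.mul ((continuous_rho_line y).continuousOn.rpow_const fun _ hl =>
    Or.inl (rho_pos_of_mem_enlarged (add_smul_mem_enlarged hy (le_of_lt hl))).ne')

theorem integrableOn_shift_rpow {a c : ℝ} (ha : a < -1) (hc : 0 < c) :
    IntegrableOn (fun l : ℝ => (l + c) ^ a) (Set.Ioi 0) :=
  integrableOn_add_rpow_Ioi_of_lt ha (by linarith)

theorem integral_shift_rpow {a c : ℝ} (ha : a < -1) (hc : 0 < c) :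
    ∫ l in Set.Ioi (0 : ℝ), (l + c) ^ a = -c ^ (a + 1) / (a + 1) := by
  have hd : ∀ x ∈ Set.Ici (0 : ℝ),
      HasDerivAt (fun t => (t + c) ^ (a + 1) / (a + 1)) ((x + c) ^ a) x := by
    intro x hx
    have hx' : 0 ≤ x := hx
    have h := (((hasDerivAt_id x).add_const c).rpow_const (p := a + 1)
      (Or.inl (by simp only [id]; positivity))).div_const (a + 1)
    refine h.congr_deriv ?_
    have : a + 1 ≠ 0 := by linarith
    simp only [id, add_sub_cancel_right]
    field_simp
  have ht : Filter.Tendsto (fun t => (t + c) ^ (a + 1) / (a + 1)) Filter.atTop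
      (𝓝 (0 / (a + 1))) := by
    rw [← neg_neg (a + 1)]
    exact ((tendsto_rpow_neg_atTop (by linarith)).comp
      (Filter.tendsto_atTop_add_const_right _ c Filter.tendsto_id)).div_const _
  rw [integral_Ioi_of_hasDerivAt_of_tendsto' hd (integrableOn_shift_rpow ha hc) ht]
  simp [neg_div]

variable {j : ℕ} {β : ℝ} {y : EuclideanSpace ℝ (Fin (m + 1))}

theorem integrableOn_line (hj : (j : ℝ) + 1 < 2 * β) (hy : y ∈ enlargedHalfSpace m) :
    IntegrableOn (fun l : ℝ => l ^ j * rho (y + l • normalVec m) ^ (-β)) (Set.Ioi 0) := by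
  have hβ : 0 ≤ β := by have : (0 : ℝ) ≤ j := Nat.cast_nonneg j; linarith
  have hc : 0 < √(rho y) := lt_of_lt_of_le (by norm_num) (half_le_sqrt_rho hy)
  refine Integrable.mono' ((integrableOn_shift_rpow (a := j - 2 * β) (by linarith) hc).const_mul
    (2 ^ β)) ((continuousOn_line j β hy).aestronglyMeasurable measurableSet_Ioi) ?_
  filter_upwards [ae_restrict_mem measurableSet_Ioi] with l hl
  have hl' : 0 < l := hl
  rw [Real.norm_of_nonneg (mul_nonneg (by positivity) (Real.rpow_nonneg (rho_nonneg _) _))]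
  exact pow_mul_rho_rpow_le j hβ hy hl'.le

theorem linePotential_nonneg : 0 ≤ linePotential j β y :=
  setIntegral_nonneg measurableSet_Ioi fun _ hl =>
    mul_nonneg (pow_nonneg (le_of_lt hl) _) (Real.rpow_nonneg (rho_nonneg _) _)

theorem linePotential_le (hj : (j : ℝ) + 1 < 2 * β) (hy : y ∈ enlargedHalfSpace m) :
    linePotential j β y ≤ 2 ^ β / (2 * β - j - 1) * rho y ^ ((j + 1 - 2 * β) / 2) := by
  have hβ : 0 ≤ β := by have : (0 : ℝ) ≤ j := Nat.cast_nonneg j; linarith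
  have hc : 0 < √(rho y) := lt_of_lt_of_le (by norm_num) (half_le_sqrt_rho hy)
  calc linePotential j β y
      ≤ ∫ l in Set.Ioi (0 : ℝ), 2 ^ β * (l + √(rho y)) ^ (j - 2 * β) :=
        setIntegral_mono_on (integrableOn_line hj hy)
          ((integrableOn_shift_rpow (by linarith) hc).const_mul _) measurableSet_Ioi
          fun l hl => pow_mul_rho_rpow_le j hβ hy (le_of_lt hl)
    _ = _ := by
        rw [integral_const_mul, integral_shift_rpow (by linarith) hc, Real.sqrt_eq_rpow,
          ← Real.rpow_mul (rho_nonneg y)]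
        have h1 : (j : ℝ) - 2 * β + 1 ≠ 0 := by linarith
        have h2 : 2 * β - j - 1 ≠ 0 := by linarith
        rw [show 1 / 2 * ((j : ℝ) - 2 * β + 1) = (j + 1 - 2 * β) / 2 by ring,
          show (j : ℝ) - 2 * β + 1 = -(2 * β - j - 1) by ring, neg_div_neg_eq]
        ring

theorem hasFDerivAt_rho_rpow (p : ℝ) (hy : 0 < rho y) :
    HasFDerivAt (fun y => rho y ^ p) (∑ a, (2 * p * (y + normalVec m) a * rho y ^ (p - 1)) •
      (EuclideanSpace.proj a : EuclideanSpace ℝ (Fin (m + 1)) →L[ℝ] ℝ)) y := by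
  refine ((contDiffAt_rho_rpow (n := 1) p hy).differentiableAt
    (by norm_num)).hasFDerivAt.congr_fderiv ?_
  ext v
  rw [fderiv_apply_eq_sum]
  simp only [pd_rho_rpow p hy, FunLike.coe_sum, Finset.sum_apply, FunLike.coe_smul, Pi.smul_apply,
    smul_eq_mul]
  exact Finset.sum_congr rfl fun a _ => mul_comm _ _

/-- The derivative in `y` of the integrand of `linePotential`. -/
def lineDeriv' (j : ℕ) (β : ℝ) (y : EuclideanSpace ℝ (Fin (m + 1))) (l : ℝ) :
    EuclideanSpace ℝ (Fin (m + 1)) →L[ℝ] ℝ :=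
  l ^ j • ∑ a, (2 * -β * (y + l • normalVec m + normalVec m) a *
    rho (y + l • normalVec m) ^ (-β - 1)) •
      (EuclideanSpace.proj a : EuclideanSpace ℝ (Fin (m + 1)) →L[ℝ] ℝ)

theorem hasFDerivAt_line (hy : y ∈ enlargedHalfSpace m) {l : ℝ} (hl : 0 ≤ l) :
    HasFDerivAt (fun y => l ^ j * rho (y + l • normalVec m) ^ (-β)) (lineDeriv' j β y l) y := by
  have h := hasFDerivAt_rho_rpow (-β) (rho_pos_of_mem_enlarged (add_smul_mem_enlarged hy hl))
  exact ((hasFDerivAt_comp_add_right (l • normalVec m)).2 h).const_mul (l ^ j)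

theorem lineDeriv'_coeff (j : ℕ) (β : ℝ) (y : EuclideanSpace ℝ (Fin (m + 1))) (l : ℝ) :
    lineDeriv' j β y l = ∑ a, (-(2 * β) * ((y + normalVec m) a *
        (l ^ j * rho (y + l • normalVec m) ^ (-(β + 1))) +
      (if a = 0 then 1 else 0) * (l ^ (j + 1) * rho (y + l • normalVec m) ^ (-(β + 1))))) •
      (EuclideanSpace.proj a : EuclideanSpace ℝ (Fin (m + 1)) →L[ℝ] ℝ) := by
  rw [lineDeriv', Finset.smul_sum]
  refine Finset.sum_congr rfl fun a _ => ?_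
  rw [smul_smul, show -β - 1 = -(β + 1) by ring]
  congr 1
  have h : (y + l • normalVec m + normalVec m) a =
      (y + normalVec m) a + l * (if a = 0 then 1 else 0) := by
    simp; ring
  rw [h]
  ring

theorem norm_lineDeriv'_le (hβ : 0 ≤ β) (hy : y ∈ enlargedHalfSpace m) {l : ℝ} (hl : 0 ≤ l) :
    ‖lineDeriv' j β y l‖ ≤
      (m + 1) * (2 * β * 2 ^ (β + 1 / 2)) * (l + √(rho y)) ^ (j - 2 * (β + 1 / 2)) := by
  have hr := rho_pos_of_mem_enlarged (add_smul_mem_enlarged hy hl)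
  have hpr : ∀ a, ‖(EuclideanSpace.proj a : EuclideanSpace ℝ (Fin (m + 1)) →L[ℝ] ℝ)‖ ≤ 1 :=
    fun a => ContinuousLinearMap.opNorm_le_bound _ zero_le_one fun v => by
      rw [one_mul]; exact PiLp.norm_apply_le v a
  have hb := pow_mul_rho_rpow_le j (by linarith : 0 ≤ β + 1 / 2) hy hl
  rw [lineDeriv', norm_smul, Real.norm_of_nonneg (by positivity)]
  calc l ^ j * ‖∑ a, (2 * -β * (y + l • normalVec m + normalVec m) a *
        rho (y + l • normalVec m) ^ (-β - 1)) •
        (EuclideanSpace.proj a : EuclideanSpace ℝ (Fin (m + 1)) →L[ℝ] ℝ)‖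
      ≤ l ^ j * ∑ a : Fin (m + 1), (2 * β * rho (y + l • normalVec m) ^ (-(β + 1 / 2))) := by
        refine mul_le_mul_of_nonneg_left ?_ (by positivity)
        refine (norm_sum_le _ _).trans (Finset.sum_le_sum fun a _ => ?_)
        rw [norm_smul]
        refine (mul_le_of_le_one_right (norm_nonneg _) (hpr a)).trans ?_
        rw [norm_mul, norm_mul, Real.norm_of_nonneg (Real.rpow_nonneg hr.le _), Real.norm_eq_abs,
          Real.norm_eq_abs, abs_mul, abs_two, abs_neg, abs_of_nonneg hβ]
        calc 2 * β * |(y + l • normalVec m + normalVec m) a| *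
              rho (y + l • normalVec m) ^ (-β - 1)
            ≤ 2 * β * rho (y + l • normalVec m) ^ (1 / 2 : ℝ) *
              rho (y + l • normalVec m) ^ (-β - 1) := by
              gcongr
              exact abs_add_normalVec_le a _
          _ = _ := by
              rw [mul_assoc, ← Real.rpow_add hr]
              congr 2
              ring
    _ = (m + 1) * (2 * β) * (l ^ j * rho (y + l • normalVec m) ^ (-(β + 1 / 2))) := by
        rw [Finset.sum_const, Finset.card_univ, Fintype.card_fin, nsmul_eq_mul]
        push_cast
        ring
    _ ≤ (m + 1) * (2 * β) * (2 ^ (β + 1 / 2) * (l + √(rho y)) ^ (j - 2 * (β + 1 / 2))) := by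
        gcongr
    _ = _ := by ring

/-- The family is closed under differentiation: ∂_a raises β by one and, in the normal direction,
also produces the moment with j + 1. Both preserve the convergence condition j + 1 < 2β. -/
theorem hasFDerivAt_linePotential (hj : (j : ℝ) + 1 < 2 * β) (hy : y ∈ enlargedHalfSpace m) :
    HasFDerivAt (linePotential j β) (∑ a, (-(2 * β) *
      ((y + normalVec m) a * linePotential j (β + 1) y +
        (if a = 0 then 1 else 0) * linePotential (j + 1) (β + 1) y)) •
      (EuclideanSpace.proj a : EuclideanSpace ℝ (Fin (m + 1)) →L[ℝ] ℝ)) y := by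
  have hj0 : (0 : ℝ) ≤ j := Nat.cast_nonneg j
  have hβ : 0 ≤ β := by linarith
  have hi1 := integrableOn_line (j := j) (β := β + 1) (by linarith) hy
  have hi2 := integrableOn_line (j := j + 1) (β := β + 1) (by push_cast; linarith) hy
  have hi3 : ∀ a : Fin (m + 1), IntegrableOn (fun l : ℝ => -(2 * β) * ((y + normalVec m) a *
        (l ^ j * rho (y + l • normalVec m) ^ (-(β + 1))) +
      (if a = 0 then 1 else 0) * (l ^ (j + 1) * rho (y + l • normalVec m) ^ (-(β + 1)))))
      (Set.Ioi 0) := fun a => ((hi1.const_mul _).add (hi2.const_mul _)).const_mul _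
  have h := hasFDerivAt_integral_of_dominated_of_fderiv_le (𝕜 := ℝ)
    (μ := volume.restrict (Set.Ioi (0 : ℝ)))
    (F := fun (y : EuclideanSpace ℝ (Fin (m + 1))) (l : ℝ) =>
      l ^ j * rho (y + l • normalVec m) ^ (-β)) (F' := lineDeriv' j β) (x₀ := y)
    -- The lower bound √ρ ≥ 1/2 on the enlarged half-space makes the dominating function independent
    -- of the point.
    (s := enlargedHalfSpace m) (bound := fun l => (m + 1) * (2 * β * 2 ^ (β + 1 / 2)) *
      (l + 1 / 2) ^ (j - 2 * (β + 1 / 2))) (isOpen_enlargedHalfSpace.mem_nhds hy) ?_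
    (integrableOn_line hj hy) ?_ ?_ ?_ ?_
  · refine h.congr_fderiv ?_
    rw [show lineDeriv' j β y = _ from funext (lineDeriv'_coeff j β y)]
    rw [integral_finsetSum _ fun a _ => (hi3 a).smul_const _]
    refine Finset.sum_congr rfl fun a _ => ?_
    rw [integral_smul_const, integral_const_mul, integral_add (hi1.const_mul _) (hi2.const_mul _),
      integral_const_mul, integral_const_mul]
    rfl
  · filter_upwards [isOpen_enlargedHalfSpace.mem_nhds hy] with x hx
    exact (continuousOn_line j β hx).aestronglyMeasurable measurableSet_Ioi
  · rw [show lineDeriv' j β y = _ from funext (lineDeriv'_coeff j β y)]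
    exact (integrable_finsetSum _ fun a _ => (hi3 a).smul_const _).aestronglyMeasurable
  · filter_upwards [ae_restrict_mem measurableSet_Ioi] with l hl x hx
    have hl' : 0 < l := hl
    refine (norm_lineDeriv'_le hβ hx hl'.le).trans ?_
    refine mul_le_mul_of_nonneg_left ?_ (by positivity)
    exact Real.rpow_le_rpow_of_nonpos (by positivity)
      (by linarith [half_le_sqrt_rho hx]) (by linarith)
  · exact (integrableOn_shift_rpow (by linarith) (by norm_num)).const_mul _
  · filter_upwards [ae_restrict_mem measurableSet_Ioi] with l hl x hx
    exact hasFDerivAt_line hx (le_of_lt hl)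

theorem norm_linePotential_le (hj : (j : ℝ) + 1 < 2 * β) (hy : y ∈ enlargedHalfSpace m) :
    ‖linePotential j β y‖ ≤ 2 ^ β / (2 * β - j - 1) * rho y ^ ((j + 1 - 2 * β) / 2) := by
  rw [Real.norm_of_nonneg linePotential_nonneg]
  exact linePotential_le hj hy

/-- Scaling predicts the degree j + 1 - 2β. The induction runs over N for all j and β at once; each
partial derivative is again a combination of potentials, of degree one less. -/
theorem isSymbol_linePotential {N : ℕ} (hj : (j : ℝ) + 1 < 2 * β) :
    IsSymbol (m := m) N (j + 1 - 2 * β) (linePotential j β) := by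
  induction N generalizing j β with
  | zero =>
    exact IsSymbol.of_continuousOn
      (fun y hy => (hasFDerivAt_linePotential hj hy).continuousAt.continuousWithinAt)
      fun y hy => norm_linePotential_le hj hy
  | succ N ih =>
    refine IsSymbol.of_pd (fun y hy => hasFDerivAt_linePotential hj hy)
      (fun y hy => norm_linePotential_le hj hy) fun a => IsSymbol.const_mul (IsSymbol.add ?_ ?_) _
    · exact ((isSymbol_coord a).mul (ih (by linarith))).mono (by linarith)
    · exact ((ih (by push_cast; linarith)).const_mul _).mono (by push_cast; linarith)

theorem hasDerivAt_rho_line (hy : y ∈ enlargedHalfSpace m) {l : ℝ} (hl : 0 ≤ l) :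
    HasDerivAt (fun l : ℝ => rho (y + l • normalVec m) ^ (-β))
      (-(2 * β) * ((1 + y 0) + l) * rho (y + l • normalVec m) ^ (-(β + 1))) l := by
  have h1 : HasDerivAt (fun l : ℝ => rho (y + l • normalVec m)) (2 * (1 + y 0) + 2 * l) l := by
    simp only [rho_add_smul]
    have := (((hasDerivAt_id l).const_mul (2 * (1 + y 0))).const_add (rho y)).fun_add
      (hasDerivAt_pow 2 l)
    simpa using this
  refine (h1.rpow_const (p := -β) (Or.inl
    (rho_pos_of_mem_enlarged (add_smul_mem_enlarged hy hl)).ne')).congr_deriv ?_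
  rw [show -β - 1 = -(β + 1) by ring]
  ring

theorem tendsto_line (hj : (j : ℝ) < 2 * β) (hy : y ∈ enlargedHalfSpace m) :
    Filter.Tendsto (fun l : ℝ => l ^ j * rho (y + l • normalVec m) ^ (-β)) Filter.atTop (𝓝 0) := by
  have hβ : 0 ≤ β := by have : (0 : ℝ) ≤ j := Nat.cast_nonneg j; linarith
  have h1 : Filter.Tendsto (fun l : ℝ => 2 ^ β * (l + √(rho y)) ^ (j - 2 * β)) Filter.atTop
      (𝓝 (2 ^ β * 0)) := by
    rw [show (j : ℝ) - 2 * β = -(2 * β - j) by ring]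
    exact ((tendsto_rpow_neg_atTop (by linarith)).comp
      (Filter.tendsto_atTop_add_const_right _ _ Filter.tendsto_id)).const_mul _
  rw [mul_zero] at h1
  refine squeeze_zero' ?_ ?_ h1
  · filter_upwards [Filter.eventually_ge_atTop 0] with l hl
    exact mul_nonneg (pow_nonneg hl _) (Real.rpow_nonneg (rho_nonneg _) _)
  · filter_upwards [Filter.eventually_ge_atTop 0] with l hl
    exact pow_mul_rho_rpow_le j hβ hy hl

/-- The fundamental theorem of calculus in λ for ρ(y+λe)^(-β), whose boundary term at λ = 0 is the
left-hand side. -/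
theorem rho_rpow_eq_linePotential (hβ : 0 < β) (hy : y ∈ enlargedHalfSpace m) :
    rho y ^ (-β) = 2 * β * ((1 + y 0) * linePotential 0 (β + 1) y + linePotential 1 (β + 1) y) := by
  have hi1 := integrableOn_line (j := 0) (β := β + 1) (by push_cast; linarith) hy
  have hi2 := integrableOn_line (j := 1) (β := β + 1) (by push_cast; linarith) hy
  have hi3 : IntegrableOn (fun l : ℝ => (1 + y 0) * (l ^ 0 * rho (y + l • normalVec m) ^
      (-(β + 1))) + l ^ 1 * rho (y + l • normalVec m) ^ (-(β + 1))) (Set.Ioi 0) :=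
    (hi1.const_mul _).add hi2
  have h := integral_Ioi_of_hasDerivAt_of_tendsto'
    (f := fun l : ℝ => rho (y + l • normalVec m) ^ (-β)) (a := 0) (m := 0)
    (f' := fun l => -(2 * β) * ((1 + y 0) * (l ^ 0 * rho (y + l • normalVec m) ^ (-(β + 1))) +
      l ^ 1 * rho (y + l • normalVec m) ^ (-(β + 1)))) (fun l hl => ?_)
    (hi3.const_mul _) ?_
  · rw [integral_const_mul, integral_add (hi1.const_mul _) hi2, integral_const_mul] at h
    simp only [zero_smul, add_zero, zero_sub] at h
    rw [linePotential, linePotential]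
    linarith
  · refine (hasDerivAt_rho_line hy hl).congr_deriv ?_
    ring
  · simpa using tendsto_line (j := 0) (β := β) (by simpa using hβ) hy

/-- The same for λ^(j+1) ρ(y+λe)^(-β), which vanishes at both ends. -/
theorem succ_mul_linePotential (hj : (j : ℝ) + 1 < 2 * β) (hy : y ∈ enlargedHalfSpace m) :
    ((j : ℝ) + 1) * linePotential j β y = 2 * β * ((1 + y 0) * linePotential (j + 1) (β + 1) y +
      linePotential (j + 2) (β + 1) y) := by
  have hi0 := integrableOn_line hj hy
  have hi1 := integrableOn_line (j := j + 1) (β := β + 1) (by push_cast; linarith) hy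
  have hi2 := integrableOn_line (j := j + 2) (β := β + 1) (by push_cast; linarith) hy
  have hi3 : IntegrableOn (fun l : ℝ => (1 + y 0) * (l ^ (j + 1) * rho (y + l • normalVec m) ^
      (-(β + 1))) + l ^ (j + 2) * rho (y + l • normalVec m) ^ (-(β + 1))) (Set.Ioi 0) :=
    (hi1.const_mul _).add hi2
  have h := integral_Ioi_of_hasDerivAt_of_tendsto'
    (f := fun l : ℝ => l ^ (j + 1) * rho (y + l • normalVec m) ^ (-β)) (a := 0) (m := 0)
    (f' := fun l => ((j : ℝ) + 1) * (l ^ j * rho (y + l • normalVec m) ^ (-β)) +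
      -(2 * β) * ((1 + y 0) * (l ^ (j + 1) * rho (y + l • normalVec m) ^ (-(β + 1))) +
      l ^ (j + 2) * rho (y + l • normalVec m) ^ (-(β + 1)))) (fun l hl => ?_)
    ((hi0.const_mul _).add (hi3.const_mul _))
    (tendsto_line (by push_cast; linarith) hy)
  · rw [integral_add (hi0.const_mul _) (hi3.const_mul _),
      integral_const_mul, integral_const_mul, integral_add (hi1.const_mul _) hi2,
      integral_const_mul] at h
    simp only [zero_pow (Nat.succ_ne_zero j), zero_mul, sub_zero] at h
    rw [linePotential, linePotential, linePotential]
    linarith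
  · refine ((hasDerivAt_pow (j + 1) l).mul (hasDerivAt_rho_line hy hl)).congr_deriv ?_
    simp only [Nat.add_sub_cancel]
    push_cast
    ring

/-- One power of ρ(y+λe) = ρ + 2(1+t)λ + λ² is split off and expanded in λ. -/
theorem linePotential_expand (hj : (j : ℝ) + 1 < 2 * β) (hy : y ∈ enlargedHalfSpace m) :
    linePotential j β y = rho y * linePotential j (β + 1) y +
      2 * (1 + y 0) * linePotential (j + 1) (β + 1) y + linePotential (j + 2) (β + 1) y := by
  have hi0 := integrableOn_line (j := j) (β := β + 1) (by linarith) hy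
  have hi1 := integrableOn_line (j := j + 1) (β := β + 1) (by push_cast; linarith) hy
  have hi2 := integrableOn_line (j := j + 2) (β := β + 1) (by push_cast; linarith) hy
  have hi3 : IntegrableOn (fun l : ℝ => rho y * (l ^ j * rho (y + l • normalVec m) ^ (-(β + 1))) +
      2 * (1 + y 0) * (l ^ (j + 1) * rho (y + l • normalVec m) ^ (-(β + 1)))) (Set.Ioi 0) :=
    (hi0.const_mul _).add (hi1.const_mul _)
  simp only [linePotential]
  rw [← integral_const_mul, ← integral_const_mul, ← integral_add (hi0.const_mul _)
    (hi1.const_mul _), ← integral_add hi3 hi2]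
  refine setIntegral_congr_fun measurableSet_Ioi fun l hl => ?_
  have hr := rho_pos_of_mem_enlarged (add_smul_mem_enlarged hy (le_of_lt hl))
  have h1 : rho (y + l • normalVec m) ^ (-β) =
      rho (y + l • normalVec m) * rho (y + l • normalVec m) ^ (-(β + 1)) := by
    rw [← Real.rpow_one_add' hr.le (by ring_nf; exact fun h => by linarith [(Nat.cast_nonneg j : (0 : ℝ) ≤ j)])]
    congr 1; ring
  simp only [h1]
  nth_rw 1 [rho_add_smul]
  ring

end LinePotential

/-! ### The radial profile of the solution -/

section Profile

variable {m : ℕ}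

theorem pd_zero_of_isOpen {f g : EuclideanSpace ℝ (Fin (m + 1)) → ℝ}
    {y : EuclideanSpace ℝ (Fin (m + 1))} (h : Set.EqOn f g (enlargedHalfSpace m))
    (hy : y ∈ enlargedHalfSpace m) (a : Fin (m + 1)) :
    pd Set.univ f a y = pd Set.univ g a y :=
  pd_univ_congr (Filter.mem_of_superset (isOpen_enlargedHalfSpace.mem_nhds hy) h) a

theorem IsSymbol.contDiffAt {F : Type*} [NormedAddCommGroup F] [NormedSpace ℝ F] {N : ℕ} {d : ℝ}
    {f : EuclideanSpace ℝ (Fin (m + 1)) → F} (hf : IsSymbol N d f)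
    {y : EuclideanSpace ℝ (Fin (m + 1))} (hy : y ∈ enlargedHalfSpace m) : ContDiffAt ℝ N f y :=
  hf.contDiffOn.contDiffAt (isOpen_enlargedHalfSpace.mem_nhds hy)

theorem add_normalVec_zero (y : EuclideanSpace ℝ (Fin (m + 1))) :
    (y + normalVec m) 0 = 1 + y 0 := by
  simp [add_comm]

section Potential

variable {j : ℕ} {β : ℝ} {y : EuclideanSpace ℝ (Fin (m + 1))}

theorem contDiffAt_linePotential {N : ℕ} (hj : (j : ℝ) + 1 < 2 * β)
    (hy : y ∈ enlargedHalfSpace m) : ContDiffAt ℝ N (linePotential j β) y :=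
  (isSymbol_linePotential hj).contDiffAt hy

theorem pd_linePotential (hj : (j : ℝ) + 1 < 2 * β) (hy : y ∈ enlargedHalfSpace m)
    (a : Fin (m + 1)) : pd Set.univ (linePotential j β) a y = -(2 * β) *
      ((y + normalVec m) a * linePotential j (β + 1) y +
        (if a = 0 then 1 else 0) * linePotential (j + 1) (β + 1) y) := by
  rw [pd_eq_of_hasFDerivAt (hasFDerivAt_linePotential hj hy)]
  simp

/-- Moving y in the normal direction is the same as moving λ, so ∂_t integrates to a boundary term.
-/
theorem pd_zero_linePotential_zero (hβ : 1 < 2 * β) (hy : y ∈ enlargedHalfSpace m) :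
    pd Set.univ (linePotential 0 β) 0 y = -rho y ^ (-β) := by
  rw [pd_linePotential (by simpa using hβ) hy, rho_rpow_eq_linePotential (by linarith) hy, add_normalVec_zero, if_pos rfl, zero_add]
  ring

/-- As before ∂_t acts as d/dλ, and an integration by parts puts the derivative on λ^(j+1). Thus ∂_t
lowers the moment, which makes the recursion for the profile terminate. -/
theorem pd_zero_linePotential_succ (hj : (j : ℝ) + 2 < 2 * β) (hy : y ∈ enlargedHalfSpace m) :
    pd Set.univ (linePotential (j + 1) β) 0 y = -((j : ℝ) + 1) * linePotential j β y := by
  have h := succ_mul_linePotential (j := j) (β := β) (by linarith) hy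
  rw [pd_linePotential (by push_cast; linarith) hy, neg_mul ((j : ℝ) + 1), h,
    add_normalVec_zero, if_pos rfl]
  ring

/-- A superposition of Δ|x|^(-2β) = 2β(2β+2-n)|x|^(-2β-2) with n = m + 1. For β = (m+3)/2 the
constant is 4(m+3), which expresses that |x|^(-(n+2)) is harmonic in dimension n + 4. -/
theorem laplacian_linePotential (hj : (j : ℝ) + 1 < 2 * β) (hy : y ∈ enlargedHalfSpace m) :
    Laplacian.laplacian (linePotential j β) y =
      2 * β * (2 * β + 1 - m) * linePotential j (β + 1) y := by
  rw [laplacian_eq_sum_pd (contDiffAt_linePotential hj hy)]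
  have h1 : ∀ a, pd Set.univ (pd Set.univ (linePotential j β) a) a y = -(2 * β) *
      (linePotential j (β + 1) y + (y + normalVec m) a * (-(2 * (β + 1)) *
        ((y + normalVec m) a * linePotential j (β + 1 + 1) y +
          (if a = 0 then 1 else 0) * linePotential (j + 1) (β + 1 + 1) y)) +
        (if a = 0 then 1 else 0) * (-(2 * (β + 1)) *
          ((y + normalVec m) a * linePotential (j + 1) (β + 1 + 1) y +
          (if a = 0 then 1 else 0) * linePotential (j + 2) (β + 1 + 1) y))) := by
    intro a
    rw [pd_zero_of_isOpen (fun x hx => pd_linePotential hj hx a) hy]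
    have hj1 : (j : ℝ) + 1 < 2 * (β + 1) := by linarith
    have hj2 : ((j + 1 : ℕ) : ℝ) + 1 < 2 * (β + 1) := by push_cast; linarith
    have d1 : DifferentiableAt ℝ (linePotential (m := m) j (β + 1)) y :=
      (hasFDerivAt_linePotential hj1 hy).differentiableAt
    have d2 : DifferentiableAt ℝ (linePotential (m := m) (j + 1) (β + 1)) y :=
      (hasFDerivAt_linePotential hj2 hy).differentiableAt
    have hc : ∀ r : ℝ, DifferentiableAt ℝ (fun _ : EuclideanSpace ℝ (Fin (m + 1)) => r) y :=
      fun r => differentiableAt_const r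
    have d3 : DifferentiableAt ℝ (fun y : EuclideanSpace ℝ (Fin (m + 1)) => y a) y :=
      (contDiff_coord (n := 1) a).differentiable (by norm_num) y
    simp only [PiLp.add_apply]
    have d4 := d3.fun_add (hc (normalVec m a))
    rw [pd_univ_mul (hc _) ((d4.fun_mul d1).fun_add ((hc _).fun_mul d2)),
      pd_univ_add (d4.fun_mul d1) ((hc _).fun_mul d2), pd_univ_mul d4 d1, pd_univ_mul (hc _) d2,
      pd_univ_add d3 (hc _), pd_const, pd_const, pd_const, pd_coord, pd_linePotential hj1 hy,
      pd_linePotential hj2 hy, if_pos rfl]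
    simp only [PiLp.add_apply]
    ring
  -- Reassembles the three moments produced by the second derivatives into one potential with
  -- exponent β + 1.
  have h2 := linePotential_expand (j := j) (β := β + 1) (by linarith) hy
  have h3 : rho y = ∑ a, (y + normalVec m) a * (y + normalVec m) a := by
    rw [rho_eq_norm_sq, norm_sq_eq_sum]
  have h4 : ∑ a, pd Set.univ (pd Set.univ (linePotential j β) a) a y =
      -(2 * β) * ((m + 1) * linePotential j (β + 1) y - 2 * (β + 1) *
        (rho y * linePotential j (β + 1 + 1) y +
          2 * (1 + y 0) * linePotential (j + 1) (β + 1 + 1) y +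
          linePotential (j + 2) (β + 1 + 1) y)) := by
    have h5 : ∀ a, pd Set.univ (pd Set.univ (linePotential j β) a) a y = -(2 * β) *
        (linePotential j (β + 1) y - 2 * (β + 1) * linePotential j (β + 1 + 1) y *
          ((y + normalVec m) a * (y + normalVec m) a) - if a = 0 then 2 * (β + 1) *
            (2 * (1 + y 0) * linePotential (j + 1) (β + 1 + 1) y +
          linePotential (j + 2) (β + 1 + 1) y) else 0) := by
      intro a
      rw [h1 a]
      by_cases ha : a = 0
      · subst ha
        simp only [add_normalVec_zero, if_true]
        ring
      · simp only [ha, if_false]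
        ring
    rw [Finset.sum_congr rfl fun a _ => h5 a, ← Finset.mul_sum, Finset.sum_sub_distrib,
      Finset.sum_sub_distrib, ← Finset.mul_sum, ← h3]
    simp only [Finset.sum_const, Finset.card_univ, Fintype.card_fin, nsmul_eq_mul,
      Finset.sum_ite_eq', Finset.mem_univ, if_true]
    push_cast
    ring
  rw [h4, ← h2]
  ring

theorem linePotential_congr {y' : EuclideanSpace ℝ (Fin (m + 1))} (h0 : y 0 = y' 0)
    (h : ‖y‖ = ‖y'‖) : linePotential j β y = linePotential j β y' := by
  have hr : rho y = rho y' := by rw [rho_eq, rho_eq, h0, h]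
  simp only [linePotential, rho_add_smul, hr, h0]

end Potential

/-- The coefficients, polynomial in the normal coordinate, of the profile. -/
def profileCoeff (m : ℕ) : ℕ → ℝ → ℝ
  | 0, t => ((m : ℝ) + 1) / 12 * (2 * ((m : ℝ) - 1) * (1 + t ^ 3) -
      2 * ((m : ℝ) + 1) * ((m : ℝ) - 2) / m)
  | 1, t => ((m : ℝ) + 1) / 12 * (3 * ((m : ℝ) - 1) * (1 + t ^ 2) -
      ((m : ℝ) - 2) * (3 * (m : ℝ) + 1) / m)
  | 2, t => ((m : ℝ) + 1) / 12 * (3 / 2 * ((m : ℝ) - 1) * (1 + t) - ((m : ℝ) - 2))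
  | 3, _ => ((m : ℝ) + 1) / 12 * (((m : ℝ) - 1) / 2)
  | _, _ => 0

/-- The derivatives of `profileCoeff`. -/
def profileCoeff' (m : ℕ) : ℕ → ℝ → ℝ
  | 0, t => ((m : ℝ) + 1) / 12 * (6 * ((m : ℝ) - 1) * t ^ 2)
  | 1, t => ((m : ℝ) + 1) / 12 * (6 * ((m : ℝ) - 1) * t)
  | 2, _ => ((m : ℝ) + 1) / 12 * (3 / 2 * ((m : ℝ) - 1))
  | _, _ => 0

/-- The second derivatives of `profileCoeff`. -/
def profileCoeff'' (m : ℕ) : ℕ → ℝ → ℝ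
  | 0, t => ((m : ℝ) + 1) / 12 * (12 * ((m : ℝ) - 1) * t)
  | 1, _ => ((m : ℝ) + 1) / 12 * (6 * ((m : ℝ) - 1))
  | _, _ => 0

theorem hasDerivAt_profileCoeff (k : ℕ) (t : ℝ) :
    HasDerivAt (profileCoeff m k) (profileCoeff' m k t) t := by
  have h1 := hasDerivAt_id t
  match k with
  | 0 =>
    refine ((((hasDerivAt_pow 3 t).const_add 1).const_mul (2 * ((m : ℝ) - 1))).sub_const
      (2 * ((m : ℝ) + 1) * ((m : ℝ) - 2) / m)).const_mul (((m : ℝ) + 1) / 12) |>.congr_deriv ?_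
    simp only [profileCoeff', Nat.cast_ofNat, Nat.reduceSub]; ring
  | 1 =>
    refine ((((hasDerivAt_pow 2 t).const_add 1).const_mul (3 * ((m : ℝ) - 1))).sub_const
      (((m : ℝ) - 2) * (3 * (m : ℝ) + 1) / m)).const_mul (((m : ℝ) + 1) / 12) |>.congr_deriv ?_
    simp only [profileCoeff', Nat.cast_ofNat, Nat.reduceSub, pow_one]; ring
  | 2 =>
    refine (((h1.const_add 1).const_mul (3 / 2 * ((m : ℝ) - 1))).sub_const
      ((m : ℝ) - 2)).const_mul (((m : ℝ) + 1) / 12) |>.congr_deriv ?_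
    simp [profileCoeff']
  | 3 => exact hasDerivAt_const t _
  | k + 4 => exact hasDerivAt_const t _

theorem hasDerivAt_profileCoeff' (k : ℕ) (t : ℝ) :
    HasDerivAt (profileCoeff' m k) (profileCoeff'' m k t) t := by
  have h1 := hasDerivAt_id t
  match k with
  | 0 =>
    refine ((hasDerivAt_pow 2 t).const_mul (6 * ((m : ℝ) - 1))).const_mul
      (((m : ℝ) + 1) / 12) |>.congr_deriv ?_
    simp only [profileCoeff'', Nat.cast_ofNat, Nat.reduceSub, pow_one]; ring
  | 1 =>
    refine (h1.const_mul (6 * ((m : ℝ) - 1))).const_mul (((m : ℝ) + 1) / 12) |>.congr_deriv ?_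
    simp [profileCoeff'']
  | 2 => exact hasDerivAt_const t _
  | 3 => exact hasDerivAt_const t _
  | k + 4 => exact hasDerivAt_const t _

/-- The constant terms chosen for the boundary condition are positive (for instance 4/m and 2 + 2/m,
up to the factor (m+1)/12). This positivity is the source of the sign of ∫ vΔv. -/
theorem profileCoeff_nonneg (hm : 2 ≤ m) (k : ℕ) {t : ℝ} (ht : 0 ≤ t) : 0 ≤ profileCoeff m k t := by
  have hm' : (2 : ℝ) ≤ m := by exact_mod_cast hm
  have h0 : (m : ℝ) ≠ 0 := by positivity
  have h1 : 0 ≤ (m : ℝ) - 1 := by linarith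
  match k with
  | 0 =>
    refine mul_nonneg (by positivity) ?_
    have : 2 * ((m : ℝ) - 1) * (1 + t ^ 3) - 2 * ((m : ℝ) + 1) * ((m : ℝ) - 2) / m =
      2 * ((m : ℝ) - 1) * t ^ 3 + 4 / m := by field_simp; ring
    rw [this]; positivity
  | 1 =>
    refine mul_nonneg (by positivity) ?_
    have : 3 * ((m : ℝ) - 1) * (1 + t ^ 2) - ((m : ℝ) - 2) * (3 * (m : ℝ) + 1) / m =
      3 * ((m : ℝ) - 1) * t ^ 2 + 2 + 2 / m := by field_simp; ring
    rw [this]; positivity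
  | 2 =>
    refine mul_nonneg (by positivity) ?_
    nlinarith [mul_nonneg h1 ht]
  | 3 => exact mul_nonneg (by positivity) (by positivity)
  | k + 4 => exact le_rfl

theorem contDiff_profileCoeff (k : ℕ) : ContDiff ℝ 2 (profileCoeff m k) := by
  match k with
  | 0 => unfold profileCoeff; fun_prop
  | 1 => unfold profileCoeff; fun_prop
  | 2 => unfold profileCoeff; fun_prop
  | 3 => exact contDiff_const
  | k + 4 => exact contDiff_const

/-- The profile `φ`: the solutions are of the form `φ(y) ∑ A_ij y_i y_j`. -/
def profile (y : EuclideanSpace ℝ (Fin (m + 1))) : ℝ :=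
  ∑ k ∈ Finset.range 4, profileCoeff m k (y 0) * linePotential k (((m : ℝ) + 3) / 2) y

variable {y : EuclideanSpace ℝ (Fin (m + 1))}

theorem profile_nonneg (hm : 2 ≤ m) (hy : y ∈ halfSpace m) : 0 ≤ profile y :=
  Finset.sum_nonneg fun k _ => mul_nonneg (profileCoeff_nonneg hm k hy) linePotential_nonneg

theorem profile_congr {y' : EuclideanSpace ℝ (Fin (m + 1))} (h0 : y 0 = y' 0)
    (h : ‖y‖ = ‖y'‖) : profile y = profile y' := by
  simp only [profile, h0, linePotential_congr h0 h]

theorem isSymbol_coord_zero_pow {N : ℕ} (k : ℕ) :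
    IsSymbol (m := m) N k (fun y => y 0 ^ k) := by
  induction k with
  | zero => simpa using isSymbol_const (m := m) (N := N) (1 : ℝ)
  | succ k ih =>
    simp only [pow_succ]
    have := ih.mul isSymbol_coord_zero
    exact_mod_cast this

theorem isSymbol_profileCoeff {N k : ℕ} (hk : k ≤ 3) :
    IsSymbol (m := m) N (3 - k) (fun y => profileCoeff m k (y 0)) := by
  have hc : ∀ (c d : ℝ), 0 ≤ d → IsSymbol (m := m) N d (fun _ => c) := fun c d hd =>
    (isSymbol_const c).mono hd
  interval_cases k
  · have h := (((hc 1 3 (by norm_num)).add ((isSymbol_coord_zero_pow 3).mono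
      (by norm_num : ((3 : ℕ) : ℝ) ≤ 3))).const_mul (2 * ((m : ℝ) - 1))).add
      (hc (-(2 * ((m : ℝ) + 1) * ((m : ℝ) - 2) / m)) 3 (by norm_num))
    refine ((h.const_mul (((m : ℝ) + 1) / 12)).mono (by norm_num)).congr fun y _ => ?_
    simp only [profileCoeff]; ring
  · have h := (((hc 1 2 (by norm_num)).add ((isSymbol_coord_zero_pow 2).mono
      (by norm_num : ((2 : ℕ) : ℝ) ≤ 2))).const_mul (3 * ((m : ℝ) - 1))).add
      (hc (-(((m : ℝ) - 2) * (3 * (m : ℝ) + 1) / m)) 2 (by norm_num))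
    refine ((h.const_mul (((m : ℝ) + 1) / 12)).mono (by norm_num)).congr fun y _ => ?_
    simp only [profileCoeff]; ring
  · have h := (((hc 1 1 (by norm_num)).add (isSymbol_coord_zero)).const_mul
      (3 / 2 * ((m : ℝ) - 1))).add (hc (-((m : ℝ) - 2)) 1 (by norm_num))
    refine ((h.const_mul (((m : ℝ) + 1) / 12)).mono (by norm_num)).congr fun y _ => ?_
    simp only [profileCoeff]; ring
  · exact (hc _ _ (by norm_num))

/-- The k-th coefficient has degree at most 3 - k and the k-th potential degree k + 1 - (m+3), so
every term has degree at most 1 - m. -/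
theorem isSymbol_profile {N : ℕ} (hm : 2 ≤ m) :
    IsSymbol (m := m) N (1 - (m : ℝ)) (profile (m := m)) := by
  have hm' : (2 : ℝ) ≤ m := by exact_mod_cast hm
  refine IsSymbol.sum fun k hk => ?_
  have hk3 : k ≤ 3 := by have := Finset.mem_range.1 hk; omega
  have hk' : (k : ℝ) ≤ 3 := by exact_mod_cast hk3
  exact ((isSymbol_profileCoeff hk3).mul (isSymbol_linePotential (by linarith))).mono (by linarith)

section Equation

variable (hm : 2 ≤ m) (hy : y ∈ enlargedHalfSpace m)

include hm in
theorem lt_of_mem_range_four {k : ℕ} (hk : k ∈ Finset.range 4) :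
    (k : ℝ) + 1 < 2 * (((m : ℝ) + 3) / 2) := by
  have hm' : (2 : ℝ) ≤ m := by exact_mod_cast hm
  have hk3 : k ≤ 3 := by have := Finset.mem_range.1 hk; omega
  have hk' : (k : ℝ) ≤ 3 := by exact_mod_cast hk3
  linarith

theorem pd_comp_coord_zero {q q' : ℝ → ℝ} (hq : ∀ t, HasDerivAt q (q' t) t) (a : Fin (m + 1)) :
    pd Set.univ (fun y : EuclideanSpace ℝ (Fin (m + 1)) => q (y 0)) a y =
      q' (y 0) * if a = 0 then 1 else 0 := by
  rw [pd_univ_comp (hq _).differentiableAt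
    ((contDiff_coord (n := 1) 0).differentiable (by norm_num) y), (hq _).deriv, pd_coord]

theorem laplacian_comp_coord_zero {q q' q'' : ℝ → ℝ} (hq2 : ContDiff ℝ 2 q)
    (hq : ∀ t, HasDerivAt q (q' t) t) (hq' : ∀ t, HasDerivAt q' (q'' t) t) :
    Laplacian.laplacian (fun y : EuclideanSpace ℝ (Fin (m + 1)) => q (y 0)) y = q'' (y 0) := by
  have h : deriv q = q' := funext fun t => (hq t).deriv
  rw [laplacian_comp hq2 (contDiff_coord 0).contDiffAt, h, (hq' _).deriv, laplacian_coord]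
  simp [pd_coord]

include hm hy in
theorem pd_profile (a : Fin (m + 1)) : pd Set.univ profile a y =
    ∑ k ∈ Finset.range 4, (profileCoeff m k (y 0) *
        pd Set.univ (linePotential k (((m : ℝ) + 3) / 2)) a y +
      profileCoeff' m k (y 0) * (if a = 0 then 1 else 0) *
        linePotential k (((m : ℝ) + 3) / 2) y) := by
  have h1 : ∀ k, DifferentiableAt ℝ
      (fun y : EuclideanSpace ℝ (Fin (m + 1)) => profileCoeff m k (y 0)) y := fun k =>
    (hasDerivAt_profileCoeff k _).differentiableAt.comp y
      ((contDiff_coord (n := 1) 0).differentiable (by norm_num) y)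
  have h2 : ∀ k ∈ Finset.range 4, DifferentiableAt ℝ (linePotential k (((m : ℝ) + 3) / 2)) y :=
    fun k hk => (hasFDerivAt_linePotential (lt_of_mem_range_four hm hk) hy).differentiableAt
  unfold profile
  rw [pd_univ_sum fun k hk => (h1 k).fun_mul (h2 k hk)]
  refine Finset.sum_congr rfl fun k hk => ?_
  rw [pd_univ_mul (h1 k) (h2 k hk), pd_comp_coord_zero (hasDerivAt_profileCoeff k)]

include hm hy in
theorem pd_succ_profile (i : Fin m) : pd Set.univ profile i.succ y =
    -((m : ℝ) + 3) * y i.succ * ∑ k ∈ Finset.range 4, profileCoeff m k (y 0) *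
      linePotential k (((m : ℝ) + 3) / 2 + 1) y := by
  rw [pd_profile hm hy, Finset.mul_sum]
  refine Finset.sum_congr rfl fun k hk => ?_
  rw [pd_linePotential (lt_of_mem_range_four hm hk) hy]
  simp
  ring

include hm hy in
-- The first term compensates the passage to dimension n + 4 (see `laplacian_quadSol`), so only 2
-- q_k' ∂_t J_k + q_k'' J_k matters. The J_0, J_1, J_2 terms cancel because q_0'' = 2 q_1', q_1'' =
-- 4 q_2' and q_2'' = 6 q_3' = 0; the source is -2 q_0' ρ^(-(m+3)/2), which requires q_0' = (m²-1)
-- t²/2. The constant terms of the q_k remain free.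
theorem laplacian_profile : Laplacian.laplacian profile y =
    4 * ((m : ℝ) + 3) * (∑ k ∈ Finset.range 4, profileCoeff m k (y 0) *
      linePotential k (((m : ℝ) + 3) / 2 + 1) y) -
    ((m : ℝ) - 1) * (m + 1) * y 0 ^ 2 * rho y ^ (-(((m : ℝ) + 3) / 2)) := by
  have hm' : (2 : ℝ) ≤ m := by exact_mod_cast hm
  have h1 : ∀ k, ContDiffAt ℝ 2
      (fun y : EuclideanSpace ℝ (Fin (m + 1)) => profileCoeff m k (y 0)) y := fun k =>
    (contDiff_profileCoeff k).contDiffAt.comp y (contDiff_coord 0).contDiffAt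
  have h2 : ∀ k ∈ Finset.range 4, ContDiffAt ℝ 2 (linePotential k (((m : ℝ) + 3) / 2)) y :=
    fun k hk => contDiffAt_linePotential (N := 2) (lt_of_mem_range_four hm hk) hy
  have h3 : ∀ k ∈ Finset.range 4, Laplacian.laplacian
      (fun y => profileCoeff m k (y 0) * linePotential k (((m : ℝ) + 3) / 2) y) y =
      4 * ((m : ℝ) + 3) * (profileCoeff m k (y 0) * linePotential k (((m : ℝ) + 3) / 2 + 1) y) +
      (2 * profileCoeff' m k (y 0) * pd Set.univ (linePotential k (((m : ℝ) + 3) / 2)) 0 y +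
      profileCoeff'' m k (y 0) * linePotential k (((m : ℝ) + 3) / 2) y) := by
    intro k hk
    rw [laplacian_mul (h1 k) (h2 k hk), laplacian_comp_coord_zero (contDiff_profileCoeff k)
      (hasDerivAt_profileCoeff k) (hasDerivAt_profileCoeff' k),
      laplacian_linePotential (lt_of_mem_range_four hm hk) hy]
    simp only [pd_comp_coord_zero (hasDerivAt_profileCoeff k)]
    simp
    ring
  have h5 : ∀ k : ℕ, k < 3 → pd Set.univ (linePotential (k + 1) (((m : ℝ) + 3) / 2)) 0 y =
      -((k : ℝ) + 1) * linePotential k (((m : ℝ) + 3) / 2) y := fun k hk => by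
    have hk' : (k : ℝ) ≤ 2 := by exact_mod_cast Nat.lt_succ_iff.1 hk
    exact pd_zero_linePotential_succ (by linarith) hy
  unfold profile
  rw [laplacian_sum fun k hk => (h1 k).mul (h2 k hk), Finset.sum_congr rfl h3,
    Finset.sum_add_distrib, ← Finset.mul_sum, sub_eq_add_neg]
  congr 1
  -- Writing the four terms out displays the recursion between consecutive coefficients.
  simp only [Finset.sum_range_succ, Finset.sum_range_zero, profileCoeff', profileCoeff'']
  have e1 := h5 0 (by norm_num)
  have e2 := h5 1 (by norm_num)
  have e3 := h5 2 (by norm_num)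
  norm_num at e1 e2 e3
  rw [pd_zero_linePotential_zero (by linarith) hy, e1, e2]
  ring

include hm in
-- At t = 0 both sides are combinations of J_0, …, J_3 and P = ρ^(-(m+3)/2). Integration by parts in
-- λ provides three linear relations among them, and the constant terms of the coefficients are such
-- that the boundary condition is a combination of these.
theorem pd_zero_profile (hy0 : y 0 = 0) :
    pd Set.univ profile 0 y = -((m : ℝ) + 1) * (rho y)⁻¹ * profile y := by
  have hm' : (2 : ℝ) ≤ m := by exact_mod_cast hm
  have hy : y ∈ enlargedHalfSpace m :=
    halfSpace_subset_enlargedHalfSpace (by change 0 ≤ y 0; rw [hy0])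
  have hr := rho_pos_of_mem_enlarged hy
  have h5 : ∀ k : ℕ, k < 3 → pd Set.univ (linePotential (k + 1) (((m : ℝ) + 3) / 2)) 0 y =
      -((k : ℝ) + 1) * linePotential k (((m : ℝ) + 3) / 2) y := fun k hk => by
    have hk' : (k : ℝ) ≤ 2 := by exact_mod_cast Nat.lt_succ_iff.1 hk
    exact pd_zero_linePotential_succ (by linarith) hy
  have e1 := h5 0 (by norm_num)
  have e2 := h5 1 (by norm_num)
  have e3 := h5 2 (by norm_num)
  norm_num at e1 e2 e3
  have hα : ((m : ℝ) + 1) / 2 + 1 = ((m : ℝ) + 3) / 2 := by ring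
  have r0 := rho_rpow_eq_linePotential (β := ((m : ℝ) + 1) / 2) (by linarith) hy
  have r1 := succ_mul_linePotential (j := 0) (β := ((m : ℝ) + 1) / 2)
    (by push_cast; linarith) hy
  have r2 := succ_mul_linePotential (j := 1) (β := ((m : ℝ) + 1) / 2)
    (by push_cast; linarith) hy
  have x1 := linePotential_expand (j := 0) (β := ((m : ℝ) + 1) / 2) (by push_cast; linarith) hy
  have x2 := linePotential_expand (j := 1) (β := ((m : ℝ) + 1) / 2) (by push_cast; linarith) hy
  rw [hα] at r0 r1 r2 x1 x2
  rw [x1] at r1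
  rw [x2] at r2
  have hρ : rho y * rho y ^ (-(((m : ℝ) + 3) / 2)) = rho y ^ (-(((m : ℝ) + 1) / 2)) := by
    rw [show -(((m : ℝ) + 1) / 2) = -(((m : ℝ) + 3) / 2) + 1 by ring, Real.rpow_add_one hr.ne',
      mul_comm]
  rw [r0] at hρ
  norm_num [hy0] at r1 r2 hρ
  rw [pd_profile hm hy, profile]
  simp only [Finset.sum_range_succ, Finset.sum_range_zero, hy0, profileCoeff, profileCoeff']
  norm_num
  rw [pd_zero_linePotential_zero (by linarith) hy, e1, e2, e3]
  generalize linePotential 0 (((m : ℝ) + 3) / 2) y = J0 at *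
  generalize linePotential 1 (((m : ℝ) + 3) / 2) y = J1 at *
  generalize linePotential 2 (((m : ℝ) + 3) / 2) y = J2 at *
  generalize linePotential 3 (((m : ℝ) + 3) / 2) y = J3 at *
  generalize rho y ^ (-(((m : ℝ) + 3) / 2)) = P at *
  have hm0 : (m : ℝ) ≠ 0 := by linarith
  field_simp
  -- The relations at t = 0 are ρP = (m+1)(J_0+J_1), ρJ_0 + 2J_1 + J_2 = (m+1)(J_1+J_2) and 2(ρJ_1 +
  -- 2J_2 + J_3) = (m+1)(J_2+J_3). The multipliers are, up to clearing denominators, the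
  -- coefficients q_0(0), q_1(0), q_2(0).
  linear_combination (-4 * (m * (m - 1) - (m + 1) * (m - 2)) : ℝ) * hρ -
    (2 * (3 * m * (m - 1) - (m - 2) * (3 * m + 1)) : ℝ) * r1 -
    (m * (3 * (m - 1) - 2 * (m - 2)) : ℝ) * r2

end Equation

end Profile

/-! ### The explicit solutions -/

section Solution

variable {m : ℕ}

theorem isSymbol_rho_rpow (p : ℝ) : IsSymbol (m := m) 0 (2 * p) (fun y => rho y ^ p) := by
  refine IsSymbol.of_continuousOn (C := 1) (fun y hy => ?_) fun y hy => ?_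
  · exact (contDiffAt_rho_rpow (n := 0) p (rho_pos_of_mem_enlarged hy)).continuousAt.continuousWithinAt
  · rw [Real.norm_of_nonneg (Real.rpow_nonneg (rho_nonneg y) _), one_mul,
      mul_div_cancel_left₀ p two_ne_zero]

theorem half_sq_norm_le_rho {y : EuclideanSpace ℝ (Fin (m + 1))} (hy : y ∈ halfSpace m) :
    (1 + ‖y‖) ^ 2 / 2 ≤ rho y := by
  have h : 0 ≤ y 0 := hy
  rw [rho_eq]
  nlinarith [sq_nonneg (1 - ‖y‖)]

theorem rho_rpow_le_of_nonpos {p : ℝ} (hp : p ≤ 0) {y : EuclideanSpace ℝ (Fin (m + 1))}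
    (hy : y ∈ halfSpace m) : rho y ^ p ≤ 2 ^ (-p) * (1 + ‖y‖) ^ (2 * p) := by
  calc rho y ^ p ≤ ((1 + ‖y‖) ^ 2 / 2) ^ p :=
        Real.rpow_le_rpow_of_nonpos (by positivity) (half_sq_norm_le_rho hy) hp
    _ = _ := by
        rw [Real.div_rpow (by positivity) (by norm_num), ← Real.rpow_natCast,
          ← Real.rpow_mul (by positivity), Real.rpow_neg (by norm_num), div_eq_inv_mul]
        norm_num

variable {F : Type*} [NormedAddCommGroup F] [NormedSpace ℝ F] {N : ℕ} {d : ℝ}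
  {f : EuclideanSpace ℝ (Fin (m + 1)) → F}

/-- A symbol is smooth across the boundary, so one-sided derivatives are ordinary ones and the
bounds on the open enlargement apply up to the boundary. -/
theorem IsSymbol.iteratedFDerivWithin_halfSpace (hf : IsSymbol N d f) {τ : ℕ} (hτ : τ ≤ N)
    {y : EuclideanSpace ℝ (Fin (m + 1))} (hy : y ∈ halfSpace m) :
    iteratedFDerivWithin ℝ τ f (halfSpace m) y =
      iteratedFDerivWithin ℝ τ f (enlargedHalfSpace m) y := by
  have hy' := halfSpace_subset_enlargedHalfSpace hy
  have hc : ContDiffAt ℝ τ f y := (hf.contDiffAt hy').of_le (by exact_mod_cast hτ)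
  rw [iteratedFDerivWithin_eq_iteratedFDeriv uniqueDiffOn_halfSpace hc hy,
    iteratedFDerivWithin_eq_iteratedFDeriv isOpen_enlargedHalfSpace.uniqueDiffOn hc hy']

theorem IsSymbol.exists_norm_iteratedFDerivWithin_le (hf : IsSymbol N d f) (hd : d ≤ 0) {τ : ℕ}
    (hτ : τ ≤ N) : ∃ C, 0 ≤ C ∧ ∀ y ∈ halfSpace m,
      ‖iteratedFDerivWithin ℝ τ f (halfSpace m) y‖ ≤ C * (1 + ‖y‖) ^ (d - τ) := by
  obtain ⟨C, hC⟩ := hf.bound τ hτ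
  have h0 : (0 : ℝ) ≤ τ := Nat.cast_nonneg τ
  refine ⟨|C| * 2 ^ (-((d - τ) / 2)), by positivity, fun y hy => ?_⟩
  rw [hf.iteratedFDerivWithin_halfSpace hτ hy]
  have h1 := rho_rpow_le_of_nonpos (p := (d - τ) / 2) (by linarith) hy
  calc ‖iteratedFDerivWithin ℝ τ f (enlargedHalfSpace m) y‖
      ≤ C * rho y ^ ((d - τ) / 2) := hC y (halfSpace_subset_enlargedHalfSpace hy)
    _ ≤ |C| * (2 ^ (-((d - τ) / 2)) * (1 + ‖y‖) ^ (2 * ((d - τ) / 2))) := by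
        gcongr
        · exact Real.rpow_nonneg (rho_nonneg y) _
        · exact le_abs_self C
    _ = _ := by rw [mul_div_cancel₀ _ two_ne_zero]; ring

theorem IsSymbol.exists_norm_le (hf : IsSymbol N d f) (hd : d ≤ 0) :
    ∃ C, 0 ≤ C ∧ ∀ y ∈ halfSpace m, ‖f y‖ ≤ C * (1 + ‖y‖) ^ d := by
  obtain ⟨C, hC, h⟩ := hf.exists_norm_iteratedFDerivWithin_le hd (Nat.zero_le N)
  exact ⟨C, hC, fun y hy => by simpa using h y hy⟩

omit [NormedSpace ℝ F] in
theorem integrableOn_of_norm_le {p C : ℝ} (hp : p < -((m : ℝ) + 1))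
    (hf : ContinuousOn f (openHalfSpace m))
    (h : ∀ y ∈ openHalfSpace m, ‖f y‖ ≤ C * (1 + ‖y‖) ^ p) : IntegrableOn f (openHalfSpace m) := by
  have hmeas := (isOpen_openHalfSpace (m := m)).measurableSet
  have h1 : Integrable (fun y : EuclideanSpace ℝ (Fin (m + 1)) => (1 + ‖y‖) ^ p) := by
    have := integrable_one_add_norm (E := EuclideanSpace ℝ (Fin (m + 1))) (μ := volume) (r := -p)
      (by rw [finrank_euclideanSpace_fin]; push_cast; linarith)
    simpa using this
  refine Integrable.mono' (h1.integrableOn.const_mul C)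
    (hf.aestronglyMeasurable hmeas) ?_
  filter_upwards [ae_restrict_mem hmeas] with y hy using h y hy

omit [NormedSpace ℝ F] in
theorem memLp_two_of_norm_le {p C : ℝ} (hp : 2 * p < -((m : ℝ) + 1))
    (hf : ContinuousOn f (openHalfSpace m))
    (h : ∀ y ∈ openHalfSpace m, ‖f y‖ ≤ C * (1 + ‖y‖) ^ p) :
    MemLp f 2 (volume.restrict (openHalfSpace m)) := by
  have hmeas := (isOpen_openHalfSpace (m := m)).measurableSet
  rw [memLp_two_iff_integrable_sq_norm (hf.aestronglyMeasurable hmeas)]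
  refine integrableOn_of_norm_le (p := 2 * p) (C := C ^ 2) hp (hf.norm.pow 2) fun y hy => ?_
  rw [norm_pow, norm_norm, mul_comm 2 p, Real.rpow_mul (by positivity)]
  calc ‖f y‖ ^ 2 ≤ (C * (1 + ‖y‖) ^ p) ^ 2 := by gcongr; exact h y hy
    _ = _ := by rw [mul_pow]; norm_cast

theorem IsSymbol.continuousOn (hf : IsSymbol N d f) : ContinuousOn f (enlargedHalfSpace m) :=
  hf.contDiffOn.continuousOn

theorem openHalfSpace_subset_enlarged : openHalfSpace m ⊆ enlargedHalfSpace m :=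
  openHalfSpace_subset.trans halfSpace_subset_enlargedHalfSpace

theorem IsSymbol.integrableOn (hf : IsSymbol N d f) (hd : d < -((m : ℝ) + 1)) :
    IntegrableOn f (openHalfSpace m) := by
  obtain ⟨C, -, hC⟩ := hf.exists_norm_le (by have : (0 : ℝ) ≤ m := Nat.cast_nonneg m; linarith)
  exact integrableOn_of_norm_le hd (hf.continuousOn.mono openHalfSpace_subset_enlarged)
    fun y hy => hC y (openHalfSpace_subset hy)

theorem IsSymbol.memLp (hf : IsSymbol N d f) (hd : 2 * d < -((m : ℝ) + 1)) :
    MemLp f 2 (volume.restrict (openHalfSpace m)) := by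
  obtain ⟨C, -, hC⟩ := hf.exists_norm_le (by have : (0 : ℝ) ≤ m := Nat.cast_nonneg m; linarith)
  exact memLp_two_of_norm_le hd (hf.continuousOn.mono openHalfSpace_subset_enlarged)
    fun y hy => hC y (openHalfSpace_subset hy)

theorem IsSymbol.memLp_fderiv (hf : IsSymbol 2 d f) (hd : 2 * d < -((m : ℝ) + 1)) :
    MemLp (fderiv ℝ f) 2 (volume.restrict (openHalfSpace m)) := by
  have hm : (0 : ℝ) ≤ m := Nat.cast_nonneg m
  obtain ⟨C, -, hC⟩ := hf.exists_norm_iteratedFDerivWithin_le (by linarith) one_le_two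
  refine memLp_two_of_norm_le (p := d - (1 : ℕ)) (C := C) (by push_cast; linarith)
    ((hf.contDiffOn.continuousOn_fderiv_of_isOpen isOpen_enlargedHalfSpace (by norm_num)).mono
      openHalfSpace_subset_enlarged) fun y hy => ?_
  have hy' := openHalfSpace_subset hy
  refine le_trans (le_of_eq ?_) (hC y hy')
  rw [iteratedFDerivWithin_eq_iteratedFDeriv uniqueDiffOn_halfSpace ((hf.contDiffAt
    (halfSpace_subset_enlargedHalfSpace hy')).of_le (by norm_num)) hy', norm_iteratedFDeriv_one]

/-- The basic functions `y_i y_j φ(y)`. -/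
def quadSol (i j : Fin m) (y : EuclideanSpace ℝ (Fin (m + 1))) : ℝ :=
  y i.succ * y j.succ * profile y

/-- The combination `∑ A_ij y_i y_j φ(y)`, which solves the linear problem for trace-free `A`. -/
def tensorSol (A : Fin m → Fin m → ℝ) (y : EuclideanSpace ℝ (Fin (m + 1))) : ℝ :=
  ∑ i, ∑ j, A i j * quadSol i j y

variable {A : Fin m → Fin m → ℝ} {y : EuclideanSpace ℝ (Fin (m + 1))}

theorem isSymbol_quadSol (hm : 2 ≤ m) (i j : Fin m) : IsSymbol N (3 - (m : ℝ)) (quadSol i j) :=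
  (((isSymbol_coord_succ i).mul (isSymbol_coord_succ j)).mul (isSymbol_profile hm)).mono
    (by linarith)

theorem isSymbol_tensorSol (hm : 2 ≤ m) : IsSymbol N (3 - (m : ℝ)) (tensorSol A) :=
  IsSymbol.sum fun i _ => IsSymbol.sum fun j _ => (isSymbol_quadSol hm i j).const_mul _

theorem tensorSol_eq (y : EuclideanSpace ℝ (Fin (m + 1))) :
    tensorSol A y = (∑ i, ∑ j, A i j * (y i.succ * y j.succ)) * profile y := by
  simp only [tensorSol, quadSol, Finset.sum_mul]
  exact Finset.sum_congr rfl fun i _ => Finset.sum_congr rfl fun j _ => by ring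

/-- The cross term 2∇(y_i y_j)·∇φ is a multiple of y_i y_j, since the tangential gradient of φ is
radial in z. It cancels the first term of `laplacian_profile`: this is the shift of the dimension by
four. -/
theorem laplacian_quadSol (hm : 2 ≤ m) (hy : y ∈ enlargedHalfSpace m) (i j : Fin m) :
    Laplacian.laplacian (quadSol i j) y = (if i = j then 2 else 0) * profile y -
      ((m : ℝ) - 1) * (m + 1) * y 0 ^ 2 * rho y ^ (-(((m : ℝ) + 3) / 2)) *
        (y i.succ * y j.succ) := by
  have hc : ∀ a : Fin (m + 1), ContDiffAt ℝ 2 (fun y : EuclideanSpace ℝ (Fin (m + 1)) => y a) y :=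
    fun a => (contDiff_coord a).contDiffAt
  have hd : ∀ a : Fin (m + 1), DifferentiableAt ℝ
    (fun y : EuclideanSpace ℝ (Fin (m + 1)) => y a) y := fun a =>
      differentiableAt_of_contDiffAt_two (hc a)
  have hp : ContDiffAt ℝ 2 (profile (m := m)) y := (isSymbol_profile (N := 2) hm).contDiffAt hy
  unfold quadSol
  rw [laplacian_mul ((hc _).mul (hc _)) hp, laplacian_mul_coord_coord]
  have h1 : ∑ a, pd Set.univ (fun y : EuclideanSpace ℝ (Fin (m + 1)) => y i.succ * y j.succ) a y *
      pd Set.univ profile a y =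
      y i.succ * pd Set.univ profile j.succ y + y j.succ * pd Set.univ profile i.succ y := by
    simp only [pd_univ_mul (hd _) (hd _), pd_coord, add_mul, Finset.sum_add_distrib]
    simp
  rw [h1, pd_succ_profile hm hy, pd_succ_profile hm hy, laplacian_profile hm hy]
  simp only [Fin.succ_inj]
  ring

/-- A(z,z) is harmonic when A is trace-free, so the δ_ij φ terms drop out in the sum. -/
theorem laplacian_tensorSol (hm : 2 ≤ m) (hA : ∑ i, A i i = 0) (hy : y ∈ enlargedHalfSpace m) :
    Laplacian.laplacian (tensorSol A) y =
      -(((m : ℝ) - 1) * (m + 1) * y 0 ^ 2 * rho y ^ (-(((m : ℝ) + 3) / 2)) *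
        ∑ i, ∑ j, A i j * (y i.succ * y j.succ)) := by
  have hc : ∀ i j, ContDiffAt ℝ 2 (quadSol (m := m) i j) y := fun i j =>
    (isSymbol_quadSol (N := 2) hm i j).contDiffAt hy
  have h1 : ∀ i j, Laplacian.laplacian (fun y => A i j * quadSol i j y) y =
      A i j * Laplacian.laplacian (quadSol i j) y := fun i j => by
    rw [laplacian_mul contDiffAt_const (hc i j), laplacian_fun_const]
    simp [pd_const]
  have h2 : ∀ i j, ContDiffAt ℝ 2 (fun y => A i j * quadSol i j y) y := fun i j =>
    contDiffAt_const.mul (hc i j)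
  unfold tensorSol
  rw [laplacian_sum fun i _ => ContDiffAt.sum fun j _ => h2 i j]
  have h3 : ∀ i, Laplacian.laplacian (fun y => ∑ j, A i j * quadSol i j y) y =
      A i i * (2 * profile y) - ∑ j, (((m : ℝ) - 1) * (m + 1) * y 0 ^ 2 *
        rho y ^ (-(((m : ℝ) + 3) / 2))) * (A i j * (y i.succ * y j.succ)) := fun i => by
    rw [laplacian_sum fun j _ => h2 i j]
    simp only [h1, laplacian_quadSol hm hy, mul_sub, Finset.sum_sub_distrib]
    congr 1
    · simp
    · exact Finset.sum_congr rfl fun j _ => by ring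
  rw [Finset.sum_congr rfl fun i _ => h3 i, Finset.sum_sub_distrib, ← Finset.sum_mul, hA, zero_mul,
    zero_sub]
  simp only [Finset.mul_sum]

theorem pd_zero_tensorSol (hm : 2 ≤ m) (hy0 : y 0 = 0) :
    pd (halfSpace m) (tensorSol A) 0 y = -((m : ℝ) + 1) * (rho y)⁻¹ * tensorSol A y := by
  have hy : y ∈ halfSpace m := by change 0 ≤ y 0; rw [hy0]
  have hy' := halfSpace_subset_enlargedHalfSpace hy
  have hd : DifferentiableAt ℝ (tensorSol A) y :=
    ((isSymbol_tensorSol (N := 1) hm).contDiffAt hy').differentiableAt (by norm_num)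
  have h1 : pd (halfSpace m) (tensorSol A) 0 y = pd Set.univ (tensorSol A) 0 y := by
    rw [pd, hd.fderivWithin (uniqueDiffOn_halfSpace y hy), pd_univ]
  have hc : ∀ a : Fin (m + 1), DifferentiableAt ℝ
    (fun y : EuclideanSpace ℝ (Fin (m + 1)) => y a) y := fun a =>
      (contDiff_coord (n := 1) a).differentiable (by norm_num) y
  have hp : DifferentiableAt ℝ (profile (m := m)) y :=
    ((isSymbol_profile (N := 1) hm).contDiffAt hy').differentiableAt (by norm_num)
  have hk : ∀ i j, DifferentiableAt ℝ
      (fun y : EuclideanSpace ℝ (Fin (m + 1)) => A i j * (y i.succ * y j.succ)) y := fun i j =>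
    (differentiableAt_const _).mul ((hc _).mul (hc _))
  have h2 : (tensorSol A) = fun y => (∑ i, ∑ j, A i j * (y i.succ * y j.succ)) * profile y :=
    funext tensorSol_eq
  rw [h1, h2, pd_univ_mul (DifferentiableAt.fun_sum fun i _ => DifferentiableAt.fun_sum
    fun j _ => hk i j) hp, pd_zero_profile hm hy0,
    pd_univ_sum fun i _ => DifferentiableAt.fun_sum fun j _ => hk i j]
  have h3 : ∀ i, pd Set.univ (fun y : EuclideanSpace ℝ (Fin (m + 1)) =>
      ∑ j, A i j * (y i.succ * y j.succ)) 0 y = 0 := fun i => by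
    rw [pd_univ_sum fun j _ => hk i j]
    refine Finset.sum_eq_zero fun j _ => ?_
    rw [pd_univ_mul (differentiableAt_const _) ((hc _).fun_mul (hc _)), pd_univ_mul (hc _) (hc _),
      pd_const, pd_coord, pd_coord, if_neg (Fin.succ_ne_zero _).symm,
      if_neg (Fin.succ_ne_zero _).symm]
    ring
  simp only [h3, Finset.sum_const_zero]
  ring

theorem isSolution_tensorSol (hm : 8 ≤ m) (hA : ∑ i, A i i = 0) :
    IsSolution (fun y => ((m : ℝ) - 1) * (m + 1) * y 0 ^ 2 * rho y ^ (-(((m : ℝ) + 3) / 2)) *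
        ∑ i, ∑ j, A i j * (y i.succ * y j.succ)) (tensorSol A) := by
  have hm' : (8 : ℝ) ≤ m := by exact_mod_cast hm
  have hs : IsSymbol 2 (3 - (m : ℝ)) (tensorSol A) := isSymbol_tensorSol (by omega)
  refine ⟨hs.contDiffOn.mono openHalfSpace_subset_enlarged,
    (hs.contDiffOn.mono halfSpace_subset_enlargedHalfSpace).of_le (by norm_num),
    -- The dimension restriction is sharp for this degree count: v has degree 3 - m, and 2(3-m) <
    -- -(m+1) means m > 7, that is n ≥ 9.
    hs.memLp (by linarith), hs.memLp_fderiv (by linarith), fun y hy => ?_, fun y hy => ?_⟩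
  · rw [laplacian_tensorSol (by omega) hA (openHalfSpace_subset_enlarged hy), neg_neg]
  · rw [pd_zero_tensorSol (by omega) hy, bubble_bdry (by omega)]

theorem tensorSol_mul_laplacian (hm : 2 ≤ m) (hA : ∑ i, A i i = 0)
    (hy : y ∈ enlargedHalfSpace m) :
    tensorSol A y * Laplacian.laplacian (tensorSol A) y =
      -(((m : ℝ) - 1) * (m + 1) * y 0 ^ 2 * rho y ^ (-(((m : ℝ) + 3) / 2)) *
        (∑ i, ∑ j, A i j * (y i.succ * y j.succ)) ^ 2 * profile y) := by
  rw [laplacian_tensorSol hm hA hy, tensorSol_eq]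
  ring

/-- The degrees add up to (3-m) + (1-m) = 4 - 2m, below -(m+1). -/
theorem integrableOn_tensorSol_mul_laplacian (hm : 8 ≤ m) (hA : ∑ i, A i i = 0) :
    IntegrableOn (fun y => tensorSol A y * Laplacian.laplacian (tensorSol A) y)
      (openHalfSpace m) := by
  have hm' : (8 : ℝ) ≤ m := by exact_mod_cast hm
  have h1 : IsSymbol (m := m) 0 (3 - (m : ℝ) + (((2 : ℕ) : ℝ) + 2 * (-(((m : ℝ) + 3) / 2)) +
      (1 + 1))) (fun y => tensorSol A y * (y 0 ^ 2 * rho y ^ (-(((m : ℝ) + 3) / 2)) *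
        ∑ i, ∑ j, A i j * (y i.succ * y j.succ))) :=
    (isSymbol_tensorSol (by omega)).mul (((isSymbol_coord_zero_pow 2).mul (isSymbol_rho_rpow _)).mul
      (IsSymbol.sum fun i _ => IsSymbol.sum fun j _ =>
        ((isSymbol_coord_succ i).mul (isSymbol_coord_succ j)).const_mul _))
  refine IntegrableOn.congr_fun ((h1.const_mul (-(((m : ℝ) - 1) * (m + 1)))).integrableOn
    (by push_cast; linarith)) (fun y hy => ?_) isOpen_openHalfSpace.measurableSet
  simp only
  rw [laplacian_tensorSol (by omega) hA (openHalfSpace_subset_enlarged hy)]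
  ring

/-- The integrand has a sign: v Δv is minus a nonnegative weight times A(z,z)² φ, with φ ≥ 0. -/
theorem integral_tensorSol_mul_laplacian_nonpos (hm : 2 ≤ m) (hA : ∑ i, A i i = 0) :
    ∫ y in openHalfSpace m, tensorSol A y * Laplacian.laplacian (tensorSol A) y ≤ 0 := by
  have hm' : (2 : ℝ) ≤ m := by exact_mod_cast hm
  refine setIntegral_nonpos isOpen_openHalfSpace.measurableSet fun y hy => ?_
  rw [tensorSol_mul_laplacian hm hA (openHalfSpace_subset_enlarged hy), neg_nonpos]
  have h1 := profile_nonneg hm (openHalfSpace_subset hy)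
  have h2 : 0 ≤ (m : ℝ) - 1 := by linarith
  have h3 := Real.rpow_nonneg (rho_nonneg y) (-(((m : ℝ) + 3) / 2))
  positivity

/-- The kernel functions agree with symbols of order `2 - n`. -/
theorem isSymbol_kernelFn (b : Fin (m + 1)) :
    IsSymbol (m := m) 0 (1 - (m : ℝ)) (kernelFn b) := by
  refine Fin.cases ?_ (fun i => ?_) b
  · have h1 : IsSymbol (m := m) 0 2 (fun y => 2 + 2 * y 0 + -1 * rho y ^ (1 : ℝ)) :=
      (((isSymbol_const 2).mono (by norm_num)).add
        ((isSymbol_coord_zero.const_mul 2).mono (by norm_num))).add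
        (((isSymbol_rho_rpow 1).mono (by norm_num)).const_mul (-1))
    refine (((h1.const_mul (((m : ℝ) - 1) / 2)).mul
      (isSymbol_rho_rpow (-(((m : ℝ) + 1) / 2)))).mono (by linarith)).congr fun y hy => ?_
    rw [kernelFn_zero (rho_pos_of_mem_enlarged hy)]
    simp only [Real.rpow_one]
    linear_combination (((m : ℝ) - 1) / 2 * rho y ^ (-(((m : ℝ) + 1) / 2))) * rho_eq y
  · refine ((((isSymbol_coord_succ i).const_mul (-((m : ℝ) - 1))).mul
      (isSymbol_rho_rpow (-(((m : ℝ) + 1) / 2)))).mono (by linarith)).congr fun y hy => ?_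
    rw [kernelFn_succ (rho_pos_of_mem_enlarged hy)]

end Solution

/-! ### Integrals vanishing by symmetry -/

section Symmetry

variable {ι : Type*} [Fintype ι]

/-- `H` only depends on the norm and on the coordinates with indices in `K`. -/
def IsInvariant (K : Set ι) (H : EuclideanSpace ℝ ι → ℝ) : Prop :=
  ∀ y y', (∀ c ∈ K, y c = y' c) → ‖y‖ = ‖y'‖ → H y = H y'

/-- The isometry changing the signs of the coordinates with indices in `s`. -/
def flipSigns (s : Set ι) [DecidablePred (· ∈ s)] : EuclideanSpace ℝ ι ≃ₗᵢ[ℝ] EuclideanSpace ℝ ι :=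
  LinearIsometryEquiv.piLpCongrRight 2 fun c =>
    if c ∈ s then LinearIsometryEquiv.neg ℝ else LinearIsometryEquiv.refl ℝ ℝ

theorem flipSigns_apply (s : Set ι) [DecidablePred (· ∈ s)] (y : EuclideanSpace ℝ ι) (c : ι) :
    flipSigns s y c = if c ∈ s then -y c else y c := by
  rw [flipSigns, LinearIsometryEquiv.piLpCongrRight_apply]
  by_cases h : c ∈ s <;> simp [h]

theorem integral_comp_isometry (T : EuclideanSpace ℝ ι ≃ₗᵢ[ℝ] EuclideanSpace ℝ ι)
    (f : EuclideanSpace ℝ ι → ℝ) : ∫ y, f (T y) = ∫ y, f y :=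
  T.measurePreserving.integral_comp T.toHomeomorph.measurableEmbedding f

variable {K : Set ι} {H : EuclideanSpace ℝ ι → ℝ}

theorem IsInvariant.flipSigns (hH : IsInvariant K H) {s : Set ι} [DecidablePred (· ∈ s)]
    (hs : ∀ c ∈ s, c ∉ K) (y : EuclideanSpace ℝ ι) :
    H (BoundaryBubble.flipSigns s y) = H y :=
  hH _ _ (fun c hc => by rw [flipSigns_apply, if_neg fun h => hs c h hc])
    ((BoundaryBubble.flipSigns s).norm_map y)

/-- Changing the sign of the a-th coordinate alone reverses the integrand. -/
theorem integral_coord_mul_coord_eq_zero (hH : IsInvariant K H) {a b : ι} (hab : a ≠ b)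
    (ha : a ∉ K) : ∫ y : EuclideanSpace ℝ ι, y a * y b * H y = 0 := by
  classical
  have h := integral_comp_isometry (flipSigns {a}) fun y => y a * y b * H y
  have h1 : ∀ y : EuclideanSpace ℝ ι, flipSigns {a} y a * flipSigns {a} y b *
      H (flipSigns {a} y) = -(y a * y b * H y) := fun y => by
    rw [hH.flipSigns (by simpa using ha), flipSigns_apply, flipSigns_apply]
    simp [Ne.symm hab]
  simp only [h1, integral_neg] at h
  linarith

theorem integral_coord_sq_eq (hH : IsInvariant K H) {a b : ι} (ha : a ∉ K) (hb : b ∉ K) :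
    ∫ y : EuclideanSpace ℝ ι, y a * y a * H y = ∫ y : EuclideanSpace ℝ ι, y b * y b * H y := by
  classical
  set T := LinearIsometryEquiv.piLpCongrLeft 2 ℝ ℝ (Equiv.swap a b) with hT
  have hTa : ∀ (y : EuclideanSpace ℝ ι) (c : ι), T y c = y (Equiv.swap a b c) := fun y c => by
    rw [hT, LinearIsometryEquiv.piLpCongrLeft_apply]
    simp
  rw [← integral_comp_isometry T]
  refine integral_congr_ae (Filter.Eventually.of_forall fun y => ?_)
  simp only
  rw [hTa, Equiv.swap_apply_left, hH (T y) y (fun c hc => ?_) (T.norm_map y)]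
  rw [hTa, Equiv.swap_apply_of_ne_of_ne (ne_of_mem_of_not_mem hc ha)
    (ne_of_mem_of_not_mem hc hb)]

/-- All free coordinates change sign simultaneously, and three factors make the integrand odd even
when indices coincide. -/
theorem integral_coord_cube_eq_zero (hH : IsInvariant K H) {a b c : ι} (ha : a ∉ K) (hb : b ∉ K)
    (hc : c ∉ K) : ∫ y : EuclideanSpace ℝ ι, y a * y b * y c * H y = 0 := by
  classical
  have h := integral_comp_isometry (flipSigns Kᶜ) fun y => y a * y b * y c * H y
  have h1 : ∀ y : EuclideanSpace ℝ ι, flipSigns Kᶜ y a * flipSigns Kᶜ y b * flipSigns Kᶜ y c *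
      H (flipSigns Kᶜ y) = -(y a * y b * y c * H y) := fun y => by
    rw [hH.flipSigns (s := Kᶜ) fun c hc => hc, flipSigns_apply, flipSigns_apply, flipSigns_apply,
      if_pos (by exact ha), if_pos (by exact hb), if_pos (by exact hc)]
    ring
  simp only [h1, integral_neg] at h
  linarith

/-- Off-diagonal moments vanish by parity and the diagonal ones are all equal by permutation, so the
integral is the trace of A times one moment. -/
theorem integral_tensor_mul_eq_zero {κ : Type*} [Fintype κ] (hH : IsInvariant K H) {f : κ → ι}
    (hf : Function.Injective f) (hK : ∀ i, f i ∉ K) {A : κ → κ → ℝ} (hA : ∑ i, A i i = 0)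
    (hint : ∀ i j, Integrable fun y : EuclideanSpace ℝ ι => y (f i) * y (f j) * H y) :
    ∫ y : EuclideanSpace ℝ ι, ∑ i, ∑ j, A i j * (y (f i) * y (f j) * H y) = 0 := by
  classical
  rw [integral_finsetSum _ fun i _ => integrable_finsetSum _ fun j _ => (hint i j).const_mul _]
  rcases isEmpty_or_nonempty κ with hκ | ⟨⟨k⟩⟩
  · simp
  have h : ∀ i, ∫ y : EuclideanSpace ℝ ι, ∑ j, A i j * (y (f i) * y (f j) * H y) =
      A i i * ∫ y : EuclideanSpace ℝ ι, y (f k) * y (f k) * H y := fun i => by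
    rw [integral_finsetSum _ fun j _ => (hint i j).const_mul _, Finset.sum_eq_single i]
    · rw [integral_const_mul, integral_coord_sq_eq hH (hK i) (hK k)]
    · intro j _ hj
      rw [integral_const_mul, integral_coord_mul_coord_eq_zero hH (fun h => hj (hf h).symm) (hK i),
        mul_zero]
    · simp
  rw [Finset.sum_congr rfl fun i _ => h i, ← Finset.sum_mul, hA, zero_mul]

end Symmetry

/-! ### Orthogonality to the kernel and the boundary integral. -/

section Orthogonality

variable {m : ℕ} {A : Fin m → Fin m → ℝ}

theorem isInvariant_indicator {G : EuclideanSpace ℝ (Fin (m + 1)) → ℝ}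
    (hG : ∀ y ∈ openHalfSpace m, ∀ y' ∈ openHalfSpace m, y 0 = y' 0 → ‖y‖ = ‖y'‖ → G y = G y') :
    IsInvariant {0} ((openHalfSpace m).indicator G) := by
  intro y y' h0 h
  have h0' : y 0 = y' 0 := h0 0 rfl
  by_cases hy : y ∈ openHalfSpace m
  · have hy' : y' ∈ openHalfSpace m := by
      change 0 < y' 0
      rw [← h0']; exact hy
    rw [Set.indicator_of_mem hy, Set.indicator_of_mem hy', hG y hy y' hy' h0' h]
  · have hy' : y' ∉ openHalfSpace m := fun h' => hy (by
      change 0 < y 0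
      rw [h0']; exact h')
    rw [Set.indicator_of_notMem hy, Set.indicator_of_notMem hy']

theorem integrableOn_tensorSol_mul_kernelFn (hm : 8 ≤ m) (b : Fin (m + 1)) :
    IntegrableOn (fun y => tensorSol A y * kernelFn b y) (openHalfSpace m) := by
  have hm' : (8 : ℝ) ≤ m := by exact_mod_cast hm
  exact ((isSymbol_tensorSol (by omega)).mul (isSymbol_kernelFn b)).integrableOn (by linarith)

theorem integrableOn_quadSol_mul_kernelFn (hm : 8 ≤ m) (i j : Fin m) (b : Fin (m + 1)) :
    IntegrableOn (fun y => quadSol i j y * kernelFn b y) (openHalfSpace m) := by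
  have hm' : (8 : ℝ) ≤ m := by exact_mod_cast hm
  exact ((isSymbol_quadSol (by omega) i j).mul (isSymbol_kernelFn b)).integrableOn (by linarith)

theorem rho_congr {y y' : EuclideanSpace ℝ (Fin (m + 1))} (h0 : y 0 = y' 0) (h : ‖y‖ = ‖y'‖) :
    rho y = rho y' := by
  rw [rho_eq, rho_eq, h0, h]

/-- Apart from the factor y_k in the tangential kernel functions, φ and the kernel depend only on t
and |y|. Against j_n the integral is a trace of A; against a tangential j_k it consists of odd cubic
moments, which vanish for any A. -/
theorem orthogonalToKernel_tensorSol (hm : 8 ≤ m) (hA : ∑ i, A i i = 0) :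
    OrthogonalToKernel (tensorSol A) := by
  have hmeas := (isOpen_openHalfSpace (m := m)).measurableSet
  intro b
  refine ⟨integrableOn_tensorSol_mul_kernelFn hm b, ?_⟩
  rw [← integral_indicator hmeas]
  refine Fin.cases ?_ (fun k => ?_) b
  · set H := (openHalfSpace m).indicator fun y => profile y * kernelFn 0 y with hH
    have hinv : IsInvariant {0} H := isInvariant_indicator fun y hy y' hy' h0 h => by
      rw [profile_congr h0 h, kernelFn_zero (rho_pos (openHalfSpace_subset hy)),
        kernelFn_zero (rho_pos (openHalfSpace_subset hy')), rho_congr h0 h, h]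
    have h1 : ∀ i j, (fun y : EuclideanSpace ℝ (Fin (m + 1)) => y i.succ * y j.succ * H y) =
        (openHalfSpace m).indicator fun y => quadSol i j y * kernelFn 0 y := fun i j => by
      ext y
      by_cases hy : y ∈ openHalfSpace m
      · rw [hH, Set.indicator_of_mem hy, Set.indicator_of_mem hy, quadSol]; ring
      · rw [hH, Set.indicator_of_notMem hy, Set.indicator_of_notMem hy, mul_zero]
    have h2 := integral_tensor_mul_eq_zero hinv (Fin.succ_injective m)
      (fun i => Fin.succ_ne_zero i) hA fun i j => by
        rw [h1]
        exact (integrable_indicator_iff hmeas).2 (integrableOn_quadSol_mul_kernelFn hm i j 0)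
    refine Eq.trans (integral_congr_ae (Filter.Eventually.of_forall fun y => ?_)) h2
    simp only [fun i j => congrFun (h1 i j) y]
    by_cases hy : y ∈ openHalfSpace m
    · simp only [Set.indicator_of_mem hy, tensorSol, Finset.sum_mul, mul_assoc]
    · simp only [Set.indicator_of_notMem hy, mul_zero, Finset.sum_const_zero]
  · set H := (openHalfSpace m).indicator fun y : EuclideanSpace ℝ (Fin (m + 1)) =>
      profile y * (-((m : ℝ) - 1) * rho y ^ (-(((m : ℝ) + 1) / 2))) with hH
    have hinv : IsInvariant {0} H := isInvariant_indicator fun y hy y' hy' h0 h => by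
      rw [profile_congr h0 h, rho_congr h0 h]
    have h1 : ∀ i j, (fun y : EuclideanSpace ℝ (Fin (m + 1)) =>
        y i.succ * y j.succ * y k.succ * H y) =
        (openHalfSpace m).indicator fun y => quadSol i j y * kernelFn k.succ y := fun i j => by
      ext y
      by_cases hy : y ∈ openHalfSpace m
      · rw [hH, Set.indicator_of_mem hy, Set.indicator_of_mem hy, quadSol,
          kernelFn_succ (rho_pos (openHalfSpace_subset hy))]
        ring
      · rw [hH, Set.indicator_of_notMem hy, Set.indicator_of_notMem hy, mul_zero]
    have hint : ∀ i j, Integrable ((openHalfSpace m).indicator fun y =>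
        quadSol i j y * kernelFn k.succ y) := fun i j =>
      (integrable_indicator_iff hmeas).2 (integrableOn_quadSol_mul_kernelFn hm i j k.succ)
    have h2 : (openHalfSpace m).indicator (fun y => tensorSol A y * kernelFn k.succ y) =
        fun y => ∑ i, ∑ j, A i j * (openHalfSpace m).indicator (fun y =>
          quadSol i j y * kernelFn k.succ y) y := by
      ext y
      by_cases hy : y ∈ openHalfSpace m
      · simp only [Set.indicator_of_mem hy, tensorSol, Finset.sum_mul, mul_assoc]
      · simp only [Set.indicator_of_notMem hy, mul_zero, Finset.sum_const_zero]
    rw [h2, integral_finsetSum _ fun i _ => integrable_finsetSum _ fun j _ =>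
      (hint i j).const_mul _]
    refine Finset.sum_eq_zero fun i _ => ?_
    rw [integral_finsetSum _ fun j _ => (hint i j).const_mul _]
    refine Finset.sum_eq_zero fun j _ => ?_
    rw [integral_const_mul, ← h1, integral_coord_cube_eq_zero hinv (Fin.succ_ne_zero i)
      (Fin.succ_ne_zero j) (Fin.succ_ne_zero k), mul_zero]

theorem norm_bdPoint (z : EuclideanSpace ℝ (Fin m)) : ‖bdPoint z‖ = ‖z‖ := by
  rw [← sq_eq_sq₀ (norm_nonneg _) (norm_nonneg _), norm_sq_eq_sum, norm_sq_eq_sum,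
    Fin.sum_univ_succ]
  simp [bdPoint]

theorem bdPoint_mem (z : EuclideanSpace ℝ (Fin m)) : bdPoint z ∈ halfSpace m := by
  change (0 : ℝ) ≤ (bdPoint z) 0
  simp [bdPoint]

theorem integrable_comp_bdPoint {f : EuclideanSpace ℝ (Fin (m + 1)) → ℝ} {N : ℕ} {d : ℝ}
    (hf : IsSymbol N d f) (hd : d < -(m : ℝ)) :
    Integrable fun z : EuclideanSpace ℝ (Fin m) => f (bdPoint z) := by
  obtain ⟨C, -, hC⟩ := hf.exists_norm_le (by have : (0 : ℝ) ≤ m := Nat.cast_nonneg m; linarith)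
  have h1 : Integrable (fun z : EuclideanSpace ℝ (Fin m) => (1 + ‖z‖) ^ d) := by
    have := integrable_one_add_norm (E := EuclideanSpace ℝ (Fin m)) (μ := volume) (r := -d)
      (by rw [finrank_euclideanSpace_fin]; linarith)
    simpa using this
  have hc : Continuous fun z : EuclideanSpace ℝ (Fin m) => f (bdPoint z) :=
    hf.continuousOn.comp_continuous (bdPointL m).continuous
      fun z => halfSpace_subset_enlargedHalfSpace (bdPoint_mem z)
  refine Integrable.mono' (h1.const_mul C) hc.aestronglyMeasurable
    (Filter.Eventually.of_forall fun z => ?_)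
  have := hC _ (bdPoint_mem z)
  rwa [norm_bdPoint] at this

theorem bubble_rpow (hm : 2 ≤ m) (y : EuclideanSpace ℝ (Fin (m + 1))) :
    bubble y ^ (((m : ℝ) + 1) / ((m : ℝ) - 1)) = rho y ^ (-(((m : ℝ) + 1) / 2)) := by
  have hm' : (2 : ℝ) ≤ m := by exact_mod_cast hm
  have h0 : (m : ℝ) - 1 ≠ 0 := by linarith
  rw [bubble_eq, ← Real.rpow_mul (rho_nonneg y)]
  congr 1
  field_simp

theorem integrable_boundary_quadSol (hm : 8 ≤ m) (i j : Fin m) :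
    Integrable fun z : EuclideanSpace ℝ (Fin m) =>
      bubble (bdPoint z) ^ (((m : ℝ) + 1) / ((m : ℝ) - 1)) * quadSol i j (bdPoint z) := by
  have hm' : (8 : ℝ) ≤ m := by exact_mod_cast hm
  simp only [bubble_rpow (by omega : 2 ≤ m)]
  exact integrable_comp_bdPoint
    ((isSymbol_rho_rpow (-(((m : ℝ) + 1) / 2))).mul (isSymbol_quadSol (by omega) i j))
    (by linarith)

theorem integrable_boundary_tensorSol (hm : 8 ≤ m) :
    Integrable fun z : EuclideanSpace ℝ (Fin m) =>
      bubble (bdPoint z) ^ (((m : ℝ) + 1) / ((m : ℝ) - 1)) * tensorSol A (bdPoint z) := by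
  have hm' : (8 : ℝ) ≤ m := by exact_mod_cast hm
  simp only [bubble_rpow (by omega : 2 ≤ m)]
  exact integrable_comp_bdPoint
    ((isSymbol_rho_rpow (-(((m : ℝ) + 1) / 2))).mul (isSymbol_tensorSol (by omega)))
    (by linarith)

/-- On the boundary U and φ are radial in z, so again only the trace of A survives. -/
theorem integral_boundary_tensorSol (hm : 8 ≤ m) (hA : ∑ i, A i i = 0) :
    ∫ z : EuclideanSpace ℝ (Fin m),
      bubble (bdPoint z) ^ (((m : ℝ) + 1) / ((m : ℝ) - 1)) * tensorSol A (bdPoint z) = 0 := by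
  set H : EuclideanSpace ℝ (Fin m) → ℝ := fun z =>
    bubble (bdPoint z) ^ (((m : ℝ) + 1) / ((m : ℝ) - 1)) * profile (bdPoint z) with hH
  have hinv : IsInvariant ∅ H := fun z z' _ h => by
    have h0 : bdPoint z 0 = bdPoint z' 0 := by simp [bdPoint]
    have h' : ‖bdPoint z‖ = ‖bdPoint z'‖ := by rw [norm_bdPoint, norm_bdPoint, h]
    rw [hH]
    simp only [bubble_rpow (by omega : 2 ≤ m), rho_congr h0 h', profile_congr h0 h']
  have h1 : ∀ i j (z : EuclideanSpace ℝ (Fin m)), z i * z j * H z =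
      bubble (bdPoint z) ^ (((m : ℝ) + 1) / ((m : ℝ) - 1)) * quadSol i j (bdPoint z) :=
    fun i j z => by
      simp only [hH, quadSol]
      have : ∀ i : Fin m, bdPoint z i.succ = z i := fun i => by simp [bdPoint]
      rw [this, this]
      ring
  have h2 := integral_tensor_mul_eq_zero hinv Function.injective_id (fun i => by simp) hA
    fun i j => by
      simp only [id, h1]
      exact integrable_boundary_quadSol hm i j
  refine Eq.trans (integral_congr_ae (Filter.Eventually.of_forall fun z => ?_)) h2
  simp only [id, h1, tensorSol, Finset.mul_sum]
  exact Finset.sum_congr rfl fun i _ => Finset.sum_congr rfl fun j _ => by ring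

end Orthogonality

/-! ### Uniform bounds and smooth dependence -/

section Dependence

variable {m : ℕ} {A : Fin m → Fin m → ℝ}

theorem iteratedFDerivWithin_tensorSol (hm : 2 ≤ m) (τ : ℕ) {y : EuclideanSpace ℝ (Fin (m + 1))}
    (hy : y ∈ halfSpace m) :
    iteratedFDerivWithin ℝ τ (tensorSol A) (halfSpace m) y =
      ∑ p : Fin m × Fin m, A p.1 p.2 • iteratedFDerivWithin ℝ τ (quadSol p.1 p.2) (halfSpace m) y := by
  have hc : ∀ p : Fin m × Fin m,
      ContDiffWithinAt ℝ τ (quadSol (m := m) p.1 p.2) (halfSpace m) y := fun p =>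
    ((isSymbol_quadSol (N := τ) hm p.1 p.2).contDiffAt
      (halfSpace_subset_enlargedHalfSpace hy)).contDiffWithinAt
  have h : tensorSol A = ∑ p : Fin m × Fin m, A p.1 p.2 • quadSol p.1 p.2 := by
    ext y
    rw [tensorSol, Finset.sum_apply, Fintype.sum_prod_type]
    rfl
  have hc' : ∀ p ∈ (Finset.univ : Finset (Fin m × Fin m)), ContDiffWithinAt ℝ τ
      (A p.1 p.2 • quadSol (m := m) p.1 p.2) (halfSpace m) y := fun p _ => ContDiffWithinAt.const_smul (A p.1 p.2) (hc p)
  rw [h, iteratedFDerivWithin_sum_apply uniqueDiffOn_halfSpace hy hc']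
  exact Finset.sum_congr rfl fun p _ =>
    iteratedFDerivWithin_const_smul_apply (hc p) uniqueDiffOn_halfSpace hy

theorem exists_quadSol_bound (hm : 8 ≤ m) {τ : ℕ} :
    ∃ C, 0 ≤ C ∧ ∀ i j, ∀ y ∈ halfSpace m,
      ‖iteratedFDerivWithin ℝ τ (quadSol i j) (halfSpace m) y‖ ≤
        C * (1 + ‖y‖) ^ ((4 : ℤ) - τ - (m + 1)) := by
  have hm' : (8 : ℝ) ≤ m := by exact_mod_cast hm
  have h : ∀ p : Fin m × Fin m, ∃ C, 0 ≤ C ∧ ∀ y ∈ halfSpace m,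
      ‖iteratedFDerivWithin ℝ τ (quadSol p.1 p.2) (halfSpace m) y‖ ≤
        C * (1 + ‖y‖) ^ (3 - (m : ℝ) - τ) := fun p =>
    (isSymbol_quadSol (N := τ) (by omega) p.1 p.2).exists_norm_iteratedFDerivWithin_le
      (by linarith) le_rfl
  choose C hC0 hC using h
  refine ⟨∑ p, C p, Finset.sum_nonneg fun p _ => hC0 p, fun i j y hy => (hC (i, j) y hy).trans ?_⟩
  have he : (1 + ‖y‖) ^ (3 - (m : ℝ) - τ) = (1 + ‖y‖) ^ ((4 : ℤ) - τ - (m + 1)) := by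
    rw [← Real.rpow_intCast]
    congr 1
    push_cast
    ring
  rw [he]
  refine mul_le_mul_of_nonneg_right ?_ (by positivity)
  exact Finset.single_le_sum (f := C) (fun p _ => hC0 p) (Finset.mem_univ (i, j))

theorem exists_tensorSol_bound (hm : 8 ≤ m) (τ : ℕ) {a : ℝ} :
    ∃ C, 0 ≤ C ∧ ∀ A : Fin m → Fin m → ℝ, (∀ i j, |A i j| ≤ a) → ∀ y ∈ halfSpace m,
      ‖iteratedFDerivWithin ℝ τ (tensorSol A) (halfSpace m) y‖ ≤
        C * (1 + ‖y‖) ^ ((4 : ℤ) - τ - (m + 1)) := by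
  obtain ⟨C, hC0, hC⟩ := exists_quadSol_bound hm (τ := τ)
  refine ⟨∑ _p : Fin m × Fin m, |a| * C, by positivity, fun A hA y hy => ?_⟩
  rw [iteratedFDerivWithin_tensorSol (by omega) τ hy, Finset.sum_mul]
  refine (norm_sum_le _ _).trans (Finset.sum_le_sum fun p _ => ?_)
  rw [norm_smul, Real.norm_eq_abs, mul_assoc]
  exact mul_le_mul ((hA _ _).trans (le_abs_self a)) (hC p.1 p.2 y hy) (norm_nonneg _) (abs_nonneg a)

/-- The weighted derivatives of the finitely many basic functions are fixed elements of the Banach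
space. The family of solutions takes values in their span, with coefficients A_ij. -/
theorem exists_weighted_quadSol (hm : 8 ≤ m) (τ : ℕ) (i j : Fin m) :
    ∃ Ψ : halfSpace m →ᵇ (EuclideanSpace ℝ (Fin (m + 1)) [×τ]→L[ℝ] ℝ), ∀ y : halfSpace m,
      Ψ y = (1 + ‖(y : EuclideanSpace ℝ (Fin (m + 1)))‖) ^ ((m + 1 : ℤ) + τ - 4) •
        iteratedFDerivWithin ℝ τ (quadSol i j) (halfSpace m) y := by
  obtain ⟨C, -, hC⟩ := exists_quadSol_bound hm (τ := τ)
  have h1 : ContinuousOn (iteratedFDerivWithin ℝ τ (quadSol i j) (halfSpace m)) (halfSpace m) :=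
    ((isSymbol_quadSol (N := τ) (by omega) i j).contDiffOn.mono
      halfSpace_subset_enlargedHalfSpace).continuousOn_iteratedFDerivWithin le_rfl
      uniqueDiffOn_halfSpace
  have h2 : Continuous fun y : halfSpace m =>
      (1 + ‖(y : EuclideanSpace ℝ (Fin (m + 1)))‖) ^ ((m + 1 : ℤ) + τ - 4) •
        iteratedFDerivWithin ℝ τ (quadSol i j) (halfSpace m) y := by
    have h3 : Continuous fun y : halfSpace m => 1 + ‖(y : EuclideanSpace ℝ (Fin (m + 1)))‖ := by
      fun_prop
    refine (h3.zpow₀ _ fun y => Or.inl (by positivity)).smul ?_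
    exact continuousOn_iff_continuous_domRestrict.1 h1
  refine ⟨BoundedContinuousFunction.ofNormedAddCommGroup _ h2 C fun y => ?_, fun y => rfl⟩
  have h0 : (0 : ℝ) < 1 + ‖(y : EuclideanSpace ℝ (Fin (m + 1)))‖ := by positivity
  rw [norm_smul, Real.norm_of_nonneg (by positivity)]
  calc (1 + ‖(y : EuclideanSpace ℝ (Fin (m + 1)))‖) ^ ((m + 1 : ℤ) + τ - 4) *
        ‖iteratedFDerivWithin ℝ τ (quadSol i j) (halfSpace m) y‖
      ≤ (1 + ‖(y : EuclideanSpace ℝ (Fin (m + 1)))‖) ^ ((m + 1 : ℤ) + τ - 4) *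
        (C * (1 + ‖(y : EuclideanSpace ℝ (Fin (m + 1)))‖) ^ ((4 : ℤ) - τ - (m + 1))) := by
        gcongr
        exact hC i j y y.2
    _ = C * ((1 + ‖(y : EuclideanSpace ℝ (Fin (m + 1)))‖) ^ (((m + 1 : ℤ) + τ - 4) +
        ((4 : ℤ) - τ - (m + 1)))) := by rw [zpow_add₀ h0.ne']; ring
    _ = C := by
        rw [show ((m + 1 : ℤ) + τ - 4) + ((4 : ℤ) - τ - (m + 1)) = 0 by ring, zpow_zero, mul_one]

end Dependence

end BoundaryBubble

end

/-! ### Assembling the theorem. -/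

open BoundaryBubble in
theorem lemma2p2 {m : ℕ} (hm : 8 ≤ m) {M : Type*} [TopologicalSpace M] [T2Space M] [CompactSpace M]
    [ChartedSpace (EuclideanHalfSpace (m + 1)) M] [IsManifold (𝓡∂ (m + 1)) ∞ M]
    (g : Bundle.ContMDiffRiemannianMetric (𝓡∂ (m + 1)) ∞ (EuclideanSpace ℝ (Fin (m + 1)))
      (fun x : M => TangentSpace (𝓡∂ (m + 1)) x))
    (Λ : M → M → ℝ) (hΛ : IsNormalizedConformalFamily g.inner Λ) :
    ∃ (v : (q : M) → (Fin (m + 1) → TangentSpace (𝓡∂ (m + 1)) q) →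
        EuclideanSpace ℝ (Fin (m + 1)) → ℝ) (C : ℝ),
      (∀ q ∈ (𝓡∂ (m + 1)).boundary M, ∀ e, IsAdaptedFrame (conformal g.inner (Λ q)) q e →
        -- existence and uniqueness
        (IsSolution (geomRhs g.inner Λ q e) (v q e) ∧ OrthogonalToKernel (v q e)) ∧
        (∀ w, IsSolution (geomRhs g.inner Λ q e) w → OrthogonalToKernel w →
          Set.EqOn w (v q e) (halfSpace m)) ∧
        -- regularity and decay
        ContDiffOn ℝ 2 (v q e) (halfSpace m) ∧
        (∀ τ : ℕ, τ ≤ 2 → ∀ y ∈ halfSpace m,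
          ‖iteratedFDerivWithin ℝ τ (v q e) (halfSpace m) y‖ ≤
            C * (1 + ‖y‖) ^ ((4 : ℤ) - τ - (m + 1))) ∧
        -- the two integral relations
        (Integrable (fun z : EuclideanSpace ℝ (Fin m) =>
            bubble (bdPoint z) ^ (((m : ℝ) + 1) / ((m : ℝ) - 1)) * v q e (bdPoint z)) ∧
          ∫ z : EuclideanSpace ℝ (Fin m),
            bubble (bdPoint z) ^ (((m : ℝ) + 1) / ((m : ℝ) - 1)) * v q e (bdPoint z) = 0) ∧
        (IntegrableOn (fun y => v q e y * Laplacian.laplacian (v q e) y) (openHalfSpace m) ∧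
          ∫ y in openHalfSpace m, v q e y * Laplacian.laplacian (v q e) y ≤ 0)) ∧
      -- `C²` dependence on `q`, along every local `C²` field of adapted frames
      (∀ (O : Set M) (e : (x : M) → Fin (m + 1) → TangentSpace (𝓡∂ (m + 1)) x), IsOpen O →
        (∀ x ∈ O ∩ (𝓡∂ (m + 1)).boundary M, IsAdaptedFrame (conformal g.inner (Λ x)) x (e x)) →
        (∀ a, ContMDiffOn (𝓡∂ (m + 1)) (𝓡∂ (m + 1)).tangent 2
          (fun x => (⟨x, e x a⟩ : TangentBundle (𝓡∂ (m + 1)) M))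
          (O ∩ (𝓡∂ (m + 1)).boundary M)) →
        ∀ τ : ℕ, τ ≤ 2 →
          ∃ Φ : M → (halfSpace m →ᵇ (EuclideanSpace ℝ (Fin (m + 1)) [×τ]→L[ℝ] ℝ)),
            (∀ x ∈ O ∩ (𝓡∂ (m + 1)).boundary M, ∀ y : halfSpace m,
              Φ x y = (1 + ‖(y : EuclideanSpace ℝ (Fin (m + 1)))‖) ^ ((m + 1 : ℤ) + τ - 4) •
                iteratedFDerivWithin ℝ τ (v x (e x)) (halfSpace m) y) ∧
            ContMDiffOn (𝓡∂ (m + 1))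
              𝓘(ℝ, halfSpace m →ᵇ (EuclideanSpace ℝ (Fin (m + 1)) [×τ]→L[ℝ] ℝ)) 2 Φ
              (O ∩ (𝓡∂ (m + 1)).boundary M)) := by
  obtain ⟨a, ha⟩ := exists_normalizedCurv_bound g
  choose C hC0 hC using fun τ => exists_tensorSol_bound hm τ (a := a)
  -- The solution is defined from the curvature of g and not of the conformal metric, so that
  -- neither the uniform bound nor the dependence on q involves Λ. The constant is a sum over the
  -- three orders of differentiation.
  refine ⟨fun q e => tensorSol (normalizedCurv g.inner q e), C 0 + C 1 + C 2,
    fun q hq e he' => ?_, fun O e _ hadapt hsmooth τ _ => ?_⟩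
  · have he := (isAdaptedFrame_conformal_iff (hΛ.one q hq) e).1 he'
    have htr := hΛ.sum_normalizedCurv (by omega) hq he
    have hs : IsSymbol 2 (3 - (m : ℝ)) (tensorSol (normalizedCurv g.inner q e)) :=
      isSymbol_tensorSol (by omega)
    have hsol : IsSolution (geomRhs g.inner Λ q e) (tensorSol (normalizedCurv g.inner q e)) := by
      have h := isSolution_tensorSol hm htr
      -- Only the equation mentions the right-hand side, and only at interior points, where ρ > 0
      -- and `geomRhs_eq` applies.
      refine ⟨h.1, h.2, h.3, h.4, fun y hy => ?_, h.6⟩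
      rw [h.equation y hy, hΛ.geomRhs_eq (by omega) hq he (rho_pos (openHalfSpace_subset hy))]
    have horth := orthogonalToKernel_tensorSol hm htr
    refine ⟨⟨hsol, horth⟩, fun w hw hwo => hw.eqOn (by omega) hwo hsol horth,
      hs.contDiffOn.mono halfSpace_subset_enlargedHalfSpace, fun τ hτ y hy => ?_,
      ⟨integrable_boundary_tensorSol hm, integral_boundary_tensorSol hm htr⟩,
      integrableOn_tensorSol_mul_laplacian hm htr,
      integral_tensorSol_mul_laplacian_nonpos (by omega) htr⟩
    refine (hC τ _ (ha q hq e he) y hy).trans (mul_le_mul_of_nonneg_right ?_ (by positivity))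
    have h0 := hC0 0
    have h1 := hC0 1
    have h2 := hC0 2
    interval_cases τ <;> linarith
  · choose Ψ hΨ using exists_weighted_quadSol hm τ
    have het : ∀ x ∈ O ∩ (𝓡∂ (m + 1)).boundary M, ∀ i : Fin m, coordVec x (e x i.succ) 0 = 0 :=
      fun x hx i => (hadapt x hx).tangent i
    -- A finite sum of scalar functions, C² in x, times fixed vectors of the Banach space.
    refine ⟨fun x => ∑ p : Fin m × Fin m, normalizedCurv g.inner x (e x) p.1 p.2 • Ψ p.1 p.2,
      fun x _ y => ?_, fun x₀ hx₀ => contMDiffWithinAt_finsetSum fun p _ => ?_⟩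
    · rw [iteratedFDerivWithin_tensorSol (by omega) τ y.2, Finset.smul_sum,
        BoundedContinuousFunction.sum_apply]
      refine Finset.sum_congr rfl fun p _ => ?_
      rw [BoundedContinuousFunction.smul_apply, hΨ, smul_comm]
    · exact (contMDiffWithinAt_normalizedCurv g hx₀ Set.inter_subset_right
        (fun a => hsmooth a x₀ hx₀) het p.1 p.2).smul contMDiffWithinAt_const
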